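/- Let $G$ be a (finite-dimensional) Lie group with Lie algebra $\mathfrak g$ acting smoothly on the left on a contractible (finite-dimensional) smooth manifold $M$; write $X_M(x)=\frac{d}{dt}\big|_{t=0}\exp(-tX)\cdot x$ for $X\in\mathfrak g$. Let $\mathcal C^G(M)$ be the set of pairs $(\phi,\gamma)$ with $\phi\in G$ and $\gamma\colon[0,1]\to M$ a piecewise smooth curve such that $\gamma(1)=\phi\cdot\gamma(0)$; let $\gamma*\gamma'$ denote concatenation (first $\gamma$, then $\gamma'$) and $\overleftarrow{\zeta}(t)=\zeta(1-t)$. A *$G$-equivariant $U(1)$-bundle with connection* $(\mathcal U,\Theta)$ over $M$ is a smooth principal $U(1)$-bundle $\mathcal U\to M$ with a smooth left action of $G$ by principal bundle automorphisms covering the action on $M$, together with a $G$-invariant principal connection form $\Theta\in\Omega^1(\mathcal U,i\mathbb R)$. Let $\mathrm{Bund}^{\nabla,G}_{U(1)}(M)$ be the set of these modulo $G$-equivariant $U(1)$-bundle isomorphisms $\Phi\colon \mathcal U'\to\mathcal U$ covering $\mathrm{id}_M$ with $\Phi^*\Theta=\Theta'$. The *equivariant log-holonomy* $\mathrm{hol}^\Theta_G\colon\mathcal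 C^G(M)\to\mathbb R/\mathbb Z$ is defined by $\overline\gamma(1)=\phi\cdot\overline\gamma(0)\cdot\exp\!\big(2\pi i\,\mathrm{hol}^\Theta_G(\phi,\gamma)\big)$ for any $\Theta$-horizontal lift $\overline\gamma$ of $\gamma$. A *$G$-equivariant differential character* (of degree $2$) is a map $\chi\colon\mathcal C^G(M)\to\mathbb R/\mathbb Z$ for which there are a closed $G$-invariant form $\omega\in\Omega^2(M)$ and a $G$-equivariant linear map $\mu\colon\mathfrak g\to C^\infty(M)$ with $\iota_{X_M}\omega=d\mu_X$ for all $X\in\mathfrak g$, such that i) $\chi(\phi'\phi,\gamma*\gamma')=\chi(\phi',\gamma')+\chi(\phi,\gamma)$ for all $(\phi,\gamma),(\phi',\gamma')\in\mathcal C^G(M)$ with $\gamma'(0)=\gamma(1)$; ii) $\chi(\phi,\overleftarrow\zeta*\gamma*(\phi\cdot\zeta))=\chi(\phi,\gamma)$ for all $(\phi,\gamma)\in\mathcal C^G(M)$ and all piecewise smooth curves $\zeta$ with $\zeta(0)=\gamma(0)$; iii) $\chi(e,\gamma)=\int_\sigma\omega\bmod\mathbb Z$ whenever $(e,\gamma)\in\mathcal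 C^G(M)$, $\sigma$ is a smooth singular $2$-chain on $M$ and $\gamma=\partial\sigma$ (where $\gamma$ is regarded as the sum of its pieces for a subdivision of $[0,1]$ into intervals on which it is smooth); iv) $\chi(\exp X,\tau^{x,X})=\mu_X(x)\bmod\mathbb Z$ for all $X\in\mathfrak g$, $x\in M$, where $\tau^{x,X}(s)=\exp(sX)\cdot x$. Let $\hat H^2_G(M)$ be the set of these characters. Then $(\mathcal U,\Theta)\mapsto\mathrm{hol}^\Theta_G$ induces a well-defined bijection $$\mathrm{Bund}^{\nabla,G}_{U(1)}(M)\;\simeq\;\hat H^2_G(M).$$ In particular, every $\chi\in\hat H^2_G(M)$ is the equivariant log-holonomy of some $G$-equivariant $U(1)$-bundle with connection over $M$. -/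

import Mathlib

open Set
open scoped Manifold ContDiff Topology

noncomputable section

namespace EquivHol

/-! ### Differential forms on manifolds without boundary -/

section Forms

variable {E : Type*} [NormedAddCommGroup E] [NormedSpace ℝ E]
  {H : Type*} [TopologicalSpace H] (I : ModelWithCorners ℝ E H)
  {M : Type*} [TopologicalSpace M] [ChartedSpace H M]

/-- The expression, in the preferred chart around `x₀`, of a field `η` of alternating `k`-linear
forms on the tangent spaces of `M`: its pull-back under the inverse of the chart. -/
def chartRep {k : ℕ} (η : ∀ x : M, TangentSpace I x [⋀^Fin k]→L[ℝ] ℝ) (x₀ : M) :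
    E → E [⋀^Fin k]→L[ℝ] ℝ := fun y =>
  (η ((extChartAt I x₀).symm y)).compContinuousLinearMap
    (mfderiv 𝓘(ℝ, E) I (extChartAt I x₀).symm y)

variable (M) in
/-- Smooth differential `k`-forms on `M`. -/
structure DifferentialForm (k : ℕ) where
  /-- the value of the form at a point -/
  toFun : ∀ x : M, TangentSpace I x [⋀^Fin k]→L[ℝ] ℝ
  smooth : ∀ x₀ : M, ContDiffOn ℝ ∞ (chartRep I toFun x₀) (extChartAt I x₀).target

variable {I}

/-- `dη = 0`, with the exterior derivative computed in charts. -/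
def DifferentialForm.IsClosed {k : ℕ} (η : DifferentialForm I M k) : Prop :=
  ∀ x₀ : M, ∀ y ∈ (extChartAt I x₀).target, extDeriv (chartRep I η.toFun x₀) y = 0

/-- The value at `x` of the pull-back `f^*η` under a map `f`. -/
def DifferentialForm.pullbackAt {k : ℕ} {E' : Type*} [NormedAddCommGroup E'] [NormedSpace ℝ E']
    {H' : Type*} [TopologicalSpace H'] {I' : ModelWithCorners ℝ E' H'}
    {N : Type*} [TopologicalSpace N] [ChartedSpace H' N]
    (η : DifferentialForm I M k) (f : N → M) (x : N) : TangentSpace I' x [⋀^Fin k]→L[ℝ] ℝ :=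
  (η.toFun (f x)).compContinuousLinearMap (mfderiv I' I f x)

end Forms

/-! ### Piecewise smooth curves -/

section Curves

variable {E : Type*} [NormedAddCommGroup E] [NormedSpace ℝ E]
  {H : Type*} [TopologicalSpace H] (I : ModelWithCorners ℝ E H)
  {M : Type*} [TopologicalSpace M] [ChartedSpace H M]

/-- The curve `γ : [0,1] → M` is smooth on every closed interval `[a,b] ⊆ [0,1]` that has no point
of `s` in its interior. -/
def SmoothAwayFrom {x y : M} (γ : Path x y) (s : Finset ℝ) : Prop :=
  ∀ a b : ℝ, 0 ≤ a → a ≤ b → b ≤ 1 → (∀ c ∈ s, c ∉ Ioo a b) →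
    ContMDiffOn 𝓘(ℝ, ℝ) I ∞ γ.extend (Icc a b)

/-- Piecewise smooth curves. -/
def PiecewiseSmooth {x y : M} (γ : Path x y) : Prop := ∃ s : Finset ℝ, SmoothAwayFrom I γ s

variable {I}

lemma PiecewiseSmooth.cast {x y x' y' : M} {γ : Path x y} (h : PiecewiseSmooth I γ)
    (hx : x' = x) (hy : y' = y) : PiecewiseSmooth I (γ.cast hx hy) := h

lemma contMDiff_affine (m c : ℝ) : ContMDiff 𝓘(ℝ, ℝ) 𝓘(ℝ, ℝ) ∞ (fun t : ℝ => m * t + c) := by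
  apply ContDiff.contMDiff
  fun_prop

lemma PiecewiseSmooth.symm {x y : M} {γ : Path x y} (h : PiecewiseSmooth I γ) :
    PiecewiseSmooth I γ.symm := by
  classical
  obtain ⟨s, hs⟩ := h
  refine ⟨s.image (fun c => 1 - c), fun a b ha hab hb hc => ?_⟩
  have h1 := hs (1 - b) (1 - a) (by linarith) (by linarith) (by linarith) (fun c hcs hmem =>
    hc (1 - c) (Finset.mem_image_of_mem _ hcs) ⟨by linarith [hmem.2], by linarith [hmem.1]⟩)
  rw [Path.extend_symm]
  have h2 := h1.comp (contMDiff_affine (-1) 1).contMDiffOn (s := Icc a b)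
    (fun t ht => ⟨by linarith [ht.2], by linarith [ht.1]⟩)
  refine h2.congr fun t _ => ?_
  simp only [Function.comp]
  congr 1
  ring

lemma PiecewiseSmooth.trans {x y z : M} {γ : Path x y} {γ' : Path y z}
    (h : PiecewiseSmooth I γ) (h' : PiecewiseSmooth I γ') : PiecewiseSmooth I (γ.trans γ') := by
  classical
  obtain ⟨s, hs⟩ := h
  obtain ⟨s', hs'⟩ := h'
  refine ⟨{1 / 2} ∪ (s.image (fun c => c / 2) ∪ s'.image (fun c => (c + 1) / 2)),
    fun a b ha hab hb hc => ?_⟩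
  have hmid : b ≤ 1 / 2 ∨ 1 / 2 ≤ a := by
    by_contra! hcon
    exact hc (1 / 2) (by simp) ⟨hcon.2, hcon.1⟩
  rcases hmid with hb2 | ha2
  · have h1 := hs (2 * a) (2 * b) (by linarith) (by linarith) (by linarith) (fun c hcs hmem =>
      hc (c / 2) (Finset.mem_union_right _ (Finset.mem_union_left _ (Finset.mem_image_of_mem _ hcs)))
        ⟨by linarith [hmem.1], by linarith [hmem.2]⟩)
    have h2 := h1.comp (contMDiff_affine 2 0).contMDiffOn (s := Icc a b)
      (fun t ht => ⟨by linarith [ht.1], by linarith [ht.2]⟩)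
    refine h2.congr fun t ht => ?_
    rw [Path.extend_trans_of_le_half _ _ (ht.2.trans hb2)]
    simp
  · have h1 := hs' (2 * a - 1) (2 * b - 1) (by linarith) (by linarith) (by linarith)
      (fun c hcs hmem => hc ((c + 1) / 2)
        (Finset.mem_union_right _ (Finset.mem_union_right _ (Finset.mem_image_of_mem _ hcs)))
        ⟨by linarith [hmem.1], by linarith [hmem.2]⟩)
    have h2 := h1.comp (contMDiff_affine 2 (-1)).contMDiffOn (s := Icc a b)
      (fun t ht => ⟨by linarith [ht.1], by linarith [ht.2]⟩)
    refine h2.congr fun t ht => ?_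
    rw [Path.extend_trans_of_half_le _ _ (ha2.trans ht.1)]
    simp only [Function.comp]
    congr 1

lemma PiecewiseSmooth.map {E' : Type*} [NormedAddCommGroup E'] [NormedSpace ℝ E']
    {H' : Type*} [TopologicalSpace H'] {I' : ModelWithCorners ℝ E' H'}
    {N : Type*} [TopologicalSpace N] [ChartedSpace H' N]
    {x y : M} {γ : Path x y} (h : PiecewiseSmooth I γ) {f : M → N} (hf : ContMDiff I I' ∞ f) :
    PiecewiseSmooth I' (γ.map hf.continuous) := by
  obtain ⟨s, hs⟩ := h
  refine ⟨s, fun a b ha hab hb hc => ?_⟩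
  exact hf.comp_contMDiffOn (hs a b ha hab hb hc)

end Curves

/-! ### Smooth singular chains and integration -/

section Chains

variable {E : Type*} [NormedAddCommGroup E] [NormedSpace ℝ E]
  {H : Type*} [TopologicalSpace H] (I : ModelWithCorners ℝ E H)
  (M : Type*) [TopologicalSpace M] [ChartedSpace H M]

/-- The standard `2`-simplex, with vertices `(0,0)`, `(1,0)`, `(0,1)`. -/
def triangle : Set (ℝ × ℝ) := {p | 0 ≤ p.1 ∧ 0 ≤ p.2 ∧ p.1 + p.2 ≤ 1}

/-- Smooth singular `2`-simplices. Only the values on the triangle are relevant (the boundary and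
the integral below do not see the other values). -/
structure Simplex2 where
  /-- the underlying map -/
  toFun : ℝ × ℝ → M
  smooth : ContMDiffOn 𝓘(ℝ, ℝ × ℝ) I ∞ toFun triangle

variable {I M}

/-- The boundary of a singular `2`-simplex, in the free abelian group on maps `[0,1] → M`:
`σ ∘ [e₁,e₂] - σ ∘ [e₀,e₂] + σ ∘ [e₀,e₁]`. -/
def Simplex2.boundary (σ : Simplex2 I M) : (unitInterval → M) →₀ ℤ :=
  Finsupp.single (fun t : unitInterval => σ.toFun (1 - (t : ℝ), (t : ℝ))) (1 : ℤ)
    - Finsupp.single (fun t : unitInterval => σ.toFun (0, (t : ℝ))) (1 : ℤ)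
    + Finsupp.single (fun t : unitInterval => σ.toFun ((t : ℝ), 0)) (1 : ℤ)

/-- The integral `∫_σ η` of a `2`-form over a singular `2`-simplex. -/
def Simplex2.integral (σ : Simplex2 I M) (η : DifferentialForm I M 2) : ℝ :=
  ∫ p in triangle, η.toFun (σ.toFun p)
    ![mfderivWithin 𝓘(ℝ, ℝ × ℝ) I σ.toFun triangle p ((1, 0) : ℝ × ℝ),
      mfderivWithin 𝓘(ℝ, ℝ × ℝ) I σ.toFun triangle p ((0, 1) : ℝ × ℝ)]

/-- The boundary operator on smooth singular `2`-chains. -/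
def chainBoundary (σ : Simplex2 I M →₀ ℤ) : (unitInterval → M) →₀ ℤ :=
  σ.sum fun s m => m • s.boundary

/-- The integral of a `2`-form over a smooth singular `2`-chain. -/
def chainIntegral (σ : Simplex2 I M →₀ ℤ) (η : DifferentialForm I M 2) : ℝ :=
  σ.sum fun s m => (m : ℝ) * s.integral η

variable (I) in
/-- `0 = t₀ < t₁ < ⋯ < tₙ = 1` is a subdivision of `[0,1]` such that `γ` is smooth on every
`[tᵢ,tᵢ₊₁]`. -/
structure IsSmoothSubdivision {x y : M} (γ : Path x y) {n : ℕ} (t : Fin (n + 1) → ℝ) : Prop where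
  strictMono : StrictMono t
  zero : t 0 = 0
  one : t (Fin.last n) = 1
  smooth : ∀ i : Fin n, ContMDiffOn 𝓘(ℝ, ℝ) I ∞ γ.extend (Icc (t i.castSucc) (t i.succ))

/-- The singular `1`-chain of a curve with a subdivision: the sum of the pieces
`γ|[tᵢ,tᵢ₊₁]`, each reparametrized affinely on `[0,1]`. -/
def curveChain {x y : M} (γ : Path x y) {n : ℕ} (t : Fin (n + 1) → ℝ) :
    (unitInterval → M) →₀ ℤ :=
  ∑ i : Fin n, Finsupp.single
    (fun s : unitInterval => γ.extend (t i.castSucc + s * (t i.succ - t i.castSucc))) 1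

end Chains

/-! ### The Lie group and its action -/

section Action

variable {EG : Type*} [NormedAddCommGroup EG] [NormedSpace ℝ EG]
  {HG : Type*} [TopologicalSpace HG] (IG : ModelWithCorners ℝ EG HG)
  {G : Type*} [TopologicalSpace G] [ChartedSpace HG G] [Group G]
  {E : Type*} [NormedAddCommGroup E] [NormedSpace ℝ E]
  {H : Type*} [TopologicalSpace H] (I : ModelWithCorners ℝ E H)
  {M : Type*} [TopologicalSpace M] [ChartedSpace H M] [MulAction G M]

/-- The adjoint action of `g` on the Lie algebra of `G`. -/
def Ad (g : G) (X : GroupLieAlgebra IG G) : GroupLieAlgebra IG G :=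
  (mfderiv IG IG (fun h : G => g * h * g⁻¹) 1 X : EG)

/-- The fundamental vector field `X_M(x) = d/dt|₀ exp(-tX)·x`, that is, minus the derivative of
`g ↦ g·x` at the identity in the direction `X`. -/
def fundamentalField (X : GroupLieAlgebra IG G) (x : M) : TangentSpace I x :=
  (-(mfderiv IG I (fun g : G => g • x) 1 X : E) : E)

/-- `c` is the one-parameter subgroup `t ↦ exp(tX)`: the smooth homomorphism `ℝ → G` with
velocity `X` at `0`. -/
structure IsOneParameterSubgroup (c : ℝ → G) (X : GroupLieAlgebra IG G) : Prop where
  smooth : ContMDiff 𝓘(ℝ, ℝ) IG ∞ c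
  map_add : ∀ s t : ℝ, c (s + t) = c s * c t
  velocity : (mfderiv 𝓘(ℝ, ℝ) IG c 0 (1 : ℝ) : EG) = (X : EG)

variable {IG} in
lemma IsOneParameterSubgroup.map_zero {c : ℝ → G} {X : GroupLieAlgebra IG G}
    (h : IsOneParameterSubgroup IG c X) : c 0 = 1 := by
  have := h.map_add 0 0
  simpa using this

variable (G M) in
/-- Elements `η + μ` of `Ω²_G(M)`: a `G`-invariant `2`-form `η` and a `G`-equivariant linear
map `μ` from the Lie algebra of `G` to the smooth functions on `M`. -/
structure EquivariantTwoForm where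
  /-- the `2`-form part -/
  form : DifferentialForm I M 2
  /-- the linear part -/
  moment : GroupLieAlgebra IG G →ₗ[ℝ] M → ℝ
  form_invariant : ∀ (g : G) (x : M), form.pullbackAt (I' := I) (fun y => g • y) x = form.toFun x
  moment_smooth : ∀ X, ContMDiff I 𝓘(ℝ, ℝ) ∞ (moment X)
  moment_equivariant : ∀ (g : G) (X : GroupLieAlgebra IG G) (x : M),
    moment (Ad IG g X) (g • x) = moment X x

variable {IG I} in
/-- `D(η + μ) = 0`, i.e. `dη = 0` and `ι_{X_M} η = d(μ_X)` for every `X`. -/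
def EquivariantTwoForm.IsClosed (w : EquivariantTwoForm IG G I M) : Prop :=
  w.form.IsClosed ∧ ∀ (X : GroupLieAlgebra IG G) (x : M) (v : TangentSpace I x),
    w.form.toFun x ![fundamentalField IG I X x, v] = (mfderiv I 𝓘(ℝ, ℝ) (w.moment X) x v : ℝ)

variable (G M) in
/-- The set `𝒞^G(M)` of pairs `(φ, γ)`, where `φ ∈ G` and `γ` is a piecewise smooth curve on `M`
with `γ(1) = φ·γ(0)`. -/
structure EquivCurve where
  /-- the group element `φ` -/
  elt : G
  /-- the initial point of the curve -/
  base : M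
  /-- the curve -/
  path : Path base (elt • base)
  smooth : PiecewiseSmooth I path

variable {I}

/-- From `(φ, γ)` and `(φ', γ')` with `γ'(0) = γ(1)` form `(φ'φ, γ * γ')`. -/
def EquivCurve.comp (p q : EquivCurve G I M) (h : q.base = p.elt • p.base) :
    EquivCurve G I M where
  elt := q.elt * p.elt
  base := p.base
  path := p.path.trans (q.path.cast h.symm (by rw [mul_smul, h]))
  smooth := p.smooth.trans (q.smooth.cast _ _)

/-- From `(φ, γ)` and a curve `ζ` with `ζ(0) = γ(0)` form `(φ, ζ⁻ * γ * (φ·ζ))`, where `ζ⁻` is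
the reversed curve. -/
def EquivCurve.conj [ContMDiffSMul IG I ∞ G M] (p : EquivCurve G I M) {y : M}
    (ζ : Path p.base y) (hζ : PiecewiseSmooth I ζ) : EquivCurve G I M where
  elt := p.elt
  base := y
  path := (ζ.symm.trans p.path).trans (ζ.map
    (ContMDiffSMul.contMDiff_const_smul (I := IG) (I' := I) (n := ∞) p.elt).continuous)
  smooth := (hζ.symm.trans p.smooth).trans
    (hζ.map (ContMDiffSMul.contMDiff_const_smul (I := IG) (I' := I) (n := ∞) p.elt))

variable {IG} in
lemma IsOneParameterSubgroup.orbit_smooth [ContMDiffSMul IG I ∞ G M] {c : ℝ → G}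
    {X : GroupLieAlgebra IG G} (h : IsOneParameterSubgroup IG c X) (x : M) :
    ContMDiff 𝓘(ℝ, ℝ) I ∞ (fun s : ℝ => c s • x) :=
  h.smooth.smul contMDiff_const

variable {IG} in
/-- The pair `(exp X, τ)` with `τ(s) = exp(sX)·x`. -/
def IsOneParameterSubgroup.orbitCurve [ContMDiffSMul IG I ∞ G M] {c : ℝ → G}
    {X : GroupLieAlgebra IG G} (h : IsOneParameterSubgroup IG c X) (x : M) :
    EquivCurve G I M where
  elt := c 1
  base := x
  path :=
    { toFun := fun s => c s • x
      continuous_toFun := (h.orbit_smooth (I := I) x).continuous.comp continuous_subtype_val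
      source' := by simp [h.map_zero]
      target' := by simp }
  smooth := ⟨∅, fun a b ha _ hb _ => (h.orbit_smooth x).contMDiffOn.congr fun t ht => by
    rw [Path.extend_apply _ ⟨ha.trans ht.1, ht.2.trans hb⟩]
    rfl⟩

/-- `χ : 𝒞^G(M) → ℝ/ℤ` is a `G`-equivariant differential character (of degree `2`) with
equivariant curvature `w`. -/
structure IsCharacterWithCurvature [ContMDiffSMul IG I ∞ G M]
    (χ : EquivCurve G I M → AddCircle (1 : ℝ)) (w : EquivariantTwoForm IG G I M) : Prop where
  closed : w.IsClosed
  map_comp : ∀ (p q : EquivCurve G I M) (h : q.base = p.elt • p.base),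
    χ (p.comp q h) = χ q + χ p
  map_conj : ∀ (p : EquivCurve G I M) (y : M) (ζ : Path p.base y) (hζ : PiecewiseSmooth I ζ),
    χ (p.conj IG ζ hζ) = χ p
  map_boundary : ∀ p : EquivCurve G I M, p.elt = 1 →
    ∀ (n : ℕ) (t : Fin (n + 1) → ℝ), IsSmoothSubdivision I p.path t →
    ∀ σ : Simplex2 I M →₀ ℤ, curveChain p.path t = chainBoundary σ →
      χ p = (chainIntegral σ w.form : AddCircle (1 : ℝ))
  map_orbit : ∀ (X : GroupLieAlgebra IG G) (c : ℝ → G) (h : IsOneParameterSubgroup IG c X) (x : M),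
    χ (h.orbitCurve x) = (w.moment X x : AddCircle (1 : ℝ))

variable (G I M) in
/-- The set `Ĥ²_G(M)` of `G`-equivariant differential characters of degree `2`. -/
def EquivDiffCharacter [ContMDiffSMul IG I ∞ G M] : Type _ :=
  {χ : EquivCurve G I M → AddCircle (1 : ℝ) //
    ∃ w : EquivariantTwoForm IG G I M, IsCharacterWithCurvature IG χ w}

end Action

/-! ### Equivariant principal `U(1)`-bundles with connection -/

section Bundles

universe u

variable {EG : Type*} [NormedAddCommGroup EG] [NormedSpace ℝ EG]
  {HG : Type*} [TopologicalSpace HG] (IG : ModelWithCorners ℝ EG HG)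
  (G : Type*) [TopologicalSpace G] [ChartedSpace HG G] [Group G]
  {E : Type*} [NormedAddCommGroup E] [NormedSpace ℝ E]
  {H : Type*} [TopologicalSpace H] (I : ModelWithCorners ℝ E H)
  (M : Type u) [TopologicalSpace M] [ChartedSpace H M] [MulAction G M]

/-- A `G`-equivariant principal `U(1)`-bundle over `M` with a `G`-invariant connection `Θ`.

As `U(1)` is commutative, its right action on the total space is written as a left action. The
`i ℝ`-valued connection form is `Θ = i θ` with the real `1`-form `θ` recorded below. -/
structure EquivariantBundle where
  /-- the total space -/
  Total : Type u
  [topTotal : TopologicalSpace Total]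
  [chartedTotal : ChartedSpace (ModelProd H (EuclideanSpace ℝ (Fin 1))) Total]
  [manifoldTotal : IsManifold (I.prod (𝓡 1)) ∞ Total]
  [circleAction : MulAction Circle Total]
  [circleSmooth : ContMDiffSMul (𝓡 1) (I.prod (𝓡 1)) ∞ Circle Total]
  [groupAction : MulAction G Total]
  [groupSmooth : ContMDiffSMul IG (I.prod (𝓡 1)) ∞ G Total]
  /-- the projection -/
  proj : Total → M
  /-- local triviality: over a neighbourhood of every point the bundle is diffeomorphic to the
  product with `U(1)`, compatibly with the projection and the action of `U(1)` -/
  locally_trivial : ∀ x : M, ∃ (U : Set M) (ψ : OpenPartialHomeomorph Total (M × Circle)),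
    IsOpen U ∧ x ∈ U ∧ ψ.source = proj ⁻¹' U ∧ ψ.target = U ×ˢ univ ∧
    ContMDiffOn (I.prod (𝓡 1)) (I.prod (𝓡 1)) ∞ ψ ψ.source ∧
    ContMDiffOn (I.prod (𝓡 1)) (I.prod (𝓡 1)) ∞ ψ.symm ψ.target ∧
    ∀ p ∈ ψ.source, (ψ p).1 = proj p ∧
      ∀ z : Circle, z • p ∈ ψ.source ∧ ψ (z • p) = ((ψ p).1, z * (ψ p).2)
  /-- `G` acts by bundle automorphisms over its action on `M` -/
  proj_smul : ∀ (g : G) (p : Total), proj (g • p) = g • proj p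
  smul_comm : ∀ (g : G) (z : Circle) (p : Total), g • z • p = z • g • p
  /-- the connection form, divided by `i` -/
  form : DifferentialForm (I.prod (𝓡 1)) Total 1
  /-- the connection form takes the value `i` on the fundamental field of `i ∈ Lie U(1)` -/
  form_vertical : ∀ p : Total, form.toFun p
    ![(mfderiv 𝓘(ℝ, ℝ) (I.prod (𝓡 1)) (fun t : ℝ => Circle.exp t • p) 0 (1 : ℝ) :
      E × EuclideanSpace ℝ (Fin 1))] = 1
  form_circle_invariant : ∀ (z : Circle) (p : Total),
    form.pullbackAt (I' := I.prod (𝓡 1)) (fun q => z • q) p = form.toFun p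
  form_invariant : ∀ (g : G) (p : Total),
    form.pullbackAt (I' := I.prod (𝓡 1)) (fun q => g • q) p = form.toFun p

attribute [instance] EquivariantBundle.topTotal EquivariantBundle.chartedTotal
  EquivariantBundle.manifoldTotal EquivariantBundle.circleAction EquivariantBundle.circleSmooth
  EquivariantBundle.groupAction EquivariantBundle.groupSmooth

variable {IG G I M}

/-- An isomorphism of `G`-equivariant `U(1)`-bundles with connection, covering the identity. -/
structure EquivariantBundle.Iso (B B' : EquivariantBundle IG G I M) where
  /-- the diffeomorphism of total spaces -/
  toDiffeo : Diffeomorph (I.prod (𝓡 1)) (I.prod (𝓡 1)) B.Total B'.Total ∞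
  map_proj : ∀ p, B'.proj (toDiffeo p) = B.proj p
  map_circle : ∀ (z : Circle) (p : B.Total), toDiffeo (z • p) = z • toDiffeo p
  map_group : ∀ (g : G) (p : B.Total), toDiffeo (g • p) = g • toDiffeo p
  map_form : ∀ p, B'.form.pullbackAt (I' := I.prod (𝓡 1)) toDiffeo p = B.form.toFun p

/-- The identity isomorphism. -/
def EquivariantBundle.Iso.refl (B : EquivariantBundle IG G I M) : B.Iso B where
  toDiffeo := Diffeomorph.refl _ _ _
  map_proj _ := rfl
  map_circle _ _ := rfl
  map_group _ _ := rfl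
  map_form p := by
    ext v
    change B.form.toFun p (fun i => mfderiv (I.prod (𝓡 1)) (I.prod (𝓡 1)) id p (v i)) = _
    simp [mfderiv_id]

/-- Composition of isomorphisms. -/
def EquivariantBundle.Iso.trans {B B' B'' : EquivariantBundle IG G I M} (Φ : B.Iso B')
    (Ψ : B'.Iso B'') : B.Iso B'' where
  toDiffeo := Φ.toDiffeo.trans Ψ.toDiffeo
  map_proj p := by simp [Φ.map_proj, Ψ.map_proj]
  map_circle z p := by simp [Φ.map_circle, Ψ.map_circle]
  map_group z p := by simp [Φ.map_group, Ψ.map_group]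
  map_form p := by
    rw [← Φ.map_form p]
    have h := Ψ.map_form (Φ.toDiffeo p)
    ext v
    have h2 := DFunLike.congr_fun h
      (fun i => mfderiv (I.prod (𝓡 1)) (I.prod (𝓡 1)) Φ.toDiffeo p (v i))
    have h3 : mfderiv (I.prod (𝓡 1)) (I.prod (𝓡 1)) (Ψ.toDiffeo ∘ Φ.toDiffeo) p = _ :=
      mfderiv_comp p (Ψ.toDiffeo.mdifferentiable (by simp) _) (Φ.toDiffeo.mdifferentiable (by simp) _)
    change B''.form.toFun _ (fun i => mfderiv (I.prod (𝓡 1)) (I.prod (𝓡 1))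
      (Ψ.toDiffeo ∘ Φ.toDiffeo) p (v i)) = _
    rw [h3]
    exact h2

/-- The inverse isomorphism. -/
def EquivariantBundle.Iso.symm {B B' : EquivariantBundle IG G I M} (Φ : B.Iso B') :
    B'.Iso B where
  toDiffeo := Φ.toDiffeo.symm
  map_proj p := by
    rw [← Φ.map_proj, Φ.toDiffeo.apply_symm_apply]
  map_circle z p := by
    apply Φ.toDiffeo.injective
    simp [Φ.map_circle]
  map_group g p := by
    apply Φ.toDiffeo.injective
    simp [Φ.map_group]
  map_form p := by
    have h := Φ.map_form (Φ.toDiffeo.symm p)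
    have hid : ∀ f : B'.Total → B'.Total, f = id →
        B'.form.pullbackAt (I' := I.prod (𝓡 1)) f p = B'.form.toFun p := by
      rintro f rfl
      ext v
      change B'.form.toFun p (fun i => mfderiv (I.prod (𝓡 1)) (I.prod (𝓡 1)) id p (v i)) = _
      simp [mfderiv_id]
    rw [← hid (Φ.toDiffeo ∘ Φ.toDiffeo.symm) (funext Φ.toDiffeo.apply_symm_apply)]
    have h3 : mfderiv (I.prod (𝓡 1)) (I.prod (𝓡 1)) (Φ.toDiffeo ∘ Φ.toDiffeo.symm) p = _ :=
      mfderiv_comp p (Φ.toDiffeo.mdifferentiable (by simp) _)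
        (Φ.toDiffeo.symm.mdifferentiable (by simp) _)
    ext v
    have h2 := DFunLike.congr_fun h
      (fun i => mfderiv (I.prod (𝓡 1)) (I.prod (𝓡 1)) Φ.toDiffeo.symm p (v i))
    change _ = B'.form.toFun _ (fun i => mfderiv (I.prod (𝓡 1)) (I.prod (𝓡 1))
      (Φ.toDiffeo ∘ Φ.toDiffeo.symm) p (v i))
    rw [h3]
    exact h2.symm

variable (IG G I M) in
/-- Two bundles are equivalent when they are isomorphic. -/
instance bundleSetoid : Setoid (EquivariantBundle IG G I M) where
  r B B' := Nonempty (B.Iso B')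
  iseqv :=
    { refl := fun B => ⟨.refl B⟩
      symm := fun ⟨Φ⟩ => ⟨Φ.symm⟩
      trans := fun ⟨Φ⟩ ⟨Ψ⟩ => ⟨Φ.trans Ψ⟩ }

variable (IG G I M) in
/-- `Bund`: the isomorphism classes of `G`-equivariant `U(1)`-bundles with connection over `M`. -/
def Bund : Type _ := Quotient (bundleSetoid IG G I M)

/-- The class of a bundle in `Bund`. -/
def EquivariantBundle.toBund (B : EquivariantBundle IG G I M) : Bund IG G I M :=
  Quotient.mk (bundleSetoid IG G I M) B

/-- `γ̄` is a horizontal lift of `γ`: a piecewise smooth curve over `γ` whose velocity is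
annihilated by the connection form (away from finitely many points). -/
structure EquivariantBundle.IsHorizontalLift (B : EquivariantBundle IG G I M) {x y : M}
    (γ : Path x y) {p q : B.Total} (γ' : Path p q) : Prop where
  lift : ∀ t, B.proj (γ' t) = γ t
  horizontal : ∃ s : Finset ℝ, SmoothAwayFrom (I.prod (𝓡 1)) γ' s ∧
    ∀ t ∈ Ioo (0 : ℝ) 1, t ∉ s → B.form.toFun (γ'.extend t)
      ![mfderiv 𝓘(ℝ, ℝ) (I.prod (𝓡 1)) γ'.extend t (1 : ℝ)] = 0

/-- `a ∈ ℝ/ℤ` is the equivariant log-holonomy of `(φ, γ)`: there are horizontal lifts of `γ`, and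
`γ̄(1) = φ·γ̄(0)·exp(2πi a)` for each of them. -/
def EquivariantBundle.IsLogHolonomy (B : EquivariantBundle IG G I M) (k : EquivCurve G I M)
    (a : AddCircle (1 : ℝ)) : Prop :=
  (∃ (p q : B.Total) (γ' : Path p q), B.IsHorizontalLift k.path γ') ∧
  ∀ (p q : B.Total) (γ' : Path p q), B.IsHorizontalLift k.path γ' →
    q = AddCircle.toCircle a • k.elt • p

end Bundles

end EquivHol

end

set_option linter.unusedSectionVars false

open Set
open scoped Manifold ContDiff Topology

noncomputable section

namespace EquivHol

section Analysis

open MeasureTheory intervalIntegral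

variable {V : Type*} [NormedAddCommGroup V] [NormedSpace ℝ V] [FiniteDimensional ℝ V]

lemma hasFDerivAt_integral_of_contDiffOn {S : Set (V × ℝ)} (hS : IsOpen S) {f : V × ℝ → ℝ}
    (hf : ContDiffOn ℝ ∞ f S) {x : V} (hx : ∀ t ∈ Icc (0 : ℝ) 1, (x, t) ∈ S) :
    HasFDerivAt (fun y => ∫ t in (0 : ℝ)..1, f (y, t))
      (∫ t in (0 : ℝ)..1, (fderiv ℝ f (x, t)).comp (ContinuousLinearMap.inl ℝ V ℝ)) x := by
  have hsub : ({x} : Set V) ×ˢ Icc (0 : ℝ) 1 ⊆ S := by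
    rintro ⟨y, t⟩ ⟨hy, ht⟩
    obtain rfl : y = x := hy
    exact hx t ht
  obtain ⟨U, O, hU, hO, hxU, hIccO, hUO⟩ :=
    generalized_tube_lemma isCompact_singleton isCompact_Icc hS hsub
  obtain ⟨r, hr, hrU⟩ := Metric.isOpen_iff.1 hU x (hxU rfl)
  have hK : IsCompact (Metric.closedBall x (r / 2) ×ˢ Icc (0 : ℝ) 1) :=
    (isCompact_closedBall x (r / 2)).prod isCompact_Icc
  have hKS : Metric.closedBall x (r / 2) ×ˢ Icc (0 : ℝ) 1 ⊆ S := by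
    rintro ⟨y, t⟩ ⟨hy, ht⟩
    exact hUO ⟨hrU (Metric.closedBall_subset_ball (by linarith) hy), hIccO ht⟩
  have hderiv : ContinuousOn (fun p : V × ℝ => (fderiv ℝ f p).comp (ContinuousLinearMap.inl ℝ V ℝ)) S :=
    (hf.continuousOn_fderiv_of_isOpen hS (by simp)).clm_comp continuousOn_const
  obtain ⟨C, hC⟩ := (hK.image_of_continuousOn (hderiv.mono hKS)).isBounded.exists_norm_le
  have hcont : ∀ y ∈ Metric.closedBall x (r / 2), ContinuousOn (fun t => f (y, t)) (Icc 0 1) :=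
    fun y hy => hf.continuousOn.comp (by fun_prop) (fun t ht => hKS ⟨hy, ht⟩)
  have hsubI : Set.uIoc (0 : ℝ) 1 ⊆ Icc 0 1 := by
    rw [uIoc_of_le zero_le_one]; exact Ioc_subset_Icc_self
  have hball : Metric.closedBall x (r / 2) ∈ 𝓝 x := Metric.closedBall_mem_nhds x (by linarith)
  refine hasFDerivAt_integral_of_dominated_of_fderiv_le (μ := volume) (bound := fun _ => C)
    (F := fun y t => f (y, t))
    (F' := fun y t => (fderiv ℝ f (y, t)).comp (ContinuousLinearMap.inl ℝ V ℝ)) hball ?_ ?_ ?_ ?_ ?_ ?_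
  · filter_upwards [hball] with y hy
    exact ((hcont y hy).mono hsubI).aestronglyMeasurable measurableSet_uIoc
  · apply ContinuousOn.intervalIntegrable
    rw [uIcc_of_le zero_le_one]
    exact hcont x (Metric.mem_closedBall_self (by linarith))
  · refine ContinuousOn.aestronglyMeasurable ?_ measurableSet_uIoc
    refine hderiv.comp (f := fun t => (x, t)) (by fun_prop) fun t ht => hx t (hsubI ht)
  · refine Filter.Eventually.of_forall fun t ht y hy => ?_
    exact hC _ (mem_image_of_mem _ ⟨hy, hsubI ht⟩)
  · exact intervalIntegrable_const
  · refine Filter.Eventually.of_forall fun t ht y hy => ?_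
    have h1 : HasFDerivAt f (fderiv ℝ f (y, t)) (y, t) :=
      ((hf.differentiableOn (by simp)).differentiableAt
        (hS.mem_nhds (hKS ⟨hy, hsubI ht⟩))).hasFDerivAt
    exact h1.comp y (hasFDerivAt_prodMk_left y t)

/-- Integrals of smooth functions depend smoothly on parameters. -/
lemma contDiffOn_integral_param {S : Set (V × ℝ)} (hS : IsOpen S) {W : Set V} (hW : IsOpen W)
    (hWS : ∀ x ∈ W, ∀ t ∈ Icc (0 : ℝ) 1, (x, t) ∈ S) {f : V × ℝ → ℝ} (hf : ContDiffOn ℝ ∞ f S) :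
    ContDiffOn ℝ ∞ (fun y => ∫ t in (0 : ℝ)..1, f (y, t)) W := by
  rw [contDiffOn_infty]
  intro n
  induction n generalizing f with
  | zero =>
    rw [Nat.cast_zero, contDiffOn_zero]
    exact fun x hx => (hasFDerivAt_integral_of_contDiffOn hS hf (hWS x hx)).continuousAt.continuousWithinAt
  | succ n ih =>
    rw [Nat.cast_succ]
    refine contDiffOn_succ_of_fderiv_apply (fun x hx =>
      (hasFDerivAt_integral_of_contDiffOn hS hf (hWS x hx)).differentiableAt.differentiableWithinAt)
      (by simp) fun y => ?_
    have h1 : ContDiffOn ℝ ∞ (fun p => fderiv ℝ f p (y, 0)) S :=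
      ((hf.fderiv_of_isOpen hS (by simp)).clm_apply contDiffOn_const)
    refine (ih h1).congr fun x hx => ?_
    have hd := hasFDerivAt_integral_of_contDiffOn hS hf (hWS x hx)
    rw [fderivWithin_of_isOpen hW hx, hd.fderiv,
      ContinuousLinearMap.intervalIntegral_apply]
    · rfl
    · apply ContinuousOn.intervalIntegrable
      rw [uIcc_of_le zero_le_one]
      refine ContinuousOn.clm_comp ?_ continuousOn_const
      exact (hf.continuousOn_fderiv_of_isOpen hS (by simp)).comp (by fun_prop) fun t ht => hWS x hx t ht

section Alternating

variable {k : ℕ}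

instance finiteDimensional_continuousAlternatingMap :
    FiniteDimensional ℝ (V [⋀^Fin k]→L[ℝ] ℝ) := by
  let b := Module.finBasis ℝ V
  let L : (V [⋀^Fin k]→L[ℝ] ℝ) →ₗ[ℝ] ((Fin k → Fin (Module.finrank ℝ V)) → ℝ) :=
    { toFun := fun A s => A (fun i => b (s i))
      map_add' := fun _ _ => rfl
      map_smul' := fun _ _ => rfl }
  refine FiniteDimensional.of_injective L fun A A' h => ?_
  refine ContinuousAlternatingMap.toAlternatingMap_injective ?_
  refine AlternatingMap.coe_multilinearMap_injective ?_
  exact Module.Basis.ext_multilinear (fun _ => b) fun s => congrFun h s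

variable {X : Type*} [NormedAddCommGroup X] [NormedSpace ℝ X]

lemma contDiffOn_alternating_of_apply {n : WithTop ℕ∞} {S : Set X} {A : X → V [⋀^Fin k]→L[ℝ] ℝ}
    (h : ∀ v, ContDiffOn ℝ n (fun x => A x v) S) : ContDiffOn ℝ n A S := by
  let b := Module.finBasis ℝ V
  let L : (V [⋀^Fin k]→L[ℝ] ℝ) →ₗ[ℝ] ((Fin k → Fin (Module.finrank ℝ V)) → ℝ) :=
    { toFun := fun A s => A (fun i => b (s i))
      map_add' := fun _ _ => rfl
      map_smul' := fun _ _ => rfl }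
  have hL : LinearMap.ker L = ⊥ := by
    rw [LinearMap.ker_eq_bot]
    intro A A' h
    refine ContinuousAlternatingMap.toAlternatingMap_injective ?_
    refine AlternatingMap.coe_multilinearMap_injective ?_
    exact Module.Basis.ext_multilinear (fun _ => b) fun s => congrFun h s
  obtain ⟨R, hR⟩ := LinearMap.exists_leftInverse_of_injective L hL
  have h1 : ContDiffOn ℝ n (fun x => L (A x)) S := contDiffOn_pi.2 fun s => h _
  have h2 := (LinearMap.toContinuousLinearMap R).contDiff.comp_contDiffOn h1
  refine h2.congr fun x _ => ?_
  exact (DFunLike.congr_fun hR (A x)).symm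

lemma contDiffOn_alternating_apply {n : WithTop ℕ∞} {S : Set X} {A : X → V [⋀^Fin k]→L[ℝ] ℝ}
    (hA : ContDiffOn ℝ n A S) {v : X → Fin k → V} (hv : ContDiffOn ℝ n v S) :
    ContDiffOn ℝ n (fun x => A x (v x)) S := by
  let b := Module.finBasis ℝ (V [⋀^Fin k]→L[ℝ] ℝ)
  have h : ∀ x, A x (v x) = ∑ i, (LinearMap.toContinuousLinearMap (b.coord i)) (A x) * b i (v x) := by
    intro x
    have h1 := congrArg (ContinuousAlternatingMap.apply ℝ V ℝ (v x)) (b.sum_repr (A x))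
    rw [map_sum] at h1
    simpa using h1.symm
  simp_rw [h]
  refine ContDiffOn.sum fun i _ => ContDiffOn.mul ?_ ?_
  · exact (ContinuousLinearMap.contDiff _).comp_contDiffOn hA
  · exact ((b i).toContinuousMultilinearMap.contDiff).comp_contDiffOn hv

end Alternating

section Segments

lemma alternating_smul_one (A : V [⋀^Fin 1]→L[ℝ] ℝ) (r : ℝ) (v : V) : A ![r • v] = r * A ![v] := by
  have h := A.map_update_smul ![v] 0 r v
  have e : ∀ w : V, Function.update ![v] 0 w = ![w] := by
    intro w; ext i; fin_cases i; simp
  simpa [e] using h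

lemma contDiffOn_vec_one {X : Type*} [NormedAddCommGroup X] [NormedSpace ℝ X] {n : WithTop ℕ∞}
    {S : Set X} {v : X → V} (hv : ContDiffOn ℝ n v S) :
    ContDiffOn ℝ n (fun x => (![v x] : Fin 1 → V)) S := by
  refine contDiffOn_pi.2 fun i => ?_
  fin_cases i
  exact hv

/-- An `ℝ/ℤ`-valued function whose differences along segments are given by the integrals of a
smooth `1`-form `A` lifts locally to a smooth primitive of `A`. -/
lemma exists_smooth_lift {W : Set V} (hW : IsOpen W) {A : V → V [⋀^Fin 1]→L[ℝ] ℝ}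
    (hA : ContDiffOn ℝ ∞ A W) {u : V → AddCircle (1 : ℝ)}
    (hu : ∀ x y, (∀ t ∈ Icc (0 : ℝ) 1, x + t • (y - x) ∈ W) →
      u y - u x = ((∫ t in (0 : ℝ)..1, A (x + t • (y - x)) ![y - x] : ℝ) : AddCircle (1 : ℝ)))
    {x₀ : V} {r : ℝ} (hr : Metric.ball x₀ r ⊆ W) :
    ∃ f : V → ℝ, f x₀ = 0 ∧ ContDiffOn ℝ ∞ f (Metric.ball x₀ r) ∧
      ∀ y ∈ Metric.ball x₀ r, u y = u x₀ + (f y : AddCircle (1 : ℝ)) ∧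
        ∀ v, fderiv ℝ f y v = A y ![v] := by
  have hconv : ∀ x ∈ Metric.ball x₀ r, ∀ y ∈ Metric.ball x₀ r, ∀ t ∈ Icc (0 : ℝ) 1,
      x + t • (y - x) ∈ Metric.ball x₀ r := fun x hx y hy t ht =>
    (convex_ball x₀ r).add_smul_sub_mem hx hy ht
  let f : V → ℝ := fun y => ∫ t in (0 : ℝ)..1, A (x₀ + t • (y - x₀)) ![y - x₀]
  have hf : ContDiffOn ℝ ∞ f (Metric.ball x₀ r) := by
    have hc : Continuous (fun p : V × ℝ => x₀ + p.2 • (p.1 - x₀)) := by fun_prop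
    refine contDiffOn_integral_param (S := (fun p : V × ℝ => x₀ + p.2 • (p.1 - x₀)) ⁻¹' Metric.ball x₀ r)
      (Metric.isOpen_ball.preimage hc) Metric.isOpen_ball (fun y hy t ht => ?_)
      (f := fun p => A (x₀ + p.2 • (p.1 - x₀)) ![p.1 - x₀]) ?_
    · refine hconv x₀ ?_ y hy t ht
      exact Metric.mem_ball_self (dist_nonneg.trans_lt hy)
    · have h1 : ContDiffOn ℝ ∞ (fun p : V × ℝ => A (x₀ + p.2 • (p.1 - x₀)))
          ((fun p : V × ℝ => x₀ + p.2 • (p.1 - x₀)) ⁻¹' Metric.ball x₀ r) :=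
        (hA.mono hr).comp (ContDiff.contDiffOn (by fun_prop)) fun p hp => hp
      exact contDiffOn_alternating_apply h1
        (contDiffOn_vec_one (ContDiff.contDiffOn (by fun_prop)))
  refine ⟨f, by simp [f], hf, fun y hy => ?_⟩
  have hx₀ : x₀ ∈ Metric.ball x₀ r := Metric.mem_ball_self (dist_nonneg.trans_lt hy)
  have hlift : ∀ y ∈ Metric.ball x₀ r, u y = u x₀ + (f y : AddCircle (1 : ℝ)) := fun y hy => by
    rw [← hu x₀ y fun t ht => hr (hconv x₀ hx₀ y hy t ht)]; abel
  refine ⟨hlift y hy, fun v => ?_⟩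
  let m : ℝ → ℝ := fun h => ∫ t in (0 : ℝ)..1, A (y + (t * h) • v) ![v]
  let O : Set ℝ := {h | ∀ t ∈ Icc (0 : ℝ) 1, y + (t * h) • v ∈ Metric.ball x₀ r}
  obtain ⟨ε, hε, hεy⟩ := Metric.isOpen_iff.1 Metric.isOpen_ball y hy
  have hO : ∀ᶠ h in 𝓝 (0 : ℝ), ∀ t ∈ Icc (0 : ℝ) 1, y + (t * h) • v ∈ Metric.ball x₀ r := by
    have h1 : ∀ᶠ h in 𝓝 (0 : ℝ), |h| * ‖v‖ < ε := by
      have : Continuous (fun h : ℝ => |h| * ‖v‖) := by fun_prop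
      exact this.continuousAt.eventually (gt_mem_nhds (by simpa using hε))
    filter_upwards [h1] with h hh t ht
    apply hεy
    rw [Metric.mem_ball, dist_eq_norm, add_sub_cancel_left, norm_smul, Real.norm_eq_abs, abs_mul,
      abs_of_nonneg ht.1]
    calc t * |h| * ‖v‖ ≤ 1 * |h| * ‖v‖ := by gcongr; exact ht.2
      _ < ε := by simpa using hh
  obtain ⟨O', hO', hO'o, h0O'⟩ := eventually_nhds_iff.1 hO
  have hm : ContDiffOn ℝ ∞ m O' := by
    have hc : Continuous (fun p : ℝ × ℝ => y + (p.2 * p.1) • v) := by fun_prop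
    refine contDiffOn_integral_param (S := (fun p : ℝ × ℝ => y + (p.2 * p.1) • v) ⁻¹' Metric.ball x₀ r)
      (Metric.isOpen_ball.preimage hc) hO'o (fun h hh t ht => hO' h hh t ht)
      (f := fun p => A (y + (p.2 * p.1) • v) ![v]) ?_
    have h1 : ContDiffOn ℝ ∞ (fun p : ℝ × ℝ => A (y + (p.2 * p.1) • v))
        ((fun p : ℝ × ℝ => y + (p.2 * p.1) • v) ⁻¹' Metric.ball x₀ r) :=
      (hA.mono hr).comp (ContDiff.contDiffOn (by fun_prop)) fun p hp => hp
    exact contDiffOn_alternating_apply h1 contDiffOn_const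
  have hm0 : ContinuousAt m 0 := (hm.continuousOn.continuousAt (hO'o.mem_nhds h0O'))
  have hfd : DifferentiableAt ℝ f y :=
    (hf.differentiableOn (by simp)).differentiableAt (Metric.isOpen_ball.mem_nhds hy)
  have hline : HasDerivAt (fun h : ℝ => f (y + h • v)) (fderiv ℝ f y v) 0 := by
    have h1 : HasDerivAt (fun h : ℝ => y + h • v) v 0 := by
      simpa using ((hasDerivAt_id (0 : ℝ)).smul_const v).const_add y
    exact HasFDerivAt.comp_hasDerivAt (0 : ℝ) (by simpa using hfd.hasFDerivAt) h1
  let ρ : ℝ → ℝ := fun h => f (y + h • v) - f y - h * m h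
  have hρ0 : ρ 0 = 0 := by simp [ρ]
  have hρc : ContinuousAt ρ 0 := (hline.continuousAt.sub continuousAt_const).sub
    (continuousAt_id.mul hm0)
  have hρ : ∀ᶠ h in 𝓝 (0 : ℝ), ρ h = 0 := by
    have h1 : ∀ᶠ h in 𝓝 (0 : ℝ), |ρ h| < 1 := by
      exact hρc.abs.eventually (gt_mem_nhds (by simp [hρ0]))
    filter_upwards [h1, hO] with h hh hmem
    have hmem1 : y + h • v ∈ Metric.ball x₀ r := by simpa using hmem 1 ⟨zero_le_one, le_rfl⟩
    have h2 := hu y (y + h • v) fun t ht => by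
      rw [add_sub_cancel_left, smul_smul]; exact hr (hmem t ht)
    rw [hlift _ hmem1, hlift y hy] at h2
    have h3 : ((ρ h : ℝ) : AddCircle (1 : ℝ)) = 0 := by
      have e : (∫ t in (0 : ℝ)..1, A (y + t • (y + h • v - y)) ![y + h • v - y]) = h * m h := by
        simp only [m, add_sub_cancel_left, smul_smul, alternating_smul_one]
        rw [intervalIntegral.integral_const_mul]
      rw [e] at h2
      simp only [ρ, AddCircle.coe_sub, ← h2]
      abel
    obtain ⟨n, hn⟩ := (AddCircle.coe_eq_zero_iff (1 : ℝ)).1 h3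
    rw [zsmul_eq_mul, mul_one] at hn
    have h4 : |(n : ℝ)| < 1 := hn ▸ hh
    have h5 : n = 0 := Int.abs_lt_one_iff.1 (by exact_mod_cast h4)
    rw [← hn, h5]; simp
  have hm1 : HasDerivAt (fun h : ℝ => h * m h) (m 0) 0 := by
    have := ((hm.differentiableOn (by simp)).differentiableAt (hO'o.mem_nhds h0O')).hasDerivAt
    simpa using (hasDerivAt_id' (0 : ℝ)).fun_mul this
  have h6 : HasDerivAt (fun h : ℝ => f (y + h • v)) (m 0) 0 := by
    refine (hm1.add_const (f y)).congr_of_eventuallyEq ?_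
    filter_upwards [hρ] with h hh
    simp only [ρ] at hh
    linarith
  rw [hline.unique h6]
  simp [m]

end Segments

section LineIntegral

/-- The integral of a `1`-form along a curve. -/
def lineInt (A : V → V [⋀^Fin 1]→L[ℝ] ℝ) (c : ℝ → V) (a b : ℝ) : ℝ :=
  ∫ t in a..b, A (c t) ![deriv c t]

lemma contDiffOn_integral_right {g : ℝ → ℝ} {a b : ℝ} (hab : a < b)
    (hg : ContDiffOn ℝ ∞ g (Icc a b)) :
    ContDiffOn ℝ ∞ (fun t => ∫ s in a..t, g s) (Icc a b) ∧
      ∀ t ∈ Icc a b, HasDerivWithinAt (fun t => ∫ s in a..t, g s) (g t) (Icc a b) t := by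
  have hder : ∀ t ∈ Icc a b, HasDerivWithinAt (fun t => ∫ s in a..t, g s) (g t) (Icc a b) t := by
    intro t ht
    have hc : Continuous (IccExtend hab.le (domRestrict (Icc a b) g)) :=
      (continuousOn_iff_continuous_domRestrict.1 hg.continuousOn).Icc_extend'
    have h1 : HasDerivAt (fun t => ∫ s in a..t, IccExtend hab.le (domRestrict (Icc a b) g) s)
        (IccExtend hab.le (domRestrict (Icc a b) g) t) t := hc.integral_hasStrictDerivAt a t |>.hasDerivAt
    have e : ∀ s ∈ Icc a b, IccExtend hab.le (domRestrict (Icc a b) g) s = g s := fun s hs =>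
      IccExtend_of_mem _ _ hs
    rw [e t ht] at h1
    refine h1.hasDerivWithinAt.congr_of_mem (fun r hr => ?_) ht
    refine intervalIntegral.integral_congr fun s hs => ?_
    rw [uIcc_of_le hr.1] at hs
    exact (e s ⟨hs.1, hs.2.trans hr.2⟩).symm
  refine ⟨?_, hder⟩
  rw [contDiffOn_infty_iff_derivWithin (uniqueDiffOn_Icc hab)]
  refine ⟨fun t ht => (hder t ht).differentiableWithinAt, hg.congr fun t ht => ?_⟩
  exact (hder t ht).derivWithin (uniqueDiffOn_Icc hab t ht)

variable {A : V → V [⋀^Fin 1]→L[ℝ] ℝ} {W : Set V} {c : ℝ → V} {a b : ℝ}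

lemma contDiffOn_lineInt_integrand (hA : ContDiffOn ℝ ∞ A W) (hab : a < b)
    (hc : ContDiffOn ℝ ∞ c (Icc a b)) (hcW : MapsTo c (Icc a b) W) :
    ContDiffOn ℝ ∞ (fun t => A (c t) ![derivWithin c (Icc a b) t]) (Icc a b) :=
  contDiffOn_alternating_apply (hA.comp hc hcW)
    (contDiffOn_vec_one (hc.derivWithin (uniqueDiffOn_Icc hab) (by simp)))

lemma lineInt_integrand_eq : ∀ t ∈ Ioo a b,
    A (c t) ![deriv c t] = A (c t) ![derivWithin c (Icc a b) t] := fun t ht => by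
  rw [derivWithin_of_mem_nhds (Icc_mem_nhds ht.1 ht.2)]

lemma intervalIntegrable_lineInt (hA : ContDiffOn ℝ ∞ A W) (hab : a < b)
    (hc : ContDiffOn ℝ ∞ c (Icc a b)) (hcW : MapsTo c (Icc a b) W) :
    IntervalIntegrable (fun t => A (c t) ![deriv c t]) volume a b := by
  have h1 : IntervalIntegrable (fun t => A (c t) ![derivWithin c (Icc a b) t]) volume a b := by
    apply ContinuousOn.intervalIntegrable
    rw [uIcc_of_le hab.le]
    exact (contDiffOn_lineInt_integrand hA hab hc hcW).continuousOn
  refine (intervalIntegrable_congr_uIoo fun t ht => ?_).1 h1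
  rw [uIoo_of_le hab.le] at ht
  exact (lineInt_integrand_eq t ht).symm

lemma lineInt_eq (hab : a ≤ b) :
    lineInt A c a b = ∫ t in a..b, A (c t) ![derivWithin c (Icc a b) t] := by
  refine intervalIntegral.integral_congr_uIoo fun t ht => ?_
  rw [uIoo_of_le hab] at ht
  exact lineInt_integrand_eq t ht

/-- The integral along a curve of the pull-back of a `1`-form. -/
lemma lineInt_pullback {V' : Type*} [NormedAddCommGroup V'] [NormedSpace ℝ V'] {g : V' → V}
    {c : ℝ → V'} {W' : Set V'} (hW' : IsOpen W') (hg : DifferentiableOn ℝ g W') (hab : a ≤ b)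
    (hc : DifferentiableOn ℝ c (Icc a b)) (hcW : MapsTo c (Icc a b) W') :
    lineInt A (g ∘ c) a b = lineInt (fun y => (A (g y)).compContinuousLinearMap (fderiv ℝ g y)) c a b := by
  refine intervalIntegral.integral_congr_uIoo fun t ht => ?_
  rw [uIoo_of_le hab] at ht
  have h1 := (hc.differentiableAt (Icc_mem_nhds ht.1 ht.2))
  have h2 : DifferentiableAt ℝ g (c t) := hg.differentiableAt (hW'.mem_nhds (hcW (Ioo_subset_Icc_self ht)))
  have h3 : deriv (g ∘ c) t = fderiv ℝ g (c t) (deriv c t) := fderiv_comp_deriv t h2 h1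
  simp only [h3, ContinuousAlternatingMap.compContinuousLinearMap_apply, Function.comp]
  congr 1
  ext i; fin_cases i; rfl

/-- Reparametrization by an affine map. -/
lemma lineInt_comp_affine (hab : a < b) (hc : ContDiffOn ℝ ∞ c (Icc a b)) :
    lineInt A (fun s => c (a + s * (b - a))) 0 1 = lineInt A c a b := by
  have h1 : lineInt A (fun s => c (a + s * (b - a))) 0 1 =
      ∫ s in (0 : ℝ)..1, (b - a) * (fun t => A (c t) ![deriv c t]) (a + (b - a) * s) := by
    refine intervalIntegral.integral_congr_uIoo fun s hs => ?_
    rw [uIoo_of_le zero_le_one] at hs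
    have hmem : a + s * (b - a) ∈ Ioo a b :=
      ⟨by nlinarith [hs.1], by nlinarith [hs.2]⟩
    have hd : HasDerivAt c (deriv c (a + s * (b - a))) (a + s * (b - a)) :=
      ((hc.differentiableOn (by simp)).differentiableAt (Icc_mem_nhds hmem.1 hmem.2)).hasDerivAt
    have ha : HasDerivAt (fun s : ℝ => a + s * (b - a)) (b - a) s := by
      simpa using ((hasDerivAt_id s).mul_const (b - a)).const_add a
    have := (HasDerivAt.scomp s hd ha).deriv
    simp only [Function.comp_def] at this
    simp only [this, alternating_smul_one, mul_comm s]
  rw [h1, intervalIntegral.integral_const_mul]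
  have := intervalIntegral.mul_integral_comp_add_mul (a := 0) (b := 1)
    (f := fun t => A (c t) ![deriv c t]) (b - a) a
  rw [this]
  simp [lineInt]

end LineIntegral

section Planar

lemma uniqueDiffOn_rect {a b c d : ℝ} (hab : a < b) (hcd : c < d) :
    UniqueDiffOn ℝ (Icc a b ×ˢ Icc c d) :=
  (uniqueDiffOn_Icc hab).prod (uniqueDiffOn_Icc hcd)

lemma alternating_vec_two (B : V [⋀^Fin 2]→L[ℝ] ℝ) (v w : V) : B ![w, v] = - B ![v, w] := by
  have h := B.toAlternatingMap.map_swap ![v, w] (i := 0) (j := 1) (by decide)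
  have e : (![v, w] ∘ (Equiv.swap (0 : Fin 2) 1)) = ![w, v] := by
    ext i; fin_cases i <;> simp
  rw [e] at h
  exact h

lemma extDeriv_one_apply {A : V → V [⋀^Fin 1]→L[ℝ] ℝ} {x : V} (h : DifferentiableAt ℝ A x) (v w : V) :
    extDeriv A x ![v, w] =
      fderiv ℝ (fun y => A y ![w]) x v - fderiv ℝ (fun y => A y ![v]) x w := by
  rw [extDeriv_apply h, Fin.sum_univ_two]
  have e0 : (0 : Fin 2).removeNth ![v, w] = ![w] := by ext i; fin_cases i; rfl
  have e1 : (1 : Fin 2).removeNth ![v, w] = ![v] := by ext i; fin_cases i; rfl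
  rw [e0, e1]
  simp [sub_eq_add_neg]

/-- Stokes' theorem for `1`-forms on rectangles. -/
lemma stokes_rectangle {a b c d : ℝ} (hab : a < b) (hcd : c < d)
    {β : ℝ × ℝ → (ℝ × ℝ) [⋀^Fin 1]→L[ℝ] ℝ} (hβ : ContDiffOn ℝ ∞ β (Icc a b ×ˢ Icc c d)) :
    ∫ x in a..b, ∫ y in c..d, extDerivWithin β (Icc a b ×ˢ Icc c d) (x, y) ![(1, 0), (0, 1)] =
      (∫ x in a..b, β (x, c) ![(1, 0)]) + (∫ y in c..d, β (b, y) ![(0, 1)])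
        - (∫ x in a..b, β (x, d) ![(1, 0)]) - ∫ y in c..d, β (a, y) ![(0, 1)] := by
  set R := Icc a b ×ˢ Icc c d with hR
  have hu : UniqueDiffOn ℝ R := uniqueDiffOn_rect hab hcd
  have happ : ∀ v : ℝ × ℝ, ContDiffOn ℝ ∞ (fun p => β p ![v]) R := fun v =>
    contDiffOn_alternating_apply hβ contDiffOn_const
  have hd : ∀ p ∈ R, extDerivWithin β R p ![(1, 0), (0, 1)] =
      fderivWithin ℝ (fun p => β p ![(0, 1)]) R p (1, 0) +
        fderivWithin ℝ (fun p => - β p ![(1, 0)]) R p (0, 1) := by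
    intro p hp
    rw [extDerivWithin_apply (hβ.differentiableOn (by simp) p hp) (hu p hp), Fin.sum_univ_two,
      fderivWithin_fun_neg (hu p hp)]
    have e0 : (0 : Fin 2).removeNth ![((1, 0) : ℝ × ℝ), (0, 1)] = ![(0, 1)] := by
      ext i <;> fin_cases i <;> rfl
    have e1 : (1 : Fin 2).removeNth ![((1, 0) : ℝ × ℝ), (0, 1)] = ![(1, 0)] := by
      ext i <;> fin_cases i <;> rfl
    rw [e0, e1]
    simp
  have hint : ∀ p ∈ Ioo (min a b) (max a b) ×ˢ Ioo (min c d) (max c d), R ∈ 𝓝 p := by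
    rintro ⟨x, y⟩ ⟨hx, hy⟩
    rw [min_eq_left hab.le, max_eq_right hab.le] at hx
    rw [min_eq_left hcd.le, max_eq_right hcd.le] at hy
    exact prod_mem_nhds (Icc_mem_nhds hx.1 hx.2) (Icc_mem_nhds hy.1 hy.2)
  have huI : uIcc a b ×ˢ uIcc c d = R := by rw [uIcc_of_le hab.le, uIcc_of_le hcd.le]
  have hdiv := integral2_divergence_prod_of_hasFDerivAt (fun p => β p ![(0, 1)])
    (fun p => - β p ![(1, 0)]) (fderivWithin ℝ (fun p => β p ![(0, 1)]) R)
    (fderivWithin ℝ (fun p => - β p ![(1, 0)]) R) a c b d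
    (by rw [huI]; exact (happ _).continuousOn) (by rw [huI]; exact (happ _).continuousOn.neg)
    (fun p hp => ((happ _).differentiableOn (by simp) p (mem_of_mem_nhds (hint p hp))).hasFDerivWithinAt.hasFDerivAt (hint p hp))
    (fun p hp => ((happ _).neg.differentiableOn (by simp) p (mem_of_mem_nhds (hint p hp))).hasFDerivWithinAt.hasFDerivAt (hint p hp))
    (by
      rw [huI]
      refine ContinuousOn.integrableOn_compact (isCompact_Icc.prod isCompact_Icc) ?_
      exact ((((happ _).continuousOn_fderivWithin hu (by simp)).clm_apply continuousOn_const).add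
        (((happ _).neg.continuousOn_fderivWithin hu (by simp)).clm_apply continuousOn_const)))
  have hcong : ∫ x in a..b, ∫ y in c..d, extDerivWithin β R (x, y) ![(1, 0), (0, 1)] =
      ∫ x in a..b, ∫ y in c..d, fderivWithin ℝ (fun p => β p ![(0, 1)]) R (x, y) (1, 0) +
        fderivWithin ℝ (fun p => - β p ![(1, 0)]) R (x, y) (0, 1) := by
    refine intervalIntegral.integral_congr fun x hx => intervalIntegral.integral_congr fun y hy => ?_
    exact hd (x, y) (huI ▸ ⟨hx, hy⟩)
  rw [hcong, hdiv]
  simp only [intervalIntegral.integral_neg]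
  ring

lemma convex_triangle : Convex ℝ triangle := by
  rintro x ⟨hx1, hx2, hx3⟩ y ⟨hy1, hy2, hy3⟩ a b ha hb hab
  refine ⟨?_, ?_, ?_⟩ <;> simp only [Prod.fst_add, Prod.snd_add, Prod.smul_fst, Prod.smul_snd, smul_eq_mul]
  · positivity
  · positivity
  · calc a * x.1 + b * y.1 + (a * x.2 + b * y.2) = a * (x.1 + x.2) + b * (y.1 + y.2) := by ring
      _ ≤ a * 1 + b * 1 := by gcongr
      _ = 1 := by rw [mul_one, mul_one, hab]

lemma isClosed_triangle : IsClosed triangle := by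
  refine (isClosed_le continuous_const continuous_fst).inter
    ((isClosed_le continuous_const continuous_snd).inter
      (isClosed_le (continuous_fst.add continuous_snd) continuous_const))

lemma triangle_subset : triangle ⊆ Icc (0 : ℝ) 1 ×ˢ Icc (0 : ℝ) 1 := by
  rintro p ⟨h1, h2, h3⟩
  exact ⟨⟨h1, by linarith⟩, ⟨h2, by linarith⟩⟩

lemma interior_triangle_nonempty : (interior triangle).Nonempty := by
  refine ⟨(1 / 4, 1 / 4), ?_⟩
  rw [mem_interior]
  refine ⟨{p | 0 < p.1 ∧ 0 < p.2 ∧ p.1 + p.2 < 1}, fun p hp => ⟨hp.1.le, hp.2.1.le, hp.2.2.le⟩, ?_,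
    by norm_num⟩
  exact (isOpen_lt continuous_const continuous_fst).inter
    ((isOpen_lt continuous_const continuous_snd).inter
      (isOpen_lt (continuous_fst.add continuous_snd) continuous_const))

lemma uniqueDiffOn_triangle : UniqueDiffOn ℝ triangle :=
  uniqueDiffOn_convex convex_triangle interior_triangle_nonempty

lemma isCompact_triangle : IsCompact triangle :=
  (isCompact_Icc.prod isCompact_Icc).of_isClosed_subset isClosed_triangle triangle_subset

/-- Points of the square above the diagonal. -/
def upperTriangle : Set (ℝ × ℝ) := {p | 0 ≤ p.1 ∧ p.1 ≤ p.2 ∧ p.2 ≤ 1}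

lemma isClosed_upperTriangle : IsClosed upperTriangle :=
  (isClosed_le continuous_const continuous_fst).inter
    ((isClosed_le continuous_fst continuous_snd).inter (isClosed_le continuous_snd continuous_const))

lemma setIntegral_triangle_shear (F : ℝ × ℝ → ℝ) :
    ∫ p in triangle, F (p.2, p.1 + p.2) = ∫ p in upperTriangle, F p := by
  have hm : MeasurePreserving (fun z : ℝ × ℝ => (z.2, z.2 + z.1)) volume volume :=
    measurePreserving_prod_add_swap volume volume
  have he : MeasurableEmbedding (fun z : ℝ × ℝ => (z.2, z.2 + z.1)) :=
    ((MeasurableEquiv.prodComm (α := ℝ) (β := ℝ)).trans (MeasurableEquiv.shearAddRight ℝ)).measurableEmbedding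
  have h := hm.setIntegral_preimage_emb he F upperTriangle
  rw [← h]
  have e : (fun z : ℝ × ℝ => (z.2, z.2 + z.1)) ⁻¹' upperTriangle = triangle := by
    ext z
    simp only [mem_preimage, upperTriangle, triangle, mem_ofPred_eq]
    constructor
    · rintro ⟨h1, h2, h3⟩; exact ⟨by linarith, h1, by linarith⟩
    · rintro ⟨h1, h2, h3⟩; exact ⟨h2, by linarith, by linarith⟩
  rw [e]
  simp only [add_comm]

lemma setIntegral_upperTriangle {F : ℝ × ℝ → ℝ} (hF : IntegrableOn F upperTriangle) :
    ∫ p in upperTriangle, F p = ∫ s in (0 : ℝ)..1, ∫ u in (0 : ℝ)..s, F (u, s) := by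
  rw [← MeasureTheory.integral_indicator isClosed_upperTriangle.measurableSet, Measure.volume_eq_prod,
    integral_prod_symm _ (by
      rw [← Measure.volume_eq_prod]; exact hF.integrable_indicator isClosed_upperTriangle.measurableSet),
    intervalIntegral.integral_of_le zero_le_one, ← integral_Icc_eq_integral_Ioc,
    ← MeasureTheory.integral_indicator measurableSet_Icc]
  congr 1
  ext s
  by_cases hs : s ∈ Icc (0 : ℝ) 1
  · rw [indicator_of_mem hs, intervalIntegral.integral_of_le hs.1, ← integral_Icc_eq_integral_Ioc,
      ← MeasureTheory.integral_indicator measurableSet_Icc]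
    congr 1
    ext u
    by_cases hu : u ∈ Icc 0 s
    · rw [indicator_of_mem hu, indicator_of_mem (show (u, s) ∈ upperTriangle from ⟨hu.1, hu.2, hs.2⟩)]
    · rw [indicator_of_notMem hu, indicator_of_notMem (fun h => hu ⟨h.1, h.2.1⟩)]
  · rw [indicator_of_notMem hs]
    refine integral_eq_zero_of_ae (Filter.Eventually.of_forall fun u => ?_)
    exact indicator_of_notMem (fun h => hs ⟨h.1.trans h.2.1, h.2.2⟩) _

/-- Integrals over the triangle in polar-like coordinates. -/
lemma setIntegral_triangle_eq {F : ℝ × ℝ → ℝ} (hF : IntegrableOn F triangle) :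
    ∫ p in triangle, F p = ∫ s in (0 : ℝ)..1, ∫ t in (0 : ℝ)..1, s * F (s * (1 - t), s * t) := by
  let F' : ℝ × ℝ → ℝ := fun q => F (q.2 - q.1, q.1)
  have hm : MeasurePreserving (fun z : ℝ × ℝ => (z.2, z.2 + z.1)) volume volume :=
    measurePreserving_prod_add_swap volume volume
  have he : MeasurableEmbedding (fun z : ℝ × ℝ => (z.2, z.2 + z.1)) :=
    ((MeasurableEquiv.prodComm (α := ℝ) (β := ℝ)).trans (MeasurableEquiv.shearAddRight ℝ)).measurableEmbedding
  have e : (fun z : ℝ × ℝ => (z.2, z.2 + z.1)) ⁻¹' upperTriangle = triangle := by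
    ext z
    simp only [mem_preimage, upperTriangle, triangle, mem_ofPred_eq]
    constructor
    · rintro ⟨h1, h2, h3⟩; exact ⟨by linarith, h1, by linarith⟩
    · rintro ⟨h1, h2, h3⟩; exact ⟨h2, by linarith, by linarith⟩
  have hF' : IntegrableOn F' upperTriangle := by
    rw [← hm.integrableOn_comp_preimage he, e]
    refine hF.congr_fun (fun p _ => ?_) isClosed_triangle.measurableSet
    simp [F']
  have h1 := setIntegral_triangle_shear F'
  simp only [F', add_sub_cancel_right] at h1
  rw [h1, setIntegral_upperTriangle hF']
  refine intervalIntegral.integral_congr fun s hs => ?_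
  have := intervalIntegral.mul_integral_comp_mul_left (a := 0) (b := 1) (f := fun u => F' (u, s)) s
  simp only [mul_zero, mul_one] at this
  rw [intervalIntegral.integral_const_mul, ← this]
  simp only [F']
  congr 2
  ext t
  ring_nf

lemma volume_diagonal : volume {p : ℝ × ℝ | p.1 = p.2} = 0 := by
  let D : Submodule ℝ (ℝ × ℝ) := LinearMap.ker (LinearMap.fst ℝ ℝ ℝ - LinearMap.snd ℝ ℝ ℝ)
  have hD : D ≠ ⊤ := by
    intro h
    have : ((1, 0) : ℝ × ℝ) ∈ D := h ▸ Submodule.mem_top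
    simp [D] at this
  have := Measure.addHaar_submodule volume D hD
  convert! this using 2
  ext p
  simp [D, sub_eq_zero]

/-- A square is the union of two triangles. -/
lemma setIntegral_two_triangles {F : ℝ × ℝ → ℝ} (hF : IntegrableOn F (Icc (0 : ℝ) 1 ×ˢ Icc (0 : ℝ) 1)) :
    (∫ p in triangle, F (p.1 + p.2, p.2)) + ∫ p in triangle, F (p.2, p.1 + p.2) =
      ∫ s in (0 : ℝ)..1, ∫ t in (0 : ℝ)..1, F (s, t) := by
  have hsw : MeasurePreserving (Prod.swap : ℝ × ℝ → ℝ × ℝ) volume volume := Measure.measurePreserving_swap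
  have h1 := setIntegral_triangle_shear (F ∘ Prod.swap)
  simp only [Function.comp, Prod.swap_prod_mk] at h1
  have h2 := hsw.setIntegral_preimage_emb MeasurableEquiv.prodComm.measurableEmbedding F
    (Prod.swap ⁻¹' upperTriangle)
  rw [← preimage_comp, Prod.swap_swap_eq, preimage_id] at h2
  rw [h1, setIntegral_triangle_shear F, h2]
  have hu : Prod.swap ⁻¹' upperTriangle ∪ upperTriangle = Icc (0 : ℝ) 1 ×ˢ Icc (0 : ℝ) 1 := by
    ext p
    simp only [upperTriangle, mem_union, mem_preimage, mem_ofPred_eq, Prod.fst_swap, Prod.snd_swap,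
      mem_prod, mem_Icc]
    constructor
    · rintro (⟨a, b, c⟩ | ⟨a, b, c⟩)
      · exact ⟨⟨a.trans b, c⟩, a, b.trans c⟩
      · exact ⟨⟨a, b.trans c⟩, a.trans b, c⟩
    · rintro ⟨⟨a, b⟩, c, d⟩
      rcases le_total p.1 p.2 with h | h
      · exact Or.inr ⟨a, h, d⟩
      · exact Or.inl ⟨c, h, b⟩
  rw [← setIntegral_union₀ ?_ isClosed_upperTriangle.measurableSet.nullMeasurableSet
    (hF.mono_set (hu ▸ subset_union_left)) (hF.mono_set (hu ▸ subset_union_right)), hu,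
    Measure.volume_eq_prod, setIntegral_prod _ (by rwa [← Measure.volume_eq_prod]),
    intervalIntegral.integral_of_le zero_le_one, ← integral_Icc_eq_integral_Ioc]
  · refine setIntegral_congr_fun measurableSet_Icc fun s _ => ?_
    rw [intervalIntegral.integral_of_le zero_le_one, ← integral_Icc_eq_integral_Ioc]
  · refine measure_mono_null (fun p hp => ?_) volume_diagonal
    exact le_antisymm hp.2.2.1 hp.1.2.1

end Planar

end Analysis

lemma two_le_infty : (2 : WithTop ℕ∞) ≤ ∞ := by
  change ((2 : ℕ∞) : WithTop ℕ∞) ≤ ((⊤ : ℕ∞) : WithTop ℕ∞)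
  exact WithTop.coe_le_coe.2 le_top

lemma minSmoothness_two_le : minSmoothness ℝ 2 ≤ ∞ := by
  simpa using two_le_infty

section Derivatives

variable {E₁ : Type*} [NormedAddCommGroup E₁] [NormedSpace ℝ E₁]
  {H₁ : Type*} [TopologicalSpace H₁] (I₁ : ModelWithCorners ℝ E₁ H₁)
  {N₁ : Type*} [TopologicalSpace N₁] [ChartedSpace H₁ N₁]
  {E₂ : Type*} [NormedAddCommGroup E₂] [NormedSpace ℝ E₂]
  {H₂ : Type*} [TopologicalSpace H₂] (I₂ : ModelWithCorners ℝ E₂ H₂)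
  {N₂ : Type*} [TopologicalSpace N₂] [ChartedSpace H₂ N₂]
  {E₃ : Type*} [NormedAddCommGroup E₃] [NormedSpace ℝ E₃]
  {H₃ : Type*} [TopologicalSpace H₃] (I₃ : ModelWithCorners ℝ E₃ H₃)
  {N₃ : Type*} [TopologicalSpace N₃] [ChartedSpace H₃ N₃]

/-- The manifold derivative within a set, as a map between the model spaces. -/
def mD (f : N₁ → N₂) (S : Set N₁) (x : N₁) : E₁ →L[ℝ] E₂ := mfderivWithin I₁ I₂ f S x

variable {I₁ I₂ I₃}

lemma mD_univ (f : N₁ → N₂) (x : N₁) : mD I₁ I₂ f univ x = (mfderiv I₁ I₂ f x : E₁ →L[ℝ] E₂) := by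
  simp only [mD, mfderivWithin_univ]; rfl

lemma mD_of_mem_nhds (f : N₁ → N₂) {S : Set N₁} {x : N₁} (h : S ∈ 𝓝 x) :
    mD I₁ I₂ f S x = mD I₁ I₂ f univ x := by
  rw [mD_univ]; exact mfderivWithin_of_mem_nhds h

lemma mD_comp {g : N₂ → N₃} {f : N₁ → N₂} {S : Set N₁} {T : Set N₂} {x : N₁}
    (hg : MDifferentiableWithinAt I₂ I₃ g T (f x)) (hf : MDifferentiableWithinAt I₁ I₂ f S x)
    (h : MapsTo f S T) (hS : UniqueMDiffWithinAt I₁ S x) :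
    mD I₁ I₃ (g ∘ f) S x = (mD I₂ I₃ g T (f x)).comp (mD I₁ I₂ f S x) :=
  mfderivWithin_comp x hg hf h hS

lemma mD_congr_of_eventuallyEq {f g : N₁ → N₂} {S : Set N₁} {x : N₁} (h : f =ᶠ[𝓝[S] x] g) (hx : f x = g x) :
    mD I₁ I₂ f S x = mD I₁ I₂ g S x :=
  h.mfderivWithin_eq hx

lemma mD_congr {f g : N₁ → N₂} {S : Set N₁} {x : N₁} (h : EqOn f g S) (hx : x ∈ S) :
    mD I₁ I₂ f S x = mD I₁ I₂ g S x :=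
  mD_congr_of_eventuallyEq (h.eventuallyEq_nhdsWithin) (h hx)

lemma mD_eq_fderivWithin {V V' : Type*} [NormedAddCommGroup V] [NormedSpace ℝ V]
    [NormedAddCommGroup V'] [NormedSpace ℝ V'] (f : V → V') (S : Set V) (x : V) :
    mD 𝓘(ℝ, V) 𝓘(ℝ, V') f S x = fderivWithin ℝ f S x := by
  simp only [mD, mfderivWithin_eq_fderivWithin]

end Derivatives

section Pull

variable {E : Type*} [NormedAddCommGroup E] [NormedSpace ℝ E]
  {H : Type*} [TopologicalSpace H] {I : ModelWithCorners ℝ E H}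
  {M : Type*} [TopologicalSpace M] [ChartedSpace H M]
  {V : Type*} [NormedAddCommGroup V] [NormedSpace ℝ V]
  {V' : Type*} [NormedAddCommGroup V'] [NormedSpace ℝ V'] {k : ℕ}

/-- The values of a differential form as alternating maps on the model space. -/
def DifferentialForm.val (η : DifferentialForm I M k) : M → E [⋀^Fin k]→L[ℝ] ℝ := η.toFun

/-- The pull-back of a form to a subset of a normed space. -/
def DifferentialForm.pull (η : DifferentialForm I M k) (f : V → M) (S : Set V) (y : V) :
    V [⋀^Fin k]→L[ℝ] ℝ :=
  (η.val (f y)).compContinuousLinearMap (mD 𝓘(ℝ, V) I f S y)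

lemma DifferentialForm.pull_congr (η : DifferentialForm I M k) {f g : V → M} {S : Set V} {y : V}
    (h : EqOn f g S) (hy : y ∈ S) : η.pull f S y = η.pull g S y := by
  rw [pull, pull, mD_congr h hy, h hy]

lemma DifferentialForm.pull_congr_of_eventuallyEq (η : DifferentialForm I M k) {f g : V → M} {S : Set V} {y : V}
    (h : f =ᶠ[𝓝[S] y] g) (hy : f y = g y) : η.pull f S y = η.pull g S y := by
  rw [pull, pull, mD_congr_of_eventuallyEq h hy, hy]

lemma DifferentialForm.pull_of_mem_nhds (η : DifferentialForm I M k) {f : V → M} {S : Set V} {y : V}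
    (h : S ∈ 𝓝 y) : η.pull f S y = η.pull f univ y := by
  rw [pull, pull, mD_of_mem_nhds f h]

lemma DifferentialForm.pull_comp (η : DifferentialForm I M k) {f : V → M} {g : V' → V} {W : Set V}
    {S : Set V'} {y : V'} (hf : MDifferentiableWithinAt 𝓘(ℝ, V) I f W (g y))
    (hg : DifferentiableWithinAt ℝ g S y) (h : MapsTo g S W) (hS : UniqueDiffWithinAt ℝ S y) :
    η.pull (f ∘ g) S y = (η.pull f W (g y)).compContinuousLinearMap (fderivWithin ℝ g S y) := by
  rw [pull, mD_comp hf hg.mdifferentiableWithinAt h hS.uniqueMDiffWithinAt, mD_eq_fderivWithin]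
  rfl

variable [FiniteDimensional ℝ E] [FiniteDimensional ℝ V] [I.Boundaryless] [IsManifold I ∞ M]

lemma DifferentialForm.pull_eq_chart (η : DifferentialForm I M k) {f : V → M} {S : Set V} {y : V}
    (x₀ : M) (hy : f y ∈ (extChartAt I x₀).source) (hf : MDifferentiableWithinAt 𝓘(ℝ, V) I f S y)
    (hS : UniqueDiffWithinAt ℝ S y) :
    η.pull f S y = (chartRep I η.toFun x₀ (extChartAt I x₀ (f y))).compContinuousLinearMap
      (fderivWithin ℝ (extChartAt I x₀ ∘ f) S y) := by
  have : IsManifold I 1 M := IsManifold.of_le (n := ∞) (by simp)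
  have hφ : MDifferentiableWithinAt I 𝓘(ℝ, E) (extChartAt I x₀) univ (f y) :=
    (mdifferentiableAt_extChartAt (by simpa using hy)).mdifferentiableWithinAt
  have hc : chartRep I η.toFun x₀ (extChartAt I x₀ (f y)) =
      (η.val ((extChartAt I x₀).symm (extChartAt I x₀ (f y)))).compContinuousLinearMap
        (mfderivWithin 𝓘(ℝ, E) I (extChartAt I x₀).symm (range I) (extChartAt I x₀ (f y)) : E →L[ℝ] E) := by
    rw [I.range_eq_univ, mfderivWithin_univ]; rfl
  rw [hc, (extChartAt I x₀).left_inv hy, ← mD_eq_fderivWithin, mD_comp hφ hf (mapsTo_univ _ _) hS.uniqueMDiffWithinAt]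
  have h1 : (mD 𝓘(ℝ, E) I (extChartAt I x₀).symm (range I) (extChartAt I x₀ (f y))).comp
      (mD I 𝓘(ℝ, E) (extChartAt I x₀) univ (f y)) = ContinuousLinearMap.id ℝ E := by
    rw [mD_univ]
    exact mfderivWithin_extChartAt_symm_comp_mfderiv_extChartAt' hy
  rw [pull]
  conv_lhs => rw [← (mD 𝓘(ℝ, V) I f S y).id_comp, ← h1]
  rfl

lemma contDiffOn_compContinuousLinearMap {X : Type*} [NormedAddCommGroup X] [NormedSpace ℝ X]
    {n : WithTop ℕ∞} {S : Set X} {A : X → E [⋀^Fin k]→L[ℝ] ℝ} {L : X → V →L[ℝ] E}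
    (hA : ContDiffOn ℝ n A S) (hL : ContDiffOn ℝ n L S) :
    ContDiffOn ℝ n (fun x => (A x).compContinuousLinearMap (L x)) S :=
  contDiffOn_alternating_of_apply fun _ => contDiffOn_alternating_apply hA
    (contDiffOn_pi.2 fun _ => hL.clm_apply contDiffOn_const)

lemma DifferentialForm.contDiffOn_pull (η : DifferentialForm I M k) {f : V → M} {S : Set V}
    (hf : ContMDiffOn 𝓘(ℝ, V) I ∞ f S) (hS : UniqueDiffOn ℝ S) : ContDiffOn ℝ ∞ (η.pull f S) S := by
  intro y hy
  set x₀ := f y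
  have hsrc : (extChartAt I x₀).source ∈ 𝓝 (f y) := extChartAt_source_mem_nhds x₀
  obtain ⟨U, hUo, hyU, hU⟩ : ∃ U : Set V, IsOpen U ∧ y ∈ U ∧ ∀ z ∈ U ∩ S, f z ∈ (extChartAt I x₀).source := by
    obtain ⟨u, huo, hyu, hu⟩ := mem_nhdsWithin.1 (hf.continuousOn y hy hsrc)
    exact ⟨u, huo, hyu, hu⟩
  have hS' : UniqueDiffOn ℝ (S ∩ U) := hS.inter hUo
  have hφf : ContDiffOn ℝ ∞ (extChartAt I x₀ ∘ f) (S ∩ U) := by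
    rw [← contMDiffOn_iff_contDiffOn]
    refine (contMDiffOn_extChartAt (x := x₀)).comp (hf.mono inter_subset_left) fun z hz => ?_
    simpa using hU z ⟨hz.2, hz.1⟩
  have h1 : ContDiffOn ℝ ∞ (fun z => (chartRep I η.toFun x₀ (extChartAt I x₀ (f z))).compContinuousLinearMap
      (fderivWithin ℝ (extChartAt I x₀ ∘ f) (S ∩ U) z)) (S ∩ U) := by
    refine contDiffOn_compContinuousLinearMap ((η.smooth x₀).comp hφf fun z hz => ?_)
      (hφf.fderivWithin hS' (by simp))
    exact (extChartAt I x₀).map_source (hU z ⟨hz.2, hz.1⟩)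
  have h2 : ContDiffOn ℝ ∞ (η.pull f S) (S ∩ U) := h1.congr fun z hz => by
    rw [η.pull_eq_chart x₀ (hU z ⟨hz.2, hz.1⟩)
      ((hf z hz.1).mdifferentiableWithinAt (by simp)) (hS z hz.1),
      fderivWithin_inter (hUo.mem_nhds hz.2)]
  exact (h2 y ⟨hy, hyU⟩).mono_of_mem_nhdsWithin
    (inter_mem_nhdsWithin S (hUo.mem_nhds hyU))

end Pull

section Potentials

variable {E : Type*} [NormedAddCommGroup E] [NormedSpace ℝ E] [FiniteDimensional ℝ E]
  {H : Type*} [TopologicalSpace H] {I : ModelWithCorners ℝ E H} [I.Boundaryless]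
  {M : Type*} [TopologicalSpace M] [ChartedSpace H M] [IsManifold I ∞ M]
  {V : Type*} [NormedAddCommGroup V] [NormedSpace ℝ V] [FiniteDimensional ℝ V]
  {V' : Type*} [NormedAddCommGroup V'] [NormedSpace ℝ V'] [FiniteDimensional ℝ V']

/-- The restriction of a curve to `[a,b]`, reparametrized affinely on `[0,1]`. -/
def arc {X : Type*} (γ : ℝ → X) (a b : ℝ) : unitInterval → X := fun s => γ (a + s * (b - a))

lemma arc_mem {a b : ℝ} (hab : a ≤ b) (s : unitInterval) : a + s * (b - a) ∈ Icc a b :=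
  ⟨by nlinarith [s.2.1, s.2.2], by nlinarith [s.2.1, s.2.2]⟩

lemma arc_congr {X : Type*} {γ γ' : ℝ → X} {a b : ℝ} (hab : a ≤ b) (h : EqOn γ γ' (Icc a b)) :
    arc γ a b = arc γ' a b :=
  funext fun s => h (arc_mem hab s)

variable (I) in
/-- On the open set `W`, the functional `P` on arcs is, along the map `f`, the integral of the
`1`-form `A` corrected by the function `h` at the end points. -/
structure IsPotential (P : (unitInterval → M) → AddCircle (1 : ℝ)) (f : V → M) (W : Set V)
    (h : V → AddCircle (1 : ℝ)) (A : V → V [⋀^Fin 1]→L[ℝ] ℝ) : Prop where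
  isOpen : IsOpen W
  smooth_map : ContMDiffOn 𝓘(ℝ, V) I ∞ f W
  smooth : ContDiffOn ℝ ∞ A W
  eq : ∀ (c : ℝ → V) (a b : ℝ), a < b → ContDiffOn ℝ ∞ c (Icc a b) → MapsTo c (Icc a b) W →
    P (arc (f ∘ c) a b) = h (c b) - h (c a) + (lineInt A c a b : AddCircle (1 : ℝ))

variable {P : (unitInterval → M) → AddCircle (1 : ℝ)} {f : V → M} {W : Set V}
  {h : V → AddCircle (1 : ℝ)} {A : V → V [⋀^Fin 1]→L[ℝ] ℝ}

lemma IsPotential.mono (hp : IsPotential I P f W h A) {W' : Set V} (hW' : IsOpen W') (hs : W' ⊆ W) :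
    IsPotential I P f W' h A where
  isOpen := hW'
  smooth_map := hp.smooth_map.mono hs
  smooth := hp.smooth.mono hs
  eq c a b hab hc hcW := hp.eq c a b hab hc fun t ht => hs (hcW ht)

lemma IsPotential.congr (hp : IsPotential I P f W h A) {f' : V → M} (hff' : EqOn f' f W) :
    IsPotential I P f' W h A where
  isOpen := hp.isOpen
  smooth_map := hp.smooth_map.congr hff'
  smooth := hp.smooth
  eq c a b hab hc hcW := by
    have e : EqOn (f' ∘ c) (f ∘ c) (Icc a b) := fun t ht => hff' (hcW ht)
    rw [← hp.eq c a b hab hc hcW, arc_congr hab.le e]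

lemma IsPotential.comp (hp : IsPotential I P f W h A) {g : V' → V} {W' : Set V'} (hW' : IsOpen W')
    (hg : ContDiffOn ℝ ∞ g W') (hgW : MapsTo g W' W) :
    IsPotential I P (f ∘ g) W' (h ∘ g) (fun y => (A (g y)).compContinuousLinearMap (fderiv ℝ g y)) where
  isOpen := hW'
  smooth_map := hp.smooth_map.comp hg.contMDiffOn hgW
  smooth := contDiffOn_compContinuousLinearMap (hp.smooth.comp hg hgW) (hg.fderiv_of_isOpen hW' (by simp))
  eq c a b hab hc hcW := by
    have h1 := hp.eq (g ∘ c) a b hab (hg.comp hc hcW) (hgW.comp hcW)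
    rw [lineInt_pullback hW' (hg.differentiableOn (by simp)) hab.le (hc.differentiableOn (by simp)) hcW] at h1
    exact h1

lemma lineInt_segment (A : V → V [⋀^Fin 1]→L[ℝ] ℝ) (x v : V) :
    lineInt A (fun t => x + t • v) 0 1 = ∫ t in (0 : ℝ)..1, A (x + t • v) ![v] := by
  have : ∀ t : ℝ, deriv (fun t : ℝ => x + t • v) t = v := fun t => by
    simpa using (((hasDerivAt_id t).smul_const v).const_add x).deriv
  simp only [lineInt, this]

/-- Two potentials along the same map differ by a gauge transformation. -/
lemma IsPotential.exists_gauge (hp : IsPotential I P f W h A) {h' : V → AddCircle (1 : ℝ)}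
    {A' : V → V [⋀^Fin 1]→L[ℝ] ℝ} (hp' : IsPotential I P f W h' A') {x₀ : V} {r : ℝ}
    (hr : Metric.ball x₀ r ⊆ W) :
    ∃ g : V → ℝ, g x₀ = 0 ∧ ContDiffOn ℝ ∞ g (Metric.ball x₀ r) ∧ ∀ y ∈ Metric.ball x₀ r,
      h y - h' y = h x₀ - h' x₀ + (g y : AddCircle (1 : ℝ)) ∧
      ∀ v, fderiv ℝ g y v = A' y ![v] - A y ![v] := by
  refine exists_smooth_lift (u := fun y => h y - h' y) hp.isOpen (hp'.smooth.sub hp.smooth)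
    (fun x y hxy => ?_) hr
  let c : ℝ → V := fun t => x + t • (y - x)
  have hc : ContDiff ℝ ∞ c := by fun_prop
  have h1 := hp.eq c 0 1 zero_lt_one hc.contDiffOn hxy
  have h2 := hp'.eq c 0 1 zero_lt_one hc.contDiffOn hxy
  have e0 : c 0 = x := by simp [c]
  have e1 : c 1 = y := by simp [c]
  rw [h1, e0, e1] at h2
  have h3 : lineInt (fun z => A' z - A z) c 0 1 = lineInt A' c 0 1 - lineInt A c 0 1 := by
    simp only [lineInt, ContinuousAlternatingMap.sub_apply]
    exact intervalIntegral.integral_sub (intervalIntegrable_lineInt hp'.smooth zero_lt_one hc.contDiffOn hxy)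
      (intervalIntegrable_lineInt hp.smooth zero_lt_one hc.contDiffOn hxy)
  have h4 : ∫ t in (0 : ℝ)..1, (A' (x + t • (y - x)) - A (x + t • (y - x))) ![y - x] = lineInt A' c 0 1 - lineInt A c 0 1 := by
    rw [← h3]; exact (lineInt_segment (A' - A) x (y - x)).symm
  rw [h4, AddCircle.coe_sub]
  have h5 := sub_eq_zero.2 h2
  rw [← sub_eq_zero, ← h5]
  abel

lemma vec_two_eta (v : Fin 2 → V) : v = ![v 0, v 1] := by
  ext i; fin_cases i <;> rfl

lemma vec_one_eta (v : Fin 1 → V) : v = ![v 0] := by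
  ext i; fin_cases i; rfl

/-- Adding an exact form does not change the exterior derivative. -/
lemma extDeriv_eq_of_sub_eq_fderiv {A A' : V → V [⋀^Fin 1]→L[ℝ] ℝ} {g : V → ℝ} {x : V}
    (hA : DifferentiableAt ℝ A x) (hA' : DifferentiableAt ℝ A' x) (hg : ContDiffAt ℝ ∞ g x)
    (h : ∀ᶠ y in 𝓝 x, ∀ v, fderiv ℝ g y v = A' y ![v] - A y ![v]) :
    extDeriv A' x = extDeriv A x := by
  have hA1 : ∀ v, DifferentiableAt ℝ (fun y => A y ![v]) x := fun v =>
    hA.continuousAlternatingMap_apply_const _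
  have hA1' : ∀ v, DifferentiableAt ℝ (fun y => A' y ![v]) x := fun v =>
    hA'.continuousAlternatingMap_apply_const _
  have hg2 : DifferentiableAt ℝ (fderiv ℝ g) x :=
    (hg.fderiv_right (m := 1) (by exact two_le_infty)).differentiableAt (by simp)
  have key : ∀ v w, fderiv ℝ (fun y => A' y ![v]) x w - fderiv ℝ (fun y => A y ![v]) x w =
      fderiv ℝ (fderiv ℝ g) x w v := fun v w => by
    rw [← ContinuousLinearMap.sub_apply, ← fderiv_fun_sub (hA1' v) (hA1 v)]
    have e : (fun y => A' y ![v] - A y ![v]) =ᶠ[𝓝 x] fun y => fderiv ℝ g y v := by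
      filter_upwards [h] with y hy using (hy v).symm
    rw [e.fderiv_eq, fderiv_clm_apply hg2 (differentiableAt_const v)]
    simp
  have hsymm : ∀ v w, fderiv ℝ (fderiv ℝ g) x w v = fderiv ℝ (fderiv ℝ g) x v w := fun v w =>
    (hg.isSymmSndFDerivAt minSmoothness_two_le) w v
  ext v
  rw [vec_two_eta v, extDeriv_one_apply hA, extDeriv_one_apply hA']
  have h1 := key (v 1) (v 0)
  have h2 := key (v 0) (v 1)
  have h3 := hsymm (v 1) (v 0)
  linarith

lemma IsPotential.extDeriv_eq (hp : IsPotential I P f W h A) {h' : V → AddCircle (1 : ℝ)}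
    {W' : Set V} {A' : V → V [⋀^Fin 1]→L[ℝ] ℝ} (hp' : IsPotential I P f W' h' A') {x₀ : V}
    (hx₀ : x₀ ∈ W) (hx₀' : x₀ ∈ W') : extDeriv A' x₀ = extDeriv A x₀ := by
  have hWW := hp.isOpen.inter hp'.isOpen
  obtain ⟨r, hr, hrW⟩ := Metric.isOpen_iff.1 hWW x₀ ⟨hx₀, hx₀'⟩
  obtain ⟨g, -, hg, hgy⟩ := (hp.mono hWW inter_subset_left).exists_gauge
    (hp'.mono hWW inter_subset_right) hrW
  have hn : Metric.ball x₀ r ∈ 𝓝 x₀ := Metric.ball_mem_nhds x₀ hr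
  refine extDeriv_eq_of_sub_eq_fderiv ?_ ?_ (hg.contDiffAt hn) ?_
  · exact (hp.smooth.differentiableOn (by simp)).differentiableAt (hp.isOpen.mem_nhds hx₀)
  · exact (hp'.smooth.differentiableOn (by simp)).differentiableAt (hp'.isOpen.mem_nhds hx₀')
  · filter_upwards [hn] with y hy using (hgy y hy).2

variable (I) in
/-- `P` has potentials in the charts around all points. -/
def HasPotentials (P : (unitInterval → M) → AddCircle (1 : ℝ)) : Prop :=
  ∀ x : M, ∃ (W : Set E) (h : E → AddCircle (1 : ℝ)) (A : E → E [⋀^Fin 1]→L[ℝ] ℝ),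
    extChartAt I x x ∈ W ∧ W ⊆ (extChartAt I x).target ∧ IsPotential I P (extChartAt I x).symm W h A

lemma contDiffOn_extChartAt_comp {f : V → M} {W : Set V} (hf : ContMDiffOn 𝓘(ℝ, V) I ∞ f W) (x : M)
    (hW : MapsTo f W (extChartAt I x).source) : ContDiffOn ℝ ∞ (extChartAt I x ∘ f) W := by
  rw [← contMDiffOn_iff_contDiffOn]
  refine (contMDiffOn_extChartAt (x := x)).comp hf fun z hz => ?_
  simpa using hW hz

/-- A potential along the inverse of a chart gives potentials along all maps into the domain. -/
lemma IsPotential.of_chart {x : M} {W : Set E} {h : E → AddCircle (1 : ℝ)} {A : E → E [⋀^Fin 1]→L[ℝ] ℝ}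
    (hp : IsPotential I P (extChartAt I x).symm W h A) {f : V → M} {O : Set V} (hO : IsOpen O)
    (hf : ContMDiffOn 𝓘(ℝ, V) I ∞ f O) (hfs : MapsTo f O (extChartAt I x).source)
    (hfW : MapsTo (extChartAt I x ∘ f) O W) :
    IsPotential I P f O (h ∘ (extChartAt I x ∘ f)) (fun y => (A (extChartAt I x (f y))).compContinuousLinearMap
      (fderiv ℝ (extChartAt I x ∘ f) y)) := by
  refine (hp.comp hO (contDiffOn_extChartAt_comp hf x hfs) hfW).congr fun y hy => ?_
  exact ((extChartAt I x).left_inv (hfs hy)).symm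

lemma exists_chart_nhds {f : V → M} {O : Set V} (hO : IsOpen O) (hf : ContMDiffOn 𝓘(ℝ, V) I ∞ f O)
    {y₀ : V} (hy₀ : y₀ ∈ O) {W : Set E} (hW : IsOpen W) (hWy : extChartAt I (f y₀) (f y₀) ∈ W) :
    ∃ O' ⊆ O, IsOpen O' ∧ y₀ ∈ O' ∧ MapsTo f O' (extChartAt I (f y₀)).source ∧
      MapsTo (extChartAt I (f y₀) ∘ f) O' W := by
  have hc : ContinuousAt f y₀ := hf.continuousOn.continuousAt (hO.mem_nhds hy₀)
  have h1 : ∀ᶠ y in 𝓝 y₀, f y ∈ (extChartAt I (f y₀)).source :=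
    hc.eventually (extChartAt_source_mem_nhds (f y₀))
  have h2 : ∀ᶠ y in 𝓝 y₀, extChartAt I (f y₀) (f y) ∈ W :=
    ((continuousAt_extChartAt (I := I) (f y₀)).comp hc).eventually (hW.mem_nhds hWy)
  obtain ⟨O', h3, h4, h5⟩ := eventually_nhds_iff.1 (h1.and (h2.and (hO.mem_nhds hy₀)))
  exact ⟨O', fun y hy => (h3 y hy).2.2, h4, h5, fun y hy => (h3 y hy).1, fun y hy => (h3 y hy).2.1⟩

lemma HasPotentials.exists_potential (hP : HasPotentials I P) {f : V → M} {O : Set V} (hO : IsOpen O)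
    (hf : ContMDiffOn 𝓘(ℝ, V) I ∞ f O) {y₀ : V} (hy₀ : y₀ ∈ O) :
    ∃ O' ⊆ O, y₀ ∈ O' ∧ ∃ h A, IsPotential I P f O' h A := by
  obtain ⟨W, h, A, hxW, -, hp⟩ := hP (f y₀)
  obtain ⟨O', h1, h2, h3, h4, h5⟩ := exists_chart_nhds hO hf hy₀ hp.isOpen hxW
  exact ⟨O', h1, h3, _, _, hp.of_chart h2 (hf.mono h1) h4 h5⟩

/-- The curvature of a functional with potentials, pointwise. -/
def HasPotentials.curvVal (hP : HasPotentials I P) (x : M) : E [⋀^Fin 2]→L[ℝ] ℝ :=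
  (extDeriv (hP x).choose_spec.choose_spec.choose (extChartAt I x x)).compContinuousLinearMap
    (mD I 𝓘(ℝ, E) (extChartAt I x) univ x)

lemma HasPotentials.curvVal_pull (hP : HasPotentials I P) (hp : IsPotential I P f W h A) {y : V}
    (hy : y ∈ W) : (hP.curvVal (f y)).compContinuousLinearMap (mD 𝓘(ℝ, V) I f univ y) = extDeriv A y := by
  have : IsManifold I 1 M := IsManifold.of_le (n := ∞) (by simp)
  set x := f y
  obtain ⟨hxW, hWt, hq⟩ := (hP x).choose_spec.choose_spec.choose_spec
  set W₀ := (hP x).choose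
  set A₀ := (hP x).choose_spec.choose_spec.choose with hA₀
  obtain ⟨O', h1, h2, h3, h4, h5⟩ := exists_chart_nhds hp.isOpen hp.smooth_map hy hq.isOpen hxW
  have hq' := hq.of_chart h2 (hp.smooth_map.mono h1) h4 h5
  rw [← hp.extDeriv_eq hq' hy h3]
  have hs : ContDiffOn ℝ ∞ (extChartAt I x ∘ f) O' :=
    contDiffOn_extChartAt_comp (hp.smooth_map.mono h1) x h4
  have hd := extDeriv_pullback (f := extChartAt I x ∘ f) (x := y) (r := ∞)
    ((hq.smooth.differentiableOn (by simp)).differentiableAt (hq.isOpen.mem_nhds (h5 h3)))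
    (hs.contDiffAt (h2.mem_nhds h3)) minSmoothness_two_le
  refine Eq.trans ?_ hd.symm
  have hφ : MDifferentiableWithinAt I 𝓘(ℝ, E) (extChartAt I x) univ (f y) :=
    (mdifferentiableAt_extChartAt (by simp [x])).mdifferentiableWithinAt
  have hf : MDifferentiableWithinAt 𝓘(ℝ, V) I f univ y :=
    ((hp.smooth_map y hy).mdifferentiableWithinAt (by simp)).mdifferentiableAt
      (hp.isOpen.mem_nhds hy) |>.mdifferentiableWithinAt
  rw [← fderivWithin_univ, ← mD_eq_fderivWithin, mD_comp hφ hf (mapsTo_univ _ _)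
    (uniqueMDiffWithinAt_univ 𝓘(ℝ, V))]
  rfl

lemma contDiffOn_extDeriv {A : V → V [⋀^Fin 1]→L[ℝ] ℝ} {W : Set V} (hW : IsOpen W)
    (hA : ContDiffOn ℝ ∞ A W) : ContDiffOn ℝ ∞ (extDeriv A) W :=
  (ContinuousAlternatingMap.alternatizeUncurryFinCLM ℝ V ℝ).contDiff.comp_contDiffOn
    (hA.fderiv_of_isOpen hW (by simp))

lemma HasPotentials.chartRep_curvVal (hP : HasPotentials I P) (x₀ : M) {y : E}
    (hy : y ∈ (extChartAt I x₀).target) :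
    ∃ W, IsOpen W ∧ y ∈ W ∧ ∃ A : E → E [⋀^Fin 1]→L[ℝ] ℝ, ContDiffOn ℝ ∞ A W ∧
      ∀ z ∈ W, chartRep I (M := M) (k := 2) hP.curvVal x₀ z = extDeriv A z := by
  obtain ⟨O', h1, h2, h, A, hp⟩ := hP.exists_potential (isOpen_extChartAt_target x₀)
    (contMDiffOn_extChartAt_symm (I := I) x₀) hy
  refine ⟨O', hp.isOpen, h2, A, hp.smooth, fun z hz => ?_⟩
  rw [← hP.curvVal_pull hp hz, mD_univ]
  rfl

/-- The curvature of a functional with potentials. -/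
def HasPotentials.curv (hP : HasPotentials I P) : DifferentialForm I M 2 where
  toFun := hP.curvVal
  smooth x₀ y hy := by
    obtain ⟨W, hW, hyW, A, hA, hAW⟩ := hP.chartRep_curvVal x₀ hy
    exact (((contDiffOn_extDeriv hW hA).congr hAW).contDiffAt (hW.mem_nhds hyW)).contDiffWithinAt

lemma HasPotentials.curv_isClosed (hP : HasPotentials I P) : hP.curv.IsClosed := by
  intro x₀ y hy
  obtain ⟨W, hW, hyW, A, hA, hAW⟩ := hP.chartRep_curvVal x₀ hy
  have e : chartRep I hP.curv.toFun x₀ =ᶠ[𝓝 y] extDeriv A :=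
    Filter.eventuallyEq_of_mem (hW.mem_nhds hyW) hAW
  rw [e.extDeriv_eq]
  exact extDeriv_extDeriv_apply (hA.contDiffAt (hW.mem_nhds hyW)) minSmoothness_two_le

lemma HasPotentials.pull_curv (hP : HasPotentials I P) (hp : IsPotential I P f W h A) {y : V}
    (hy : y ∈ W) : hP.curv.pull f univ y = extDeriv A y :=
  hP.curvVal_pull hp hy

end Potentials

lemma alternating_add_one {V : Type*} [NormedAddCommGroup V] [NormedSpace ℝ V]
    (A : V [⋀^Fin 1]→L[ℝ] ℝ) (v w : V) : A ![v + w] = A ![v] + A ![w] := by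
  have h := A.map_update_add ![v] 0 v w
  have e : ∀ w : V, Function.update ![v] 0 w = ![w] := by
    intro w; ext i; fin_cases i; simp
  simpa [e] using h

/-- A smooth circle-valued function is locally the exponential of a smooth function. -/
lemma exists_angle {V : Type*} [NormedAddCommGroup V] [NormedSpace ℝ V] {ζ : V → Circle}
    {S : Set V} {x : V} (hx : x ∈ S) (h : ContMDiffWithinAt 𝓘(ℝ, V) (𝓡 1) ∞ ζ S x) :
    ∃ ϑ : V → ℝ, ContDiffWithinAt ℝ ∞ ϑ S x ∧ ∀ᶠ y in 𝓝[S] x, ζ y = Circle.exp (ϑ y) := by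
  have h1 : ContDiffWithinAt ℝ ∞ (fun y => ((ζ y : ℂ))) S x := by
    rw [← contMDiffWithinAt_iff_contDiffWithinAt]
    have : Fact (Module.finrank ℝ ℂ = 1 + 1) := ⟨Complex.finrank_real_complex⟩
    exact (contMDiff_coe_sphere (E := ℂ) (n := 1)).contMDiffAt.comp_contMDiffWithinAt x h
  have h2 : ContDiffWithinAt ℝ ∞ (fun y => ((ζ x : ℂ))⁻¹ * (ζ y : ℂ)) S x := contDiffWithinAt_const.mul h1
  have h3 : ContDiffWithinAt ℝ ∞ (fun y => Complex.log (((ζ x : ℂ))⁻¹ * (ζ y : ℂ))) S x := by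
    refine ContDiffAt.comp_contDiffWithinAt (g := Complex.log) x ?_ h2
    refine (Complex.contDiffAt_log (n := ∞) ?_).restrict_scalars ℝ
    rw [inv_mul_cancel₀ (Circle.coe_ne_zero _)]
    exact Complex.one_mem_slitPlane
  refine ⟨fun y => (Complex.log (((ζ x : ℂ))⁻¹ * (ζ y : ℂ))).im + (ζ x : ℂ).arg,
    (Complex.imCLM.contDiff.comp_contDiffWithinAt h3).add contDiffWithinAt_const, ?_⟩
  refine Filter.Eventually.of_forall fun y => ?_
  have h4 : ((ζ x : ℂ))⁻¹ * (ζ y : ℂ) = (((ζ x)⁻¹ * ζ y : Circle) : ℂ) := by simp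
  change ζ y = Circle.exp ((Complex.log (((ζ x : ℂ))⁻¹ * (ζ y : ℂ))).im + (ζ x : ℂ).arg)
  rw [Complex.log_im, h4, Circle.exp_add, Circle.exp_arg, Circle.exp_arg]
  simp [mul_comm]

section Bundle

variable {EG : Type*} [NormedAddCommGroup EG] [NormedSpace ℝ EG] [FiniteDimensional ℝ EG]
  {HG : Type*} [TopologicalSpace HG] {IG : ModelWithCorners ℝ EG HG} [IG.Boundaryless]
  {G : Type*} [TopologicalSpace G] [ChartedSpace HG G] [Group G]
  {E : Type*} [NormedAddCommGroup E] [NormedSpace ℝ E] [FiniteDimensional ℝ E]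
  {H : Type*} [TopologicalSpace H] {I : ModelWithCorners ℝ E H} [I.Boundaryless]
  {M : Type*} [TopologicalSpace M] [ChartedSpace H M] [IsManifold I ∞ M] [MulAction G M]
  {V : Type*} [NormedAddCommGroup V] [NormedSpace ℝ V]
  {X : Type*} [TopologicalSpace X]
  (B : EquivariantBundle IG G I M)

namespace EquivariantBundle

lemma proj_circle (z : Circle) (p : B.Total) : B.proj (z • p) = B.proj p := by
  obtain ⟨U, ψ, -, hxU, hs, -, -, -, h⟩ := B.locally_trivial (B.proj p)
  have hp : p ∈ ψ.source := by rw [hs]; exact hxU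
  obtain ⟨h1, h2⟩ := h p hp
  obtain ⟨h3, h4⟩ := h2 z
  rw [← (h _ h3).1, h4, h1]

lemma eq_smul_of_trivialization {U : Set M} {ψ : OpenPartialHomeomorph B.Total (M × Circle)}
    (h : ∀ p ∈ ψ.source, (ψ p).1 = B.proj p ∧
      ∀ z : Circle, z • p ∈ ψ.source ∧ ψ (z • p) = ((ψ p).1, z * (ψ p).2))
    {p q : B.Total} (hp : p ∈ ψ.source) (hq : q ∈ ψ.source) (hpq : B.proj q = B.proj p) :
    q = ((ψ q).2 * (ψ p).2⁻¹) • p := by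
  obtain ⟨h1, h2⟩ := h p hp
  obtain ⟨h3, h4⟩ := h2 ((ψ q).2 * (ψ p).2⁻¹)
  refine ψ.injOn hq h3 ?_
  rw [h4, h1, ← hpq, ← (h q hq).1]
  ext <;> simp

lemma exists_smul_eq {p q : B.Total} (hpq : B.proj p = B.proj q) : ∃ z : Circle, q = z • p := by
  obtain ⟨U, ψ, -, hxU, hs, -, -, -, h⟩ := B.locally_trivial (B.proj p)
  have hp : p ∈ ψ.source := by rw [hs]; exact hxU
  have hq : q ∈ ψ.source := by rw [hs, mem_preimage, ← hpq]; exact hxU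
  exact ⟨_, B.eq_smul_of_trivialization (U := U) h hp hq hpq.symm⟩

lemma circle_free {z z' : Circle} {p : B.Total} (hz : z • p = z' • p) : z = z' := by
  obtain ⟨U, ψ, -, hxU, hs, -, -, -, h⟩ := B.locally_trivial (B.proj p)
  have hp : p ∈ ψ.source := by rw [hs]; exact hxU
  have h1 := ((h p hp).2 z).2
  rw [hz, ((h p hp).2 z').2] at h1
  simpa using (congrArg Prod.snd h1).symm

lemma contMDiff_proj : ContMDiff (I.prod (𝓡 1)) I ∞ B.proj := by
  intro p
  obtain ⟨U, ψ, hU, hxU, hs, -, hψ, -, h⟩ := B.locally_trivial (B.proj p)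
  have hp : p ∈ ψ.source := by rw [hs]; exact hxU
  have h1 : ContMDiffAt (I.prod (𝓡 1)) I ∞ (fun q => (ψ q).1) p :=
    contMDiff_fst.contMDiffAt.comp p (hψ.contMDiffAt (ψ.open_source.mem_nhds hp))
  refine h1.congr_of_eventuallyEq ?_
  filter_upwards [ψ.open_source.mem_nhds hp] with q hq using (h q hq).1.symm

/-- Smooth local sections along maps into the base. -/
lemma exists_local_section {f : V → M} {O : Set V} (hO : IsOpen O)
    (hf : ContMDiffOn 𝓘(ℝ, V) I ∞ f O) {y₀ : V} (hy₀ : y₀ ∈ O) :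
    ∃ O' ⊆ O, IsOpen O' ∧ y₀ ∈ O' ∧ ∃ σ : V → B.Total,
      ContMDiffOn 𝓘(ℝ, V) (I.prod (𝓡 1)) ∞ σ O' ∧ ∀ y ∈ O', B.proj (σ y) = f y := by
  obtain ⟨U, ψ, hU, hxU, hs, ht, -, hψ, h⟩ := B.locally_trivial (f y₀)
  refine ⟨O ∩ f ⁻¹' U, inter_subset_left, hf.continuousOn.isOpen_inter_preimage hO hU, ⟨hy₀, hxU⟩,
    fun y => ψ.symm (f y, 1), ?_, fun y hy => ?_⟩
  · refine hψ.comp ((hf.mono inter_subset_left).prodMk contMDiffOn_const) fun y hy => ?_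
    rw [ht]
    exact ⟨hy.2, mem_univ _⟩
  · have hm : (f y, (1 : Circle)) ∈ ψ.target := by rw [ht]; exact ⟨hy.2, mem_univ _⟩
    rw [← (h _ (ψ.map_target hm)).1, ψ.right_inv hm]

lemma proj_surjective : Function.Surjective B.proj := by
  intro x
  obtain ⟨U, ψ, hU, hxU, hs, ht, -, hψ, h⟩ := B.locally_trivial x
  have hm : (x, (1 : Circle)) ∈ ψ.target := by rw [ht]; exact ⟨hxU, mem_univ _⟩
  exact ⟨ψ.symm (x, 1), by rw [← (h _ (ψ.map_target hm)).1, ψ.right_inv hm]⟩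

/-- The ratio of two smooth maps with the same projection is smooth. -/
lemma contMDiffWithinAt_ratio {E₁ : Type*} [NormedAddCommGroup E₁] [NormedSpace ℝ E₁]
    {H₁ : Type*} [TopologicalSpace H₁] {I₁ : ModelWithCorners ℝ E₁ H₁}
    {N : Type*} [TopologicalSpace N] [ChartedSpace H₁ N] {F₁ F₂ : N → B.Total} {ζ : N → Circle} {S : Set N} {x : N}
    (h₁ : ContMDiffWithinAt I₁ (I.prod (𝓡 1)) ∞ F₁ S x)
    (h₂ : ContMDiffWithinAt I₁ (I.prod (𝓡 1)) ∞ F₂ S x) (hx : x ∈ S)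
    (h : ∀ y ∈ S, F₂ y = ζ y • F₁ y) : ContMDiffWithinAt I₁ (𝓡 1) ∞ ζ S x := by
  obtain ⟨U, ψ, hU, hxU, hs, ht, hψ, -, hψ'⟩ := B.locally_trivial (B.proj (F₁ x))
  have hp : F₁ x ∈ ψ.source := by rw [hs]; exact hxU
  have hq : F₂ x ∈ ψ.source := by rw [h x hx]; exact ((hψ' _ hp).2 _).1
  have e₁ : ContMDiffWithinAt I₁ (𝓡 1) ∞ (fun y => (ψ (F₁ y)).2) S x :=
    contMDiff_snd.contMDiffAt.comp_contMDiffWithinAt x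
      ((hψ.contMDiffAt (ψ.open_source.mem_nhds hp)).comp_contMDiffWithinAt x h₁)
  have e₂ : ContMDiffWithinAt I₁ (𝓡 1) ∞ (fun y => (ψ (F₂ y)).2) S x :=
    contMDiff_snd.contMDiffAt.comp_contMDiffWithinAt x
      ((hψ.contMDiffAt (ψ.open_source.mem_nhds hq)).comp_contMDiffWithinAt x h₂)
  refine (e₂.mul e₁.inv).congr_of_eventuallyEq_of_mem ?_ hx
  filter_upwards [h₁.continuousWithinAt.eventually (ψ.open_source.mem_nhds hp), self_mem_nhdsWithin] with y hy hyS
  change ζ y = (ψ (F₂ y)).2 * (ψ (F₁ y)).2⁻¹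
  rw [h y hyS, ((hψ' _ hy).2 _).2]
  simp

lemma continuousWithinAt_ratio {F₁ F₂ : X → B.Total} {ζ : X → Circle} {S : Set X} {x : X}
    (h₁ : ContinuousWithinAt F₁ S x) (h₂ : ContinuousWithinAt F₂ S x) (hx : x ∈ S)
    (h : ∀ y ∈ S, F₂ y = ζ y • F₁ y) : ContinuousWithinAt ζ S x := by
  obtain ⟨U, ψ, hU, hxU, hs, ht, hψ, -, hψ'⟩ := B.locally_trivial (B.proj (F₁ x))
  have hp : F₁ x ∈ ψ.source := by rw [hs]; exact hxU
  have hq : F₂ x ∈ ψ.source := by rw [h x hx]; exact ((hψ' _ hp).2 _).1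
  have e₁ : ContinuousWithinAt (fun y => (ψ (F₁ y)).2) S x :=
    continuous_snd.continuousAt.comp_continuousWithinAt
      ((ψ.continuousAt hp).comp_continuousWithinAt h₁)
  have e₂ : ContinuousWithinAt (fun y => (ψ (F₂ y)).2) S x :=
    continuous_snd.continuousAt.comp_continuousWithinAt
      ((ψ.continuousAt hq).comp_continuousWithinAt h₂)
  refine (e₂.mul e₁.inv).congr_of_eventuallyEq_of_mem ?_ hx
  filter_upwards [h₁.eventually (ψ.open_source.mem_nhds hp), self_mem_nhdsWithin] with y hy hyS
  change ζ y = (ψ (F₂ y)).2 * (ψ (F₁ y)).2⁻¹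
  rw [h y hyS, ((hψ' _ hy).2 _).2]
  simp

variable {B} {σ : V → B.Total} {S : Set V} {y : V}

lemma mDifferentiableAt_circle_smul (z : Circle) (p : B.Total) :
    MDifferentiableAt (I.prod (𝓡 1)) (I.prod (𝓡 1)) (fun q : B.Total => z • q) p :=
  ((ContMDiffSMul.contMDiff_const_smul (I := 𝓡 1) (I' := I.prod (𝓡 1)) (n := ∞) z).contMDiffAt).mdifferentiableAt
    (by simp)

lemma mDifferentiableAt_group_smul (g : G) (p : B.Total) :
    MDifferentiableAt (I.prod (𝓡 1)) (I.prod (𝓡 1)) (fun q : B.Total => g • q) p :=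
  ((ContMDiffSMul.contMDiff_const_smul (I := IG) (I' := I.prod (𝓡 1)) (n := ∞) g).contMDiffAt).mdifferentiableAt
    (by simp)

lemma val_circle (z : Circle) (p : B.Total) (w : E × EuclideanSpace ℝ (Fin 1)) :
    B.form.val (z • p) ![mD (I.prod (𝓡 1)) (I.prod (𝓡 1)) (fun q : B.Total => z • q) univ p w] =
      B.form.val p ![w] := by
  have h := DFunLike.congr_fun (B.form_circle_invariant z p) ![w]
  rw [mD_univ]
  refine Eq.trans ?_ h
  refine congrArg (B.form.val (z • p)) ?_
  ext1 i
  fin_cases i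
  rfl

lemma val_group (g : G) (p : B.Total) (w : E × EuclideanSpace ℝ (Fin 1)) :
    B.form.val (g • p) ![mD (I.prod (𝓡 1)) (I.prod (𝓡 1)) (fun q : B.Total => g • q) univ p w] =
      B.form.val p ![w] := by
  have h := DFunLike.congr_fun (B.form_invariant g p) ![w]
  rw [mD_univ]
  refine Eq.trans ?_ h
  refine congrArg (B.form.val (g • p)) ?_
  ext1 i
  fin_cases i
  rfl

lemma pull_apply_one (η : DifferentialForm (I.prod (𝓡 1)) B.Total 1) (v : V) :
    η.pull σ S y ![v] = η.val (σ y) ![mD 𝓘(ℝ, V) (I.prod (𝓡 1)) σ S y v] := by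
  refine congrArg (η.val (σ y)) ?_
  ext1 i
  fin_cases i
  rfl

lemma pull_circle (z : Circle) (hσ : MDifferentiableWithinAt 𝓘(ℝ, V) (I.prod (𝓡 1)) σ S y)
    (hS : UniqueDiffWithinAt ℝ S y) (v : V) :
    B.form.pull (fun x => z • σ x) S y ![v] = B.form.pull σ S y ![v] := by
  rw [pull_apply_one, pull_apply_one, ← val_circle z (σ y)]
  have h := mD_comp (mDifferentiableAt_circle_smul z (σ y)).mdifferentiableWithinAt hσ
    (mapsTo_univ _ _) hS.uniqueMDiffWithinAt
  exact congrArg (fun w => B.form.val (z • σ y) ![w]) (DFunLike.congr_fun h v)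

lemma pull_group (g : G) (hσ : MDifferentiableWithinAt 𝓘(ℝ, V) (I.prod (𝓡 1)) σ S y)
    (hS : UniqueDiffWithinAt ℝ S y) (v : V) :
    B.form.pull (fun x => g • σ x) S y ![v] = B.form.pull σ S y ![v] := by
  rw [pull_apply_one, pull_apply_one, ← val_group g (σ y)]
  have h := mD_comp (mDifferentiableAt_group_smul g (σ y)).mdifferentiableWithinAt hσ
    (mapsTo_univ _ _) hS.uniqueMDiffWithinAt
  exact congrArg (fun w => B.form.val (g • σ y) ![w]) (DFunLike.congr_fun h v)

lemma contMDiff_exp_smul : ContMDiff (𝓘(ℝ, ℝ).prod (I.prod (𝓡 1))) (I.prod (𝓡 1)) ∞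
    (fun q : ℝ × B.Total => Circle.exp q.1 • q.2) :=
  (contMDiff_circleExp.comp contMDiff_fst).smul contMDiff_snd

lemma val_vertical (t : ℝ) (p : B.Total) :
    B.form.val (Circle.exp t • p)
      ![mD 𝓘(ℝ, ℝ) (I.prod (𝓡 1)) (fun s : ℝ => Circle.exp s • p) univ t 1] = 1 := by
  have e : (fun s : ℝ => Circle.exp s • p) =
      (fun s : ℝ => Circle.exp s • Circle.exp t • p) ∘ fun s : ℝ => s - t := by
    ext s
    simp [← mul_smul, ← Circle.exp_add]
  have hm : ∀ s, MDifferentiableAt 𝓘(ℝ, ℝ) (I.prod (𝓡 1)) (fun s : ℝ => Circle.exp s • Circle.exp t • p) s :=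
    fun s => ((contMDiff_exp_smul (B := B)).comp
      (contMDiff_id.prodMk contMDiff_const)).contMDiffAt.mdifferentiableAt (by simp)
  have hs : DifferentiableAt ℝ (fun s : ℝ => s - t) t := by fun_prop
  rw [e, mD_comp (hm _).mdifferentiableWithinAt hs.mdifferentiableAt.mdifferentiableWithinAt
    (mapsTo_univ _ _) (uniqueMDiffWithinAt_univ _), mD_eq_fderivWithin, fderivWithin_univ]
  have h1 : fderiv ℝ (fun s : ℝ => s - t) t 1 = 1 := by simp
  rw [ContinuousLinearMap.comp_apply, h1, sub_self, mD_univ]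
  exact B.form_vertical (Circle.exp t • p)

lemma pull_gauge {ϑ : V → ℝ} (hσ : MDifferentiableWithinAt 𝓘(ℝ, V) (I.prod (𝓡 1)) σ S y)
    (hϑ : DifferentiableWithinAt ℝ ϑ S y) (hS : UniqueDiffWithinAt ℝ S y) (v : V) :
    B.form.pull (fun x => Circle.exp (ϑ x) • σ x) S y ![v] =
      fderivWithin ℝ ϑ S y v + B.form.pull σ S y ![v] := by
  have hm := (contMDiff_exp_smul (B := B)).contMDiffAt (x := (ϑ y, σ y)) |>.mdifferentiableAt (by simp)
  have hF : MDifferentiableWithinAt 𝓘(ℝ, V) (𝓘(ℝ, ℝ).prod (I.prod (𝓡 1))) (fun x => (ϑ x, σ x)) S y :=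
    hϑ.mdifferentiableWithinAt.prodMk hσ
  have h1 : mD 𝓘(ℝ, V) (I.prod (𝓡 1)) (fun x => Circle.exp (ϑ x) • σ x) S y v =
      mD (𝓘(ℝ, ℝ).prod (I.prod (𝓡 1))) (I.prod (𝓡 1)) (fun q : ℝ × B.Total => Circle.exp q.1 • q.2)
        univ (ϑ y, σ y) (fderivWithin ℝ ϑ S y v, mD 𝓘(ℝ, V) (I.prod (𝓡 1)) σ S y v) := by
    have h0 := mD_comp (g := fun q : ℝ × B.Total => Circle.exp q.1 • q.2) (f := fun x => (ϑ x, σ x))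
      (hm.mdifferentiableWithinAt) hF (mapsTo_univ _ _) hS.uniqueMDiffWithinAt
    refine (DFunLike.congr_fun h0 v).trans ?_
    rw [ContinuousLinearMap.comp_apply]
    refine congrArg _ ?_
    have h2 : mfderivWithin 𝓘(ℝ, V) (𝓘(ℝ, ℝ).prod (I.prod (𝓡 1))) (fun x => (ϑ x, σ x)) S y = _ :=
      mfderivWithin_prodMk hϑ.mdifferentiableWithinAt hσ hS.uniqueMDiffWithinAt
    rw [mD, h2, ← mD_eq_fderivWithin]
    rfl
  have h3 : mD (𝓘(ℝ, ℝ).prod (I.prod (𝓡 1))) (I.prod (𝓡 1)) (fun q : ℝ × B.Total => Circle.exp q.1 • q.2)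
        univ (ϑ y, σ y) (fderivWithin ℝ ϑ S y v, mD 𝓘(ℝ, V) (I.prod (𝓡 1)) σ S y v) =
      mD 𝓘(ℝ, ℝ) (I.prod (𝓡 1)) (fun s : ℝ => Circle.exp s • σ y) univ (ϑ y) (fderivWithin ℝ ϑ S y v) +
      mD (I.prod (𝓡 1)) (I.prod (𝓡 1)) (fun q : B.Total => Circle.exp (ϑ y) • q) univ (σ y)
        (mD 𝓘(ℝ, V) (I.prod (𝓡 1)) σ S y v) := by
    rw [mD_univ, mD_univ, mD_univ]
    exact mfderiv_prod_eq_add_apply hm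
  have h4 : mD 𝓘(ℝ, ℝ) (I.prod (𝓡 1)) (fun s : ℝ => Circle.exp s • σ y) univ (ϑ y) (fderivWithin ℝ ϑ S y v) =
      (fderivWithin ℝ ϑ S y v) • mD 𝓘(ℝ, ℝ) (I.prod (𝓡 1)) (fun s : ℝ => Circle.exp s • σ y) univ (ϑ y) 1 := by
    rw [← ContinuousLinearMap.map_smul, smul_eq_mul, mul_one]
  rw [pull_apply_one, pull_apply_one, h1, h3, alternating_add_one, h4, alternating_smul_one,
    val_vertical, val_circle, mul_one]

end EquivariantBundle
end Bundle

lemma exists_subinterval_avoiding {a b t : ℝ} (ht : t ∈ Ioo a b) {s : Finset ℝ} (hts : t ∉ s) :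
    ∃ a' b', a ≤ a' ∧ a' < t ∧ t < b' ∧ b' ≤ b ∧ ∀ c ∈ s, c ∉ Ioo a' b' := by
  have ho : IsOpen (Ioo a b \ (s : Set ℝ)) := isOpen_Ioo.sdiff s.finite_toSet.isClosed
  obtain ⟨r, hr, hrs⟩ := Metric.isOpen_iff.1 ho t ⟨ht, hts⟩
  rw [Real.ball_eq_Ioo] at hrs
  have h1 : t - r / 2 ∈ Ioo a b := (hrs ⟨by linarith, by linarith⟩).1
  have h2 : t + r / 2 ∈ Ioo a b := (hrs ⟨by linarith, by linarith⟩).1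
  refine ⟨t - r / 2, t + r / 2, h1.1.le, by linarith, by linarith, h2.2.le, fun c hc hm => ?_⟩
  exact (hrs ⟨by linarith [hm.1], by linarith [hm.2]⟩).2 hc

/-- A transitive relation between the points of an interval that holds locally holds globally. -/
lemma interval_induction {a b : ℝ} (hab : a ≤ b) {Q : ℝ → ℝ → Prop} (refl : ∀ x, Q x x)
    (trans : ∀ x y z, a ≤ x → x < y → y < z → z ≤ b → Q x y → Q y z → Q x z)
    (loc : ∀ t ∈ Icc a b, ∃ U ∈ 𝓝 t, ∀ x ∈ U, ∀ y ∈ U, a ≤ x → x < y → y ≤ b → Q x y) : Q a b := by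
  choose! U hU hQ using loc
  have hcov : (univ : Set (Icc a b)) ⊆ ⋃ t : Icc a b, Subtype.val ⁻¹' interior (U t) := fun t _ =>
    mem_iUnion.2 ⟨t, mem_interior_iff_mem_nhds.2 (hU t t.2)⟩
  obtain ⟨t, h0, hmono, ⟨m, hm⟩, ht⟩ := exists_monotone_Icc_subset_open_cover_Icc hab
    (fun i => isOpen_interior.preimage continuous_subtype_val) hcov
  have hstep : ∀ n, Q (t n) (t (n + 1)) := by
    intro n
    obtain ⟨i, hi⟩ := ht n
    rcases (hmono n.le_succ).eq_or_lt with h | h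
    · rw [← h]; exact refl _
    · exact hQ i i.2 _ (interior_subset (hi ⟨le_rfl, h.le⟩)) _ (interior_subset (hi ⟨h.le, le_rfl⟩))
        (t n).2.1 h (t (n + 1)).2.2
  have hall : ∀ n, Q a (t n) := by
    intro n
    induction n with
    | zero => rw [h0]; exact refl a
    | succ n ih =>
      rcases (hmono n.le_succ).eq_or_lt with h | h
      · rw [← h]; exact ih
      · rcases (t n).2.1.eq_or_lt with h' | h'
        · have hs := hstep n
          rwa [← h'] at hs
        · exact trans _ _ _ le_rfl h' h (t (n + 1)).2.2 ih (hstep n)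
  have := hall m
  rwa [hm m le_rfl] at this

section Bundle

variable {EG : Type*} [NormedAddCommGroup EG] [NormedSpace ℝ EG] [FiniteDimensional ℝ EG]
  {HG : Type*} [TopologicalSpace HG] {IG : ModelWithCorners ℝ EG HG} [IG.Boundaryless]
  {G : Type*} [TopologicalSpace G] [ChartedSpace HG G] [Group G]
  {E : Type*} [NormedAddCommGroup E] [NormedSpace ℝ E] [FiniteDimensional ℝ E]
  {H : Type*} [TopologicalSpace H] {I : ModelWithCorners ℝ E H} [I.Boundaryless]
  {M : Type*} [TopologicalSpace M] [ChartedSpace H M] [IsManifold I ∞ M] [MulAction G M]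
  {V : Type*} [NormedAddCommGroup V] [NormedSpace ℝ V] [FiniteDimensional ℝ V]
  {B : EquivariantBundle IG G I M}

namespace EquivariantBundle

variable (B) in
/-- `Γ` is a piecewise smooth horizontal lift of `γ` over `[a,b]`. -/
structure IsHorizontalOn (γ : ℝ → M) (a b : ℝ) (Γ : ℝ → B.Total) : Prop where
  lift : ∀ t ∈ Icc a b, B.proj (Γ t) = γ t
  continuousOn : ContinuousOn Γ (Icc a b)
  horizontal : ∃ s : Finset ℝ,
    (∀ a' b', a ≤ a' → a' ≤ b' → b' ≤ b → (∀ c ∈ s, c ∉ Ioo a' b') →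
      ContMDiffOn 𝓘(ℝ, ℝ) (I.prod (𝓡 1)) ∞ Γ (Icc a' b')) ∧
    ∀ t ∈ Ioo a b, t ∉ s → B.form.pull Γ univ t ![1] = 0

variable {γ : ℝ → M} {a b d : ℝ} {Γ Γ' : ℝ → B.Total}

lemma IsHorizontalOn.congr (h : B.IsHorizontalOn γ a b Γ) {γ' : ℝ → M} (hγ : EqOn γ' γ (Icc a b))
    (hΓ : EqOn Γ' Γ (Icc a b)) : B.IsHorizontalOn γ' a b Γ' where
  lift t ht := by rw [hΓ ht, hγ ht, h.lift t ht]
  continuousOn := h.continuousOn.congr hΓ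
  horizontal := by
    obtain ⟨s, h1, h2⟩ := h.horizontal
    refine ⟨s, fun a' b' ha hab hb hc => (h1 a' b' ha hab hb hc).congr
      fun t ht => hΓ ⟨ha.trans ht.1, ht.2.trans hb⟩, fun t ht hts => ?_⟩
    rw [← h2 t ht hts, B.form.pull_congr_of_eventuallyEq (g := Γ) _ (hΓ ⟨ht.1.le, ht.2.le⟩)]
    exact (hΓ.eventuallyEq_of_mem (Icc_mem_nhds ht.1 ht.2)).filter_mono nhdsWithin_le_nhds

lemma IsHorizontalOn.contMDiffAt {s : Finset ℝ}
    (hs : ∀ a' b', a ≤ a' → a' ≤ b' → b' ≤ b → (∀ c ∈ s, c ∉ Ioo a' b') →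
      ContMDiffOn 𝓘(ℝ, ℝ) (I.prod (𝓡 1)) ∞ Γ (Icc a' b')) {t : ℝ} (ht : t ∈ Ioo a b) (hts : t ∉ s) :
    ContMDiffAt 𝓘(ℝ, ℝ) (I.prod (𝓡 1)) ∞ Γ t := by
  obtain ⟨a', b', h1, h2, h3, h4, h5⟩ := exists_subinterval_avoiding ht hts
  exact (hs a' b' h1 (h2.trans h3).le h4 h5).contMDiffAt (Icc_mem_nhds h2 h3)

lemma IsHorizontalOn.circle (h : B.IsHorizontalOn γ a b Γ) (z : Circle) :
    B.IsHorizontalOn γ a b (fun t => z • Γ t) where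
  lift t ht := by rw [proj_circle, h.lift t ht]
  continuousOn := ((ContMDiffSMul.contMDiff_const_smul (I := 𝓡 1) (I' := I.prod (𝓡 1))
    (n := ∞) z).continuous).comp_continuousOn h.continuousOn
  horizontal := by
    obtain ⟨s, h1, h2⟩ := h.horizontal
    refine ⟨s, fun x y hx hxy hy hc => (ContMDiffSMul.contMDiff_const_smul (I := 𝓡 1)
      (I' := I.prod (𝓡 1)) (n := ∞) z).comp_contMDiffOn (h1 x y hx hxy hy hc), fun t ht hts => ?_⟩
    rw [pull_circle z _ uniqueDiffWithinAt_univ, h2 t ht hts]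
    exact ((IsHorizontalOn.contMDiffAt h1 ht hts).mdifferentiableAt (by simp)).mdifferentiableWithinAt

lemma IsHorizontalOn.group (h : B.IsHorizontalOn γ a b Γ) (g : G) :
    B.IsHorizontalOn (fun t => g • γ t) a b (fun t => g • Γ t) where
  lift t ht := by rw [B.proj_smul, h.lift t ht]
  continuousOn := ((ContMDiffSMul.contMDiff_const_smul (I := IG) (I' := I.prod (𝓡 1))
    (n := ∞) g).continuous).comp_continuousOn h.continuousOn
  horizontal := by
    obtain ⟨s, h1, h2⟩ := h.horizontal
    refine ⟨s, fun x y hx hxy hy hc => (ContMDiffSMul.contMDiff_const_smul (I := IG)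
      (I' := I.prod (𝓡 1)) (n := ∞) g).comp_contMDiffOn (h1 x y hx hxy hy hc), fun t ht hts => ?_⟩
    rw [pull_group g _ uniqueDiffWithinAt_univ, h2 t ht hts]
    exact ((IsHorizontalOn.contMDiffAt h1 ht hts).mdifferentiableAt (by simp)).mdifferentiableWithinAt

lemma IsHorizontalOn.affine (h : B.IsHorizontalOn γ a b Γ) {a' b' m c : ℝ} (hm : m ≠ 0)
    (hab : ∀ t, (t ∈ Icc a' b' → m * t + c ∈ Icc a b) ∧ (t ∈ Ioo a' b' → m * t + c ∈ Ioo a b)) :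
    B.IsHorizontalOn (fun t => γ (m * t + c)) a' b' (fun t => Γ (m * t + c)) where
  lift t ht := h.lift _ ((hab t).1 ht)
  continuousOn := h.continuousOn.comp (by fun_prop) fun t ht => (hab t).1 ht
  horizontal := by
    classical
    obtain ⟨s, h1, h2⟩ := h.horizontal
    refine ⟨s.image (fun u => (u - c) / m), fun x y hx hxy hy hc => ?_, fun t ht hts => ?_⟩
    · have hx' := (hab x).1 ⟨hx, hxy.trans hy⟩
      have hy' := (hab y).1 ⟨hx.trans hxy, hy⟩
      have hc' : ∀ u ∈ s, u ∉ Ioo (min (m * x + c) (m * y + c)) (max (m * x + c) (m * y + c)) := by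
        intro u hu hmem
        refine hc _ (Finset.mem_image_of_mem _ hu) ?_
        rcases lt_or_gt_of_ne hm with hneg | hpos
        · have hle : m * y + c ≤ m * x + c := by nlinarith
          rw [min_eq_right hle, max_eq_left hle] at hmem
          exact ⟨by rw [lt_div_iff_of_neg hneg]; linarith [hmem.2],
            by rw [div_lt_iff_of_neg hneg]; linarith [hmem.1]⟩
        · have hle : m * x + c ≤ m * y + c := by nlinarith
          rw [min_eq_left hle, max_eq_right hle] at hmem
          exact ⟨by rw [lt_div_iff₀ hpos]; linarith [hmem.1],
            by rw [div_lt_iff₀ hpos]; linarith [hmem.2]⟩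
      refine (h1 _ _ (le_min hx'.1 hy'.1) min_le_max (max_le hx'.2 hy'.2) hc').comp
        (contMDiff_affine m c).contMDiffOn fun t ht => ?_
      rcases lt_or_gt_of_ne hm with hneg | hpos
      · have hle : m * y + c ≤ m * x + c := by nlinarith [ht.1.trans ht.2]
        rw [min_eq_right hle, max_eq_left hle]
        exact ⟨by nlinarith [ht.2], by nlinarith [ht.1]⟩
      · have hle : m * x + c ≤ m * y + c := by nlinarith [ht.1.trans ht.2]
        rw [min_eq_left hle, max_eq_right hle]
        exact ⟨by nlinarith [ht.1], by nlinarith [ht.2]⟩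
    · have hts' : m * t + c ∉ s := fun hmem => hts (by
        refine Finset.mem_image.2 ⟨_, hmem, ?_⟩
        field_simp
        ring)
      have ht' := (hab t).2 ht
      have hd : DifferentiableAt ℝ (fun t : ℝ => m * t + c) t := by fun_prop
      have e := B.form.pull_comp (f := Γ) (g := fun t : ℝ => m * t + c) (W := univ) (S := univ) (y := t)
        ((IsHorizontalOn.contMDiffAt h1 ht' hts').mdifferentiableAt (by simp)).mdifferentiableWithinAt
        hd.differentiableWithinAt (mapsTo_univ _ _) uniqueDiffWithinAt_univ
      have e2 : fderivWithin ℝ (fun t : ℝ => m * t + c) univ t 1 = m • 1 := by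
        rw [fderivWithin_univ]
        simp
      have e3 := DFunLike.congr_fun e ![1]
      refine e3.trans ?_
      have e4 : (fun i => fderivWithin ℝ (fun t : ℝ => m * t + c) univ t ((![1] : Fin 1 → ℝ) i)) = ![m • 1] := by
        ext i; fin_cases i; exact e2
      change (B.form.pull Γ univ (m * t + c)) (fun i => fderivWithin ℝ (fun t : ℝ => m * t + c) univ t ((![1] : Fin 1 → ℝ) i)) = 0
      rw [e4, alternating_smul_one, h2 _ ht' hts', mul_zero]

lemma IsHorizontalOn.concat (h : B.IsHorizontalOn γ a d Γ) (h' : B.IsHorizontalOn γ d b Γ')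
    (hd : Γ d = Γ' d) (had : a ≤ d) (hdb : d ≤ b) :
    B.IsHorizontalOn γ a b (fun t => if t ≤ d then Γ t else Γ' t) := by
  classical
  have e1 : EqOn (fun t => if t ≤ d then Γ t else Γ' t) Γ (Icc a d) := fun t ht => if_pos ht.2
  have e2 : EqOn (fun t => if t ≤ d then Γ t else Γ' t) Γ' (Icc d b) := fun t ht => by
    rcases ht.1.eq_or_lt with h | h
    · subst h; simp [hd]
    · exact if_neg h.not_ge
  have k1 := h.congr (fun t _ => rfl) e1
  have k2 := h'.congr (fun t _ => rfl) e2
  refine ⟨fun t ht => ?_, ?_, ?_⟩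
  · rcases le_total t d with h | h
    · exact k1.lift t ⟨ht.1, h⟩
    · exact k2.lift t ⟨h, ht.2⟩
  · rw [← Icc_union_Icc_eq_Icc had hdb]
    exact k1.continuousOn.union_of_isClosed k2.continuousOn isClosed_Icc isClosed_Icc
  · obtain ⟨s1, p1, q1⟩ := k1.horizontal
    obtain ⟨s2, p2, q2⟩ := k2.horizontal
    refine ⟨{d} ∪ (s1 ∪ s2), fun x y hx hxy hy hc => ?_, fun t ht hts => ?_⟩
    · have hmid : y ≤ d ∨ d ≤ x := by
        by_contra! hcon
        exact hc d (by simp) ⟨hcon.2, hcon.1⟩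
      rcases hmid with hm | hm
      · exact p1 x y hx hxy hm fun c hcs => hc c (by simp [hcs])
      · exact p2 x y hm hxy hy fun c hcs => hc c (by simp [hcs])
    · simp only [Finset.mem_union, Finset.mem_singleton, not_or] at hts
      rcases lt_or_gt_of_ne hts.1 with h | h
      · exact q1 t ⟨ht.1, h⟩ hts.2.1
      · exact q2 t ⟨h, ht.2⟩ hts.2.2

lemma IsHorizontalOn.unique (h : B.IsHorizontalOn γ a b Γ) (h' : B.IsHorizontalOn γ a b Γ')
    (hab : a ≤ b) (ha : Γ a = Γ' a) : Γ b = Γ' b := by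
  classical
  have hex : ∀ t, ∃ z : Circle, t ∈ Icc a b → Γ' t = z • Γ t := fun t => by
    by_cases ht : t ∈ Icc a b
    · obtain ⟨z, hz⟩ := B.exists_smul_eq ((h.lift t ht).trans (h'.lift t ht).symm)
      exact ⟨z, fun _ => hz⟩
    · exact ⟨1, fun h => absurd h ht⟩
  choose ζ hζ using hex
  obtain ⟨s1, p1, q1⟩ := h.horizontal
  obtain ⟨s2, p2, q2⟩ := h'.horizontal
  have hcont : ContinuousOn (fun t => (ζ t : ℂ)) (Icc a b) := fun t ht =>
    continuous_subtype_val.continuousAt.comp_continuousWithinAt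
      (B.continuousWithinAt_ratio (h.continuousOn t ht) (h'.continuousOn t ht) ht hζ)
  have hder : ∀ t ∈ Ioo a b \ (↑(s1 ∪ s2) : Set ℝ), HasDerivAt (fun t => (ζ t : ℂ)) 0 t := by
    rintro t ⟨ht, hts⟩
    simp only [Finset.coe_union, mem_union, Finset.mem_coe, not_or] at hts
    have m1 := IsHorizontalOn.contMDiffAt p1 ht hts.1
    have m2 := IsHorizontalOn.contMDiffAt p2 ht hts.2
    have hn : Icc a b ∈ 𝓝 t := Icc_mem_nhds ht.1 ht.2
    have hI : t ∈ Icc a b := ⟨ht.1.le, ht.2.le⟩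
    have m3 := B.contMDiffWithinAt_ratio (m1.contMDiffWithinAt (s := Icc a b)) m2.contMDiffWithinAt hI hζ
    obtain ⟨ϑ, hϑ, heq⟩ := exists_angle hI m3
    rw [nhdsWithin_eq_nhds.2 hn] at heq
    have hϑd : DifferentiableAt ℝ ϑ t := (hϑ.contDiffAt hn).differentiableAt (by simp)
    have e1 : Γ' =ᶠ[𝓝 t] fun x => Circle.exp (ϑ x) • Γ x := by
      filter_upwards [heq, hn] with x hx hx'
      rw [hζ x hx', hx]
    have e2 := B.form.pull_congr_of_eventuallyEq (S := univ) (e1.filter_mono nhdsWithin_le_nhds) e1.self_of_nhds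
    have e3 := DFunLike.congr_fun e2 ![1]
    rw [q2 t ht hts.2, pull_gauge (m1.mdifferentiableAt (by simp)).mdifferentiableWithinAt
      hϑd.differentiableWithinAt uniqueDiffWithinAt_univ, q1 t ht hts.1, fderivWithin_univ, add_zero] at e3
    have hd : HasDerivAt ϑ 0 t := by
      rw [show (0 : ℝ) = deriv ϑ t from e3]
      exact hϑd.hasDerivAt
    have h4 : HasDerivAt (fun x => Complex.exp ((ϑ x : ℂ) * Complex.I)) 0 t := by
      have := ((hd.ofReal_comp).mul_const Complex.I).cexp
      simpa using this
    refine h4.congr_of_eventuallyEq ?_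
    filter_upwards [heq] with x hx
    rw [hx, Circle.coe_exp]
  have hint := MeasureTheory.integral_eq_of_hasDerivAt_off_countable_of_le (fun t => (ζ t : ℂ)) 0 hab
    (s := ↑(s1 ∪ s2)) (Finset.countable_toSet _) hcont hder
    (intervalIntegrable_const (c := (0 : ℂ)))
  simp only [Pi.zero_apply, intervalIntegral.integral_zero] at hint
  have hζa : ζ a = 1 := by
    have := hζ a ⟨le_rfl, hab⟩
    rw [← ha] at this
    exact B.circle_free (p := Γ a) (by rw [← this, one_smul])
  have hζb : ζ b = 1 := by
    rw [← hζa]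
    exact Subtype.ext (sub_eq_zero.1 hint.symm)
  rw [hζ b ⟨hab, le_rfl⟩, hζb, one_smul]

end EquivariantBundle
end Bundle

lemma exists_toCircle_eq (z : Circle) : ∃ r : AddCircle (1 : ℝ), AddCircle.toCircle r = z :=
  ⟨((z : ℂ).arg / (2 * Real.pi) : ℝ), by
    rw [AddCircle.toCircle_apply_mk, div_one, mul_div_cancel₀ _ (by positivity), Circle.exp_arg]⟩

lemma toCircle_injective {r r' : AddCircle (1 : ℝ)} (h : AddCircle.toCircle r = AddCircle.toCircle r') :
    r = r' :=
  AddCircle.injective_toCircle one_ne_zero h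

lemma circleExp_eq_toCircle (r : ℝ) :
    Circle.exp (2 * Real.pi * r) = AddCircle.toCircle ((r : ℝ) : AddCircle (1 : ℝ)) := by
  rw [AddCircle.toCircle_apply_mk, div_one]

lemma arc_zero {X : Type*} (γ : ℝ → X) (a b : ℝ) : arc γ a b 0 = γ a := by simp [arc]

lemma arc_one {X : Type*} (γ : ℝ → X) (a b : ℝ) : arc γ a b 1 = γ b := by simp [arc]

section Bundle

variable {EG : Type*} [NormedAddCommGroup EG] [NormedSpace ℝ EG] [FiniteDimensional ℝ EG]
  {HG : Type*} [TopologicalSpace HG] {IG : ModelWithCorners ℝ EG HG} [IG.Boundaryless]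
  {G : Type*} [TopologicalSpace G] [ChartedSpace HG G] [Group G]
  {E : Type*} [NormedAddCommGroup E] [NormedSpace ℝ E] [FiniteDimensional ℝ E]
  {H : Type*} [TopologicalSpace H] {I : ModelWithCorners ℝ E H} [I.Boundaryless]
  {M : Type*} [TopologicalSpace M] [ChartedSpace H M] [IsManifold I ∞ M] [MulAction G M]
  {V : Type*} [NormedAddCommGroup V] [NormedSpace ℝ V] [FiniteDimensional ℝ V]
  {B : EquivariantBundle IG G I M}

namespace EquivariantBundle

variable (B) in
/-- Some piecewise smooth horizontal lift of `γ` over `[a,b]` leads from `p` to `q`. -/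
def Transport (γ : ℝ → M) (a b : ℝ) (p q : B.Total) : Prop :=
  ∃ Γ, B.IsHorizontalOn γ a b Γ ∧ Γ a = p ∧ Γ b = q

variable {γ : ℝ → M} {a b d : ℝ} {p q r : B.Total}

lemma transport_refl (hp : B.proj p = γ a) : B.Transport γ a a p p := by
  refine ⟨fun _ => p, ⟨fun t ht => ?_, continuousOn_const, ∅, fun _ _ _ _ _ _ => contMDiffOn_const,
    fun t ht => ?_⟩, rfl, rfl⟩
  · obtain rfl : t = a := le_antisymm ht.2 ht.1
    exact hp
  · exact absurd (ht.1.trans ht.2) (lt_irrefl _)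

lemma Transport.trans (h : B.Transport γ a d p q) (h' : B.Transport γ d b q r) (had : a ≤ d)
    (hdb : d ≤ b) : B.Transport γ a b p r := by
  obtain ⟨Γ, h1, h2, h3⟩ := h
  obtain ⟨Γ', h1', h2', h3'⟩ := h'
  refine ⟨_, h1.concat h1' (h3.trans h2'.symm) had hdb, by simp [had, h2], ?_⟩
  rcases hdb.eq_or_lt with e | e
  · subst e; simp [h3, ← h2', ← h3']
  · simp [e.not_ge, h3']

lemma Transport.unique (h : B.Transport γ a b p q) (h' : B.Transport γ a b p r) (hab : a ≤ b) : q = r := by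
  obtain ⟨Γ, h1, h2, h3⟩ := h
  obtain ⟨Γ', h1', h2', h3'⟩ := h'
  rw [← h3, ← h3']
  exact h1.unique h1' hab (h2.trans h2'.symm)

lemma Transport.circle (h : B.Transport γ a b p q) (z : Circle) : B.Transport γ a b (z • p) (z • q) := by
  obtain ⟨Γ, h1, rfl, rfl⟩ := h
  exact ⟨_, h1.circle z, rfl, rfl⟩

lemma Transport.group (h : B.Transport γ a b p q) (g : G) :
    B.Transport (fun t => g • γ t) a b (g • p) (g • q) := by
  obtain ⟨Γ, h1, rfl, rfl⟩ := h
  exact ⟨_, h1.group g, rfl, rfl⟩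

lemma Transport.congr (h : B.Transport γ a b p q) {γ' : ℝ → M} (hγ : EqOn γ' γ (Icc a b)) :
    B.Transport γ' a b p q := by
  obtain ⟨Γ, h1, h2⟩ := h
  exact ⟨Γ, h1.congr hγ fun _ _ => rfl, h2⟩

lemma Transport.proj_left (h : B.Transport γ a b p q) (hab : a ≤ b) : B.proj p = γ a := by
  obtain ⟨Γ, h1, rfl, rfl⟩ := h
  exact h1.lift a ⟨le_rfl, hab⟩

lemma Transport.proj_right (h : B.Transport γ a b p q) (hab : a ≤ b) : B.proj q = γ b := by
  obtain ⟨Γ, h1, rfl, rfl⟩ := h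
  exact h1.lift b ⟨hab, le_rfl⟩

lemma Transport.affine (h : B.Transport γ a b p q) (hab : a < b) :
    B.Transport (fun t => γ (a + t * (b - a))) 0 1 p q := by
  obtain ⟨Γ, h1, rfl, rfl⟩ := h
  have h2 := (h1.affine (a' := 0) (b' := 1) (m := b - a) (c := a) (sub_ne_zero.2 hab.ne') fun t =>
    ⟨fun ht => ⟨by nlinarith [ht.1], by nlinarith [ht.2]⟩,
      fun ht => ⟨by nlinarith [ht.1], by nlinarith [ht.2]⟩⟩)
  exact ⟨_, h2.congr (fun t _ => by simp only; congr 1; ring) fun t _ => rfl, by simp, by simp⟩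

lemma transport_of_affine (hab : a < b) (h : B.Transport (fun t => γ (a + t * (b - a))) 0 1 p q) :
    B.Transport γ a b p q := by
  obtain ⟨Γ, h1, rfl, rfl⟩ := h
  have hm : 0 < b - a := sub_pos.2 hab
  have key : ∀ t, (b - a)⁻¹ * t + -a * (b - a)⁻¹ = (t - a) / (b - a) := fun t => by
    rw [div_eq_inv_mul]; ring
  have h2 := (h1.affine (a' := a) (b' := b) (m := (b - a)⁻¹) (c := -a * (b - a)⁻¹) (inv_ne_zero hm.ne') fun t =>
    ⟨fun ht => by rw [key]; exact ⟨div_nonneg (by linarith [ht.1]) hm.le, by rw [div_le_one hm]; linarith [ht.2]⟩,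
      fun ht => by rw [key]; exact ⟨div_pos (by linarith [ht.1]) hm, by rw [div_lt_one hm]; linarith [ht.2]⟩⟩)
  refine ⟨_, h2.congr (fun t _ => ?_) fun t _ => rfl, ?_, ?_⟩
  · simp only [key]; congr 1; field_simp; ring
  · simp only [key]; simp
  · simp only [key]; rw [div_self hm.ne']

/-- The local connection form of a smooth map into the total space. -/
def localForm (σ : V → B.Total) (y : V) : V [⋀^Fin 1]→L[ℝ] ℝ :=
  (-(2 * Real.pi)⁻¹) • B.form.pull σ univ y

lemma contDiffOn_localForm {σ : V → B.Total} {W : Set V} (hW : IsOpen W)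
    (hσ : ContMDiffOn 𝓘(ℝ, V) (I.prod (𝓡 1)) ∞ σ W) : ContDiffOn ℝ ∞ (localForm σ) W := by
  refine ContDiffOn.const_smul _ ?_
  exact (B.form.contDiffOn_pull hσ hW.uniqueDiffOn).congr fun y hy =>
    (B.form.pull_of_mem_nhds (hW.mem_nhds hy)).symm

lemma transport_local {σ : V → B.Total} {W : Set V} (hW : IsOpen W)
    (hσ : ContMDiffOn 𝓘(ℝ, V) (I.prod (𝓡 1)) ∞ σ W) {c : ℝ → V} (hab : a < b)
    (hc : ContDiffOn ℝ ∞ c (Icc a b)) (hcW : MapsTo c (Icc a b) W) :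
    B.Transport (fun t => B.proj (σ (c t))) a b (σ (c a))
      (AddCircle.toCircle ((lineInt (localForm σ) c a b : ℝ) : AddCircle (1 : ℝ)) • σ (c b)) := by
  have hA := contDiffOn_localForm hW hσ
  set g : ℝ → ℝ := fun t => localForm σ (c t) ![derivWithin c (Icc a b) t]
  obtain ⟨h1, h2⟩ := contDiffOn_integral_right hab (contDiffOn_lineInt_integrand hA hab hc hcW)
  have hσc : ContMDiffOn 𝓘(ℝ, ℝ) (I.prod (𝓡 1)) ∞ (fun t => σ (c t)) (Icc a b) :=
    hσ.comp hc.contMDiffOn hcW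
  set ϑ : ℝ → ℝ := fun t => 2 * Real.pi * ∫ s in a..t, g s
  have hϑ : ContDiffOn ℝ ∞ ϑ (Icc a b) := contDiffOn_const.mul h1
  have hΓ : ContMDiffOn 𝓘(ℝ, ℝ) (I.prod (𝓡 1)) ∞ (fun t => Circle.exp (ϑ t) • σ (c t)) (Icc a b) :=
    contMDiff_exp_smul.comp_contMDiffOn (hϑ.contMDiffOn.prodMk hσc)
  refine ⟨fun t => Circle.exp (ϑ t) • σ (c t), ⟨fun t _ => B.proj_circle _ _, hΓ.continuousOn, ∅,
    fun a' b' ha _ hb _ => hΓ.mono (Icc_subset_Icc ha hb), fun t ht _ => ?_⟩, ?_, ?_⟩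
  · have hn : Icc a b ∈ 𝓝 t := Icc_mem_nhds ht.1 ht.2
    have hI : t ∈ Icc a b := ⟨ht.1.le, ht.2.le⟩
    have hϑt : HasDerivAt ϑ (2 * Real.pi * g t) t := ((h2 t hI).hasDerivAt hn).const_mul _
    have hct : DifferentiableAt ℝ c t := (hc.differentiableOn (by simp)).differentiableAt hn
    have hσt : MDifferentiableAt 𝓘(ℝ, V) (I.prod (𝓡 1)) σ (c t) :=
      ((hσ.contMDiffAt (hW.mem_nhds (hcW hI))).mdifferentiableAt (by simp))
    rw [pull_gauge ((hσc.contMDiffAt hn).mdifferentiableAt (by simp)).mdifferentiableWithinAt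
      hϑt.differentiableAt.differentiableWithinAt uniqueDiffWithinAt_univ, fderivWithin_univ,
      show fderiv ℝ ϑ t 1 = 2 * Real.pi * g t from hϑt.deriv]
    have e := B.form.pull_comp (f := σ) (g := c) (W := univ) (S := univ) (y := t)
      hσt.mdifferentiableWithinAt hct.differentiableWithinAt (mapsTo_univ _ _) uniqueDiffWithinAt_univ
    have e3 : B.form.pull (fun t => σ (c t)) univ t ![1] = B.form.pull σ univ (c t) ![deriv c t] := by
      refine (DFunLike.congr_fun e ![1]).trans ?_
      refine congrArg (B.form.pull σ univ (c t)) ?_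
      ext1 i
      fin_cases i
      change fderivWithin ℝ c univ t 1 = deriv c t
      rw [fderivWithin_univ]
      rfl
    have e4 : g t = -(2 * Real.pi)⁻¹ * B.form.pull σ univ (c t) ![deriv c t] := by
      simp only [g]
      rw [derivWithin_of_mem_nhds hn]
      rfl
    rw [e3, e4]
    field_simp
    ring
  · simp [ϑ]
  · rw [lineInt_eq hab.le, ← circleExp_eq_toCircle]

/-- Horizontal lifts of smooth curves exist. -/
lemma exists_transport (hab : a ≤ b) (hγ : ContMDiffOn 𝓘(ℝ, ℝ) I ∞ γ (Icc a b)) (hp : B.proj p = γ a) :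
    ∃ q, B.Transport γ a b p q := by
  suffices h : ∀ p, B.proj p = γ a → ∃ q, B.Transport γ a b p q from h p hp
  refine interval_induction hab (Q := fun x y => ∀ p, B.proj p = γ x → ∃ q, B.Transport γ x y p q)
    (fun x p hp => ⟨p, transport_refl hp⟩) (fun x y z _ hxy hyz _ h1 h2 p hp => ?_) fun t₀ ht₀ => ?_
  · obtain ⟨q, hq⟩ := h1 p hp
    obtain ⟨r, hr⟩ := h2 q (hq.proj_right hxy.le)
    exact ⟨r, hq.trans hr hxy.le hyz.le⟩
  · set x₀ := γ t₀
    obtain ⟨O, hO, hOo, hxO, σ, hσ, hσp⟩ := B.exists_local_section (isOpen_extChartAt_target (I := I) x₀)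
      (contMDiffOn_extChartAt_symm (I := I) x₀) (mem_extChartAt_target x₀)
    set c : ℝ → E := fun t => extChartAt I x₀ (γ t)
    have hcont : ContinuousWithinAt γ (Icc a b) t₀ := hγ.continuousOn t₀ ht₀
    have hn1 : ∀ᶠ t in 𝓝[Icc a b] t₀, γ t ∈ (extChartAt I x₀).source :=
      hcont.eventually (extChartAt_source_mem_nhds x₀)
    have hn2 : ∀ᶠ t in 𝓝[Icc a b] t₀, c t ∈ O :=
      ((continuousAt_extChartAt (I := I) x₀).comp_continuousWithinAt hcont).eventually (hOo.mem_nhds hxO)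
    obtain ⟨U, hU, hUs⟩ := mem_nhdsWithin_iff_exists_mem_nhds_inter.1 (hn1.and hn2)
    obtain ⟨r, hr, hrU⟩ := Metric.mem_nhds_iff.1 hU
    refine ⟨Metric.ball t₀ r, Metric.ball_mem_nhds _ hr, fun x hx y hy hax hxy hyb p hp => ?_⟩
    have hsub : ∀ t ∈ Icc x y, γ t ∈ (extChartAt I x₀).source ∧ c t ∈ O := fun t ht =>
      hUs ⟨hrU ((convex_ball t₀ r).ordConnected.out hx hy ht), hax.trans ht.1, ht.2.trans hyb⟩
    have hc : ContDiffOn ℝ ∞ c (Icc x y) := contDiffOn_extChartAt_comp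
      (hγ.mono (Icc_subset_Icc hax hyb)) x₀ fun t ht => (hsub t ht).1
    have e : EqOn γ (fun t => B.proj (σ (c t))) (Icc x y) := fun t ht => by
      simp only
      rw [hσp _ (hsub t ht).2, (extChartAt I x₀).left_inv (hsub t ht).1]
    have h1 := (transport_local hOo hσ hxy hc fun t ht => (hsub t ht).2).congr e
    obtain ⟨z, hz⟩ := B.exists_smul_eq ((h1.proj_left hxy.le).trans hp.symm)
    rw [hz]
    exact ⟨_, h1.circle z⟩

section Phase

variable {s : M → B.Total} (hs : ∀ x, B.proj (s x) = x)

/-- The parallel transport along a curve, compared with the values of a section. -/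
def phase (s : M → B.Total) (c : unitInterval → M) : AddCircle (1 : ℝ) := by
  classical
  exact if h : ∃ r : AddCircle (1 : ℝ), B.Transport (IccExtend zero_le_one c) 0 1 (s (c 0))
    (AddCircle.toCircle r • s (c 1)) then h.choose else 0

lemma phase_eq (hab : a < b) {r : AddCircle (1 : ℝ)}
    (h : B.Transport γ a b (s (γ a)) (AddCircle.toCircle r • s (γ b))) : phase s (arc γ a b) = r := by
  have h1 : B.Transport (IccExtend zero_le_one (arc γ a b)) 0 1 (s (arc γ a b 0))
      (AddCircle.toCircle r • s (arc γ a b 1)) := by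
    rw [arc_zero, arc_one]
    refine (h.affine hab).congr fun t ht => ?_
    rw [IccExtend_of_mem _ _ ht]
    rfl
  have hex : ∃ r : AddCircle (1 : ℝ), B.Transport (IccExtend zero_le_one (arc γ a b)) 0 1 (s (arc γ a b 0))
    (AddCircle.toCircle r • s (arc γ a b 1)) := ⟨r, h1⟩
  rw [phase, dif_pos hex]
  exact toCircle_injective (B.circle_free (hex.choose_spec.unique h1 zero_le_one))

include hs in
lemma transport_phase (hab : a < b) (hγ : ContMDiffOn 𝓘(ℝ, ℝ) I ∞ γ (Icc a b)) :
    B.Transport γ a b (s (γ a)) (AddCircle.toCircle (phase s (arc γ a b)) • s (γ b)) := by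
  obtain ⟨q, hq⟩ := exists_transport hab.le hγ (hs (γ a))
  obtain ⟨z, hz⟩ := B.exists_smul_eq ((hs (γ b)).trans (hq.proj_right hab.le).symm)
  obtain ⟨r, rfl⟩ := exists_toCircle_eq z
  rw [hz] at hq
  rwa [phase_eq hab hq]

/-- The action of the group, compared with the values of a section. -/
def twist (s : M → B.Total) (hs : ∀ x, B.proj (s x) = x) (φ : G) (x : M) : AddCircle (1 : ℝ) :=
  -(exists_toCircle_eq (B.exists_smul_eq (p := s (φ • x)) (q := φ • s x)
    (by rw [hs, B.proj_smul, hs])).choose).choose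

lemma smul_section (φ : G) (x : M) :
    φ • s x = AddCircle.toCircle (-twist s hs φ x) • s (φ • x) := by
  have hex := B.exists_smul_eq (p := s (φ • x)) (q := φ • s x) (by rw [hs, B.proj_smul, hs])
  rw [twist, neg_neg, (exists_toCircle_eq hex.choose).choose_spec]
  exact hex.choose_spec

lemma twist_mul (φ ψ : G) (x : M) : twist s hs (ψ * φ) x = twist s hs ψ (φ • x) + twist s hs φ x := by
  have h1 := smul_section hs (ψ * φ) x
  rw [mul_smul, mul_smul, smul_section hs φ x, B.smul_comm, smul_section hs ψ (φ • x), ← mul_smul,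
    ← AddCircle.toCircle_add] at h1
  have h2 := toCircle_injective (B.circle_free h1)
  rw [← neg_inj, ← h2]
  abel

include hs in
lemma phase_split (had : a < d) (hdb : d < b) (hγ : ContMDiffOn 𝓘(ℝ, ℝ) I ∞ γ (Icc a b)) :
    phase s (arc γ a b) = phase s (arc γ a d) + phase s (arc γ d b) := by
  have h1 := transport_phase hs had (hγ.mono (Icc_subset_Icc_right hdb.le))
  have h2 := transport_phase hs hdb (hγ.mono (Icc_subset_Icc_left had.le))
  refine phase_eq (had.trans hdb) ?_
  rw [AddCircle.toCircle_add, mul_smul]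
  exact h1.trans (h2.circle _) had.le hdb.le

include hs in
lemma isPotential_phase {σ : V → B.Total} {W : Set V} (hW : IsOpen W)
    (hσ : ContMDiffOn 𝓘(ℝ, V) (I.prod (𝓡 1)) ∞ σ W) {h : V → AddCircle (1 : ℝ)}
    (hh : ∀ y ∈ W, σ y = AddCircle.toCircle (h y) • s (B.proj (σ y))) :
    IsPotential I (phase s) (fun y => B.proj (σ y)) W h (localForm σ) where
  isOpen := hW
  smooth_map := B.contMDiff_proj.comp_contMDiffOn hσ
  smooth := contDiffOn_localForm hW hσ
  eq c a b hab hc hcW := by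
    have h1 := transport_local hW hσ hab hc hcW
    rw [hh _ (hcW ⟨le_rfl, hab.le⟩), hh _ (hcW ⟨hab.le, le_rfl⟩)] at h1
    have h2 := h1.circle (AddCircle.toCircle (-h (c a)))
    refine phase_eq hab ?_
    rw [← mul_smul, ← mul_smul, ← mul_smul, ← AddCircle.toCircle_add, ← AddCircle.toCircle_add,
      ← AddCircle.toCircle_add, neg_add_cancel, AddCircle.toCircle_zero, one_smul] at h2
    have e : h (c b) - h (c a) + ((lineInt (localForm σ) c a b : ℝ) : AddCircle (1 : ℝ)) =
        -h (c a) + ((lineInt (localForm σ) c a b : ℝ) : AddCircle (1 : ℝ)) + h (c b) := by abel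
    rw [e]
    exact h2

lemma exists_phase (hs : ∀ x, B.proj (s x) = x) (σ : V → B.Total) :
    ∃ h : V → AddCircle (1 : ℝ), ∀ y, σ y = AddCircle.toCircle (h y) • s (B.proj (σ y)) := by
  have : ∀ y, ∃ r : AddCircle (1 : ℝ), σ y = AddCircle.toCircle r • s (B.proj (σ y)) := fun y => by
    obtain ⟨z, hz⟩ := B.exists_smul_eq (hs (B.proj (σ y)))
    obtain ⟨r, rfl⟩ := exists_toCircle_eq z
    exact ⟨r, hz⟩
  choose h hh using this
  exact ⟨h, hh⟩

include hs in
lemma hasPotentials_phase : HasPotentials I (phase s) := by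
  intro x
  obtain ⟨O, hO, hOo, hxO, σ, hσ, hσp⟩ := B.exists_local_section (isOpen_extChartAt_target (I := I) x)
    (contMDiffOn_extChartAt_symm (I := I) x) (mem_extChartAt_target x)
  obtain ⟨h, hh⟩ := exists_phase hs σ
  exact ⟨O, h, _, hxO, hO, (isPotential_phase hs hOo hσ fun y _ => hh y).congr fun y hy => (hσp y hy).symm⟩

end Phase

end EquivariantBundle
end Bundle

section Subdivision

variable {E : Type*} [NormedAddCommGroup E] [NormedSpace ℝ E]
  {H : Type*} [TopologicalSpace H] {I : ModelWithCorners ℝ E H}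
  {M : Type*} [TopologicalSpace M] [ChartedSpace H M]

lemma PiecewiseSmooth.exists_subdivision {x y : M} {γ : Path x y} (h : PiecewiseSmooth I γ) :
    ∃ (n : ℕ) (t : Fin (n + 1) → ℝ), IsSmoothSubdivision I γ t := by
  classical
  obtain ⟨s, hs⟩ := h
  set s' : Finset ℝ := insert 0 (insert 1 (s.filter fun c => c ∈ Ioo (0 : ℝ) 1)) with hs'
  have hsub : ∀ c ∈ s', 0 ≤ c ∧ c ≤ 1 := by
    intro c hc
    simp only [hs', Finset.mem_insert, Finset.mem_filter] at hc
    rcases hc with rfl | rfl | ⟨-, h⟩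
    · simp
    · simp
    · exact ⟨h.1.le, h.2.le⟩
  have hpos : 0 < s'.card := Finset.card_pos.2 ⟨0, by simp [hs']⟩
  obtain ⟨n, hn⟩ : ∃ n, s'.card = n + 1 := ⟨s'.card - 1, by omega⟩
  have h0 : (0 : ℝ) ∈ s' := by simp [hs']
  have h1 : (1 : ℝ) ∈ s' := by simp [hs']
  refine ⟨n, s'.orderEmbOfFin hn, (s'.orderEmbOfFin hn).strictMono, ?_, ?_, fun i => ?_⟩
  · have e := Finset.orderEmbOfFin_zero hn n.succ_pos
    have e' : (s'.orderEmbOfFin hn) 0 = s'.min' ⟨0, h0⟩ := e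
    rw [e']
    exact le_antisymm (Finset.min'_le _ _ h0) (hsub _ (Finset.min'_mem _ _)).1
  · have e := Finset.orderEmbOfFin_last hn n.succ_pos
    have e' : (s'.orderEmbOfFin hn) (Fin.last n) = s'.max' ⟨0, h0⟩ := e
    rw [e']
    exact le_antisymm (hsub _ (Finset.max'_mem _ _)).2 (Finset.le_max' _ _ h1)
  · refine hs _ _ (hsub _ (Finset.orderEmbOfFin_mem s' hn _)).1
      ((s'.orderEmbOfFin hn).monotone (Fin.castSucc_lt_succ).le)
      (hsub _ (Finset.orderEmbOfFin_mem s' hn _)).2 fun c hc hm => ?_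
    have hc' : c ∈ s' := by
      simp only [hs', Finset.mem_insert, Finset.mem_filter]
      refine Or.inr (Or.inr ⟨hc, ?_, ?_⟩)
      · exact (hsub _ (Finset.orderEmbOfFin_mem s' hn _)).1.trans_lt hm.1
      · exact hm.2.trans_le (hsub _ (Finset.orderEmbOfFin_mem s' hn _)).2
    have hr : c ∈ Set.range (s'.orderEmbOfFin hn) := by
      rw [Finset.range_orderEmbOfFin]; exact hc'
    obtain ⟨j, rfl⟩ := hr
    have hj1 := (s'.orderEmbOfFin hn).lt_iff_lt.1 hm.1
    have hj2 := (s'.orderEmbOfFin hn).lt_iff_lt.1 hm.2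
    rw [Fin.lt_def] at hj1 hj2
    simp at hj1 hj2
    omega

/-- The sum of the values of a functional on the pieces of a subdivided curve. -/
def pieceSum {A : Type*} [AddCommMonoid A] (P : (unitInterval → M) → A) {x y : M} (γ : Path x y) {n : ℕ}
    (t : Fin (n + 1) → ℝ) : A :=
  ∑ i : Fin n, P (arc γ.extend (t i.castSucc) (t i.succ))

/-- The value on a closed equivariant curve determined by a functional on arcs and a twist. -/
def holonomyOf {G : Type*} [Group G] [MulAction G M] (P : (unitInterval → M) → AddCircle (1 : ℝ))
    (K : G → M → AddCircle (1 : ℝ)) (k : EquivCurve G I M) : AddCircle (1 : ℝ) :=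
  pieceSum P k.path k.smooth.exists_subdivision.choose_spec.choose + K k.elt k.base

end Subdivision

section Bundle

variable {EG : Type*} [NormedAddCommGroup EG] [NormedSpace ℝ EG] [FiniteDimensional ℝ EG]
  {HG : Type*} [TopologicalSpace HG] {IG : ModelWithCorners ℝ EG HG} [IG.Boundaryless]
  {G : Type*} [TopologicalSpace G] [ChartedSpace HG G] [Group G]
  {E : Type*} [NormedAddCommGroup E] [NormedSpace ℝ E] [FiniteDimensional ℝ E]
  {H : Type*} [TopologicalSpace H] {I : ModelWithCorners ℝ E H} [I.Boundaryless]
  {M : Type*} [TopologicalSpace M] [ChartedSpace H M] [IsManifold I ∞ M] [MulAction G M]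
  {B : EquivariantBundle IG G I M} {s : M → B.Total} (hs : ∀ x, B.proj (s x) = x)

namespace EquivariantBundle

include hs in
lemma transport_path {x y : M} {γ : Path x y} {n : ℕ} {t : Fin (n + 1) → ℝ} (ht : IsSmoothSubdivision I γ t) :
    B.Transport γ.extend 0 1 (s x) (AddCircle.toCircle (pieceSum (phase s) γ t) • s y) := by
  have key : ∀ m (hm : m ≤ n), B.Transport γ.extend 0 (t ⟨m, by omega⟩) (s x)
      (AddCircle.toCircle (∑ i : Fin m, phase s (arc γ.extend (t (i.castLE hm).castSucc) (t (i.castLE hm).succ))) •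
        s (γ.extend (t ⟨m, by omega⟩))) := by
    intro m
    induction m with
    | zero =>
      intro hm
      have e : t ⟨0, by omega⟩ = 0 := ht.zero
      rw [e]
      simpa using transport_refl (B := B) (γ := γ.extend) (a := 0) (p := s x) (by simp [hs])
    | succ m ih =>
      intro hm
      have h1 := ih (by omega)
      let i : Fin n := ⟨m, hm⟩
      have h2 := transport_phase hs (ht.strictMono (Fin.castSucc_lt_succ (i := i))) (ht.smooth i)
      have h0 : 0 ≤ t ⟨m, by omega⟩ := by
        rw [← ht.zero]; exact ht.strictMono.monotone (Fin.zero_le _)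
      have h3 := h1.trans (h2.circle _) h0 (ht.strictMono (Fin.castSucc_lt_succ (i := i))).le
      rw [Fin.sum_univ_castSucc, AddCircle.toCircle_add, mul_smul]
      exact h3
  have h1 := key n le_rfl
  have e : t ⟨n, by omega⟩ = 1 := ht.one
  rw [e, γ.extend_one] at h1
  exact h1

lemma IsHorizontalLift.isHorizontalOn {x y : M} {γ : Path x y} {p q : B.Total} {γ' : Path p q}
    (h : B.IsHorizontalLift γ γ') : B.IsHorizontalOn γ.extend 0 1 γ'.extend where
  lift t ht := by
    rw [Path.extend_apply _ ht, Path.extend_apply _ ht]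
    exact h.lift _
  continuousOn := γ'.continuous_extend.continuousOn
  horizontal := by
    obtain ⟨s, h1, h2⟩ := h.horizontal
    refine ⟨s, h1, fun t ht hts => ?_⟩
    rw [pull_apply_one, mD_univ]
    exact h2 t ht hts

lemma IsHorizontalOn.exists_isHorizontalLift {x y : M} {γ : Path x y} {Γ : ℝ → B.Total}
    (h : B.IsHorizontalOn γ.extend 0 1 Γ) : ∃ γ' : Path (Γ 0) (Γ 1), B.IsHorizontalLift γ γ' := by
  let γ' : Path (Γ 0) (Γ 1) :=
    { toFun := fun t => Γ t
      continuous_toFun := continuousOn_iff_continuous_restrict.1 h.continuousOn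
      source' := by simp
      target' := by simp }
  have e : EqOn γ'.extend Γ (Icc 0 1) := fun t ht => Path.extend_apply γ' ht
  refine ⟨γ', fun t => ?_, ?_⟩
  · have := h.lift t t.2
    rw [Path.extend_apply _ t.2] at this
    exact this
  · obtain ⟨s, h1, h2⟩ := (h.congr (fun _ _ => rfl) e).horizontal
    refine ⟨s, h1, fun t ht hts => ?_⟩
    have := h2 t ht hts
    rw [pull_apply_one, mD_univ] at this
    exact this

/-- The log-holonomy in terms of a section and a subdivision. -/
lemma isLogHolonomy_pieceSum (k : EquivCurve G I M) {n : ℕ} {t : Fin (n + 1) → ℝ}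
    (ht : IsSmoothSubdivision I k.path t) :
    B.IsLogHolonomy k (pieceSum (phase s) k.path t + twist s hs k.elt k.base) := by
  have h1 := transport_path hs ht
  have e1 : s (k.elt • k.base) = AddCircle.toCircle (twist s hs k.elt k.base) • k.elt • s k.base := by
    rw [smul_section hs, ← mul_smul, ← AddCircle.toCircle_add, add_neg_cancel, AddCircle.toCircle_zero, one_smul]
  rw [e1, ← mul_smul, ← AddCircle.toCircle_add] at h1
  constructor
  · obtain ⟨Γ, h2, -, -⟩ := h1
    obtain ⟨γ', h3⟩ := h2.exists_isHorizontalLift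
    exact ⟨_, _, γ', h3⟩
  · intro p q γ' hγ'
    have h2 : B.Transport k.path.extend 0 1 p q := ⟨_, hγ'.isHorizontalOn, by simp, by simp⟩
    obtain ⟨z, rfl⟩ := B.exists_smul_eq ((h1.proj_left zero_le_one).trans (h2.proj_left zero_le_one).symm)
    rw [(h2.unique (h1.circle z) zero_le_one), B.smul_comm, ← mul_smul, ← mul_smul, mul_comm]

lemma isLogHolonomy_holonomyOf (k : EquivCurve G I M) :
    B.IsLogHolonomy k (holonomyOf (phase s) (twist s hs) k) :=
  isLogHolonomy_pieceSum hs k k.smooth.exists_subdivision.choose_spec.choose_spec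

lemma IsLogHolonomy.unique {k : EquivCurve G I M} {a a' : AddCircle (1 : ℝ)} (h : B.IsLogHolonomy k a)
    (h' : B.IsLogHolonomy k a') : a = a' := by
  obtain ⟨p, q, γ', hγ'⟩ := h.1
  exact toCircle_injective (B.circle_free ((h.2 p q γ' hγ').symm.trans (h'.2 p q γ' hγ')))

lemma exists_section (B : EquivariantBundle IG G I M) : ∃ s : M → B.Total, ∀ x, B.proj (s x) = x := by
  choose s hs using B.proj_surjective
  exact ⟨s, hs⟩

lemma holonomyOf_eq_pieceSum (k : EquivCurve G I M) {n : ℕ} {t : Fin (n + 1) → ℝ}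
    (ht : IsSmoothSubdivision I k.path t) :
    holonomyOf (phase s) (twist s hs) k = pieceSum (phase s) k.path t + twist s hs k.elt k.base :=
  (isLogHolonomy_holonomyOf hs k).unique (isLogHolonomy_pieceSum hs k ht)

end EquivariantBundle
end Bundle

lemma alternating_add_two {V : Type*} [NormedAddCommGroup V] [NormedSpace ℝ V] [FiniteDimensional ℝ V]
    (B : V [⋀^Fin 2]→L[ℝ] ℝ) (v v' w : V) : B ![v + v', w] = B ![v, w] + B ![v', w] := by
  have h := B.map_update_add ![v, w] 0 v v'
  have e : ∀ u : V, Function.update ![v, w] 0 u = ![u, w] := by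
    intro u; ext i; fin_cases i <;> simp
  simpa [e] using h

lemma alternating_smul_two {V : Type*} [NormedAddCommGroup V] [NormedSpace ℝ V] [FiniteDimensional ℝ V]
    (B : V [⋀^Fin 2]→L[ℝ] ℝ) (r : ℝ) (v w : V) : B ![r • v, w] = r * B ![v, w] := by
  have h := B.map_update_smul ![v, w] 0 r v
  have e : ∀ u : V, Function.update ![v, w] 0 u = ![u, w] := by
    intro u; ext i; fin_cases i <;> simp
  simpa [e] using h

lemma alternating_self_two {V : Type*} [NormedAddCommGroup V] [NormedSpace ℝ V] [FiniteDimensional ℝ V]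
    (B : V [⋀^Fin 2]→L[ℝ] ℝ) (v : V) : B ![v, v] = 0 := by
  have := alternating_vec_two B v v
  linarith

lemma alternating_add_two' {V : Type*} [NormedAddCommGroup V] [NormedSpace ℝ V] [FiniteDimensional ℝ V]
    (B : V [⋀^Fin 2]→L[ℝ] ℝ) (v w w' : V) : B ![v, w + w'] = B ![v, w] + B ![v, w'] := by
  rw [alternating_vec_two B (w + w') v, alternating_add_two, alternating_vec_two B v w,
    alternating_vec_two B v w']
  ring

lemma alternating_smul_two' {V : Type*} [NormedAddCommGroup V] [NormedSpace ℝ V] [FiniteDimensional ℝ V]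
    (B : V [⋀^Fin 2]→L[ℝ] ℝ) (r : ℝ) (v w : V) : B ![v, r • w] = r * B ![v, w] := by
  rw [alternating_vec_two B (r • w) v, alternating_smul_two, alternating_vec_two B v w]
  ring

lemma alternating_two_det {V : Type*} [NormedAddCommGroup V] [NormedSpace ℝ V] [FiniteDimensional ℝ V]
    (B : V [⋀^Fin 2]→L[ℝ] ℝ) (a b c d : ℝ) (v w : V) :
    B ![a • v + b • w, c • v + d • w] = (a * d - b * c) * B ![v, w] := by
  rw [alternating_add_two, alternating_add_two', alternating_add_two']
  simp only [alternating_smul_two, alternating_smul_two', alternating_self_two]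
  rw [alternating_vec_two B v w]
  ring

lemma pair_eq_add (x y : ℝ) : ((x, y) : ℝ × ℝ) = x • (1, 0) + y • (0, 1) := by
  ext <;> simp

section Rectangle

variable {E : Type*} [NormedAddCommGroup E] [NormedSpace ℝ E] [FiniteDimensional ℝ E]
  {H : Type*} [TopologicalSpace H] {I : ModelWithCorners ℝ E H} [I.Boundaryless]
  {M : Type*} [TopologicalSpace M] [ChartedSpace H M] [IsManifold I ∞ M]
  {V : Type*} [NormedAddCommGroup V] [NormedSpace ℝ V] [FiniteDimensional ℝ V]

variable (I) in
/-- Additivity of a functional on smooth arcs under subdivision. -/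
def SplitAdditive (P : (unitInterval → M) → AddCircle (1 : ℝ)) : Prop :=
  ∀ (γ : ℝ → M) (a d b : ℝ), a < d → d < b → ContMDiffOn 𝓘(ℝ, ℝ) I ∞ γ (Icc a b) →
    P (arc γ a b) = P (arc γ a d) + P (arc γ d b)

lemma DifferentialForm.pull_mono {k : ℕ} (η : DifferentialForm I M k) {f : V → M} {S S' : Set V} {y : V}
    (hS : UniqueDiffWithinAt ℝ S' y) (h : S' ⊆ S) (hf : MDifferentiableWithinAt 𝓘(ℝ, V) I f S y) :
    η.pull f S' y = η.pull f S y := by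
  rw [pull, pull]
  congr 1
  exact hf.mfderivWithin_mono hS.uniqueMDiffWithinAt h

variable {P : (unitInterval → M) → AddCircle (1 : ℝ)}

lemma deriv_slice_fst {q : ℝ × ℝ → V} {a b c d x y : ℝ} (hab : a < b) (hcd : c < d)
    (hq : DifferentiableOn ℝ q (Icc a b ×ˢ Icc c d)) (hx : x ∈ Ioo a b) (hy : y ∈ Icc c d) :
    deriv (fun t => q (t, y)) x = fderivWithin ℝ q (Icc a b ×ˢ Icc c d) (x, y) (1, 0) := by
  have h1 := (hq (x, y) ⟨Ioo_subset_Icc_self hx, hy⟩).hasFDerivWithinAt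
  have h2 : HasDerivWithinAt (fun t : ℝ => (t, y)) (1, 0) (Icc a b) x :=
    (hasDerivWithinAt_id x _).prodMk (hasDerivWithinAt_const x _ y)
  have h3 := h1.comp_hasDerivWithinAt x h2 (fun t ht => show (t, y) ∈ Icc a b ×ˢ Icc c d from ⟨ht, hy⟩)
  exact (h3.hasDerivAt (Icc_mem_nhds hx.1 hx.2)).deriv

lemma deriv_slice_snd {q : ℝ × ℝ → V} {a b c d x y : ℝ} (hab : a < b) (hcd : c < d)
    (hq : DifferentiableOn ℝ q (Icc a b ×ˢ Icc c d)) (hx : x ∈ Icc a b) (hy : y ∈ Ioo c d) :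
    deriv (fun t => q (x, t)) y = fderivWithin ℝ q (Icc a b ×ˢ Icc c d) (x, y) (0, 1) := by
  have h1 := (hq (x, y) ⟨hx, Ioo_subset_Icc_self hy⟩).hasFDerivWithinAt
  have h2 : HasDerivWithinAt (fun t : ℝ => (x, t)) (0, 1) (Icc c d) y :=
    (hasDerivWithinAt_const y _ x).prodMk (hasDerivWithinAt_id y _)
  have h3 := h1.comp_hasDerivWithinAt y h2 (fun t ht => show (x, t) ∈ Icc a b ×ˢ Icc c d from ⟨hx, ht⟩)
  exact (h3.hasDerivAt (Icc_mem_nhds hy.1 hy.2)).deriv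

variable (P) in
/-- The value of a functional on the boundary of a rectangle. -/
def rectBoundary (Q : ℝ × ℝ → M) (a b c d : ℝ) : AddCircle (1 : ℝ) :=
  P (arc (fun x => Q (x, c)) a b) + P (arc (fun y => Q (b, y)) c d)
    - P (arc (fun x => Q (x, d)) a b) - P (arc (fun y => Q (a, y)) c d)

lemma rectangle_local (hP : HasPotentials I P) {W : Set E} {h : E → AddCircle (1 : ℝ)}
    {A : E → E [⋀^Fin 1]→L[ℝ] ℝ} {f : E → M} (hp : IsPotential I P f W h A) {q : ℝ × ℝ → E}
    {a b c d : ℝ} (hab : a < b) (hcd : c < d) (hq : ContDiffOn ℝ ∞ q (Icc a b ×ˢ Icc c d))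
    (hqW : MapsTo q (Icc a b ×ˢ Icc c d) W) :
    rectBoundary P (f ∘ q) a b c d =
      ((∫ x in a..b, ∫ y in c..d, hP.curv.pull (f ∘ q) (Icc a b ×ˢ Icc c d) (x, y) ![(1, 0), (0, 1)] : ℝ) :
        AddCircle (1 : ℝ)) := by
  set R := Icc a b ×ˢ Icc c d
  have hu : UniqueDiffOn ℝ R := uniqueDiffOn_rect hab hcd
  set β : ℝ × ℝ → (ℝ × ℝ) [⋀^Fin 1]→L[ℝ] ℝ := fun p =>
    (A (q p)).compContinuousLinearMap (fderivWithin ℝ q R p)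
  have hβ : ContDiffOn ℝ ∞ β R := contDiffOn_compContinuousLinearMap (hp.smooth.comp hq hqW)
    (hq.fderivWithin hu (by simp))
  have ha : a ∈ Icc a b := ⟨le_rfl, hab.le⟩
  have hb : b ∈ Icc a b := ⟨hab.le, le_rfl⟩
  have hc : c ∈ Icc c d := ⟨le_rfl, hcd.le⟩
  have hd : d ∈ Icc c d := ⟨hcd.le, le_rfl⟩
  have hqd := hq.differentiableOn (by simp)
  have hor : ∀ y ∈ Icc c d, P (arc (fun x => (f ∘ q) (x, y)) a b) =
      h (q (b, y)) - h (q (a, y)) + ((∫ x in a..b, β (x, y) ![(1, 0)] : ℝ) : AddCircle (1 : ℝ)) := fun y hy => by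
    have h1 := hp.eq (fun x => q (x, y)) a b hab
      (hq.comp (by fun_prop) fun x hx => ⟨hx, hy⟩) fun x hx => hqW ⟨hx, hy⟩
    refine h1.trans ?_
    congr 2
    refine intervalIntegral.integral_congr_uIoo fun x hx => ?_
    rw [uIoo_of_le hab.le] at hx
    simp only
    rw [deriv_slice_fst hab hcd hqd hx hy]
    refine congrArg (A (q (x, y))) ?_
    ext1 i; fin_cases i; rfl
  have ver : ∀ x ∈ Icc a b, P (arc (fun y => (f ∘ q) (x, y)) c d) =
      h (q (x, d)) - h (q (x, c)) + ((∫ y in c..d, β (x, y) ![(0, 1)] : ℝ) : AddCircle (1 : ℝ)) := fun x hx => by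
    have h1 := hp.eq (fun y => q (x, y)) c d hcd
      (hq.comp (by fun_prop) fun y hy => ⟨hx, hy⟩) fun y hy => hqW ⟨hx, hy⟩
    refine h1.trans ?_
    congr 2
    refine intervalIntegral.integral_congr_uIoo fun y hy => ?_
    rw [uIoo_of_le hcd.le] at hy
    simp only
    rw [deriv_slice_snd hab hcd hqd hx hy]
    refine congrArg (A (q (x, y))) ?_
    ext1 i; fin_cases i; rfl
  have hst := stokes_rectangle hab hcd hβ
  have hint : ∫ x in a..b, ∫ y in c..d, hP.curv.pull (f ∘ q) R (x, y) ![(1, 0), (0, 1)] =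
      ∫ x in a..b, ∫ y in c..d, extDerivWithin β R (x, y) ![(1, 0), (0, 1)] := by
    refine intervalIntegral.integral_congr fun x hx => ?_
    refine intervalIntegral.integral_congr fun y hy => ?_
    rw [uIcc_of_le hab.le] at hx
    rw [uIcc_of_le hcd.le] at hy
    have hxy : (x, y) ∈ R := ⟨hx, hy⟩
    have hf : MDifferentiableAt 𝓘(ℝ, E) I f (q (x, y)) :=
      (hp.smooth_map.contMDiffAt (hp.isOpen.mem_nhds (hqW hxy))).mdifferentiableAt (by simp)
    rw [hP.curv.pull_comp hf.mdifferentiableWithinAt (hqd _ hxy) (mapsTo_univ _ _) (hu _ hxy),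
      hP.pull_curv hp (hqW hxy)]
    have hmem : (x, y) ∈ closure (interior R) := by
      rw [interior_prod_eq, interior_Icc, interior_Icc, closure_prod_eq, closure_Ioo hab.ne, closure_Ioo hcd.ne]
      exact hxy
    have hA : DifferentiableAt ℝ A (q (x, y)) :=
      (hp.smooth.differentiableOn (by simp)).differentiableAt (hp.isOpen.mem_nhds (hqW hxy))
    have e := extDerivWithin_pullback (f := q) (s := R) (t := univ) (x := (x, y)) (r := ∞)
      hA.differentiableWithinAt (hq _ hxy) minSmoothness_two_le hu hmem hxy (mapsTo_univ _ _)
    rw [extDerivWithin_univ] at e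
    rw [e]
  rw [hint, hst, rectBoundary, hor c hc, hor d hd, ver a ha, ver b hb]
  rw [AddCircle.coe_sub, AddCircle.coe_sub, AddCircle.coe_add]
  abel

/-- Stokes' theorem for rectangles. -/
lemma rectangle_stokes (hP : HasPotentials I P) (hsplit : SplitAdditive I P) {Q : ℝ × ℝ → M}
    (hQ : ContMDiffOn 𝓘(ℝ, ℝ × ℝ) I ∞ Q (Icc 0 1 ×ˢ Icc 0 1)) :
    rectBoundary P Q 0 1 0 1 =
      ((∫ x in (0 : ℝ)..1, ∫ y in (0 : ℝ)..1, hP.curv.pull Q (Icc 0 1 ×ˢ Icc 0 1) (x, y) ![(1, 0), (0, 1)] : ℝ) :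
        AddCircle (1 : ℝ)) := by
  set S : Set (ℝ × ℝ) := Icc 0 1 ×ˢ Icc 0 1
  have huS : UniqueDiffOn ℝ S := uniqueDiffOn_rect zero_lt_one zero_lt_one
  set F : ℝ × ℝ → ℝ := fun p => hP.curv.pull Q S p ![(1, 0), (0, 1)] with hF
  have hFc : ContinuousOn F S :=
    (contDiffOn_alternating_apply (hP.curv.contDiffOn_pull hQ huS) contDiffOn_const).continuousOn
  let pr : ℝ × ℝ → ℝ × ℝ := fun p => (projIcc 0 1 zero_le_one p.1, projIcc 0 1 zero_le_one p.2)
  have hpr : Continuous pr := by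
    refine Continuous.prodMk ?_ ?_
    · exact continuous_subtype_val.comp (continuous_projIcc.comp continuous_fst)
    · exact continuous_subtype_val.comp (continuous_projIcc.comp continuous_snd)
  have hprS : ∀ p, pr p ∈ S := fun p => ⟨Subtype.prop _, Subtype.prop _⟩
  set F' : ℝ × ℝ → ℝ := F ∘ pr
  have hF' : Continuous F' := hFc.comp_continuous hpr hprS
  have hFF' : ∀ p ∈ S, F' p = F p := fun p hp => by
    change F (pr p) = F p
    congr 1
    ext
    · simp [pr, projIcc_of_mem zero_le_one hp.1]
    · simp [pr, projIcc_of_mem zero_le_one hp.2]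
  have hin : ∀ x, Continuous fun y => F' (x, y) := fun x => hF'.comp (by fun_prop)
  have hout : ∀ c d, Continuous fun x => ∫ y in c..d, F' (x, y) := fun c d =>
    intervalIntegral.continuous_parametric_intervalIntegral_of_continuous' (f := fun x y => F' (x, y)) hF' c d
  let J : ℝ → ℝ → ℝ → ℝ → ℝ := fun a b c d => ∫ x in a..b, ∫ y in c..d, F' (x, y)
  have hJ1 : ∀ a b e c d, J a b c d + J b e c d = J a e c d := fun a b e c d =>
    intervalIntegral.integral_add_adjacent_intervals ((hout c d).intervalIntegrable _ _)
      ((hout c d).intervalIntegrable _ _)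
  have hJ2 : ∀ a b c d e, J a b c d + J a b d e = J a b c e := fun a b c d e => by
    simp only [J]
    rw [← intervalIntegral.integral_add ((hout c d).intervalIntegrable _ _) ((hout d e).intervalIntegrable _ _)]
    congr 1
    ext x
    exact intervalIntegral.integral_add_adjacent_intervals ((hin x).intervalIntegrable _ _)
      ((hin x).intervalIntegrable _ _)
  have hhor : ∀ y ∈ Icc (0 : ℝ) 1, ContMDiffOn 𝓘(ℝ, ℝ) I ∞ (fun x => Q (x, y)) (Icc 0 1) := fun y hy =>
    hQ.comp (f := fun x : ℝ => (x, y))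
      ((contDiff_id.prodMk contDiff_const).contMDiff.contMDiffOn) fun x hx => ⟨hx, hy⟩
  have hver : ∀ x ∈ Icc (0 : ℝ) 1, ContMDiffOn 𝓘(ℝ, ℝ) I ∞ (fun y => Q (x, y)) (Icc 0 1) := fun x hx =>
    hQ.comp (f := fun y : ℝ => (x, y))
      ((contDiff_const.prodMk contDiff_id).contMDiff.contMDiffOn) fun y hy => ⟨hx, hy⟩
  -- small rectangles
  obtain ⟨δ, hδ, hloc⟩ : ∃ δ > 0, ∀ a b c d, 0 ≤ a → a < b → b ≤ 1 → 0 ≤ c → c < d → d ≤ 1 →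
      b - a < δ → d - c < δ → rectBoundary P Q a b c d = (J a b c d : AddCircle (1 : ℝ)) := by
    have hpt : ∀ p : ℝ × ℝ, ∃ U : Set (ℝ × ℝ), IsOpen U ∧ (p ∈ S → p ∈ U) ∧
        ∃ (W : Set E) (h : E → AddCircle (1 : ℝ)) (A : E → E [⋀^Fin 1]→L[ℝ] ℝ),
          IsPotential I P (extChartAt I (Q p)).symm W h A ∧
          ∀ z ∈ U ∩ S, Q z ∈ (extChartAt I (Q p)).source ∧ extChartAt I (Q p) (Q z) ∈ W := by
      intro p
      obtain ⟨W, h, A, hxW, -, hp⟩ := hP (Q p)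
      by_cases hpS : p ∈ S
      · have hc : ContinuousWithinAt Q S p := hQ.continuousOn p hpS
        have h1 : ∀ᶠ z in 𝓝[S] p, Q z ∈ (extChartAt I (Q p)).source :=
          hc.eventually (extChartAt_source_mem_nhds (Q p))
        have h2 : ∀ᶠ z in 𝓝[S] p, extChartAt I (Q p) (Q z) ∈ W :=
          ((continuousAt_extChartAt (I := I) (Q p)).comp_continuousWithinAt hc).eventually
            (hp.isOpen.mem_nhds hxW)
        obtain ⟨U, hUo, hpU, hU⟩ := mem_nhdsWithin.1 (h1.and h2)
        exact ⟨U, hUo, fun _ => hpU, W, h, A, hp, fun z hz => hU hz⟩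
      · exact ⟨∅, isOpen_empty, fun h => absurd h hpS, W, h, A, hp, fun z hz => hz.1.elim⟩
    choose U hUo hpU W h A hp hU using hpt
    obtain ⟨δ, hδ, hleb⟩ := lebesgue_number_lemma_of_metric (isCompact_Icc.prod isCompact_Icc : IsCompact S) hUo
      (fun p hpS => mem_iUnion.2 ⟨p, hpU p hpS⟩)
    refine ⟨δ, hδ, fun a b c d ha hab hb hc hcd hd h1 h2 => ?_⟩
    obtain ⟨p, hp'⟩ := hleb (a, c) ⟨⟨ha, by linarith⟩, ⟨hc, by linarith⟩⟩
    have hR : Icc a b ×ˢ Icc c d ⊆ S := prod_mono (Icc_subset_Icc ha hb) (Icc_subset_Icc hc hd)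
    have hRU : ∀ z ∈ Icc a b ×ˢ Icc c d, z ∈ U p := fun z hz => hp' (by
      rw [Metric.mem_ball, Prod.dist_eq, max_lt_iff, Real.dist_eq, Real.dist_eq, abs_lt, abs_lt]
      exact ⟨⟨by linarith [hz.1.1], by linarith [hz.1.2]⟩, ⟨by linarith [hz.2.1], by linarith [hz.2.2]⟩⟩)
    have hsrc := fun z hz => (hU p z ⟨hRU z hz, hR hz⟩).1
    have hq : ContDiffOn ℝ ∞ (extChartAt I (Q p) ∘ Q) (Icc a b ×ˢ Icc c d) :=
      contDiffOn_extChartAt_comp (hQ.mono hR) _ hsrc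
    have h3 := rectangle_local hP (hp p) hab hcd hq fun z hz => (hU p z ⟨hRU z hz, hR hz⟩).2
    have hEq : EqOn ((extChartAt I (Q p)).symm ∘ (extChartAt I (Q p) ∘ Q)) Q (Icc a b ×ˢ Icc c d) :=
      fun z hz => (extChartAt I (Q p)).left_inv (hsrc z hz)
    have e1 : rectBoundary P ((extChartAt I (Q p)).symm ∘ (extChartAt I (Q p) ∘ Q)) a b c d =
        rectBoundary P Q a b c d := by
      simp only [rectBoundary]
      rw [arc_congr hab.le (fun x hx => hEq (x := (x, c)) ⟨hx, le_rfl, hcd.le⟩),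
        arc_congr hab.le (fun x hx => hEq (x := (x, d)) ⟨hx, hcd.le, le_rfl⟩),
        arc_congr hcd.le (fun y hy => hEq (x := (a, y)) ⟨⟨le_rfl, hab.le⟩, hy⟩),
        arc_congr hcd.le (fun y hy => hEq (x := (b, y)) ⟨⟨hab.le, le_rfl⟩, hy⟩)]
    rw [← e1, h3]
    congr 1
    refine intervalIntegral.integral_congr fun x hx => ?_
    refine intervalIntegral.integral_congr fun y hy => ?_
    rw [uIcc_of_le hab.le] at hx
    rw [uIcc_of_le hcd.le] at hy
    have hxy : (x, y) ∈ Icc a b ×ˢ Icc c d := ⟨hx, hy⟩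
    refine Eq.trans ?_ (hFF' _ (hR hxy)).symm
    rw [hF, hP.curv.pull_congr hEq hxy]
    rw [hP.curv.pull_mono (uniqueDiffOn_rect hab hcd _ hxy) hR ((hQ _ (hR hxy)).mdifferentiableWithinAt (by simp))]
  have hJ0 : ∀ a c d, J a a c d = 0 := fun a c d => intervalIntegral.integral_same
  -- strips
  have hstrip : ∀ c d, 0 ≤ c → c < d → d ≤ 1 → d - c < δ →
      rectBoundary P Q 0 1 c d = (J 0 1 c d : AddCircle (1 : ℝ)) := by
    intro c d hc hcd hd hdc
    have := interval_induction (a := 0) (b := 1) zero_le_one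
      (Q := fun a b => a = b ∨ rectBoundary P Q a b c d = (J a b c d : AddCircle (1 : ℝ)))
      (fun x => Or.inl rfl) (fun x y z hx hxy hyz hz h1 h2 => ?_) fun t ht => ?_
    · exact this.resolve_left zero_ne_one
    · have h1' := h1.resolve_left hxy.ne
      have h2' := h2.resolve_left hyz.ne
      right
      have s1 := hsplit _ x y z hxy hyz ((hhor c ⟨hc, by linarith⟩).mono (Icc_subset_Icc hx hz))
      have s2 := hsplit _ x y z hxy hyz ((hhor d ⟨by linarith, hd⟩).mono (Icc_subset_Icc hx hz))
      rw [← hJ1 x y z, AddCircle.coe_add, ← h1', ← h2']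
      simp only [rectBoundary, s1, s2]
      abel
    · refine ⟨Metric.ball t (δ / 2), Metric.ball_mem_nhds _ (by positivity), fun x hx y hy h0 hxy h1 => ?_⟩
      rw [Real.ball_eq_Ioo] at hx hy
      exact Or.inr (hloc x y c d h0 hxy h1 hc hcd hd (by linarith [hx.1, hy.2]) hdc)
  have := interval_induction (a := 0) (b := 1) zero_le_one
    (Q := fun c d => c = d ∨ rectBoundary P Q 0 1 c d = (J 0 1 c d : AddCircle (1 : ℝ)))
    (fun x => Or.inl rfl) (fun x y z hx hxy hyz hz h1 h2 => ?_) fun t ht => ?_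
  · rw [this.resolve_left zero_ne_one]
    congr 1
    refine intervalIntegral.integral_congr fun x hx => ?_
    refine intervalIntegral.integral_congr fun y hy => ?_
    rw [uIcc_of_le zero_le_one] at hx hy
    exact hFF' _ ⟨hx, hy⟩
  · have h1' := h1.resolve_left hxy.ne
    have h2' := h2.resolve_left hyz.ne
    right
    have s1 := hsplit _ x y z hxy hyz ((hver 0 (by simp)).mono (Icc_subset_Icc hx hz))
    have s2 := hsplit _ x y z hxy hyz ((hver 1 (by simp)).mono (Icc_subset_Icc hx hz))
    rw [← hJ2 0 1 x y z, AddCircle.coe_add, ← h1', ← h2']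
    simp only [rectBoundary, s1, s2]
    abel
  · refine ⟨Metric.ball t (δ / 2), Metric.ball_mem_nhds _ (by positivity), fun x hx y hy h0 hxy h1 => ?_⟩
    rw [Real.ball_eq_Ioo] at hx hy
    exact Or.inr (hstrip x y h0 hxy h1 (by linarith [hx.1, hy.2]))

lemma HasPotentials.const (hP : HasPotentials I P) (x : M) : P (fun _ => x) = 0 := by
  obtain ⟨W, h, A, hxW, -, hp⟩ := hP x
  have h1 := hp.eq (fun _ => extChartAt I x x) 0 1 zero_lt_one contDiffOn_const fun _ _ => hxW
  have e : arc ((extChartAt I x).symm ∘ fun _ : ℝ => extChartAt I x x) 0 1 = fun _ => x := by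
    ext s
    exact extChartAt_to_inv x
  have e2 : lineInt A (fun _ => extChartAt I x x) 0 1 = 0 := by
    have : ∀ B : E [⋀^Fin 1]→L[ℝ] ℝ, B ![0] = 0 := fun B => by
      have := alternating_smul_one B 0 0
      simpa using this
    simp [lineInt, this]
  rw [e, e2] at h1
  simpa using h1

lemma unitSquare_to_triangle {s t : ℝ} (hs : s ∈ Icc (0 : ℝ) 1) (ht : t ∈ Icc (0 : ℝ) 1) :
    (s * (1 - t), s * t) ∈ triangle :=
  ⟨mul_nonneg hs.1 (by linarith [ht.2]), mul_nonneg hs.1 ht.1, by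
    simp only
    nlinarith [hs.2]⟩

/-- Stokes' theorem for singular simplices. -/
lemma simplex_stokes (hP : HasPotentials I P) (hsplit : SplitAdditive I P) (σ : Simplex2 I M) :
    P (fun t : unitInterval => σ.toFun (1 - (t : ℝ), (t : ℝ))) - P (fun t : unitInterval => σ.toFun (0, (t : ℝ)))
      + P (fun t : unitInterval => σ.toFun ((t : ℝ), 0)) = ((σ.integral hP.curv : ℝ) : AddCircle (1 : ℝ)) := by
  set m : ℝ × ℝ → ℝ × ℝ := fun p => (p.1 * (1 - p.2), p.1 * p.2) with hm
  set S : Set (ℝ × ℝ) := Icc 0 1 ×ˢ Icc 0 1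
  have huS : UniqueDiffOn ℝ S := uniqueDiffOn_rect zero_lt_one zero_lt_one
  have hmc : ContDiff ℝ ∞ m := by fun_prop
  have hmS : MapsTo m S triangle := fun p hp => unitSquare_to_triangle hp.1 hp.2
  have hQ : ContMDiffOn 𝓘(ℝ, ℝ × ℝ) I ∞ (σ.toFun ∘ m) S := σ.smooth.comp hmc.contMDiff.contMDiffOn hmS
  have h1 := rectangle_stokes hP hsplit hQ
  have b1 : arc (fun x => (σ.toFun ∘ m) (x, 0)) 0 1 = fun t : unitInterval => σ.toFun ((t : ℝ), 0) := by
    ext t; simp [arc, m]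
  have b2 : arc (fun y => (σ.toFun ∘ m) (1, y)) 0 1 = fun t : unitInterval => σ.toFun (1 - (t : ℝ), (t : ℝ)) := by
    ext t; simp [arc, m]
  have b3 : arc (fun x => (σ.toFun ∘ m) (x, 1)) 0 1 = fun t : unitInterval => σ.toFun (0, (t : ℝ)) := by
    ext t; simp [arc, m]
  have b4 : arc (fun y => (σ.toFun ∘ m) (0, y)) 0 1 = fun t : unitInterval => σ.toFun (0, 0) := by
    ext t; simp [arc, m]
  rw [rectBoundary, b1, b2, b3, b4, hP.const, sub_zero] at h1
  have h2 : P (fun t : unitInterval => σ.toFun (1 - (t : ℝ), (t : ℝ))) - P (fun t : unitInterval => σ.toFun (0, (t : ℝ)))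
      + P (fun t : unitInterval => σ.toFun ((t : ℝ), 0)) = P (fun t : unitInterval => σ.toFun ((t : ℝ), 0)) +
      P (fun t : unitInterval => σ.toFun (1 - (t : ℝ), (t : ℝ))) - P (fun t : unitInterval => σ.toFun (0, (t : ℝ))) := by abel
  rw [h2, h1]
  congr 1
  set F : ℝ × ℝ → ℝ := fun p => hP.curv.pull σ.toFun triangle p ![(1, 0), (0, 1)] with hF
  have hFc : ContinuousOn F triangle :=
    (contDiffOn_alternating_apply (hP.curv.contDiffOn_pull σ.smooth uniqueDiffOn_triangle)
      contDiffOn_const).continuousOn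
  have hint : σ.integral hP.curv = ∫ p in triangle, F p := by
    refine MeasureTheory.integral_congr_ae (Filter.Eventually.of_forall fun p => ?_)
    refine congrArg (hP.curv.val (σ.toFun p)) ?_
    ext1 i
    fin_cases i <;> rfl
  rw [hint, setIntegral_triangle_eq (hFc.integrableOn_compact isCompact_triangle)]
  refine intervalIntegral.integral_congr fun s hs => ?_
  refine intervalIntegral.integral_congr fun t ht => ?_
  rw [uIcc_of_le zero_le_one] at hs ht
  have hst : (s, t) ∈ S := ⟨hs, ht⟩
  have hd : HasFDerivAt m ((ContinuousLinearMap.prod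
      ((s • (-ContinuousLinearMap.snd ℝ ℝ ℝ)) + (1 - t) • ContinuousLinearMap.fst ℝ ℝ ℝ)
      ((s • ContinuousLinearMap.snd ℝ ℝ ℝ) + t • ContinuousLinearMap.fst ℝ ℝ ℝ))) (s, t) := by
    have k1 : HasFDerivAt (fun p : ℝ × ℝ => p.1) (ContinuousLinearMap.fst ℝ ℝ ℝ) (s, t) := hasFDerivAt_fst
    have k2 : HasFDerivAt (fun p : ℝ × ℝ => p.2) (ContinuousLinearMap.snd ℝ ℝ ℝ) (s, t) := hasFDerivAt_snd
    exact (k1.mul (k2.const_sub 1)).prodMk (k1.mul k2)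
  have e1 := hP.curv.pull_comp (f := σ.toFun) (g := m) (W := triangle) (S := S) (y := (s, t))
    ((σ.smooth _ (hmS hst)).mdifferentiableWithinAt (by simp)) hd.differentiableAt.differentiableWithinAt hmS
    (huS _ hst)
  rw [e1, hd.hasFDerivWithinAt.fderivWithin (huS _ hst)]
  have e2 := alternating_two_det (hP.curv.pull σ.toFun triangle (m (s, t))) (1 - t) t (-s) s (1, 0) (0, 1)
  rw [← pair_eq_add, ← pair_eq_add] at e2
  have e3 : ((1 - t) * s - t * -s) = s := by ring
  rw [e3] at e2
  refine Eq.trans ?_ e2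
  refine congrArg (hP.curv.pull σ.toFun triangle (m (s, t))) ?_
  ext1 i
  fin_cases i
  · simp
  · simp

/-- A functional on arcs, extended to chains. -/
def chainExtend (P : (unitInterval → M) → AddCircle (1 : ℝ)) :
    ((unitInterval → M) →₀ ℤ) →+ AddCircle (1 : ℝ) :=
  Finsupp.liftAddHom fun c => (zmultiplesHom (AddCircle (1 : ℝ))) (P c)

lemma chainExtend_single (c : unitInterval → M) (n : ℤ) : chainExtend P (Finsupp.single c n) = n • P c := by
  simp [chainExtend]

lemma chainExtend_curveChain {x y : M} (γ : Path x y) {n : ℕ} (t : Fin (n + 1) → ℝ) :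
    chainExtend P (curveChain γ t) = pieceSum P γ t := by
  rw [curveChain, map_sum, pieceSum]
  refine Finset.sum_congr rfl fun i _ => ?_
  rw [chainExtend_single, one_smul]
  rfl

/-- Stokes' theorem for chains. -/
lemma chain_stokes (hP : HasPotentials I P) (hsplit : SplitAdditive I P) (σ : Simplex2 I M →₀ ℤ) :
    chainExtend P (chainBoundary σ) = ((chainIntegral σ hP.curv : ℝ) : AddCircle (1 : ℝ)) := by
  rw [chainBoundary, chainIntegral, Finsupp.sum, Finsupp.sum, map_sum]
  have : (((∑ a ∈ σ.support, (σ a : ℝ) * a.integral hP.curv : ℝ)) : AddCircle (1 : ℝ)) =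
      ∑ a ∈ σ.support, ((((σ a : ℝ) * a.integral hP.curv : ℝ)) : AddCircle (1 : ℝ)) :=
    map_sum (QuotientAddGroup.mk' (AddSubgroup.zmultiples (1 : ℝ))) _ _
  rw [this]
  refine Finset.sum_congr rfl fun a _ => ?_
  rw [map_zsmul, Simplex2.boundary, map_add, map_sub, chainExtend_single, chainExtend_single,
    chainExtend_single, one_smul, one_smul, one_smul, simplex_stokes hP hsplit a, ← AddCircle.coe_zsmul,
    zsmul_eq_mul]

end Rectangle

section Curves

variable {E : Type*} [NormedAddCommGroup E] [NormedSpace ℝ E] [FiniteDimensional ℝ E]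
  {H : Type*} [TopologicalSpace H] {I : ModelWithCorners ℝ E H} [I.Boundaryless]
  {M : Type*} [TopologicalSpace M] [ChartedSpace H M] [IsManifold I ∞ M]
  {V : Type*} [NormedAddCommGroup V] [NormedSpace ℝ V]

variable (I) in
lemma mD_symm_comp_mD (x : M) :
    (mD 𝓘(ℝ, E) I (extChartAt I x).symm univ (extChartAt I x x)).comp
      (mD I 𝓘(ℝ, E) (extChartAt I x) univ x) = ContinuousLinearMap.id ℝ E := by
  have : IsManifold I 1 M := IsManifold.of_le (n := ∞) (by simp)
  have h : (mfderivWithin 𝓘(ℝ, E) I (extChartAt I x).symm (range I) (extChartAt I x x) : E →L[ℝ] E).comp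
      (mfderiv I 𝓘(ℝ, E) (extChartAt I x) x : E →L[ℝ] E) = ContinuousLinearMap.id ℝ E :=
    mfderivWithin_extChartAt_symm_comp_mfderiv_extChartAt' (I := I) (mem_extChartAt_source x)
  rw [I.range_eq_univ] at h
  rw [mD_univ (extChartAt I x)]
  exact h

variable (I) in
lemma mD_symm_surjective (x : M) (v : E) :
    mD 𝓘(ℝ, E) I (extChartAt I x).symm univ (extChartAt I x x)
      (mD I 𝓘(ℝ, E) (extChartAt I x) univ x v) = v :=
  DFunLike.congr_fun (mD_symm_comp_mD I x) v

lemma eq_of_comp_mD_symm {k : ℕ} {α β : E [⋀^Fin k]→L[ℝ] ℝ} (x : M)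
    (h : α.compContinuousLinearMap (mD 𝓘(ℝ, E) I (extChartAt I x).symm univ (extChartAt I x x)) =
      β.compContinuousLinearMap (mD 𝓘(ℝ, E) I (extChartAt I x).symm univ (extChartAt I x x))) : α = β := by
  ext v
  have := DFunLike.congr_fun h (fun i => mD I 𝓘(ℝ, E) (extChartAt I x) univ x (v i))
  simp only [ContinuousAlternatingMap.compContinuousLinearMap_apply, Function.comp_def] at this
  simpa only [mD_symm_surjective] using this

variable (I) in
/-- Every tangent vector is the velocity of a smooth curve. -/
lemma exists_curve_velocity (x : M) (v : E) : ∃ (c : ℝ → M) (O : Set ℝ), IsOpen O ∧ (0 : ℝ) ∈ O ∧ c 0 = x ∧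
    ContMDiffOn 𝓘(ℝ, ℝ) I ∞ c O ∧ mD 𝓘(ℝ, ℝ) I c univ 0 1 = v := by
  set v' : E := mD I 𝓘(ℝ, E) (extChartAt I x) univ x v with hv'
  set l : ℝ → E := fun t => extChartAt I x x + t • v' with hl
  have hl0 : l 0 = extChartAt I x x := by simp [hl]
  have hlc : ContDiff ℝ ∞ l := by fun_prop
  have hO : IsOpen (l ⁻¹' (extChartAt I x).target) := (isOpen_extChartAt_target x).preimage hlc.continuous
  have h0 : (0 : ℝ) ∈ l ⁻¹' (extChartAt I x).target := by
    rw [mem_preimage, hl0]; exact mem_extChartAt_target x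
  refine ⟨(extChartAt I x).symm ∘ l, _, hO, h0, by simp [hl0], ?_, ?_⟩
  · exact (contMDiffOn_extChartAt_symm (I := I) x).comp hlc.contMDiff.contMDiffOn fun t ht => ht
  · have h1 : MDifferentiableAt 𝓘(ℝ, E) I (extChartAt I x).symm (l 0) :=
      ((contMDiffOn_extChartAt_symm (n := ∞) (I := I) x).contMDiffAt
        ((isOpen_extChartAt_target x).mem_nhds h0)).mdifferentiableAt (by simp)
    rw [mD_comp h1.mdifferentiableWithinAt (hlc.differentiable (by simp) 0).mdifferentiableAt.mdifferentiableWithinAt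
      (mapsTo_univ _ _) (uniqueMDiffWithinAt_univ _), mD_eq_fderivWithin, fderivWithin_univ,
      ContinuousLinearMap.comp_apply]
    have h2 : fderiv ℝ l 0 1 = v' := by
      have : HasDerivAt l ((1 : ℝ) • v') 0 := ((hasDerivAt_id (0 : ℝ)).smul_const v').const_add (extChartAt I x x)
      rw [one_smul] at this
      exact this.deriv
    rw [h2, hl0, mD_symm_surjective]

end Curves

section Bundle

variable {EG : Type*} [NormedAddCommGroup EG] [NormedSpace ℝ EG] [FiniteDimensional ℝ EG]
  {HG : Type*} [TopologicalSpace HG] {IG : ModelWithCorners ℝ EG HG} [IG.Boundaryless]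
  {G : Type*} [TopologicalSpace G] [ChartedSpace HG G] [Group G] [LieGroup IG ∞ G]
  {E : Type*} [NormedAddCommGroup E] [NormedSpace ℝ E] [FiniteDimensional ℝ E]
  {H : Type*} [TopologicalSpace H] {I : ModelWithCorners ℝ E H} [I.Boundaryless]
  {M : Type*} [TopologicalSpace M] [ChartedSpace H M] [IsManifold I ∞ M] [MulAction G M]
  [ContMDiffSMul IG I ∞ G M]
  {V : Type*} [NormedAddCommGroup V] [NormedSpace ℝ V] [FiniteDimensional ℝ V]
  {B : EquivariantBundle IG G I M}

lemma mDifferentiableAt_group_smul_base (IG : ModelWithCorners ℝ EG HG) [ContMDiffSMul IG I ∞ G M] (φ : G) (x : M) : MDifferentiableAt I I (fun y : M => φ • y) x :=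
  ((ContMDiffSMul.contMDiff_const_smul (I := IG) (I' := I) (n := ∞) φ).contMDiffAt).mdifferentiableAt (by simp)

namespace EquivariantBundle

section Curvature

variable {s : M → B.Total} (hs : ∀ x, B.proj (s x) = x)

lemma pull_curv_phase {σ : V → B.Total} {W : Set V} (hW : IsOpen W)
    (hσ : ContMDiffOn 𝓘(ℝ, V) (I.prod (𝓡 1)) ∞ σ W) {y : V} (hy : y ∈ W) :
    (hasPotentials_phase hs).curv.pull (fun y => B.proj (σ y)) univ y = extDeriv (localForm σ) y := by
  obtain ⟨h, hh⟩ := exists_phase hs σ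
  exact (hasPotentials_phase hs).pull_curv (isPotential_phase hs hW hσ fun y _ => hh y) hy

lemma curv_phase_invariant (φ : G) (x : M) :
    (hasPotentials_phase hs).curv.pullbackAt (I' := I) (fun y => φ • y) x =
      (hasPotentials_phase hs).curv.toFun x := by
  set w := (hasPotentials_phase hs).curv
  refine eq_of_comp_mD_symm (I := I) x ?_
  set f : E → M := fun z => (extChartAt I x).symm z with hf
  set y := extChartAt I x x
  obtain ⟨O, hO, hOo, hxO, σ, hσ, hσp⟩ := B.exists_local_section (isOpen_extChartAt_target (I := I) x)
    (contMDiffOn_extChartAt_symm (I := I) x) (mem_extChartAt_target x)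
  have hg : ContMDiffOn 𝓘(ℝ, E) (I.prod (𝓡 1)) ∞ (fun y => φ • σ y) O :=
    (ContMDiffSMul.contMDiff_const_smul (I := IG) (I' := I.prod (𝓡 1)) (n := ∞) φ).comp_contMDiffOn hσ
  have h1 := pull_curv_phase hs hOo hσ hxO
  have h2 := pull_curv_phase hs hOo hg hxO
  have h3 : localForm (fun y => φ • σ y) =ᶠ[𝓝 y] localForm σ := by
    filter_upwards [hOo.mem_nhds hxO] with z hz
    ext v
    rw [vec_one_eta v]
    simp only [localForm, ContinuousAlternatingMap.smul_apply]
    rw [pull_group φ ((hσ.contMDiffAt (hOo.mem_nhds hz)).mdifferentiableAt (by simp)).mdifferentiableWithinAt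
      uniqueDiffWithinAt_univ]
  rw [h3.extDeriv_eq, ← h1] at h2
  have hf : MDifferentiableAt 𝓘(ℝ, E) I f y :=
    ((contMDiffOn_extChartAt_symm (n := ∞) (I := I) x).contMDiffAt
        ((isOpen_extChartAt_target x).mem_nhds (mem_extChartAt_target x))).mdifferentiableAt (by simp)
  have e1 : (fun y => B.proj (σ y)) =ᶠ[𝓝 y] f := by
    filter_upwards [hOo.mem_nhds hxO] with z hz using hσp z hz
  have e2 : (fun y => B.proj (φ • σ y)) =ᶠ[𝓝 y] (fun x : M => φ • x) ∘ f := by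
    filter_upwards [hOo.mem_nhds hxO] with z hz
    rw [B.proj_smul, hσp z hz]
    rfl
  rw [w.pull_congr_of_eventuallyEq (e1.filter_mono nhdsWithin_le_nhds) e1.self_of_nhds,
    w.pull_congr_of_eventuallyEq (e2.filter_mono nhdsWithin_le_nhds) e2.self_of_nhds,
    DifferentialForm.pull, DifferentialForm.pull, mD_comp
    (mDifferentiableAt_group_smul_base IG φ (f y)).mdifferentiableWithinAt hf.mdifferentiableWithinAt (mapsTo_univ _ _)
    (uniqueMDiffWithinAt_univ _)] at h2
  have hfy : f y = x := by simp [f, y]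
  rw [hfy] at h2
  refine Eq.trans ?_ h2
  rw [mD_univ (fun x : M => φ • x)]
  simp only [Function.comp, hfy]
  rfl

/-- The value of the moment map, computed at a point of the total space. -/
def momentVal (B : EquivariantBundle IG G I M) (X : EG) (p : B.Total) : ℝ :=
  -(2 * Real.pi)⁻¹ * B.form.val p ![mD IG (I.prod (𝓡 1)) (fun g : G => g • p) univ 1 X]

lemma mDifferentiableAt_orbit (p : B.Total) (g : G) :
    MDifferentiableAt IG (I.prod (𝓡 1)) (fun g : G => g • p) g :=
  ((contMDiff_id.smul (I := IG) (I' := I.prod (𝓡 1)) (n := ∞) (contMDiff_const (c := p))).contMDiffAt).mdifferentiableAt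
    (by simp)

lemma momentVal_circle (X : EG) (z : Circle) (p : B.Total) : B.momentVal X (z • p) = B.momentVal X p := by
  have e : (fun g : G => g • z • p) = (fun q : B.Total => z • q) ∘ fun g : G => g • p := by
    ext g; exact B.smul_comm g z p
  rw [momentVal, momentVal, e, mD_comp (mDifferentiableAt_circle_smul z _).mdifferentiableWithinAt
    (mDifferentiableAt_orbit p 1).mdifferentiableWithinAt (mapsTo_univ _ _) (uniqueMDiffWithinAt_univ _),
    ContinuousLinearMap.comp_apply, one_smul, val_circle]

lemma momentVal_congr (X : EG) {p q : B.Total} (h : B.proj p = B.proj q) : B.momentVal X p = B.momentVal X q := by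
  obtain ⟨z, rfl⟩ := B.exists_smul_eq h
  rw [momentVal_circle]

lemma mD_orbit_translate (φ : G) (p : B.Total) (X : EG) :
    mD IG (I.prod (𝓡 1)) (fun g : G => (φ * g) • p) univ 1 X =
      mD (I.prod (𝓡 1)) (I.prod (𝓡 1)) (fun q : B.Total => φ • q) univ p
        (mD IG (I.prod (𝓡 1)) (fun g : G => g • p) univ 1 X) := by
  have e : (fun g : G => (φ * g) • p) = (fun q : B.Total => φ • q) ∘ fun g : G => g • p := by
    ext g; exact mul_smul φ g p
  rw [e, mD_comp (mDifferentiableAt_group_smul φ _).mdifferentiableWithinAt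
    (mDifferentiableAt_orbit p 1).mdifferentiableWithinAt (mapsTo_univ _ _) (uniqueMDiffWithinAt_univ _),
    ContinuousLinearMap.comp_apply, one_smul]

lemma momentVal_conj (φ : G) (X : EG) (p : B.Total) :
    B.momentVal (mD IG IG (fun h : G => φ * h * φ⁻¹) univ 1 X) (φ • p) = B.momentVal X p := by
  have e : (fun g : G => g • φ • p) ∘ (fun h : G => φ * h * φ⁻¹) = fun g : G => (φ * g) • p := by
    ext g; simp [mul_smul]
  have hc : MDifferentiableAt IG IG (fun h : G => φ * h * φ⁻¹) 1 :=
    (((contMDiff_const.mul (I := IG) (n := ∞) contMDiff_id).mul contMDiff_const).contMDiffAt).mdifferentiableAt (by simp)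
  have h1 := mD_comp (mDifferentiableAt_orbit (φ • p) _).mdifferentiableWithinAt
    hc.mdifferentiableWithinAt (mapsTo_univ _ _) (uniqueMDiffWithinAt_univ _)
  rw [e] at h1
  have h2 := DFunLike.congr_fun h1 X
  rw [mD_orbit_translate (B := B) (IG := IG) φ p X, ContinuousLinearMap.comp_apply] at h2
  have h3 : φ * 1 * φ⁻¹ = (1 : G) := by simp
  rw [h3] at h2
  rw [momentVal, momentVal, ← val_group φ p]
  rw [h2]

lemma momentVal_equivariant (φ : G) (X : GroupLieAlgebra IG G) (p : B.Total) :
    B.momentVal (Ad IG φ X) (φ • p) = B.momentVal X p := by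
  have h := momentVal_conj (IG := IG) (B := B) φ X p
  rw [mD_univ] at h
  exact h

end Curvature
end EquivariantBundle
end Bundle

section Bundle

variable {EG : Type*} [NormedAddCommGroup EG] [NormedSpace ℝ EG] [FiniteDimensional ℝ EG]
  {HG : Type*} [TopologicalSpace HG] {IG : ModelWithCorners ℝ EG HG} [IG.Boundaryless]
  {G : Type*} [TopologicalSpace G] [ChartedSpace HG G] [Group G] [LieGroup IG ∞ G]
  {E : Type*} [NormedAddCommGroup E] [NormedSpace ℝ E] [FiniteDimensional ℝ E]
  {H : Type*} [TopologicalSpace H] {I : ModelWithCorners ℝ E H} [I.Boundaryless]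
  {M : Type*} [TopologicalSpace M] [ChartedSpace H M] [IsManifold I ∞ M] [MulAction G M]
  [ContMDiffSMul IG I ∞ G M]
  {V : Type*} [NormedAddCommGroup V] [NormedSpace ℝ V] [FiniteDimensional ℝ V]
  {B : EquivariantBundle IG G I M}

lemma contMDiffAt_of_chart {f : M → ℝ} {x : M} {O : Set E} (hO : IsOpen O) (hx : extChartAt I x x ∈ O)
    (h : ContDiffOn ℝ ∞ (f ∘ (extChartAt I x).symm) O) : ContMDiffAt I 𝓘(ℝ, ℝ) ∞ f x := by
  have h1 : ContMDiffAt I 𝓘(ℝ, ℝ) ∞ ((f ∘ (extChartAt I x).symm) ∘ extChartAt I x) x :=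
    (h.contMDiffOn.contMDiffAt (hO.mem_nhds hx)).comp x (contMDiffAt_extChartAt (I := I) (n := ∞))
  refine h1.congr_of_eventuallyEq ?_
  filter_upwards [extChartAt_source_mem_nhds (I := I) x] with z hz
  simp only [Function.comp]
  rw [(extChartAt I x).left_inv hz]

namespace EquivariantBundle

variable {σ : V → B.Total} {W : Set V} {c : ℝ → G} {O : Set ℝ}

lemma contMDiffOn_curve_smul (hσ : ContMDiffOn 𝓘(ℝ, V) (I.prod (𝓡 1)) ∞ σ W)
    (hc : ContMDiffOn 𝓘(ℝ, ℝ) IG ∞ c O) :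
    ContMDiffOn 𝓘(ℝ, ℝ × V) (I.prod (𝓡 1)) ∞ (fun p : ℝ × V => c p.1 • σ p.2) (O ×ˢ W) :=
  (hc.comp contDiff_fst.contMDiff.contMDiffOn fun p hp => hp.1).smul
    (hσ.comp contDiff_snd.contMDiff.contMDiffOn fun p hp => hp.2)

lemma localForm_comp {V' : Type*} [NormedAddCommGroup V'] [NormedSpace ℝ V'] {g : V' → V} {y : V'}
    (hσ : MDifferentiableAt 𝓘(ℝ, V) (I.prod (𝓡 1)) σ (g y)) (hg : DifferentiableAt ℝ g y) (v : V') :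
    localForm (σ ∘ g) y ![v] = localForm σ (g y) ![fderiv ℝ g y v] := by
  have e := B.form.pull_comp (f := σ) (g := g) (W := univ) (S := univ) (y := y)
    hσ.mdifferentiableWithinAt hg.differentiableWithinAt (mapsTo_univ _ _) uniqueDiffWithinAt_univ
  rw [fderivWithin_univ] at e
  simp only [localForm, ContinuousAlternatingMap.smul_apply]
  congr 1
  rw [e]
  refine congrArg (B.form.pull σ univ (g y)) ?_
  ext1 i
  fin_cases i
  rfl

lemma localForm_group (φ : G) {y : V} (hσ : MDifferentiableAt 𝓘(ℝ, V) (I.prod (𝓡 1)) σ y) (v : V) :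
    localForm (fun y => φ • σ y) y ![v] = localForm σ y ![v] := by
  simp only [localForm, ContinuousAlternatingMap.smul_apply]
  rw [pull_group φ hσ.mdifferentiableWithinAt uniqueDiffWithinAt_univ]

/-- Along an orbit, the local connection form is the moment map. -/
lemma localForm_orbit (p : B.Total) {t : ℝ} {X : EG} (hc : MDifferentiableAt 𝓘(ℝ, ℝ) IG c t)
    (h : c t = 1) (hX : mD 𝓘(ℝ, ℝ) IG c univ t 1 = X) :
    localForm (fun t => c t • p) t ![(1 : ℝ)] = B.momentVal X p := by
  simp only [localForm, ContinuousAlternatingMap.smul_apply, momentVal, smul_eq_mul]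
  rw [pull_apply_one, h, one_smul]
  have h1 := mD_comp (g := fun g : G => g • p) (mDifferentiableAt_orbit p _).mdifferentiableWithinAt
    hc.mdifferentiableWithinAt (mapsTo_univ _ _) (uniqueMDiffWithinAt_univ _)
  have h2 := DFunLike.congr_fun h1 (1 : ℝ)
  rw [ContinuousLinearMap.comp_apply, hX, h] at h2
  rw [← h2]
  rfl

lemma localForm_curve_fst (hW : IsOpen W) (hσ : ContMDiffOn 𝓘(ℝ, V) (I.prod (𝓡 1)) ∞ σ W) (hO : IsOpen O)
    (hc : ContMDiffOn 𝓘(ℝ, ℝ) IG ∞ c O) (h0 : (0 : ℝ) ∈ O) (hc0 : c 0 = 1) {X : EG}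
    (hX : mD 𝓘(ℝ, ℝ) IG c univ 0 1 = X) {y : V} (hy : y ∈ W) :
    localForm (fun p : ℝ × V => c p.1 • σ p.2) (0, y) ![((1 : ℝ), (0 : V))] = B.momentVal X (σ y) := by
  have hF := (contMDiffOn_curve_smul hσ hc).contMDiffAt (x := (0, y)) ((hO.prod hW).mem_nhds ⟨h0, hy⟩)
  have h1 := localForm_comp (σ := fun p : ℝ × V => c p.1 • σ p.2) (g := fun t : ℝ => (t, y)) (y := (0 : ℝ))
    (hF.mdifferentiableAt (by simp)) (by fun_prop) 1
  have hd : HasDerivAt (fun t : ℝ => (t, y)) ((1 : ℝ), (0 : V)) 0 := (hasDerivAt_id _).prodMk (hasDerivAt_const _ _)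
  rw [show fderiv ℝ (fun t : ℝ => (t, y)) 0 1 = ((1 : ℝ), (0 : V)) from hd.deriv] at h1
  rw [← h1, ← localForm_orbit (σ y) ((hc.contMDiffAt (hO.mem_nhds h0)).mdifferentiableAt (by simp)) hc0 hX]
  rfl

lemma localForm_curve_snd (hW : IsOpen W) (hσ : ContMDiffOn 𝓘(ℝ, V) (I.prod (𝓡 1)) ∞ σ W) (hO : IsOpen O)
    (hc : ContMDiffOn 𝓘(ℝ, ℝ) IG ∞ c O) {t : ℝ} (ht : t ∈ O) {y : V} (hy : y ∈ W) (v : V) :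
    localForm (fun p : ℝ × V => c p.1 • σ p.2) (t, y) ![((0 : ℝ), v)] = localForm σ y ![v] := by
  have hF := (contMDiffOn_curve_smul hσ hc).contMDiffAt (x := (t, y)) ((hO.prod hW).mem_nhds ⟨ht, hy⟩)
  have h1 := localForm_comp (σ := fun p : ℝ × V => c p.1 • σ p.2) (g := fun y : V => (t, y)) (y := y)
    (hF.mdifferentiableAt (by simp)) (by fun_prop) v
  have hd : HasFDerivAt (fun y : V => (t, y)) (ContinuousLinearMap.inr ℝ ℝ V) y := hasFDerivAt_prodMk_right t y
  rw [hd.fderiv, ContinuousLinearMap.inr_apply] at h1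
  rw [← h1, ← localForm_group (c t) ((hσ.contMDiffAt (hW.mem_nhds hy)).mdifferentiableAt (by simp))]
  rfl

lemma contDiffOn_momentVal (X : EG) (hW : IsOpen W) (hσ : ContMDiffOn 𝓘(ℝ, V) (I.prod (𝓡 1)) ∞ σ W) :
    ContDiffOn ℝ ∞ (fun y => B.momentVal X (σ y)) W := by
  obtain ⟨c, O, hO, h0, hc0, hc, hX⟩ := exists_curve_velocity IG (1 : G) X
  have h1 := contDiffOn_localForm (hO.prod hW) (contMDiffOn_curve_smul hσ hc)
  have h2 : ContDiffOn ℝ ∞ (fun y : V => localForm (fun p : ℝ × V => c p.1 • σ p.2) (0, y)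
      ![((1 : ℝ), (0 : V))]) W :=
    contDiffOn_alternating_apply (h1.comp (contDiff_const.prodMk contDiff_id).contDiffOn
      fun y hy => ⟨h0, hy⟩) contDiffOn_const
  exact h2.congr fun y hy => (localForm_curve_fst hW hσ hO hc h0 hc0 hX hy).symm

lemma extDeriv_curve (X : EG) (hW : IsOpen W) (hσ : ContMDiffOn 𝓘(ℝ, V) (I.prod (𝓡 1)) ∞ σ W) (hO : IsOpen O)
    (hc : ContMDiffOn 𝓘(ℝ, ℝ) IG ∞ c O) (h0 : (0 : ℝ) ∈ O) (hc0 : c 0 = 1)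
    (hX : mD 𝓘(ℝ, ℝ) IG c univ 0 1 = X) {y : V} (hy : y ∈ W) (v : V) :
    extDeriv (localForm (fun p : ℝ × V => c p.1 • σ p.2)) (0, y) ![((1 : ℝ), (0 : V)), ((0 : ℝ), v)] =
      - fderiv ℝ (fun y => B.momentVal X (σ y)) y v := by
  set L := localForm (fun p : ℝ × V => c p.1 • σ p.2)
  have hL : ContDiffOn ℝ ∞ L (O ×ˢ W) := contDiffOn_localForm (hO.prod hW) (contMDiffOn_curve_smul hσ hc)
  have hLd : DifferentiableAt ℝ L (0, y) :=
    (hL.differentiableOn (by simp)).differentiableAt ((hO.prod hW).mem_nhds ⟨h0, hy⟩)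
  rw [extDeriv_one_apply hLd]
  have hA : ∀ w, DifferentiableAt ℝ (fun p => L p ![w]) (0, y) := fun w =>
    hLd.continuousAlternatingMap_apply_const _
  have e1 : fderiv ℝ (fun p => L p ![((0 : ℝ), v)]) (0, y) ((1 : ℝ), (0 : V)) = 0 := by
    have hd : HasDerivAt (fun t : ℝ => (t, y)) ((1 : ℝ), (0 : V)) 0 := (hasDerivAt_id _).prodMk (hasDerivAt_const _ _)
    have h1 := (hA ((0 : ℝ), v)).hasFDerivAt.comp_hasDerivAt (0 : ℝ) hd
    have h2 : (fun t : ℝ => L (t, y) ![((0 : ℝ), v)]) =ᶠ[𝓝 0] fun _ => localForm σ y ![v] := by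
      filter_upwards [hO.mem_nhds h0] with t ht using localForm_curve_snd hW hσ hO hc ht hy v
    exact h1.unique ((hasDerivAt_const (0 : ℝ) _).congr_of_eventuallyEq h2)
  have e2 : fderiv ℝ (fun p => L p ![((1 : ℝ), (0 : V))]) (0, y) ((0 : ℝ), v) =
      fderiv ℝ (fun y => B.momentVal X (σ y)) y v := by
    have hd : HasFDerivAt (fun y : V => ((0 : ℝ), y)) (ContinuousLinearMap.inr ℝ ℝ V) y := hasFDerivAt_prodMk_right 0 y
    have h1 := (hA ((1 : ℝ), (0 : V))).hasFDerivAt.comp y hd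
    have h2 : (fun y => B.momentVal X (σ y)) =ᶠ[𝓝 y] (fun p => L p ![((1 : ℝ), (0 : V))]) ∘ fun y : V => ((0 : ℝ), y) := by
      filter_upwards [hW.mem_nhds hy] with z hz using (localForm_curve_fst hW hσ hO hc h0 hc0 hX hz).symm
    rw [h2.fderiv_eq, h1.fderiv]
    simp
  rw [e1, e2, zero_sub]

section Section

variable {s : M → B.Total} (hs : ∀ x, B.proj (s x) = x)

lemma mDifferentiableAt_orbit_base (x : M) (g : G) : MDifferentiableAt IG I (fun g : G => g • x) g :=
  ((contMDiff_id.smul (I := IG) (I' := I) (n := ∞) (contMDiff_const (c := x))).contMDiffAt).mdifferentiableAt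
    (by simp)

include hs in
lemma contMDiff_moment (X : EG) : ContMDiff I 𝓘(ℝ, ℝ) ∞ (fun x => B.momentVal X (s x)) := by
  intro x
  obtain ⟨O, hO, hOo, hxO, σ, hσ, hσp⟩ := B.exists_local_section (isOpen_extChartAt_target (I := I) x)
    (contMDiffOn_extChartAt_symm (I := I) x) (mem_extChartAt_target x)
  refine contMDiffAt_of_chart hOo hxO ((contDiffOn_momentVal X hOo hσ).congr fun y hy => ?_)
  exact momentVal_congr X (by rw [hs, hσp y hy])

lemma contraction_curv (X : EG) (x : M) (v : E) :
    (hasPotentials_phase hs).curv.val x ![-mD IG I (fun g : G => g • x) univ 1 X, v] =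
      mD I 𝓘(ℝ, ℝ) (fun x => B.momentVal X (s x)) univ x v := by
  obtain ⟨c, O, hO, h0, hc0, hc, hX⟩ := exists_curve_velocity IG (1 : G) X
  obtain ⟨W, hWt, hW, hxW, σ, hσ, hσp⟩ := B.exists_local_section (isOpen_extChartAt_target (I := I) x)
    (contMDiffOn_extChartAt_symm (I := I) x) (mem_extChartAt_target x)
  set w := (hasPotentials_phase hs).curv
  set f : E → M := fun z => (extChartAt I x).symm z
  set y := extChartAt I x x
  have hfy : f y = x := extChartAt_to_inv x
  set v' := mD I 𝓘(ℝ, E) (extChartAt I x) univ x v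
  have hv' : mD 𝓘(ℝ, E) I f univ y v' = v := mD_symm_surjective I x v
  have hf : MDifferentiableAt 𝓘(ℝ, E) I f y :=
    ((contMDiffOn_extChartAt_symm (n := ∞) (I := I) x).contMDiffAt
        ((isOpen_extChartAt_target x).mem_nhds (mem_extChartAt_target x))).mdifferentiableAt (by simp)
  have h1 := pull_curv_phase hs (hO.prod hW) (contMDiffOn_curve_smul hσ hc) (y := (0, y)) ⟨h0, hxW⟩
  have h2 := extDeriv_curve X hW hσ hO hc h0 hc0 hX hxW v'
  rw [← h1] at h2
  -- the projected map
  set F : ℝ × E → M := fun p => c p.1 • f p.2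
  have hF : (fun p : ℝ × E => B.proj (c p.1 • σ p.2)) =ᶠ[𝓝 (0, y)] F := by
    filter_upwards [(hO.prod hW).mem_nhds (show ((0 : ℝ), y) ∈ O ×ˢ W from ⟨h0, hxW⟩)] with p hp
    rw [B.proj_smul, hσp _ hp.2]
  have hFs : ContMDiffOn 𝓘(ℝ, ℝ × E) I ∞ F (O ×ˢ (extChartAt I x).target) :=
    (hc.comp contDiff_fst.contMDiff.contMDiffOn fun p hp => hp.1).smul
      ((contMDiffOn_extChartAt_symm (I := I) x).comp contDiff_snd.contMDiff.contMDiffOn fun p hp => hp.2)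
  have hFd : MDifferentiableAt 𝓘(ℝ, ℝ × E) I F (0, y) :=
    (hFs.contMDiffAt ((hO.prod (isOpen_extChartAt_target x)).mem_nhds
      ⟨h0, mem_extChartAt_target x⟩)).mdifferentiableAt (by simp)
  rw [w.pull_congr_of_eventuallyEq (hF.filter_mono nhdsWithin_le_nhds) hF.self_of_nhds] at h2
  have d1 : mD 𝓘(ℝ, ℝ × E) I F univ (0, y) ((1 : ℝ), (0 : E)) = mD IG I (fun g : G => g • x) univ 1 X := by
    have hd : HasDerivAt (fun t : ℝ => (t, y)) ((1 : ℝ), (0 : E)) 0 := (hasDerivAt_id _).prodMk (hasDerivAt_const _ _)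
    have k1 := mD_comp (f := fun t : ℝ => (t, y)) (x := (0 : ℝ)) (g := F) hFd.mdifferentiableWithinAt
      hd.differentiableAt.mdifferentiableAt.mdifferentiableWithinAt (mapsTo_univ _ _) (uniqueMDiffWithinAt_univ _)
    have k2 := DFunLike.congr_fun k1 (1 : ℝ)
    rw [ContinuousLinearMap.comp_apply, mD_eq_fderivWithin, fderivWithin_univ,
      show fderiv ℝ (fun t : ℝ => (t, y)) 0 1 = ((1 : ℝ), (0 : E)) from hd.deriv] at k2
    have k3 := mD_comp (g := fun g : G => g • f y) (f := c) (mDifferentiableAt_orbit_base (IG := IG) (I := I) (f y) (c 0)).mdifferentiableWithinAt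
      ((hc.contMDiffAt (hO.mem_nhds h0)).mdifferentiableAt (by simp)).mdifferentiableWithinAt (mapsTo_univ _ _)
      (uniqueMDiffWithinAt_univ _)
    have k4 := DFunLike.congr_fun k3 (1 : ℝ)
    rw [ContinuousLinearMap.comp_apply, hX, hc0, hfy] at k4
    rw [← k2, ← k4]
    simp only [F, Function.comp_def, hfy]
  have d2 : mD 𝓘(ℝ, ℝ × E) I F univ (0, y) ((0 : ℝ), v') = v := by
    have hd : HasFDerivAt (fun y : E => ((0 : ℝ), y)) (ContinuousLinearMap.inr ℝ ℝ E) y := hasFDerivAt_prodMk_right 0 y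
    have k1 := mD_comp (f := fun y : E => ((0 : ℝ), y)) (x := y) (g := F) hFd.mdifferentiableWithinAt
      hd.differentiableAt.mdifferentiableAt.mdifferentiableWithinAt (mapsTo_univ _ _) (uniqueMDiffWithinAt_univ _)
    have k2 := DFunLike.congr_fun k1 v'
    rw [ContinuousLinearMap.comp_apply, mD_eq_fderivWithin, fderivWithin_univ, hd.fderiv,
      ContinuousLinearMap.inr_apply] at k2
    rw [← k2, ← hv']
    have : F ∘ (fun y : E => ((0 : ℝ), y)) = f := by
      ext z; simp [F, hc0]
    rw [this]
  have hl : w.pull F univ (0, y) ![((1 : ℝ), (0 : E)), ((0 : ℝ), v')] =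
      w.val x ![mD IG I (fun g : G => g • x) univ 1 X, v] := by
    have hF0 : F (0, y) = x := by simp [F, hc0, hfy]
    rw [DifferentialForm.pull, hF0, ← d1, ← d2]
    refine congrArg (w.val x) ?_
    ext1 i
    fin_cases i <;> rfl
  have hr : fderiv ℝ (fun y => B.momentVal X (σ y)) y v' =
      mD I 𝓘(ℝ, ℝ) (fun x => B.momentVal X (s x)) univ x v := by
    have e : (fun y => B.momentVal X (σ y)) =ᶠ[𝓝 y] (fun x => B.momentVal X (s x)) ∘ f := by
      filter_upwards [hW.mem_nhds hxW] with z hz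
      exact momentVal_congr X (by rw [hs, hσp z hz])
    have hm : MDifferentiableAt I 𝓘(ℝ, ℝ) (fun x => B.momentVal X (s x)) (f y) :=
      ((contMDiff_moment hs X).contMDiffAt).mdifferentiableAt (by simp)
    have k1 := mD_comp hm.mdifferentiableWithinAt hf.mdifferentiableWithinAt (mapsTo_univ _ _)
      (uniqueMDiffWithinAt_univ _)
    have k2 := DFunLike.congr_fun k1 v'
    rw [ContinuousLinearMap.comp_apply, hv', mD_eq_fderivWithin, fderivWithin_univ, hfy] at k2
    rw [e.fderiv_eq, k2]
  have hneg : w.val x ![-mD IG I (fun g : G => g • x) univ 1 X, v] =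
      -w.val x ![mD IG I (fun g : G => g • x) univ 1 X, v] := by
    have := alternating_smul_two (w.val x) (-1) (mD IG I (fun g : G => g • x) univ 1 X) v
    simpa using this
  rw [hneg, ← hl, h2, neg_neg, hr]

/-- The equivariant curvature of a bundle with connection. -/
def equivCurv : EquivariantTwoForm IG G I M where
  form := (hasPotentials_phase hs).curv
  moment :=
    { toFun := fun X x => B.momentVal X (s x)
      map_add' := fun X Y => by
        ext x
        simp only [momentVal, Pi.add_apply]
        rw [← mul_add, ← alternating_add_one]
        congr 3
        exact (mD IG (I.prod (𝓡 1)) (fun g : G => g • s x) univ 1).map_add X Y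
      map_smul' := fun r X => by
        ext x
        simp only [momentVal, Pi.smul_apply, smul_eq_mul, RingHom.id_apply]
        have : mD IG (I.prod (𝓡 1)) (fun g : G => g • s x) univ 1 (r • X : GroupLieAlgebra IG G) =
          r • mD IG (I.prod (𝓡 1)) (fun g : G => g • s x) univ 1 X :=
          (mD IG (I.prod (𝓡 1)) (fun g : G => g • s x) univ 1).map_smul r X
        rw [this, alternating_smul_one]
        ring }
  form_invariant := curv_phase_invariant hs
  moment_smooth X := contMDiff_moment hs X
  moment_equivariant g X x := by
    refine Eq.trans ?_ (momentVal_equivariant g X (s x))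
    exact momentVal_congr _ (by rw [hs, B.proj_smul, hs])

lemma equivCurv_isClosed : (equivCurv hs).IsClosed := by
  refine ⟨(hasPotentials_phase hs).curv_isClosed, fun X x v => ?_⟩
  have h := contraction_curv hs X x v
  rw [mD_univ, mD_univ] at h
  exact h

end Section

end EquivariantBundle
end Bundle

section Bundle

variable {EG : Type*} [NormedAddCommGroup EG] [NormedSpace ℝ EG] [FiniteDimensional ℝ EG]
  {HG : Type*} [TopologicalSpace HG] {IG : ModelWithCorners ℝ EG HG} [IG.Boundaryless]
  {G : Type*} [TopologicalSpace G] [ChartedSpace HG G] [Group G] [LieGroup IG ∞ G]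
  {E : Type*} [NormedAddCommGroup E] [NormedSpace ℝ E] [FiniteDimensional ℝ E]
  {H : Type*} [TopologicalSpace H] {I : ModelWithCorners ℝ E H} [I.Boundaryless]
  {M : Type*} [TopologicalSpace M] [ChartedSpace H M] [IsManifold I ∞ M] [MulAction G M]
  [ContMDiffSMul IG I ∞ G M]
  {B : EquivariantBundle IG G I M}

namespace EquivariantBundle

lemma Transport.path_trans {x y z : M} {γ : Path x y} {γ' : Path y z} {p q r : B.Total}
    (h : B.Transport γ.extend 0 1 p q) (h' : B.Transport γ'.extend 0 1 q r) :
    B.Transport (γ.trans γ').extend 0 1 p r := by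
  obtain ⟨Γ, h1, rfl, rfl⟩ := h
  obtain ⟨Γ', h1', h2', rfl⟩ := h'
  have k1 : B.Transport (γ.trans γ').extend 0 (1 / 2) (Γ 0) (Γ 1) := by
    have := h1.affine (a' := 0) (b' := 1 / 2) (m := 2) (c := 0) two_ne_zero fun t =>
      ⟨fun ht => ⟨by linarith [ht.1], by linarith [ht.2]⟩, fun ht => ⟨by linarith [ht.1], by linarith [ht.2]⟩⟩
    refine ⟨_, this.congr (fun t ht => ?_) fun t _ => rfl, by simp, by norm_num⟩
    rw [Path.extend_trans_of_le_half _ _ ht.2]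
    simp only [add_zero]
  have k2 : B.Transport (γ.trans γ').extend (1 / 2) 1 (Γ' 0) (Γ' 1) := by
    have := h1'.affine (a' := 1 / 2) (b' := 1) (m := 2) (c := -1) two_ne_zero fun t =>
      ⟨fun ht => ⟨by linarith [ht.1], by linarith [ht.2]⟩, fun ht => ⟨by linarith [ht.1], by linarith [ht.2]⟩⟩
    refine ⟨_, this.congr (fun t ht => ?_) fun t _ => rfl, by norm_num, by norm_num⟩
    rw [Path.extend_trans_of_half_le _ _ ht.1]
    rfl
  rw [h2'] at k2
  exact k1.trans k2 (by norm_num) (by norm_num)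

lemma Transport.path_symm {x y : M} {γ : Path x y} {p q : B.Total}
    (h : B.Transport γ.extend 0 1 p q) : B.Transport γ.symm.extend 0 1 q p := by
  obtain ⟨Γ, h1, rfl, rfl⟩ := h
  have := h1.affine (a' := 0) (b' := 1) (m := -1) (c := 1) (by norm_num) fun t =>
    ⟨fun ht => ⟨by linarith [ht.2], by linarith [ht.1]⟩, fun ht => ⟨by linarith [ht.2], by linarith [ht.1]⟩⟩
  refine ⟨_, this.congr (fun t ht => ?_) fun t _ => rfl, by simp, by simp⟩
  rw [Path.extend_symm]
  simp only
  congr 1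
  ring

lemma Transport.eq_of_isLogHolonomy {k : EquivCurve G I M} {a : AddCircle (1 : ℝ)} (h : B.IsLogHolonomy k a)
    {p q : B.Total} (hpq : B.Transport k.path.extend 0 1 p q) : q = AddCircle.toCircle a • k.elt • p := by
  obtain ⟨Γ, h1, rfl, rfl⟩ := hpq
  obtain ⟨γ', h2⟩ := h1.exists_isHorizontalLift
  exact h.2 _ _ γ' h2

lemma IsLogHolonomy.transport {k : EquivCurve G I M} {a : AddCircle (1 : ℝ)} (h : B.IsLogHolonomy k a)
    {p : B.Total} (hp : B.proj p = k.base) :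
    B.Transport k.path.extend 0 1 p (AddCircle.toCircle a • k.elt • p) := by
  obtain ⟨p₀, q₀, γ', h1⟩ := h.1
  have h2 : B.Transport k.path.extend 0 1 p₀ q₀ := ⟨_, h1.isHorizontalOn, by simp, by simp⟩
  have h3 : B.proj p₀ = k.base := by simpa using h2.proj_left zero_le_one
  obtain ⟨z, rfl⟩ := B.exists_smul_eq (h3.trans hp.symm)
  rw [B.smul_comm, ← mul_smul, mul_comm, mul_smul, ← h2.eq_of_isLogHolonomy h]
  exact h2.circle z

lemma IsLogHolonomy.of_transport {k : EquivCurve G I M} {a : AddCircle (1 : ℝ)} {p : B.Total}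
    (h : B.Transport k.path.extend 0 1 p (AddCircle.toCircle a • k.elt • p)) : B.IsLogHolonomy k a := by
  obtain ⟨s, hs⟩ := exists_section B
  have h1 := isLogHolonomy_holonomyOf hs k
  have h2 := h.eq_of_isLogHolonomy h1
  rwa [toCircle_injective (B.circle_free h2)]

lemma IsLogHolonomy.comp {p q : EquivCurve G I M} {a b : AddCircle (1 : ℝ)} (hp : B.IsLogHolonomy p a)
    (hq : B.IsLogHolonomy q b) (h : q.base = p.elt • p.base) : B.IsLogHolonomy (p.comp q h) (b + a) := by
  obtain ⟨u, hu⟩ := B.proj_surjective p.base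
  have h1 := hp.transport hu
  have hv : B.proj (AddCircle.toCircle a • p.elt • u) = q.base := by rw [B.proj_circle, B.proj_smul, hu, h]
  have h2 := hq.transport hv
  refine IsLogHolonomy.of_transport (p := u) ?_
  have h3 := Transport.path_trans (z := (q.elt * p.elt) • p.base) (γ := p.path) (γ' := q.path.cast h.symm (by rw [mul_smul, h])) h1 h2
  have e : AddCircle.toCircle b • q.elt • AddCircle.toCircle a • p.elt • u =
      AddCircle.toCircle (b + a) • (q.elt * p.elt) • u := by
    rw [B.smul_comm, ← mul_smul, ← mul_smul, AddCircle.toCircle_add]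
  rw [e] at h3
  exact h3

lemma exists_transport_path {x y : M} {γ : Path x y} (hγ : PiecewiseSmooth I γ) {p : B.Total} (hp : B.proj p = x) :
    ∃ q, B.Transport γ.extend 0 1 p q := by
  obtain ⟨s, hs⟩ := exists_section B
  obtain ⟨n, t, ht⟩ := hγ.exists_subdivision
  have h := transport_path hs ht
  obtain ⟨z, rfl⟩ := B.exists_smul_eq ((hs x).trans hp.symm)
  exact ⟨_, h.circle z⟩

lemma IsLogHolonomy.conj {p : EquivCurve G I M} {a : AddCircle (1 : ℝ)} (hp : B.IsLogHolonomy p a)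
    {y : M} (ζ : Path p.base y) (hζ : PiecewiseSmooth I ζ) : B.IsLogHolonomy (p.conj IG ζ hζ) a := by
  obtain ⟨u, hu⟩ := B.proj_surjective p.base
  obtain ⟨v, hv⟩ := exists_transport_path hζ hu
  refine IsLogHolonomy.of_transport (p := v) ?_
  have h1 := (hv.path_symm.path_trans (hp.transport hu))
  have h2 := (hv.group p.elt).circle (AddCircle.toCircle a)
  have h3 : B.Transport (ζ.map (ContMDiffSMul.contMDiff_const_smul (I := IG) (I' := I) (n := ∞) p.elt).continuous).extend 0 1
      (AddCircle.toCircle a • p.elt • u) (AddCircle.toCircle a • p.elt • v) := h2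
  exact h1.path_trans h3

lemma isLogHolonomy_orbit {X : GroupLieAlgebra IG G} {c : ℝ → G} (h : IsOneParameterSubgroup IG c X) {x : M}
    {p : B.Total} (hp : B.proj p = x) :
    B.IsLogHolonomy (h.orbitCurve (I := I) x) ((B.momentVal X p : ℝ) : AddCircle (1 : ℝ)) := by
  set μ := B.momentVal X p
  refine IsLogHolonomy.of_transport (p := p) ?_
  have hc0 : c 0 = 1 := h.map_zero
  have hcp : ContMDiff 𝓘(ℝ, ℝ) (I.prod (𝓡 1)) ∞ (fun t => c t • p) := h.smooth.smul contMDiff_const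
  have hϑ : ContDiff ℝ ∞ (fun t : ℝ => 2 * Real.pi * (t * μ)) := by fun_prop
  have hΓ : ContMDiff 𝓘(ℝ, ℝ) (I.prod (𝓡 1)) ∞ (fun t => Circle.exp (2 * Real.pi * (t * μ)) • c t • p) :=
    contMDiff_exp_smul.comp (hϑ.contMDiff.prodMk hcp)
  refine ⟨fun t => Circle.exp (2 * Real.pi * (t * μ)) • c t • p, ⟨fun t ht => ?_, hΓ.continuous.continuousOn,
    ∅, fun _ _ _ _ _ _ => hΓ.contMDiffOn, fun t ht _ => ?_⟩, ?_, ?_⟩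
  · rw [B.proj_circle, B.proj_smul, hp, Path.extend_apply _ ht]
    rfl
  · have hd : HasDerivAt (fun t : ℝ => 2 * Real.pi * (t * μ)) (2 * Real.pi * (1 * μ)) t :=
      ((hasDerivAt_id t).mul_const μ).const_mul _
    rw [pull_gauge (σ := fun t => c t • p) (ϑ := fun t => 2 * Real.pi * (t * μ))
      (hcp.contMDiffAt.mdifferentiableAt (by simp)).mdifferentiableWithinAt
      hd.differentiableAt.differentiableWithinAt uniqueDiffWithinAt_univ, fderivWithin_univ,
      show fderiv ℝ (fun t : ℝ => 2 * Real.pi * (t * μ)) t 1 = 2 * Real.pi * (1 * μ) from hd.deriv]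
    -- translate to the identity
    have e0 : (fun r : ℝ => c r • p) = (fun r : ℝ => c t • (fun r : ℝ => c r • p) (r - t)) := by
      ext r
      simp only
      rw [← mul_smul, ← h.map_add]
      congr 2
      ring
    have hs : DifferentiableAt ℝ (fun r : ℝ => r - t) t := by fun_prop
    have hcd : MDifferentiableAt 𝓘(ℝ, ℝ) (I.prod (𝓡 1)) (fun r : ℝ => c r • p) (t - t) :=
      hcp.contMDiffAt.mdifferentiableAt (by simp)
    have h1 : localForm (fun r : ℝ => c r • p) t ![(1 : ℝ)] = μ := by
      have e1 := localForm_group (c t) (MDifferentiableAt.comp (f := fun r : ℝ => r - t) t hcd hs.mdifferentiableAt) (1 : ℝ)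
      have e2 := localForm_comp (g := fun r : ℝ => r - t) hcd hs (1 : ℝ)
      have h2 : fderiv ℝ (fun r : ℝ => r - t) t 1 = 1 := by simp
      rw [h2, sub_self] at e2
      rw [e0]
      refine e1.trans (e2.trans ?_)
      refine localForm_orbit p (h.smooth.contMDiffAt.mdifferentiableAt (by simp)) hc0 ?_
      rw [mD_univ]
      exact h.velocity
    simp only [localForm, ContinuousAlternatingMap.smul_apply, smul_eq_mul] at h1
    rw [← h1]
    field_simp
    ring
  · change Circle.exp (2 * Real.pi * (0 * μ)) • c 0 • p = p
    rw [hc0]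
    simp
  · change Circle.exp (2 * Real.pi * (1 * μ)) • c 1 • p = _
    rw [← circleExp_eq_toCircle, one_mul]
    rfl

/-- The log-holonomy of a bundle. -/
def logHol (B : EquivariantBundle IG G I M) (k : EquivCurve G I M) : AddCircle (1 : ℝ) :=
  holonomyOf (phase (exists_section B).choose) (twist _ (exists_section B).choose_spec) k

lemma isLogHolonomy_logHol (B : EquivariantBundle IG G I M) (k : EquivCurve G I M) :
    B.IsLogHolonomy k (B.logHol k) := isLogHolonomy_holonomyOf _ k

lemma isCharacter_logHol (B : EquivariantBundle IG G I M) :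
    IsCharacterWithCurvature IG B.logHol (equivCurv (exists_section B).choose_spec) where
  closed := equivCurv_isClosed _
  map_comp p q h := (isLogHolonomy_logHol B _).unique
    ((isLogHolonomy_logHol B p).comp (isLogHolonomy_logHol B q) h)
  map_conj p y ζ hζ := (isLogHolonomy_logHol B _).unique ((isLogHolonomy_logHol B p).conj ζ hζ)
  map_boundary p hp n t ht σ hσ := by
    set hs := (exists_section B).choose_spec
    have h1 : B.logHol p = _ := holonomyOf_eq_pieceSum hs p ht
    have h2 := chain_stokes (hasPotentials_phase hs)
      (fun γ a d b had hdb hγ => phase_split hs had hdb hγ) σ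
    rw [← hσ, chainExtend_curveChain] at h2
    have h3 : twist _ hs p.elt p.base = 0 := by
      have := twist_mul hs (1 : G) 1 p.base
      rw [mul_one, one_smul] at this
      rw [hp]
      simpa using this
    rw [h1, h2, h3, add_zero]
    rfl
  map_orbit X c h x := (isLogHolonomy_logHol B _).unique
    (isLogHolonomy_orbit h ((exists_section B).choose_spec x))

/-- Isomorphic bundles have the same holonomy. -/
lemma Iso.logHol_eq {B B' : EquivariantBundle IG G I M} (Φ : B.Iso B') : B.logHol = B'.logHol := by
  funext k
  obtain ⟨u, hu⟩ := B.proj_surjective k.base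
  obtain ⟨Γ, h1, rfl, h2⟩ := (isLogHolonomy_logHol B k).transport hu
  have hΦ : ContMDiff (I.prod (𝓡 1)) (I.prod (𝓡 1)) ∞ Φ.toDiffeo := Φ.toDiffeo.contMDiff
  have h3 : B'.IsHorizontalOn k.path.extend 0 1 (fun t => Φ.toDiffeo (Γ t)) := by
    obtain ⟨s, k1, k2⟩ := h1.horizontal
    refine ⟨fun t ht => by rw [Φ.map_proj, h1.lift t ht], hΦ.continuous.comp_continuousOn h1.continuousOn, s,
      fun a' b' ha hab hb hc => hΦ.comp_contMDiffOn (k1 a' b' ha hab hb hc), fun t ht hts => ?_⟩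
    rw [← k2 t ht hts, pull_apply_one, pull_apply_one]
    have m1 := (IsHorizontalOn.contMDiffAt k1 ht hts).mdifferentiableAt (by simp)
    have m2 := mD_comp ((hΦ.contMDiffAt (x := Γ t)).mdifferentiableAt (by simp)).mdifferentiableWithinAt
      m1.mdifferentiableWithinAt (mapsTo_univ _ univ) (uniqueMDiffWithinAt_univ _)
    have m3 := DFunLike.congr_fun m2 (1 : ℝ)
    rw [ContinuousLinearMap.comp_apply] at m3
    have m4 := DFunLike.congr_fun (Φ.map_form (Γ t)) ![mD 𝓘(ℝ, ℝ) (I.prod (𝓡 1)) Γ univ t 1]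
    refine Eq.trans ?_ m4
    refine congrArg (B'.form.val (Φ.toDiffeo (Γ t))) ?_
    ext1 i
    fin_cases i
    refine m3.trans ?_
    rw [mD_univ Φ.toDiffeo]
    rfl
  have h4 : B'.Transport k.path.extend 0 1 (Φ.toDiffeo (Γ 0)) (Φ.toDiffeo (Γ 1)) := ⟨_, h3, rfl, rfl⟩
  rw [h2, Φ.map_circle, Φ.map_group] at h4
  exact (IsLogHolonomy.of_transport h4).unique (isLogHolonomy_logHol B' k)

end EquivariantBundle
end Bundle

section Paths

variable {E : Type*} [NormedAddCommGroup E] [NormedSpace ℝ E]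
  {H : Type*} [TopologicalSpace H] {I : ModelWithCorners ℝ E H}
  {M : Type*} [TopologicalSpace M] [ChartedSpace H M]

lemma contMDiffOn_arc {γ : ℝ → M} {a b : ℝ} (hab : a ≤ b) (hγ : ContMDiffOn 𝓘(ℝ, ℝ) I ∞ γ (Icc a b)) :
    ContMDiffOn 𝓘(ℝ, ℝ) I ∞ (fun t : ℝ => γ (a + t * (b - a))) (Icc 0 1) := by
  have h : ContDiff ℝ ∞ (fun t : ℝ => a + t * (b - a)) := by fun_prop
  exact hγ.comp h.contMDiff.contMDiffOn fun t ht => ⟨by nlinarith [ht.1], by nlinarith [ht.2]⟩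

/-- A smooth arc as a path. -/
def arcPath (γ : ℝ → M) {a b : ℝ} (hab : a ≤ b) (hγ : ContMDiffOn 𝓘(ℝ, ℝ) I ∞ γ (Icc a b)) :
    Path (γ a) (γ b) where
  toFun := arc γ a b
  continuous_toFun := continuousOn_iff_continuous_restrict.1 (contMDiffOn_arc hab hγ).continuousOn
  source' := arc_zero γ a b
  target' := arc_one γ a b

lemma arcPath_extend {γ : ℝ → M} {a b : ℝ} (hab : a ≤ b) (hγ : ContMDiffOn 𝓘(ℝ, ℝ) I ∞ γ (Icc a b)) :
    EqOn (arcPath γ hab hγ).extend (fun t : ℝ => γ (a + t * (b - a))) (Icc 0 1) := fun _ ht =>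
  Path.extend_apply _ ht

lemma arcPath_smooth {γ : ℝ → M} {a b : ℝ} (hab : a ≤ b) (hγ : ContMDiffOn 𝓘(ℝ, ℝ) I ∞ γ (Icc a b)) :
    ContMDiffOn 𝓘(ℝ, ℝ) I ∞ (arcPath γ hab hγ).extend (Icc 0 1) :=
  (contMDiffOn_arc hab hγ).congr (arcPath_extend hab hγ)

lemma arcPath_piecewiseSmooth {γ : ℝ → M} {a b : ℝ} (hab : a ≤ b) (hγ : ContMDiffOn 𝓘(ℝ, ℝ) I ∞ γ (Icc a b)) :
    PiecewiseSmooth I (arcPath γ hab hγ) :=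
  ⟨∅, fun _ _ ha _ hb _ => (arcPath_smooth hab hγ).mono (Icc_subset_Icc ha hb)⟩

variable (I M) in
/-- Piecewise smooth paths from a base point to all points. -/
structure BasePaths where
  /-- the base point -/
  base : M
  /-- the paths -/
  path : ∀ x, Path base x
  smooth : ∀ x, PiecewiseSmooth I (path x)

variable {G : Type*} [Group G] [MulAction G M] (b : BasePaths I M)

variable (G) in
/-- The loop at the base point determined by a path. -/
def BasePaths.loop {x y : M} {γ : Path x y} (hγ : PiecewiseSmooth I γ) : EquivCurve G I M where
  elt := 1
  base := b.base
  path := ((b.path x).trans (γ.trans (b.path y).symm)).cast rfl (one_smul G b.base)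
  smooth := ((b.smooth x).trans (hγ.trans (b.smooth y).symm)).cast _ _

/-- The closed equivariant curve determined by a group element and a point. -/
def BasePaths.twistCurve (φ : G) (x : M) : EquivCurve G I M where
  elt := φ
  base := x
  path := (b.path x).symm.trans (b.path (φ • x))
  smooth := (b.smooth x).symm.trans (b.smooth (φ • x))

/-- The functional on arcs determined by a function on closed equivariant curves. -/
def charArc (χ : EquivCurve G I M → AddCircle (1 : ℝ)) (c : unitInterval → M) : AddCircle (1 : ℝ) := by
  classical
  exact if h : ∃ γ : Path (c 0) (c 1), PiecewiseSmooth I γ ∧ ∀ t, γ t = c t then χ (b.loop G h.choose_spec.1) else 0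

/-- The twist determined by a function on closed equivariant curves. -/
def charTwist (χ : EquivCurve G I M → AddCircle (1 : ℝ)) (φ : G) (x : M) : AddCircle (1 : ℝ) :=
  χ (b.twistCurve φ x)

variable (G) in
lemma BasePaths.loop_congr {x y x' y' : M} {γ : Path x y} {γ' : Path x' y'} (hγ : PiecewiseSmooth I γ)
    (hγ' : PiecewiseSmooth I γ') (h : ∀ t, γ t = γ' t) : b.loop G hγ = b.loop G hγ' := by
  have hx : x = x' := by simpa using h 0
  have hy : y = y' := by simpa using h 1
  subst hx hy
  obtain rfl : γ = γ' := Path.ext (funext h)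
  rfl

lemma charArc_eq (χ : EquivCurve G I M → AddCircle (1 : ℝ)) {x y : M} {γ : Path x y}
    (hγ : PiecewiseSmooth I γ) : charArc b χ γ = χ (b.loop G hγ) := by
  have hex : ∃ γ' : Path (γ 0) (γ 1), PiecewiseSmooth I γ' ∧ ∀ t, γ' t = γ t :=
    ⟨γ.cast γ.source γ.target, hγ, fun _ => rfl⟩
  rw [charArc, dif_pos hex]
  exact congrArg χ (b.loop_congr G _ _ hex.choose_spec.2)

end Paths

section Connected

variable {E : Type*} [NormedAddCommGroup E] [NormedSpace ℝ E]
  {H : Type*} [TopologicalSpace H] {I : ModelWithCorners ℝ E H} [I.Boundaryless]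
  {M : Type*} [TopologicalSpace M] [ChartedSpace H M] [IsManifold I ∞ M]

variable (I) in
lemma exists_piecewiseSmooth_path [PreconnectedSpace M] (x y : M) : ∃ γ : Path x y, PiecewiseSmooth I γ := by
  have : Std.Symm (fun x y : M => ∃ γ : Path x y, PiecewiseSmooth I γ) :=
    ⟨fun x y ⟨γ, h⟩ => ⟨γ.symm, h.symm⟩⟩
  refine PreconnectedSpace.induction₂ (fun x y : M => ∃ γ : Path x y, PiecewiseSmooth I γ) (fun x => ?_)
    ⟨fun x y z ⟨γ, h⟩ ⟨γ', h'⟩ => ⟨γ.trans γ', h.trans h'⟩⟩ x y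
  obtain ⟨r, hr, hrW⟩ := Metric.isOpen_iff.1 (isOpen_extChartAt_target (I := I) x) _ (mem_extChartAt_target x)
  have h1 : ∀ᶠ y in 𝓝 x, extChartAt I x y ∈ Metric.ball (extChartAt I x x) r :=
    (continuousAt_extChartAt (I := I) x).eventually (Metric.ball_mem_nhds _ hr)
  filter_upwards [h1, extChartAt_source_mem_nhds (I := I) x] with y hy hys
  set l : ℝ → E := fun t => extChartAt I x x + t • (extChartAt I x y - extChartAt I x x)
  have hl : ContDiff ℝ ∞ l := by fun_prop
  have hm : MapsTo l (Icc 0 1) (extChartAt I x).target := fun t ht =>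
    hrW ((convex_ball _ r).add_smul_sub_mem (Metric.mem_ball_self hr) hy ht)
  have hγ : ContMDiffOn 𝓘(ℝ, ℝ) I ∞ ((extChartAt I x).symm ∘ l) (Icc 0 1) :=
    (contMDiffOn_extChartAt_symm (I := I) x).comp hl.contMDiff.contMDiffOn hm
  have e0 : x = ((extChartAt I x).symm ∘ l) 0 := by simp [l]
  have e1 : y = ((extChartAt I x).symm ∘ l) 1 := by
    have hl1 : l 1 = extChartAt I x y := by simp [l]
    rw [Function.comp_apply, hl1, (extChartAt I x).left_inv hys]
  exact ⟨(arcPath _ zero_le_one hγ).cast e0 e1, (arcPath_piecewiseSmooth zero_le_one hγ).cast _ _⟩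

variable (I M) in
lemma nonempty_basePaths [ConnectedSpace M] : Nonempty (BasePaths I M) := by
  obtain ⟨x⟩ := (inferInstance : Nonempty M)
  choose p hp using fun y => exists_piecewiseSmooth_path I x y
  exact ⟨⟨x, p, hp⟩⟩

end Connected

section Bundle

variable {EG : Type*} [NormedAddCommGroup EG] [NormedSpace ℝ EG] [FiniteDimensional ℝ EG]
  {HG : Type*} [TopologicalSpace HG] {IG : ModelWithCorners ℝ EG HG} [IG.Boundaryless]
  {G : Type*} [TopologicalSpace G] [ChartedSpace HG G] [Group G] [LieGroup IG ∞ G]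
  {E : Type*} [NormedAddCommGroup E] [NormedSpace ℝ E] [FiniteDimensional ℝ E]
  {H : Type*} [TopologicalSpace H] {I : ModelWithCorners ℝ E H} [I.Boundaryless]
  {M : Type*} [TopologicalSpace M] [ChartedSpace H M] [IsManifold I ∞ M] [MulAction G M]
  [ContMDiffSMul IG I ∞ G M]
  {V : Type*} [NormedAddCommGroup V] [NormedSpace ℝ V] [FiniteDimensional ℝ V]
  {B B' : EquivariantBundle IG G I M}

lemma contMDiffAt_of_comp_symm {E' : Type*} [NormedAddCommGroup E'] [NormedSpace ℝ E']
    {H' : Type*} [TopologicalSpace H'] {I' : ModelWithCorners ℝ E' H'}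
    {N : Type*} [TopologicalSpace N] [ChartedSpace H' N] {f : M → N} {x : M} {O : Set E} (hO : IsOpen O)
    (hx : extChartAt I x x ∈ O)
    (h : ContMDiffOn 𝓘(ℝ, E) I' ∞ (f ∘ (extChartAt I x).symm) O) : ContMDiffAt I I' ∞ f x := by
  have h1 : ContMDiffAt I I' ∞ ((f ∘ (extChartAt I x).symm) ∘ extChartAt I x) x :=
    (h.contMDiffAt (hO.mem_nhds hx)).comp x (contMDiffAt_extChartAt (I := I) (n := ∞))
  refine h1.congr_of_eventuallyEq ?_
  filter_upwards [extChartAt_source_mem_nhds (I := I) x] with z hz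
  simp only [Function.comp]
  rw [(extChartAt I x).left_inv hz]

namespace EquivariantBundle

/-- The parallel section along the base paths. -/
lemma exists_parallel_section (B : EquivariantBundle IG G I M) (b : BasePaths I M) :
    ∃ (p₀ : B.Total) (s : M → B.Total), ∀ x, B.Transport (b.path x).extend 0 1 p₀ (s x) := by
  obtain ⟨p₀, hp₀⟩ := B.proj_surjective b.base
  choose s hs using fun x => exists_transport_path (b.smooth x) hp₀
  exact ⟨p₀, s, hs⟩

variable {b : BasePaths I M} {p₀ : B.Total} {s : M → B.Total}

lemma proj_parallel (h : ∀ x, B.Transport (b.path x).extend 0 1 p₀ (s x)) (x : M) : B.proj (s x) = x := by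
  simpa using (h x).proj_right zero_le_one

lemma transport_charArc (h : ∀ x, B.Transport (b.path x).extend 0 1 p₀ (s x)) {x y : M} {γ : Path x y}
    (hγ : PiecewiseSmooth I γ) :
    B.Transport γ.extend 0 1 (s x) (AddCircle.toCircle (charArc b B.logHol γ) • s y) := by
  obtain ⟨q, hq⟩ := exists_transport_path hγ (proj_parallel h x)
  have hpy : B.proj q = y := by simpa using hq.proj_right zero_le_one
  obtain ⟨z, rfl⟩ := B.exists_smul_eq ((proj_parallel h y).trans hpy.symm)
  have h1 := (h x).path_trans (hq.path_trans ((h y).path_symm.circle z))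
  have h2 : B.Transport (b.loop G hγ).path.extend 0 1 p₀ (z • p₀) := h1
  have h3 := h2.eq_of_isLogHolonomy (isLogHolonomy_logHol B _)
  have h4 : (b.loop G hγ).elt • p₀ = p₀ := one_smul G p₀
  rw [h4] at h3
  rw [charArc_eq b _ hγ, ← B.circle_free h3]
  exact hq

lemma phase_eq_charArc (h : ∀ x, B.Transport (b.path x).extend 0 1 p₀ (s x)) {γ : ℝ → M} {a d : ℝ} (had : a < d)
    (hγ : ContMDiffOn 𝓘(ℝ, ℝ) I ∞ γ (Icc a d)) : phase s (arc γ a d) = charArc b B.logHol (arc γ a d) := by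
  refine phase_eq had (transport_of_affine had ?_)
  exact (transport_charArc h (arcPath_piecewiseSmooth had.le hγ)).congr fun t ht => (arcPath_extend had.le hγ ht).symm

lemma twist_eq_charTwist (h : ∀ x, B.Transport (b.path x).extend 0 1 p₀ (s x)) (φ : G) (x : M) :
    twist s (proj_parallel h) φ x = charTwist b B.logHol φ x := by
  have h1 : B.Transport (b.twistCurve φ x).path.extend 0 1 (s x) (s (φ • x)) := (h x).path_symm.path_trans (h (φ • x))
  have h2 := h1.eq_of_isLogHolonomy (isLogHolonomy_logHol B _)
  have h3 : (b.twistCurve φ x).elt • s x = φ • s x := rfl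
  rw [h3, smul_section (proj_parallel h), ← mul_smul, ← AddCircle.toCircle_add] at h2
  have h4 := B.circle_free (p := s (φ • x)) (z := 1) ((one_smul _ _).trans h2)
  rw [← AddCircle.toCircle_zero (T := 1)] at h4
  have h5 := toCircle_injective h4
  rw [charTwist, ← sub_eq_zero, ← neg_eq_zero, h5]
  abel

end EquivariantBundle
end Bundle

section Bundle

variable {EG : Type*} [NormedAddCommGroup EG] [NormedSpace ℝ EG] [FiniteDimensional ℝ EG]
  {HG : Type*} [TopologicalSpace HG] {IG : ModelWithCorners ℝ EG HG} [IG.Boundaryless]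
  {G : Type*} [TopologicalSpace G] [ChartedSpace HG G] [Group G] [LieGroup IG ∞ G]
  {E : Type*} [NormedAddCommGroup E] [NormedSpace ℝ E] [FiniteDimensional ℝ E]
  {H : Type*} [TopologicalSpace H] {I : ModelWithCorners ℝ E H} [I.Boundaryless]
  {M : Type*} [TopologicalSpace M] [ChartedSpace H M] [IsManifold I ∞ M] [MulAction G M]
  [ContMDiffSMul IG I ∞ G M]
  {V : Type*} [NormedAddCommGroup V] [NormedSpace ℝ V] [FiniteDimensional ℝ V]
  {B B' : EquivariantBundle IG G I M}

lemma IsPotential.congr_functional {P P' : (unitInterval → M) → AddCircle (1 : ℝ)} {f : V → M} {W : Set V}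
    {h : V → AddCircle (1 : ℝ)} {A : V → V [⋀^Fin 1]→L[ℝ] ℝ} (hp : IsPotential I P f W h A)
    (hPP : ∀ (γ : ℝ → M) (a b : ℝ), a < b → ContMDiffOn 𝓘(ℝ, ℝ) I ∞ γ (Icc a b) → P' (arc γ a b) = P (arc γ a b)) :
    IsPotential I P' f W h A where
  isOpen := hp.isOpen
  smooth_map := hp.smooth_map
  smooth := hp.smooth
  eq c a b hab hc hcW := by
    rw [hPP _ _ _ hab (hp.smooth_map.comp hc.contMDiffOn hcW), hp.eq c a b hab hc hcW]

namespace EquivariantBundle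

/-- The map of total spaces that takes one section to another. -/
def sectionMap {s : M → B.Total} (hs : ∀ x, B.proj (s x) = x) (s' : M → B'.Total) (p : B.Total) : B'.Total :=
  (B.exists_smul_eq (hs (B.proj p))).choose • s' (B.proj p)

section

variable {s : M → B.Total} (hs : ∀ x, B.proj (s x) = x) {s' : M → B'.Total} (hs' : ∀ x, B'.proj (s' x) = x)

lemma sectionMap_smul (z : Circle) (x : M) : sectionMap hs s' (z • s x) = z • s' x := by
  have hp : B.proj (z • s x) = x := by rw [B.proj_circle, hs]
  have h := (B.exists_smul_eq (hs (B.proj (z • s x)))).choose_spec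
  rw [sectionMap]
  generalize (B.exists_smul_eq (hs (B.proj (z • s x)))).choose = w at h ⊢
  rw [hp] at h ⊢
  rw [B.circle_free h]

include hs in
lemma exists_eq_smul_section (p : B.Total) : ∃ z : Circle, p = z • s (B.proj p) :=
  B.exists_smul_eq (hs (B.proj p))

include hs' in
lemma proj_sectionMap (p : B.Total) : B'.proj (sectionMap hs s' p) = B.proj p := by
  rw [sectionMap, B'.proj_circle, hs']

lemma sectionMap_circle (z : Circle) (p : B.Total) : sectionMap hs s' (z • p) = z • sectionMap hs s' p := by
  obtain ⟨w, hw⟩ := exists_eq_smul_section hs p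
  rw [hw, ← mul_smul, sectionMap_smul, sectionMap_smul, mul_smul]

lemma sectionMap_group (hK : ∀ (φ : G) x, twist s hs φ x = twist s' hs' φ x) (φ : G) (p : B.Total) :
    sectionMap hs s' (φ • p) = φ • sectionMap hs s' p := by
  obtain ⟨w, hw⟩ := exists_eq_smul_section hs p
  rw [hw, sectionMap_smul, B.smul_comm, smul_section hs, sectionMap_circle, sectionMap_smul, hK, B'.smul_comm,
    smul_section hs']

lemma sectionMap_sectionMap (p : B.Total) : sectionMap hs' s (sectionMap hs s' p) = p := by
  obtain ⟨w, hw⟩ := exists_eq_smul_section hs p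
  rw [hw, sectionMap_smul, sectionMap_smul]

include hs' in
lemma sectionMap_local (hP : ∀ (γ : ℝ → M) (a b : ℝ), a < b → ContMDiffOn 𝓘(ℝ, ℝ) I ∞ γ (Icc a b) →
      phase s' (arc γ a b) = phase s (arc γ a b)) {σ : V → B.Total} {W : Set V} (hW : IsOpen W)
    (hσ : ContMDiffOn 𝓘(ℝ, V) (I.prod (𝓡 1)) ∞ σ W) {y₀ : V} (hy₀ : y₀ ∈ W) :
    ∃ O, IsOpen O ∧ y₀ ∈ O ∧ ContMDiffOn 𝓘(ℝ, V) (I.prod (𝓡 1)) ∞ (sectionMap hs s' ∘ σ) O ∧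
      ∀ y ∈ O, ∀ v, B'.form.pull (sectionMap hs s' ∘ σ) univ y ![v] = B.form.pull σ univ y ![v] := by
  obtain ⟨O, hOW, hO, hyO, σ', hσ', hp'⟩ := B'.exists_local_section hW (B.contMDiff_proj.comp_contMDiffOn hσ) hy₀
  obtain ⟨h, hh⟩ := exists_phase hs σ
  obtain ⟨h', hh'⟩ := exists_phase hs' σ'
  have p1 := (isPotential_phase hs hW hσ fun y _ => hh y).mono hO hOW
  have p2 := ((isPotential_phase hs' hO hσ' fun y _ => hh' y).congr (f' := fun y => B.proj (σ y))
    fun y hy => (hp' y hy).symm).congr_functional fun γ a b hab hγ => (hP γ a b hab hγ).symm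
  obtain ⟨r, hr, hrO⟩ := Metric.isOpen_iff.1 hO y₀ hyO
  obtain ⟨g, -, hg, hgy⟩ := p1.exists_gauge p2 hrO
  set z₀ := AddCircle.toCircle (h y₀ - h' y₀)
  have hϑ : ContDiffOn ℝ ∞ (fun y => 2 * Real.pi * g y) (Metric.ball y₀ r) := contDiffOn_const.mul hg
  have key : ∀ y ∈ Metric.ball y₀ r, (sectionMap hs s' ∘ σ) y = z₀ • Circle.exp (2 * Real.pi * g y) • σ' y := by
    intro y hy
    have e1 : B.proj (σ y) = B'.proj (σ' y) := (hp' y (hrO hy)).symm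
    change sectionMap hs s' (σ y) = _
    rw [hh y, sectionMap_smul, e1]
    conv_rhs => rw [hh' y]
    rw [circleExp_eq_toCircle, ← mul_smul, ← mul_smul, ← AddCircle.toCircle_add, ← AddCircle.toCircle_add]
    congr 2
    rw [← (hgy y hy).1]
    abel
  have hΦ : ContMDiffOn 𝓘(ℝ, V) (I.prod (𝓡 1)) ∞ (fun y => Circle.exp (2 * Real.pi * g y) • σ' y)
      (Metric.ball y₀ r) :=
    contMDiff_exp_smul.comp_contMDiffOn (hϑ.contMDiffOn.prodMk (hσ'.mono hrO))
  refine ⟨Metric.ball y₀ r, Metric.isOpen_ball, Metric.mem_ball_self hr, ?_, fun y hy v => ?_⟩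
  · exact ((ContMDiffSMul.contMDiff_const_smul (I := 𝓡 1) (I' := I.prod (𝓡 1)) (n := ∞) z₀).comp_contMDiffOn
      hΦ).congr key
  · have hn : Metric.ball y₀ r ∈ 𝓝 y := Metric.isOpen_ball.mem_nhds hy
    have e : sectionMap hs s' ∘ σ =ᶠ[𝓝 y] fun y => z₀ • Circle.exp (2 * Real.pi * g y) • σ' y := by
      filter_upwards [hn] with z hz using key z hz
    have hgd : DifferentiableAt ℝ g y := (hg.differentiableOn (by simp)).differentiableAt hn
    rw [B'.form.pull_congr_of_eventuallyEq (e.filter_mono nhdsWithin_le_nhds) e.self_of_nhds,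
      pull_circle z₀ ((hΦ.contMDiffAt hn).mdifferentiableAt (by simp)).mdifferentiableWithinAt uniqueDiffWithinAt_univ,
      pull_gauge ((hσ'.contMDiffAt (hO.mem_nhds (hrO hy))).mdifferentiableAt (by simp)).mdifferentiableWithinAt
        (hgd.const_mul _).differentiableWithinAt uniqueDiffWithinAt_univ, fderivWithin_univ,
      fderiv_const_mul hgd]
    have h1 := (hgy y hy).2 v
    simp only [localForm, ContinuousAlternatingMap.smul_apply, smul_eq_mul] at h1
    rw [ContinuousLinearMap.smul_apply, h1, smul_eq_mul]
    field_simp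
    ring

include hs' in
lemma contMDiff_sectionMap (hP : ∀ (γ : ℝ → M) (a b : ℝ), a < b → ContMDiffOn 𝓘(ℝ, ℝ) I ∞ γ (Icc a b) →
      phase s' (arc γ a b) = phase s (arc γ a b)) :
    ContMDiff (I.prod (𝓡 1)) (I.prod (𝓡 1)) ∞ (sectionMap hs s') := by
  intro p
  obtain ⟨O, hO, hpO, h1, -⟩ := sectionMap_local hs hs' hP (isOpen_extChartAt_target (I := I.prod (𝓡 1)) p)
    (contMDiffOn_extChartAt_symm (I := I.prod (𝓡 1)) p) (mem_extChartAt_target p)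
  exact contMDiffAt_of_comp_symm hO hpO h1

include hs' in
lemma pullback_sectionMap (hP : ∀ (γ : ℝ → M) (a b : ℝ), a < b → ContMDiffOn 𝓘(ℝ, ℝ) I ∞ γ (Icc a b) →
      phase s' (arc γ a b) = phase s (arc γ a b)) (p : B.Total) :
    B'.form.pullbackAt (I' := I.prod (𝓡 1)) (sectionMap hs s') p = B.form.toFun p := by
  obtain ⟨O, hO, hpO, h1, h2⟩ := sectionMap_local hs hs' hP (isOpen_extChartAt_target (I := I.prod (𝓡 1)) p)
    (contMDiffOn_extChartAt_symm (I := I.prod (𝓡 1)) p) (mem_extChartAt_target p)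
  refine eq_of_comp_mD_symm (I := I.prod (𝓡 1)) p ?_
  have h3 : B'.form.pull (sectionMap hs s' ∘ (extChartAt (I.prod (𝓡 1)) p).symm) univ (extChartAt (I.prod (𝓡 1)) p p) =
      B.form.pull (extChartAt (I.prod (𝓡 1)) p).symm univ (extChartAt (I.prod (𝓡 1)) p p) := by
    ext v
    rw [vec_one_eta v]
    exact h2 _ hpO _
  have hd : MDifferentiableAt 𝓘(ℝ, E × EuclideanSpace ℝ (Fin 1)) (I.prod (𝓡 1)) (extChartAt (I.prod (𝓡 1)) p).symm
      (extChartAt (I.prod (𝓡 1)) p p) :=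
    ((contMDiffOn_extChartAt_symm (n := ∞) (I := I.prod (𝓡 1)) p).contMDiffAt
        ((isOpen_extChartAt_target p).mem_nhds (mem_extChartAt_target p))).mdifferentiableAt (by simp)
  have hm := (contMDiff_sectionMap hs hs' hP).contMDiffAt
    (x := (extChartAt (I.prod (𝓡 1)) p).symm (extChartAt (I.prod (𝓡 1)) p p)) |>.mdifferentiableAt (by simp)
  rw [DifferentialForm.pull, DifferentialForm.pull, mD_comp hm.mdifferentiableWithinAt hd.mdifferentiableWithinAt
    (mapsTo_univ _ _) (uniqueMDiffWithinAt_univ _)] at h3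
  have hp : (extChartAt (I.prod (𝓡 1)) p).symm (extChartAt (I.prod (𝓡 1)) p p) = p := extChartAt_to_inv p
  simp only [Function.comp, hp] at h3
  refine Eq.trans ?_ h3
  rw [mD_univ (sectionMap hs s')]
  rfl

/-- Bundles whose transports and twists agree are isomorphic. -/
def isoOfSections (hP : ∀ (γ : ℝ → M) (a b : ℝ), a < b → ContMDiffOn 𝓘(ℝ, ℝ) I ∞ γ (Icc a b) →
      phase s' (arc γ a b) = phase s (arc γ a b)) (hK : ∀ (φ : G) x, twist s hs φ x = twist s' hs' φ x) :
    B.Iso B' where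
  toDiffeo :=
    { toFun := sectionMap hs s'
      invFun := sectionMap hs' s
      left_inv := sectionMap_sectionMap hs hs'
      right_inv := sectionMap_sectionMap hs' hs
      contMDiff_toFun := contMDiff_sectionMap hs hs' hP
      contMDiff_invFun := contMDiff_sectionMap hs' hs fun γ a b hab hγ => (hP γ a b hab hγ).symm }
  map_proj := proj_sectionMap hs hs'
  map_circle := sectionMap_circle hs
  map_group := sectionMap_group hs hs' hK
  map_form := pullback_sectionMap hs hs' hP

end

/-- Bundles with the same holonomy are isomorphic. -/
lemma nonempty_iso_of_logHol_eq [ConnectedSpace M] (h : B.logHol = B'.logHol) : Nonempty (B.Iso B') := by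
  obtain ⟨b⟩ := nonempty_basePaths I M
  obtain ⟨p₀, s, hs⟩ := B.exists_parallel_section b
  obtain ⟨p₀', s', hs'⟩ := B'.exists_parallel_section b
  refine ⟨isoOfSections (proj_parallel hs) (proj_parallel hs') (fun γ a c hac hγ => ?_) fun φ x => ?_⟩
  · rw [phase_eq_charArc hs hac hγ, phase_eq_charArc hs' hac hγ, h]
  · rw [twist_eq_charTwist hs, twist_eq_charTwist hs', h]

end EquivariantBundle
end Bundle

section Chains

variable {E : Type*} [NormedAddCommGroup E] [NormedSpace ℝ E] [FiniteDimensional ℝ E]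
  {H : Type*} [TopologicalSpace H] {I : ModelWithCorners ℝ E H} [I.Boundaryless]
  {M : Type*} [TopologicalSpace M] [ChartedSpace H M] [IsManifold I ∞ M]
  (η : DifferentialForm I M 2)

/-- The boundary of a chain together with the integral of a form over it. -/
def boundaryIntegral : (Simplex2 I M →₀ ℤ) →+ ((unitInterval → M) →₀ ℤ) × ℝ :=
  Finsupp.liftAddHom fun σ => zmultiplesHom (((unitInterval → M) →₀ ℤ) × ℝ) (σ.boundary, σ.integral η)

lemma boundaryIntegral_apply (σ : Simplex2 I M →₀ ℤ) :
    boundaryIntegral η σ = (chainBoundary σ, chainIntegral σ η) := by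
  refine Prod.ext ?_ ?_
  · simp [boundaryIntegral, chainBoundary, Finsupp.sum, Prod.fst_sum]
  · simp [boundaryIntegral, chainIntegral, Finsupp.sum, Prod.snd_sum]

/-- The `1`-chain `κ` bounds a `2`-chain over which the integral of `η` is `v`. -/
def Bounds (κ : (unitInterval → M) →₀ ℤ) (v : ℝ) : Prop := (κ, v) ∈ (boundaryIntegral η).range

variable {η} {κ κ' : (unitInterval → M) →₀ ℤ} {v v' : ℝ}

lemma Bounds.add (h : Bounds η κ v) (h' : Bounds η κ' v') : Bounds η (κ + κ') (v + v') :=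
  (boundaryIntegral η).range.add_mem h h'

lemma Bounds.neg (h : Bounds η κ v) : Bounds η (-κ) (-v) := (boundaryIntegral η).range.neg_mem h

lemma Bounds.sub (h : Bounds η κ v) (h' : Bounds η κ' v') : Bounds η (κ - κ') (v - v') :=
  (boundaryIntegral η).range.sub_mem h h'

variable (η) in
lemma Bounds.zero : Bounds η 0 0 := (boundaryIntegral η).range.zero_mem

lemma Bounds.congr (h : Bounds η κ v) (hκ : κ = κ') (hv : v = v') : Bounds η κ' v' := hκ ▸ hv ▸ h

lemma Bounds.zero_add (h : Bounds η κ 0) (h' : Bounds η κ' 0) : Bounds η (κ + κ') 0 :=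
  (h.add h').congr rfl (by simp)

variable (η) in
lemma bounds_boundary (σ : Simplex2 I M) : Bounds η σ.boundary (σ.integral η) := by
  refine ⟨Finsupp.single σ 1, ?_⟩
  simp [boundaryIntegral]

lemma integral_eq_pull (σ : Simplex2 I M) :
    σ.integral η = ∫ p in triangle, η.pull σ.toFun triangle p ![(1, 0), (0, 1)] := by
  rw [Simplex2.integral]
  refine MeasureTheory.integral_congr_ae (Filter.Eventually.of_forall fun p => ?_)
  have : ∀ L : ℝ × ℝ →L[ℝ] E, (fun i => L ((![(1, 0), (0, 1)] : Fin 2 → ℝ × ℝ) i)) = ![L (1, 0), L (0, 1)] := by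
    intro L; ext i; fin_cases i <;> rfl
  exact (congrArg (η.val (σ.toFun p)) (this (mD 𝓘(ℝ, ℝ × ℝ) I σ.toFun triangle p))).symm

variable (η) in
/-- A degenerate simplex has integral zero. -/
lemma bounds_degenerate {c : ℝ → M} (hc : ContMDiffOn 𝓘(ℝ, ℝ) I ∞ c (Icc 0 1)) {l : ℝ × ℝ → ℝ}
    (hl : ContDiff ℝ ∞ l) (hlt : MapsTo l triangle (Icc 0 1)) :
    Bounds η (Finsupp.single (fun t : unitInterval => c (l (1 - (t : ℝ), (t : ℝ)))) (1 : ℤ)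
      - Finsupp.single (fun t : unitInterval => c (l (0, (t : ℝ)))) (1 : ℤ)
      + Finsupp.single (fun t : unitInterval => c (l ((t : ℝ), 0))) (1 : ℤ)) 0 := by
  let σ : Simplex2 I M := ⟨c ∘ l, hc.comp hl.contMDiff.contMDiffOn hlt⟩
  refine (bounds_boundary η σ).congr rfl ?_
  rw [integral_eq_pull]
  refine MeasureTheory.setIntegral_eq_zero_of_forall_eq_zero fun p hp => ?_
  change η.pull (c ∘ l) triangle p _ = 0
  rw [η.pull_comp ((hc _ (hlt hp)).mdifferentiableWithinAt (by simp))
    ((hl.differentiable (by simp)).differentiableAt.differentiableWithinAt) hlt (uniqueDiffOn_triangle p hp)]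
  set B := η.pull c (Icc 0 1) (l p)
  set L := fderivWithin ℝ l triangle p
  have e : (fun i => L ((![(1, 0), (0, 1)] : Fin 2 → ℝ × ℝ) i)) = ![L (1, 0) • (1 : ℝ) + (0 : ℝ) • (1 : ℝ), L (0, 1) • (1 : ℝ) + (0 : ℝ) • (1 : ℝ)] := by
    ext i; fin_cases i <;> simp
  have : B (fun i => L ((![(1, 0), (0, 1)] : Fin 2 → ℝ × ℝ) i)) = 0 := by
    rw [e, alternating_two_det]
    ring
  exact this

lemma bounds_const (x : M) : Bounds η (Finsupp.single (fun _ => x) 1) 0 := by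
  refine (bounds_degenerate η (c := fun _ => x) contMDiffOn_const (l := fun _ => 0) contDiff_const
    (fun _ _ => by simp)).congr (by abel) rfl

lemma bounds_reverse {γ : ℝ → M} {a b : ℝ} (hab : a ≤ b) (hγ : ContMDiffOn 𝓘(ℝ, ℝ) I ∞ γ (Icc a b)) :
    Bounds η (Finsupp.single (arc γ a b) 1 + Finsupp.single (arc γ b a) 1) 0 := by
  have h := bounds_degenerate η (contMDiffOn_arc hab hγ) (l := fun p => p.1) contDiff_fst
    (fun p hp => (triangle_subset hp).1)
  refine (h.zero_add (bounds_const (η := η) (γ a))).congr ?_ rfl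
  have e1 : (fun t : unitInterval => γ (a + (1 - (t : ℝ)) * (b - a))) = arc γ b a := by
    ext t; simp only [arc]; congr 1; ring
  have e2 : (fun _ : unitInterval => γ (a + 0 * (b - a))) = fun _ => γ a := by simp
  have e3 : (fun t : unitInterval => γ (a + (t : ℝ) * (b - a))) = arc γ a b := rfl
  simp only
  rw [e1, e2, e3]
  abel

lemma bounds_split {γ : ℝ → M} {a d b : ℝ} (had : a < d) (hdb : d < b)
    (hγ : ContMDiffOn 𝓘(ℝ, ℝ) I ∞ γ (Icc a b)) :
    Bounds η (Finsupp.single (arc γ a d) 1 + Finsupp.single (arc γ d b) 1 - Finsupp.single (arc γ a b) 1) 0 := by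
  have hba : 0 < b - a := by linarith
  set m := (d - a) / (b - a) with hm
  have hm0 : 0 ≤ m := div_nonneg (by linarith) hba.le
  have hm1 : m ≤ 1 := (div_le_one hba).2 (by linarith)
  have hmd : m * (b - a) = d - a := by rw [hm]; field_simp
  have h := bounds_degenerate η (contMDiffOn_arc (had.trans hdb).le hγ) (l := fun p => m * p.1 + p.2) (by fun_prop)
    (fun p hp => ⟨by have := hp.1; have := hp.2.1; positivity, by nlinarith [hp.1, hp.2.2]⟩)
  refine h.congr ?_ rfl
  have e1 : (fun t : unitInterval => γ (a + (m * (1 - (t : ℝ)) + t) * (b - a))) = arc γ d b := by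
    ext t; simp only [arc]; congr 1
    linear_combination (1 - (t : ℝ)) * hmd
  have e2 : (fun t : unitInterval => γ (a + (m * 0 + (t : ℝ)) * (b - a))) = arc γ a b := by
    ext t; simp only [arc]; congr 1; ring
  have e3 : (fun t : unitInterval => γ (a + (m * (t : ℝ) + 0) * (b - a))) = arc γ a d := by
    ext t; simp only [arc]; congr 1
    linear_combination (t : ℝ) * hmd
  simp only
  rw [e1, e2, e3]
  abel

/-- The square, as a difference of two triangles. -/
lemma bounds_square {Q : ℝ × ℝ → M} (hQ : ContMDiffOn 𝓘(ℝ, ℝ × ℝ) I ∞ Q (Icc 0 1 ×ˢ Icc 0 1)) :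
    Bounds η (Finsupp.single (arc (fun x => Q (x, 0)) 0 1) 1 + Finsupp.single (arc (fun y => Q (1, y)) 0 1) 1
      - Finsupp.single (arc (fun x => Q (x, 1)) 0 1) 1 - Finsupp.single (arc (fun y => Q (0, y)) 0 1) 1)
      (∫ s in (0 : ℝ)..1, ∫ t in (0 : ℝ)..1, η.pull Q (Icc 0 1 ×ˢ Icc 0 1) (s, t) ![(1, 0), (0, 1)]) := by
  set S : Set (ℝ × ℝ) := Icc 0 1 ×ˢ Icc 0 1
  have huS : UniqueDiffOn ℝ S := uniqueDiffOn_rect zero_lt_one zero_lt_one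
  let l₁ : ℝ × ℝ → ℝ × ℝ := fun p => (p.1 + p.2, p.2)
  let l₂ : ℝ × ℝ → ℝ × ℝ := fun p => (p.2, p.1 + p.2)
  have hl₁ : ContDiff ℝ ∞ l₁ := by fun_prop
  have hl₂ : ContDiff ℝ ∞ l₂ := by fun_prop
  have hm₁ : MapsTo l₁ triangle S := fun p hp =>
    ⟨⟨add_nonneg hp.1 hp.2.1, hp.2.2⟩, (triangle_subset hp).2⟩
  have hm₂ : MapsTo l₂ triangle S := fun p hp =>
    ⟨(triangle_subset hp).2, ⟨add_nonneg hp.1 hp.2.1, hp.2.2⟩⟩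
  let T₁ : Simplex2 I M := ⟨Q ∘ l₁, hQ.comp hl₁.contMDiff.contMDiffOn hm₁⟩
  let T₂ : Simplex2 I M := ⟨Q ∘ l₂, hQ.comp hl₂.contMDiff.contMDiffOn hm₂⟩
  set F : ℝ × ℝ → ℝ := fun p => η.pull Q S p ![(1, 0), (0, 1)] with hF
  have hFc : ContinuousOn F S :=
    (contDiffOn_alternating_apply (η.contDiffOn_pull hQ huS) contDiffOn_const).continuousOn
  have hd₁ : ∀ p v, fderiv ℝ l₁ p v = l₁ v := fun p v => by
    have : HasFDerivAt l₁ (((ContinuousLinearMap.fst ℝ ℝ ℝ) + ContinuousLinearMap.snd ℝ ℝ ℝ).prod (ContinuousLinearMap.snd ℝ ℝ ℝ)) p :=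
      (hasFDerivAt_fst.add hasFDerivAt_snd).prodMk hasFDerivAt_snd
    rw [this.fderiv]; rfl
  have hd₂ : ∀ p v, fderiv ℝ l₂ p v = l₂ v := fun p v => by
    have : HasFDerivAt l₂ ((ContinuousLinearMap.snd ℝ ℝ ℝ).prod ((ContinuousLinearMap.fst ℝ ℝ ℝ) + ContinuousLinearMap.snd ℝ ℝ ℝ)) p :=
      hasFDerivAt_snd.prodMk (hasFDerivAt_fst.add hasFDerivAt_snd)
    rw [this.fderiv]; rfl
  have key : ∀ (l : ℝ × ℝ → ℝ × ℝ) (_ : ContDiff ℝ ∞ l) (_ : MapsTo l triangle S) (_ : ∀ p v, fderiv ℝ l p v = l v),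
      ∀ p ∈ triangle, η.pull (Q ∘ l) triangle p ![(1, 0), (0, 1)] =
        ((l (1, 0)).1 * (l (0, 1)).2 - (l (1, 0)).2 * (l (0, 1)).1) * F (l p) := by
    intro l hl hm hd p hp
    rw [η.pull_comp ((hQ _ (hm hp)).mdifferentiableWithinAt (by simp))
      ((hl.differentiable (by simp)).differentiableAt.differentiableWithinAt) hm (uniqueDiffOn_triangle p hp),
      fderivWithin_eq_fderiv (uniqueDiffOn_triangle p hp) (hl.differentiable (by simp)).differentiableAt]
    rw [hF, ← alternating_two_det, ← pair_eq_add, ← pair_eq_add]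
    refine congrArg (η.pull Q S (l p)) ?_
    ext1 i; fin_cases i <;> exact hd p _
  refine ((bounds_boundary η T₁).sub (bounds_boundary η T₂)).congr ?_ ?_
  · have e1 : (fun t : unitInterval => Q (1 - (t : ℝ) + t, (t : ℝ))) = arc (fun y => Q (1, y)) 0 1 := by
      ext t; simp [arc]
    have e2 : (fun t : unitInterval => Q (0 + (t : ℝ), (t : ℝ))) = fun t : unitInterval => Q (t, t) := by simp
    have e3 : (fun t : unitInterval => Q ((t : ℝ) + 0, (0 : ℝ))) = arc (fun x => Q (x, 0)) 0 1 := by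
      ext t; simp [arc]
    have e4 : (fun t : unitInterval => Q ((t : ℝ), 1 - (t : ℝ) + t)) = arc (fun x => Q (x, 1)) 0 1 := by
      ext t; simp [arc]
    have e5 : (fun t : unitInterval => Q ((t : ℝ), 0 + (t : ℝ))) = fun t : unitInterval => Q (t, t) := by simp
    have e6 : (fun t : unitInterval => Q ((0 : ℝ), (t : ℝ) + 0)) = arc (fun y => Q (0, y)) 0 1 := by
      ext t; simp [arc]
    simp only [Simplex2.boundary, T₁, T₂, Function.comp, l₁, l₂]
    rw [e1, e2, e3, e4, e5, e6]
    abel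
  · rw [integral_eq_pull, integral_eq_pull, ← setIntegral_two_triangles (F := F)
      (hFc.integrableOn_compact (isCompact_Icc.prod isCompact_Icc)), sub_eq_add_neg, ← MeasureTheory.integral_neg]
    congr 1
    · refine MeasureTheory.setIntegral_congr_fun isClosed_triangle.measurableSet fun p hp => ?_
      exact (key l₁ hl₁ hm₁ hd₁ p hp).trans (by simp [l₁])
    · refine MeasureTheory.setIntegral_congr_fun isClosed_triangle.measurableSet fun p hp => ?_
      rw [show η.pull T₂.toFun triangle p ![(1, 0), (0, 1)] = _ from key l₂ hl₂ hm₂ hd₂ p hp]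
      simp [l₂]

end Chains

section PathClass

variable {E : Type*} [NormedAddCommGroup E] [NormedSpace ℝ E] [FiniteDimensional ℝ E]
  {H : Type*} [TopologicalSpace H] {I : ModelWithCorners ℝ E H} [I.Boundaryless]
  {M : Type*} [TopologicalSpace M] [ChartedSpace H M] [IsManifold I ∞ M]
  {η : DifferentialForm I M 2}

variable (I) in
/-- `κ` is the sum of the pieces of a subdivision of the curve `γ` on `[a,b]`. -/
inductive HasChain (γ : ℝ → M) (a : ℝ) : ℝ → ((unitInterval → M) →₀ ℤ) → Prop
  | nil : HasChain γ a a 0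
  | snoc {b d : ℝ} {κ : (unitInterval → M) →₀ ℤ} (h : HasChain γ a b κ) (hbd : b < d)
      (hs : ContMDiffOn 𝓘(ℝ, ℝ) I ∞ γ (Icc b d)) : HasChain γ a d (κ + Finsupp.single (arc γ b d) 1)

namespace HasChain

variable {γ δ : ℝ → M} {a b d : ℝ} {κ κ' : (unitInterval → M) →₀ ℤ}

lemma le (h : HasChain I γ a b κ) : a ≤ b := by
  induction h with
  | nil => exact le_rfl
  | snoc h hbd hs ih => exact ih.trans hbd.le

lemma single (hab : a < b) (hs : ContMDiffOn 𝓘(ℝ, ℝ) I ∞ γ (Icc a b)) :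
    HasChain I γ a b (Finsupp.single (arc γ a b) 1) := by
  simpa using HasChain.nil.snoc hab hs

lemma concat (h : HasChain I γ a b κ) (h' : HasChain I γ b d κ') : HasChain I γ a d (κ + κ') := by
  induction h' with
  | nil => simpa using h
  | snoc h' hbd hs ih => rw [← add_assoc]; exact ih.snoc hbd hs

lemma exists_subdivision (h : HasChain I γ a b κ) : ∃ (n : ℕ) (t : Fin (n + 1) → ℝ), StrictMono t ∧ t 0 = a ∧
    t (Fin.last n) = b ∧ (∀ i : Fin n, ContMDiffOn 𝓘(ℝ, ℝ) I ∞ γ (Icc (t i.castSucc) (t i.succ))) ∧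
    κ = ∑ i : Fin n, Finsupp.single (arc γ (t i.castSucc) (t i.succ)) 1 := by
  induction h with
  | nil => exact ⟨0, fun _ => a, fun i j hij => absurd hij (by omega), rfl, rfl, fun i => i.elim0, by simp⟩
  | @snoc b d κ h hbd hs ih =>
    obtain ⟨n, t, h1, h2, h3, h4, h5⟩ := ih
    have e : ∀ i : Fin n, (Fin.snoc t d : Fin (n + 2) → ℝ) i.castSucc.succ = t i.succ := fun i => by
      rw [← Fin.castSucc_succ, Fin.snoc_castSucc]
    refine ⟨n + 1, Fin.snoc t d, ?_, ?_, by simp, ?_, ?_⟩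
    · rw [Fin.strictMono_iff_lt_succ]
      refine Fin.lastCases ?_ fun i => ?_
      · rw [Fin.succ_last, Fin.snoc_last, Fin.snoc_castSucc, h3]; exact hbd
      · rw [e, Fin.snoc_castSucc]; exact h1 (Fin.castSucc_lt_succ)
    · rw [← h2]
      exact Fin.snoc_castSucc (α := fun _ => ℝ) d t 0
    · refine Fin.lastCases ?_ fun i => ?_
      · rw [Fin.succ_last, Fin.snoc_last, Fin.snoc_castSucc, h3]; exact hs
      · rw [e, Fin.snoc_castSucc]; exact h4 i
    · rw [Fin.sum_univ_castSucc, Fin.succ_last, Fin.snoc_last, Fin.snoc_castSucc, h3, h5]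
      congr 1
      refine Finset.sum_congr rfl fun i _ => ?_
      rw [e, Fin.snoc_castSucc]

lemma affine (h : HasChain I γ a b κ) {m c : ℝ} (hm : 0 < m) (he : EqOn (fun v => δ (m * v + c)) γ (Icc a b)) :
    HasChain I δ (m * a + c) (m * b + c) κ := by
  induction h with
  | nil => exact .nil
  | @snoc b d κ h hbd hs ih =>
    have h1 := ih (he.mono (Icc_subset_Icc_right hbd.le))
    have he' : EqOn (fun v => δ (m * v + c)) γ (Icc b d) := he.mono (Icc_subset_Icc_left h.le)
    have e : arc γ b d = arc δ (m * b + c) (m * d + c) := by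
      ext s
      have := he' (arc_mem hbd.le s)
      simp only [arc] at this ⊢
      rw [← this]
      congr 1
      ring
    rw [e]
    refine h1.snoc (by nlinarith) ?_
    have h2 : ContDiff ℝ ∞ (fun u : ℝ => (u - c) / m) := by fun_prop
    have h3 : MapsTo (fun u : ℝ => (u - c) / m) (Icc (m * b + c) (m * d + c)) (Icc b d) := fun u hu =>
      ⟨by rw [le_div_iff₀ hm]; linarith [hu.1], by rw [div_le_iff₀ hm]; linarith [hu.2]⟩
    refine (hs.comp h2.contMDiff.contMDiffOn h3).congr fun u hu => ?_
    rw [Function.comp_apply, ← he' (h3 hu)]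
    simp only
    congr 1
    field_simp
    ring

lemma congr (h : HasChain I γ a b κ) (he : EqOn δ γ (Icc a b)) : HasChain I δ a b κ := by
  simpa using h.affine (δ := δ) one_pos (c := 0) (by simpa using he)

variable (η) in
lemma reverse (h : HasChain I γ a b κ) {c : ℝ} (he : EqOn (fun v => δ (c - v)) γ (Icc a b)) :
    ∃ κ', HasChain I δ (c - b) (c - a) κ' ∧ Bounds η (κ' + κ) 0 := by
  induction h with
  | nil => exact ⟨0, .nil, by simpa using Bounds.zero η⟩
  | @snoc b d κ h hbd hs ih =>
    obtain ⟨κ', h1, h2⟩ := ih (he.mono (Icc_subset_Icc_right hbd.le))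
    have he' : EqOn (fun v => δ (c - v)) γ (Icc b d) := he.mono (Icc_subset_Icc_left h.le)
    have hd : ContMDiffOn 𝓘(ℝ, ℝ) I ∞ δ (Icc (c - d) (c - b)) := by
      have h2 : ContDiff ℝ ∞ (fun u : ℝ => c - u) := by fun_prop
      have h3 : MapsTo (fun u : ℝ => c - u) (Icc (c - d) (c - b)) (Icc b d) := fun u hu =>
        ⟨by linarith [hu.2], by linarith [hu.1]⟩
      refine (hs.comp h2.contMDiff.contMDiffOn h3).congr fun u hu => ?_
      rw [Function.comp_apply, ← he' (h3 hu)]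
      simp
    have e : arc γ b d = arc δ (c - b) (c - d) := by
      ext s
      have := he' (arc_mem hbd.le s)
      simp only [arc] at this ⊢
      rw [← this]
      congr 1
      ring
    refine ⟨_, (single (by linarith) hd).concat h1, (h2.zero_add (bounds_reverse (by linarith) hd)).congr ?_ rfl⟩
    rw [e]
    abel

lemma map {N : Type*} [TopologicalSpace N] [ChartedSpace H N] (h : HasChain I γ a b κ) {g : M → N}
    (hg : ContMDiff I I ∞ g) :
    HasChain I (g ∘ γ) a b (κ.mapDomain (fun (c : unitInterval → M) t => g (c t))) := by
  induction h with
  | nil => simpa using HasChain.nil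
  | snoc h hbd hs ih =>
    rw [Finsupp.mapDomain_add, Finsupp.mapDomain_single]
    exact ih.snoc hbd (hg.comp_contMDiffOn hs)

lemma of_subdivision {x y : M} {γ : Path x y} {n : ℕ} {t : Fin (n + 1) → ℝ} (ht : IsSmoothSubdivision I γ t) :
    HasChain I γ.extend 0 1 (curveChain γ t) := by
  have key : ∀ m (hm : m ≤ n), HasChain I γ.extend 0 (t ⟨m, by omega⟩)
      (∑ i : Fin m, Finsupp.single (arc γ.extend (t (i.castLE hm).castSucc) (t (i.castLE hm).succ)) 1) := by
    intro m
    induction m with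
    | zero =>
      intro hm
      have e : t ⟨0, by omega⟩ = 0 := ht.zero
      rw [e]
      simpa using HasChain.nil
    | succ m ih =>
      intro hm
      let i : Fin n := ⟨m, hm⟩
      rw [Fin.sum_univ_castSucc]
      exact (ih (by omega)).snoc (ht.strictMono (Fin.castSucc_lt_succ (i := i))) (ht.smooth i)
  have h1 := key n le_rfl
  have e : t ⟨n, by omega⟩ = 1 := ht.one
  rw [e] at h1
  exact h1

lemma isSmoothSubdivision {x y : M} {γ : Path x y} (h : HasChain I γ.extend 0 1 κ) :
    ∃ (n : ℕ) (t : Fin (n + 1) → ℝ), IsSmoothSubdivision I γ t ∧ curveChain γ t = κ := by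
  obtain ⟨n, t, h1, h2, h3, h4, h5⟩ := h.exists_subdivision
  exact ⟨n, t, ⟨h1, h2, h3, h4⟩, h5.symm⟩

lemma trans {x y z : M} {γ : Path x y} {γ' : Path y z} (h : HasChain I γ.extend 0 1 κ)
    (h' : HasChain I γ'.extend 0 1 κ') : HasChain I (γ.trans γ').extend 0 1 (κ + κ') := by
  have h1 := h.affine (δ := (γ.trans γ').extend) (m := 1 / 2) (c := 0) (by norm_num) fun v hv => by
    simp only
    rw [Path.extend_trans_of_le_half _ _ (by linarith [hv.2])]
    congr 1
    ring
  have h2 := h'.affine (δ := (γ.trans γ').extend) (m := 1 / 2) (c := 1 / 2) (by norm_num) fun v hv => by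
    simp only
    rw [Path.extend_trans_of_half_le _ _ (by linarith [hv.1])]
    congr 1
    ring
  norm_num at h1 h2
  exact h1.concat h2

end HasChain

lemma PiecewiseSmooth.exists_hasChain {x y : M} {γ : Path x y} (h : PiecewiseSmooth I γ) :
    ∃ κ, HasChain I γ.extend 0 1 κ := by
  obtain ⟨n, t, ht⟩ := h.exists_subdivision
  exact ⟨_, .of_subdivision ht⟩

variable (η) in
/-- The chain `κ` represents the path `γ`, up to boundaries of chains over which `η` has integral
zero. -/
def PathClass {x y : M} (γ : Path x y) (κ : (unitInterval → M) →₀ ℤ) : Prop :=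
  ∃ κ', HasChain I γ.extend 0 1 κ' ∧ Bounds η (κ' - κ) 0

namespace PathClass

variable {x y z : M} {γ : Path x y} {γ' : Path y z} {κ κ' : (unitInterval → M) →₀ ℤ}

lemma of_hasChain (h : HasChain I γ.extend 0 1 κ) : PathClass η γ κ := ⟨κ, h, by simpa using Bounds.zero η⟩

lemma trans (h : PathClass η γ κ) (h' : PathClass η γ' κ') : PathClass η (γ.trans γ') (κ + κ') := by
  obtain ⟨κ₁, h1, h2⟩ := h
  obtain ⟨κ₂, h3, h4⟩ := h'
  exact ⟨_, h1.trans h3, (h2.zero_add h4).congr (by abel) rfl⟩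

lemma symm (h : PathClass η γ κ) : PathClass η γ.symm (-κ) := by
  obtain ⟨κ₁, h1, h2⟩ := h
  obtain ⟨κ', h3, h4⟩ := h1.reverse η (δ := γ.symm.extend) (c := 1) (fun v _ => by simp [Path.extend_symm])
  rw [sub_self, sub_zero] at h3
  exact ⟨κ', h3, (h4.sub h2).congr (by abel) (by simp)⟩

lemma cast (h : PathClass η γ κ) {x' y' : M} (hx : x' = x) (hy : y' = y) : PathClass η (γ.cast hx hy) κ := h

lemma arc {γ : ℝ → M} {a b : ℝ} (hab : a < b) (hγ : ContMDiffOn 𝓘(ℝ, ℝ) I ∞ γ (Icc a b)) :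
    PathClass η (arcPath γ hab.le hγ) (Finsupp.single (EquivHol.arc γ a b) 1) := by
  have h := HasChain.single zero_lt_one (arcPath_smooth hab.le hγ)
  have e : EquivHol.arc (arcPath γ hab.le hγ).extend 0 1 = EquivHol.arc γ a b := by
    ext s
    have := arcPath_extend hab.le hγ s.2
    simp only [EquivHol.arc, zero_add, sub_zero, mul_one]
    exact this
  rw [e] at h
  exact of_hasChain h

end PathClass

end PathClass

section Character

variable {EG : Type*} [NormedAddCommGroup EG] [NormedSpace ℝ EG]
  {HG : Type*} [TopologicalSpace HG] {IG : ModelWithCorners ℝ EG HG}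
  {G : Type*} [TopologicalSpace G] [ChartedSpace HG G] [Group G]
  {E : Type*} [NormedAddCommGroup E] [NormedSpace ℝ E] [FiniteDimensional ℝ E]
  {H : Type*} [TopologicalSpace H] {I : ModelWithCorners ℝ E H} [I.Boundaryless]
  {M : Type*} [TopologicalSpace M] [ChartedSpace H M] [IsManifold I ∞ M] [MulAction G M]
  [ContMDiffSMul IG I ∞ G M]
  {χ : EquivCurve G I M → AddCircle (1 : ℝ)} {w : EquivariantTwoForm IG G I M} {η : DifferentialForm I M 2}
  {κ κ' : (unitInterval → M) →₀ ℤ} {v : ℝ}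

/-- The chain obtained by applying a group element. -/
def smulChain (φ : G) (κ : (unitInterval → M) →₀ ℤ) : (unitInterval → M) →₀ ℤ :=
  κ.mapDomain fun (c : unitInterval → M) t => φ • c t

lemma smulChain_one (κ : (unitInterval → M) →₀ ℤ) : smulChain (1 : G) κ = κ := by
  have : (fun (c : unitInterval → M) t => (1 : G) • c t) = id := by ext; simp
  rw [smulChain, this, Finsupp.mapDomain_id]

lemma PathClass.comp {p q : EquivCurve G I M} (hp : PathClass η p.path κ) (hq : PathClass η q.path κ')
    (h : q.base = p.elt • p.base) : PathClass η (p.comp q h).path (κ + κ') :=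
  hp.trans (hq.cast _ _)

variable (IG) in
lemma PathClass.conj {p : EquivCurve G I M} (hp : PathClass η p.path κ) {y : M} {ζ : Path p.base y}
    (hζ : PiecewiseSmooth I ζ) (h : HasChain I ζ.extend 0 1 κ') :
    PathClass η (p.conj IG ζ hζ).path (-κ' + κ + smulChain p.elt κ') := by
  refine ((of_hasChain h).symm.trans hp).trans (of_hasChain ?_)
  exact h.map (ContMDiffSMul.contMDiff_const_smul (I := IG) (I' := I) (n := ∞) p.elt)

namespace IsCharacterWithCurvature

lemma eq_of_bounds (hχ : IsCharacterWithCurvature IG χ w) {p : EquivCurve G I M} (he : p.elt = 1)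
    (hp : PathClass w.form p.path κ) (h : Bounds w.form κ v) : χ p = (v : AddCircle (1 : ℝ)) := by
  obtain ⟨κ', h1, h2⟩ := hp
  obtain ⟨n, t, ht, rfl⟩ := h1.isSmoothSubdivision
  obtain ⟨σ, hσ⟩ := h2.add h
  rw [boundaryIntegral_apply] at hσ
  have e1 := congrArg Prod.fst hσ
  have e2 := congrArg Prod.snd hσ
  simp only [sub_add_cancel, zero_add] at e1 e2
  rw [hχ.map_boundary p he n t ht σ e1.symm, e2]

lemma sub_eq (hχ : IsCharacterWithCurvature IG χ w) {p q : EquivCurve G I M} (he : p.elt = q.elt)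
    (hb : p.base = q.base) (hp : PathClass w.form p.path κ) (hq : PathClass w.form q.path κ')
    (h : Bounds w.form (κ - κ') v) : χ p - χ q = (v : AddCircle (1 : ℝ)) := by
  obtain ⟨φ, x, γ, hγ⟩ := p
  obtain ⟨φ', x', γ', hγ'⟩ := q
  dsimp only at he hb
  subst he hb
  let r : EquivCurve G I M := ⟨φ⁻¹, φ • x, γ'.symm.cast rfl (inv_smul_smul φ x), hγ'.symm.cast _ _⟩
  have hr : PathClass w.form r.path (-κ') := hq.symm
  have h1 := hχ.map_comp ⟨φ, x, γ, hγ⟩ r rfl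
  have h2 := hχ.map_comp ⟨φ, x, γ', hγ'⟩ r rfl
  rw [hχ.eq_of_bounds (inv_mul_cancel φ) (hp.comp hr rfl) (h.congr (sub_eq_add_neg _ _) rfl)] at h1
  rw [hχ.eq_of_bounds (inv_mul_cancel φ) (hq.comp hr rfl) ((Bounds.zero _).congr (by abel) rfl)] at h2
  rw [AddCircle.coe_zero] at h2
  rw [h1]
  calc _ = χ r + χ ⟨φ, x, γ, hγ⟩ - (χ r + χ ⟨φ, x, γ', hγ'⟩) := by abel
    _ = _ := by rw [← h2]; abel

lemma eq_of_class (hχ : IsCharacterWithCurvature IG χ w) {p q : EquivCurve G I M} (he : p.elt = q.elt)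
    (hb : p.base = q.base) (hp : PathClass w.form p.path κ) (hq : PathClass w.form q.path κ')
    (h : κ = κ') : χ p = χ q := by
  have := hχ.sub_eq he hb hp hq (v := 0) (by rw [h, sub_self]; exact Bounds.zero _)
  rw [AddCircle.coe_zero] at this
  exact sub_eq_zero.1 this

end IsCharacterWithCurvature

variable (b : BasePaths I M)

/-- Chains of the base paths. -/
def BasePaths.chain (x : M) : (unitInterval → M) →₀ ℤ := (b.smooth x).exists_hasChain.choose

lemma BasePaths.hasChain (x : M) : HasChain I (b.path x).extend 0 1 (b.chain x) :=
  (b.smooth x).exists_hasChain.choose_spec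

variable (G) in
lemma BasePaths.loop_class {x y : M} {γ : Path x y} (hγ : PiecewiseSmooth I γ) (h : PathClass η γ κ) :
    PathClass η (b.loop G hγ).path (b.chain x + (κ - b.chain y)) := by
  refine (PathClass.of_hasChain (b.hasChain x)).trans ?_
  rw [sub_eq_add_neg]
  exact h.trans (PathClass.of_hasChain (b.hasChain y)).symm

lemma BasePaths.twistCurve_class (φ : G) (x : M) :
    PathClass η (b.twistCurve φ x).path (-b.chain x + b.chain (φ • x)) :=
  (PathClass.of_hasChain (b.hasChain x)).symm.trans (PathClass.of_hasChain (b.hasChain (φ • x)))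

namespace IsCharacterWithCurvature

variable {b}

/-- The functional determined by a character is additive up to the integral of the curvature. -/
lemma charArc_add (hχ : IsCharacterWithCurvature IG χ w) {x y z : M} {γ₁ : Path x y} {γ₂ : Path y z}
    {γ₃ : Path x z} (h₁ : PiecewiseSmooth I γ₁) (h₂ : PiecewiseSmooth I γ₂) (h₃ : PiecewiseSmooth I γ₃)
    {κ₁ κ₂ κ₃ : (unitInterval → M) →₀ ℤ} (c₁ : PathClass w.form γ₁ κ₁) (c₂ : PathClass w.form γ₂ κ₂)
    (c₃ : PathClass w.form γ₃ κ₃) (h : Bounds w.form (κ₁ + κ₂ - κ₃) v) :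
    charArc b χ γ₁ + charArc b χ γ₂ = charArc b χ γ₃ + (v : AddCircle (1 : ℝ)) := by
  rw [charArc_eq b χ h₁, charArc_eq b χ h₂, charArc_eq b χ h₃]
  have hb : (b.loop G h₂).base = (b.loop G h₁).elt • (b.loop G h₁).base := (one_smul G b.base).symm
  have h4 := hχ.sub_eq (p := (b.loop G h₁).comp (b.loop G h₂) hb) (q := b.loop G h₃) (mul_one 1) rfl
    ((b.loop_class G h₁ c₁).comp (b.loop_class G h₂ c₂) hb) (b.loop_class G h₃ c₃) (h.congr (by abel) rfl)
  rw [hχ.map_comp] at h4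
  rw [← h4]
  abel

lemma splitAdditive_charArc (hχ : IsCharacterWithCurvature IG χ w) : SplitAdditive I (charArc b χ) := by
  intro γ a d c had hdc hγ
  have h1 := hγ.mono (Icc_subset_Icc_right hdc.le : Icc a d ⊆ Icc a c)
  have h2 := hγ.mono (Icc_subset_Icc_left had.le : Icc d c ⊆ Icc a c)
  have h := hχ.charArc_add (b := b) (arcPath_piecewiseSmooth had.le h1) (arcPath_piecewiseSmooth hdc.le h2)
    (arcPath_piecewiseSmooth (had.trans hdc).le hγ) (PathClass.arc had h1) (PathClass.arc hdc h2)
    (PathClass.arc (had.trans hdc) hγ) (bounds_split had hdc hγ)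
  rw [AddCircle.coe_zero, add_zero] at h
  exact h.symm

lemma charTwist_mul (hχ : IsCharacterWithCurvature IG χ w) (ψ φ : G) (x : M) :
    charTwist b χ (ψ * φ) x = charTwist b χ ψ (φ • x) + charTwist b χ φ x := by
  have h := hχ.map_comp (b.twistCurve φ x) (b.twistCurve ψ (φ • x)) rfl
  rw [charTwist, charTwist, charTwist, ← h]
  refine hχ.eq_of_class rfl rfl (b.twistCurve_class (ψ * φ) x)
    ((b.twistCurve_class φ x).comp (b.twistCurve_class ψ (φ • x)) rfl) ?_
  rw [mul_smul]
  abel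

/-- Values on arcs as values on loops based at an arbitrary point. -/
lemma exists_loop (hχ : IsCharacterWithCurvature IG χ w) {x y : M} {γ : Path x y} (hγ : PiecewiseSmooth I γ)
    (c : PathClass w.form γ κ) (z : M) : ∃ p : EquivCurve G I M, p.elt = 1 ∧ p.base = z ∧
      PathClass w.form p.path (κ + b.chain x - b.chain y) ∧ χ p = charArc b χ γ := by
  let ζ : Path (b.loop G hγ).base z := b.path z
  have hζ : PiecewiseSmooth I ζ := b.smooth z
  refine ⟨(b.loop G hγ).conj IG ζ hζ, rfl, rfl, ?_, ?_⟩
  · have h := (b.loop_class G hγ c).conj IG hζ (b.hasChain z)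
    have e : smulChain (b.loop G hγ).elt (b.chain z) = b.chain z := smulChain_one _
    rw [e] at h
    convert h using 1
    abel
  · rw [hχ.map_conj, charArc_eq]

lemma charArc_smul (hχ : IsCharacterWithCurvature IG χ w) (φ : G) {γ : ℝ → M} {a d : ℝ} (had : a < d)
    (hγ : ContMDiffOn 𝓘(ℝ, ℝ) I ∞ γ (Icc a d)) :
    charArc b χ (arc (fun t => φ • γ t) a d) =
      charArc b χ (arc γ a d) + charTwist b χ φ (γ a) - charTwist b χ φ (γ d) := by
  have hφγ : ContMDiffOn 𝓘(ℝ, ℝ) I ∞ (fun t => φ • γ t) (Icc a d) :=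
    (ContMDiffSMul.contMDiff_const_smul (I := IG) (I' := I) (n := ∞) φ).comp_contMDiffOn hγ
  have hp := arcPath_piecewiseSmooth had.le hγ
  obtain ⟨p, p1, p2, p3, p4⟩ := hχ.exists_loop (b := b) hp (PathClass.arc had hγ) (γ a)
  obtain ⟨q, q1, q2, q3, q4⟩ := hχ.exists_loop (b := b) (arcPath_piecewiseSmooth had.le hφγ)
    (PathClass.arc had hφγ) (φ • γ d)
  have hpb : (b.twistCurve φ (γ a)).base = p.elt • p.base := by rw [p1, p2, one_smul]; rfl
  have hqb : q.base = (b.twistCurve φ (γ d)).elt • (b.twistCurve φ (γ d)).base := q2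
  let k := p.comp (b.twistCurve φ (γ a)) hpb
  have hk : k.base = γ a := p2
  let ζ : Path k.base (γ d) := (arcPath γ had.le hγ).cast hk rfl
  have hζ : PiecewiseSmooth I ζ := hp.cast _ _
  have hζc : HasChain I ζ.extend 0 1 (Finsupp.single (arc γ a d) 1) := by
    have h := HasChain.single zero_lt_one (arcPath_smooth had.le hγ)
    have e : arc (arcPath γ had.le hγ).extend 0 1 = arc γ a d := by
      ext s
      have := arcPath_extend had.le hγ s.2
      simp only [arc, zero_add, sub_zero, mul_one]
      exact this
    rwa [e] at h
  have hke : k.elt = φ := by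
    change φ * p.elt = φ
    rw [p1, mul_one]
  have h1 := (p3.comp (b.twistCurve_class φ (γ a)) hpb).conj IG hζ hζc
  have h2 := (b.twistCurve_class φ (γ d)).comp q3 hqb
  have h3 := hχ.eq_of_class (p := k.conj IG ζ hζ) (q := (b.twistCurve φ (γ d)).comp q hqb)
    (by change k.elt = q.elt * φ; rw [hke, q1, one_mul]) rfl h1 h2 (by
      have : smulChain k.elt (Finsupp.single (arc γ a d) (1 : ℤ)) = Finsupp.single (arc (fun t => φ • γ t) a d) 1 := by
        rw [smulChain, Finsupp.mapDomain_single, hke]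
        rfl
      rw [show smulChain (p.comp (b.twistCurve φ (γ a)) hpb).elt (Finsupp.single (arc γ a d) (1 : ℤ)) = _ from this]
      abel)
  rw [hχ.map_conj, hχ.map_comp, hχ.map_comp, p4, q4] at h3
  have h4 : charTwist b χ φ (γ a) + charArc b χ (arc γ a d) =
      charArc b χ (arc (fun t => φ • γ t) a d) + charTwist b χ φ (γ d) := h3
  rw [add_comm, h4]
  abel

lemma exists_loop_chain (hχ : IsCharacterWithCurvature IG χ w) {γ : ℝ → M} {a d : ℝ} (h : HasChain I γ a d κ) (z : M) :
    ∃ p : EquivCurve G I M, p.elt = 1 ∧ p.base = z ∧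
      PathClass w.form p.path (κ + b.chain (γ a) - b.chain (γ d)) ∧ χ p = chainExtend (charArc b χ) κ := by
  induction h with
  | nil =>
    let p : EquivCurve G I M := ⟨1, z, (Path.refl z).cast rfl (one_smul G z), ∅, fun _ _ _ _ _ _ => by
      rw [Path.extend_cast, Path.refl_extend]; exact contMDiffOn_const⟩
    have hp : PathClass w.form p.path 0 := by
      have h1 : HasChain I (fun _ => z) 0 1 (Finsupp.single (arc (fun _ => z) 0 1) 1) :=
        HasChain.single zero_lt_one contMDiffOn_const
      refine ⟨_, h1.congr fun t _ => ?_, (bounds_const z).congr (sub_zero _).symm rfl⟩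
      change (Path.refl z).extend t = z
      simp
    refine ⟨p, rfl, rfl, by simpa using hp, ?_⟩
    rw [hχ.eq_of_bounds rfl hp (Bounds.zero _), map_zero, AddCircle.coe_zero]
  | @snoc d c κ h hbd hs ih =>
    obtain ⟨p, p1, p2, p3, p4⟩ := ih
    obtain ⟨q, q1, q2, q3, q4⟩ := hχ.exists_loop (b := b) (arcPath_piecewiseSmooth hbd.le hs) (PathClass.arc hbd hs) z
    have hpq : q.base = p.elt • p.base := by rw [p1, p2, one_smul, q2]
    refine ⟨p.comp q hpq, ?_, p2, ?_, ?_⟩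
    · change q.elt * p.elt = 1
      rw [p1, q1, one_mul]
    · convert p3.comp q3 hpq using 1
      abel
    · rw [hχ.map_comp, p4, q4, map_add, chainExtend_single, one_smul, add_comm]
      rfl

/-- A character is determined by its values on arcs and its twist. -/
lemma eq_pieceSum (hχ : IsCharacterWithCurvature IG χ w) (k : EquivCurve G I M) {n : ℕ} {t : Fin (n + 1) → ℝ}
    (ht : IsSmoothSubdivision I k.path t) :
    χ k = pieceSum (charArc b χ) k.path t + charTwist b χ k.elt k.base := by
  have h := HasChain.of_subdivision ht
  obtain ⟨p, p1, p2, p3, p4⟩ := hχ.exists_loop_chain (b := b) h k.base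
  have hb : (b.twistCurve k.elt k.base).base = p.elt • p.base := by rw [p1, p2, one_smul]; rfl
  have h1 := hχ.eq_of_class (p := p.comp (b.twistCurve k.elt k.base) hb) (q := k)
    (by change k.elt * p.elt = k.elt; rw [p1, mul_one]) p2
    (p3.comp (b.twistCurve_class k.elt k.base) hb) (PathClass.of_hasChain h) (by
      rw [k.path.extend_zero, k.path.extend_one]; abel)
  rw [← h1, hχ.map_comp, p4, chainExtend_curveChain, add_comm]
  rfl

end IsCharacterWithCurvature

end Character

section Cone

variable {V : Type*} [NormedAddCommGroup V] [NormedSpace ℝ V] [FiniteDimensional ℝ V]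

/-- The `1`-form obtained from a `2`-form by integration over segments starting at `y₀`. -/
def coneForm (Ω : V → V [⋀^Fin 2]→L[ℝ] ℝ) (y₀ y : V) : V [⋀^Fin 1]→L[ℝ] ℝ :=
  ∫ s in (0 : ℝ)..1, s • (Ω (y₀ + s • (y - y₀))).curryLeft (y - y₀)

variable {Ω : V → V [⋀^Fin 2]→L[ℝ] ℝ} {y₀ : V} {r : ℝ}

lemma segment_mem_ball {y : V} (hy : y ∈ Metric.ball y₀ r) {s : ℝ} (hs : s ∈ Icc (0 : ℝ) 1) :
    y₀ + s • (y - y₀) ∈ Metric.ball y₀ r :=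
  (convex_ball _ r).add_smul_sub_mem (Metric.mem_ball_self (Metric.pos_of_mem_ball hy)) hy hs

lemma coneForm_apply (hΩ : ContDiffOn ℝ ∞ Ω (Metric.ball y₀ r)) {y : V} (hy : y ∈ Metric.ball y₀ r) (v : Fin 1 → V) :
    coneForm Ω y₀ y v = ∫ s in (0 : ℝ)..1, s * Ω (y₀ + s • (y - y₀)) (Matrix.vecCons (y - y₀) v) := by
  have hc : ContDiffOn ℝ ∞ (fun s : ℝ => s • (Ω (y₀ + s • (y - y₀))).curryLeft (y - y₀)) (Icc 0 1) := by
    refine contDiffOn_alternating_of_apply fun v => ?_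
    have h1 : ContDiffOn ℝ ∞ (fun s : ℝ => Ω (y₀ + s • (y - y₀))) (Icc 0 1) :=
      hΩ.comp (ContDiff.contDiffOn (by fun_prop)) fun s hs => segment_mem_ball hy hs
    exact contDiffOn_id.mul (contDiffOn_alternating_apply h1 (v := fun _ => Matrix.vecCons (y - y₀) v) contDiffOn_const)
  have hi : IntervalIntegrable (fun s : ℝ => s • (Ω (y₀ + s • (y - y₀))).curryLeft (y - y₀)) MeasureTheory.volume 0 1 := by
    apply ContinuousOn.intervalIntegrable
    rw [uIcc_of_le zero_le_one]
    exact hc.continuousOn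
  exact ((ContinuousAlternatingMap.apply ℝ V ℝ v).intervalIntegral_comp_comm hi).symm

lemma contDiffOn_coneForm (hΩ : ContDiffOn ℝ ∞ Ω (Metric.ball y₀ r)) :
    ContDiffOn ℝ ∞ (coneForm Ω y₀) (Metric.ball y₀ r) := by
  refine contDiffOn_alternating_of_apply fun v => ?_
  let l : V × ℝ → V := fun p => y₀ + p.2 • (p.1 - y₀)
  have hl : ContDiff ℝ ∞ l := by fun_prop
  have hS : IsOpen (l ⁻¹' Metric.ball y₀ r) := Metric.isOpen_ball.preimage hl.continuous
  have h1 : ContDiffOn ℝ ∞ (fun p : V × ℝ => p.2 * Ω (l p) (Matrix.vecCons (p.1 - y₀) v)) (l ⁻¹' Metric.ball y₀ r) := by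
    refine contDiffOn_snd.mul (contDiffOn_alternating_apply (hΩ.comp hl.contDiffOn fun p hp => hp) ?_)
    refine contDiffOn_pi.2 fun i => ?_
    refine Fin.cases ?_ (fun j => ?_) i
    · exact contDiffOn_fst.sub contDiffOn_const
    · exact contDiffOn_const
  exact (contDiffOn_integral_param hS Metric.isOpen_ball (fun y hy s hs => segment_mem_ball hy hs) h1).congr
    fun y hy => coneForm_apply hΩ hy v

end Cone

section Character

variable {EG : Type*} [NormedAddCommGroup EG] [NormedSpace ℝ EG]
  {HG : Type*} [TopologicalSpace HG] {IG : ModelWithCorners ℝ EG HG}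
  {G : Type*} [TopologicalSpace G] [ChartedSpace HG G] [Group G]
  {E : Type*} [NormedAddCommGroup E] [NormedSpace ℝ E] [FiniteDimensional ℝ E]
  {H : Type*} [TopologicalSpace H] {I : ModelWithCorners ℝ E H} [I.Boundaryless]
  {M : Type*} [TopologicalSpace M] [ChartedSpace H M] [IsManifold I ∞ M] [MulAction G M]
  [ContMDiffSMul IG I ∞ G M]
  {χ : EquivCurve G I M → AddCircle (1 : ℝ)} {w : EquivariantTwoForm IG G I M}
  {b : BasePaths I M} {v : ℝ}

namespace IsCharacterWithCurvature

lemma charArc_add_arcs (hχ : IsCharacterWithCurvature IG χ w) {γ₁ γ₂ γ₃ : ℝ → M} {a₁ b₁ a₂ b₂ a₃ b₃ : ℝ}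
    (h₁ : a₁ < b₁) (h₂ : a₂ < b₂) (h₃ : a₃ < b₃) (s₁ : ContMDiffOn 𝓘(ℝ, ℝ) I ∞ γ₁ (Icc a₁ b₁))
    (s₂ : ContMDiffOn 𝓘(ℝ, ℝ) I ∞ γ₂ (Icc a₂ b₂)) (s₃ : ContMDiffOn 𝓘(ℝ, ℝ) I ∞ γ₃ (Icc a₃ b₃))
    (e₁ : γ₂ a₂ = γ₁ b₁) (e₂ : γ₃ a₃ = γ₁ a₁) (e₃ : γ₃ b₃ = γ₂ b₂)
    (h : Bounds w.form (Finsupp.single (arc γ₁ a₁ b₁) 1 + Finsupp.single (arc γ₂ a₂ b₂) 1 -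
      Finsupp.single (arc γ₃ a₃ b₃) 1) v) :
    charArc b χ (arc γ₁ a₁ b₁) + charArc b χ (arc γ₂ a₂ b₂) = charArc b χ (arc γ₃ a₃ b₃) + (v : AddCircle (1 : ℝ)) :=
  hχ.charArc_add (γ₁ := arcPath γ₁ h₁.le s₁) (γ₂ := (arcPath γ₂ h₂.le s₂).cast e₁.symm rfl)
    (γ₃ := (arcPath γ₃ h₃.le s₃).cast e₂.symm e₃.symm) (arcPath_piecewiseSmooth h₁.le s₁)
    (arcPath_piecewiseSmooth h₂.le s₂) (arcPath_piecewiseSmooth h₃.le s₃) (PathClass.arc h₁ s₁)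
    (PathClass.arc h₂ s₂) (PathClass.arc h₃ s₃) h

lemma isPotential_charArc (hχ : IsCharacterWithCurvature IG χ w) {f : E → M} {y₀ : E} {r : ℝ}
    (hf : ContMDiffOn 𝓘(ℝ, E) I ∞ f (Metric.ball y₀ r)) :
    IsPotential I (charArc b χ) f (Metric.ball y₀ r)
      (fun y => charArc b χ (arc (fun s : ℝ => f (y₀ + s • (y - y₀))) 0 1))
      (coneForm (w.form.pull f (Metric.ball y₀ r)) y₀) := by
  set W := Metric.ball y₀ r
  set Ω := w.form.pull f W with hΩ_def
  have hΩ : ContDiffOn ℝ ∞ Ω W := w.form.contDiffOn_pull hf Metric.isOpen_ball.uniqueDiffOn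
  refine ⟨Metric.isOpen_ball, hf, contDiffOn_coneForm hΩ, fun c a d had hc hcW => ?_⟩
  set c' : ℝ → E := fun t => c (a + t * (d - a)) with hc'
  have haff : MapsTo (fun t : ℝ => a + t * (d - a)) (Icc 0 1) (Icc a d) := fun t ht =>
    ⟨by nlinarith [ht.1], by nlinarith [ht.2]⟩
  have hc's : ContDiffOn ℝ ∞ c' (Icc 0 1) := hc.comp (ContDiff.contDiffOn (by fun_prop)) haff
  have hc'W : MapsTo c' (Icc 0 1) W := hcW.comp haff
  set S : Set (ℝ × ℝ) := Icc 0 1 ×ˢ Icc 0 1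
  have huS : UniqueDiffOn ℝ S := uniqueDiffOn_rect zero_lt_one zero_lt_one
  let q : ℝ × ℝ → E := fun p => y₀ + p.2 • (c' p.1 - y₀)
  have hq : ContDiffOn ℝ ∞ q S :=
    contDiffOn_const.add (contDiffOn_snd.smul ((hc's.comp contDiffOn_fst fun p hp => hp.1).sub contDiffOn_const))
  have hqW : MapsTo q S W := fun p hp => segment_mem_ball (hc'W hp.1) hp.2
  have hQ : ContMDiffOn 𝓘(ℝ, ℝ × ℝ) I ∞ (f ∘ q) S := hf.comp hq.contMDiffOn hqW
  have hrad : ∀ y ∈ W, ContMDiffOn 𝓘(ℝ, ℝ) I ∞ (fun s : ℝ => f (y₀ + s • (y - y₀))) (Icc 0 1) := fun y hy =>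
    hf.comp (ContDiff.contMDiff (f := fun s : ℝ => y₀ + s • (y - y₀)) (by fun_prop)).contMDiffOn
      fun s hs => segment_mem_ball hy hs
  have hfc : ContMDiffOn 𝓘(ℝ, ℝ) I ∞ (f ∘ c) (Icc a d) := hf.comp hc.contMDiffOn hcW
  have e0 : c' 0 = c a := by simp [hc']
  have e1 : c' 1 = c d := by simp [hc']
  have hv : ∫ t in (0 : ℝ)..1, ∫ s in (0 : ℝ)..1, w.form.pull (f ∘ q) S (t, s) ![(1, 0), (0, 1)] =
      -lineInt (coneForm Ω y₀) c a d := by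
    rw [← lineInt_comp_affine had hc, lineInt, ← intervalIntegral.integral_neg]
    refine intervalIntegral.integral_congr_uIoo fun t ht => ?_
    rw [uIoo_of_le zero_le_one] at ht
    rw [coneForm_apply hΩ (hc'W (Ioo_subset_Icc_self ht)), ← intervalIntegral.integral_neg]
    refine intervalIntegral.integral_congr_uIoo fun s hs => ?_
    rw [uIoo_of_le zero_le_one] at hs
    have hmem : (t, s) ∈ S := ⟨Ioo_subset_Icc_self ht, Ioo_subset_Icc_self hs⟩
    rw [w.form.pull_comp ((hf _ (hqW hmem)).mdifferentiableWithinAt (by simp))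
      ((hq.differentiableOn (by simp)) _ hmem) hqW (huS _ hmem)]
    have hc't : DifferentiableAt ℝ c' t := (hc's.differentiableOn (by simp)).differentiableAt (Icc_mem_nhds ht.1 ht.2)
    have d1 : fderivWithin ℝ q S (t, s) (1, 0) = s • deriv c' t := by
      rw [← deriv_slice_fst zero_lt_one zero_lt_one (hq.differentiableOn (by simp)) ht (Ioo_subset_Icc_self hs)]
      exact (((hc't.hasDerivAt.sub_const y₀).const_smul s).const_add y₀).deriv
    have d2 : fderivWithin ℝ q S (t, s) (0, 1) = c' t - y₀ := by
      rw [← deriv_slice_snd zero_lt_one zero_lt_one (hq.differentiableOn (by simp)) (Ioo_subset_Icc_self ht) hs]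
      simpa [q] using (((hasDerivAt_id s).smul_const (c' t - y₀)).const_add y₀).deriv
    have e : (fun i => fderivWithin ℝ q S (t, s) ((![(1, 0), (0, 1)] : Fin 2 → ℝ × ℝ) i)) = ![s • deriv c' t, c' t - y₀] := by
      ext1 i
      fin_cases i
      · exact d1
      · exact d2
    change Ω (q (t, s)) (fun i => fderivWithin ℝ q S (t, s) ((![(1, 0), (0, 1)] : Fin 2 → ℝ × ℝ) i)) = _
    rw [e, alternating_smul_two, alternating_vec_two]
    simp only [mul_neg]
    rfl
  have hb := ((bounds_square (η := w.form) hQ).congr rfl hv).neg.add (bounds_const (η := w.form) (f y₀))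
  rw [neg_neg, add_zero] at hb
  have h := hχ.charArc_add_arcs (b := b) zero_lt_one had zero_lt_one (hrad _ (hcW (left_mem_Icc.2 had.le))) hfc
    (hrad _ (hcW (right_mem_Icc.2 had.le))) (by simp) (by simp) (by simp) (hb.congr (by
      have a1 : arc (fun x => (f ∘ q) (x, 0)) 0 1 = fun _ => f y₀ := by ext; simp [arc, q]
      have a2 : arc (fun y => (f ∘ q) (1, y)) 0 1 = arc (fun s : ℝ => f (y₀ + s • (c d - y₀))) 0 1 := by
        simp [q, e1, Function.comp_def]
      have a3 : arc (fun x => (f ∘ q) (x, 1)) 0 1 = arc (f ∘ c) a d := by ext; simp [arc, q, hc']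
      have a4 : arc (fun y => (f ∘ q) (0, y)) 0 1 = arc (fun s : ℝ => f (y₀ + s • (c a - y₀))) 0 1 := by
        simp [q, e0, Function.comp_def]
      rw [a1, a2, a3, a4]
      abel) rfl)
  rw [add_comm] at h
  rw [eq_sub_of_add_eq h]
  abel

lemma hasPotentials_charArc (hχ : IsCharacterWithCurvature IG χ w) : HasPotentials I (charArc b χ) := by
  intro x
  obtain ⟨r, hr, hrW⟩ := Metric.isOpen_iff.1 (isOpen_extChartAt_target (I := I) x) _ (mem_extChartAt_target x)
  exact ⟨_, _, _, Metric.mem_ball_self hr, hrW,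
    hχ.isPotential_charArc ((contMDiffOn_extChartAt_symm (I := I) x).mono hrW)⟩

end IsCharacterWithCurvature

end Character

section OneParameter

variable {EG : Type*} [NormedAddCommGroup EG] [NormedSpace ℝ EG] [FiniteDimensional ℝ EG]
  {HG : Type*} [TopologicalSpace HG] {IG : ModelWithCorners ℝ EG HG} [IG.Boundaryless]
  {G : Type*} [TopologicalSpace G] [ChartedSpace HG G] [Group G] [LieGroup IG ∞ G]

lemma t2Space_of_lieGroup {EG : Type*} [NormedAddCommGroup EG] [NormedSpace ℝ EG]
    {HG : Type*} [TopologicalSpace HG] (IG : ModelWithCorners ℝ EG HG)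
    (G : Type*) [TopologicalSpace G] [ChartedSpace HG G] [Group G] [LieGroup IG ∞ G] : T2Space G := by
  have : IsTopologicalGroup G := topologicalGroup_of_lieGroup IG ∞
  have hH : T2Space HG := IG.isClosedEmbedding.isEmbedding.t2Space
  have : T1Space G := by
    refine t1Space_iff_exists_open.2 fun x y hxy => ?_
    by_cases hy : y ∈ (chartAt HG x).source
    · have hne : chartAt HG x x ≠ chartAt HG x y := fun h =>
        hxy ((chartAt HG x).injOn (mem_chart_source HG x) hy h)
      obtain ⟨u, v, hu, hv, hxu, hyv, huv⟩ := t2_separation hne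
      refine ⟨(chartAt HG x).source ∩ chartAt HG x ⁻¹' u, (chartAt HG x).isOpen_inter_preimage hu,
        ⟨mem_chart_source HG x, hxu⟩, fun h => ?_⟩
      exact Set.disjoint_left.1 huv h.2 hyv
    · exact ⟨(chartAt HG x).source, (chartAt HG x).open_source, mem_chart_source HG x, hy⟩
  infer_instance

/-- A homomorphism from the real line that is differentiable at the origin is smooth. -/
lemma contMDiff_of_homomorphism {c : ℝ → G} (hc : ∀ s t, c (s + t) = c s * c t)
    (hd : MDifferentiableAt 𝓘(ℝ, ℝ) IG c 0) : ContMDiff 𝓘(ℝ, ℝ) IG ∞ c := by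
  have : IsManifold IG 1 G := IsManifold.of_le (n := ∞) (by simp)
  have h0 : c 0 = 1 := by simpa using hc 0 0
  set φ := extChartAt IG (1 : G) with hφ
  set y₀ := φ 1
  have hT : IsOpen φ.target := isOpen_extChartAt_target (I := IG) (1 : G)
  have hs : ContMDiffOn 𝓘(ℝ, EG) IG ∞ φ.symm φ.target := contMDiffOn_extChartAt_symm (I := IG) (1 : G)
  have hφ1 : φ.symm y₀ = 1 := extChartAt_to_inv (I := IG) (1 : G)
  have hy₀ : y₀ ∈ φ.target := mem_extChartAt_target (I := IG) (1 : G)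
  let m : EG × EG → EG := fun p => φ (φ.symm p.1 * φ.symm p.2)
  have hmul : ContMDiffOn 𝓘(ℝ, EG × EG) IG ∞ (fun p : EG × EG => φ.symm p.1 * φ.symm p.2) (φ.target ×ˢ φ.target) :=
    (hs.comp (contDiff_fst.contMDiff (n := ∞)).contMDiffOn fun p hp => hp.1).mul
      (hs.comp (contDiff_snd.contMDiff (n := ∞)).contMDiffOn fun p hp => hp.2)
  set S : Set (EG × EG) := φ.target ×ˢ φ.target ∩ (fun p : EG × EG => φ.symm p.1 * φ.symm p.2) ⁻¹' φ.source with hS_def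
  have hS : IsOpen S := hmul.continuousOn.isOpen_inter_preimage (hT.prod hT) (isOpen_extChartAt_source (I := IG) (1 : G))
  have hm : ContDiffOn ℝ ∞ m S := contDiffOn_extChartAt_comp (hmul.mono inter_subset_left) 1 fun p hp => hp.2
  have hSy : (y₀, y₀) ∈ S := ⟨⟨hy₀, hy₀⟩, by
    change φ.symm y₀ * φ.symm y₀ ∈ φ.source
    rw [hφ1, mul_one]; exact mem_extChartAt_source (I := IG) (1 : G)⟩
  set x : ℝ → EG := fun t => φ (c t) with hx
  have hxd : DifferentiableAt ℝ x 0 := by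
    have h1 : MDifferentiableAt IG 𝓘(ℝ, EG) φ (c 0) :=
      mdifferentiableAt_extChartAt (by rw [h0]; exact mem_chart_source HG 1)
    exact mdifferentiableAt_iff_differentiableAt.1 (h1.comp 0 hd)
  set ξ := deriv x 0 with hξ
  set F : EG → EG := fun y => fderiv ℝ m (y, y₀) (0, ξ)
  set S₀ : Set EG := {y | (y, y₀) ∈ S}
  have hS₀ : IsOpen S₀ := hS.preimage (by fun_prop : Continuous fun y : EG => (y, y₀))
  have hF : ContDiffOn ℝ ∞ F S₀ :=
    ((hm.fderiv_of_isOpen hS (by simp)).comp (ContDiff.contDiffOn (by fun_prop : ContDiff ℝ ∞ fun y : EG => (y, y₀)))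
      fun y hy => hy).clm_apply contDiffOn_const
  have hx0 : x 0 = y₀ := by simp [hx, h0, y₀]
  have hev : ∀ᶠ t in 𝓝 (0 : ℝ), c t ∈ φ.source ∧ x t ∈ S₀ := by
    refine (hd.continuousAt.eventually ?_).and (hxd.continuousAt.eventually ?_)
    · rw [h0]; exact extChartAt_source_mem_nhds (I := IG) 1
    · rw [hx0]; exact hS₀.mem_nhds hSy
  obtain ⟨ε, hε, hb⟩ := Metric.nhds_basis_closedBall.eventually_iff.1 hev
  have hb' : ∀ t ∈ Icc (-ε) ε, c t ∈ φ.source ∧ x t ∈ S₀ := fun t ht =>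
    hb (by rw [Metric.mem_closedBall, dist_zero_right, Real.norm_eq_abs]; exact abs_le.2 ht)
  have hder : ∀ t ∈ Icc (-ε) ε, HasDerivAt x (F (x t)) t := by
    intro t ht
    obtain ⟨h1, h2⟩ := hb' t ht
    have e : x =ᶠ[𝓝 t] fun u => m (x t, x (u - t)) := by
      have h3 : ∀ᶠ u in 𝓝 t, c (u - t) ∈ φ.source := by
        have h4 : Filter.Tendsto (fun u : ℝ => u - t) (𝓝 t) (𝓝 0) := by
          have : Continuous fun u : ℝ => u - t := by fun_prop
          simpa using this.tendsto t
        exact h4.eventually (hev.mono fun _ h => h.1)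
      filter_upwards [h3] with u hu
      simp only [hx, m]
      rw [φ.left_inv h1, φ.left_inv hu, ← hc]
      congr 2
      ring
    refine HasDerivAt.congr_of_eventuallyEq ?_ e
    have h5 : HasDerivAt (fun u => x (u - t)) ξ t := by
      have : HasDerivAt x ξ (t - t) := by rw [sub_self]; exact hxd.hasDerivAt
      exact this.comp_sub_const t t
    have h6 : HasDerivAt (fun u => (x t, x (u - t))) (0, ξ) t := (hasDerivAt_const t (x t)).prodMk h5
    have h7 : HasFDerivAt m (fderiv ℝ m (x t, y₀)) (x t, x (t - t)) := by
      rw [sub_self, hx0]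
      exact ((hm.contDiffAt (hS.mem_nhds h2)).differentiableAt (by simp)).hasFDerivAt
    exact h7.comp_hasDerivAt t h6
  have hxs : ContDiffOn ℝ ∞ x (Icc (-ε) ε) := by
    refine ODE.contDiffOn_enat_Icc_of_hasDerivWithinAt (n := ⊤) (f := fun _ => F) (u := S₀) ?_
      (fun t ht => (hder t ht).hasDerivWithinAt) fun t ht => (hb' t ht).2
    exact hF.comp contDiffOn_snd fun p hp => hp.2
  have hc0 : ContMDiffAt 𝓘(ℝ, ℝ) IG ∞ c 0 := by
    have hn : Icc (-ε) ε ∈ 𝓝 (0 : ℝ) := Icc_mem_nhds (by linarith) hε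
    have h1 : ContMDiffAt 𝓘(ℝ, ℝ) IG ∞ (φ.symm ∘ x) 0 :=
      ((hs.contMDiffAt (hT.mem_nhds (by rw [hx0]; exact hy₀))).comp 0 (hxs.contDiffAt hn).contMDiffAt)
    refine h1.congr_of_eventuallyEq ?_
    filter_upwards [hev] with t ht
    exact (φ.left_inv ht.1).symm
  intro t
  have h1 : ContMDiffAt 𝓘(ℝ, ℝ) IG ∞ (fun u => c t * c (u - t)) t := by
    refine contMDiffAt_const.mul ?_
    have h2 : ContMDiffAt 𝓘(ℝ, ℝ) 𝓘(ℝ, ℝ) ∞ (fun u : ℝ => u - t) t :=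
      (ContDiff.contMDiff (by fun_prop)).contMDiffAt
    refine ContMDiffAt.comp t ?_ h2
    rw [sub_self]
    exact hc0
  refine h1.congr_of_eventuallyEq (Filter.Eventually.of_forall fun u => ?_)
  simp only
  rw [← hc]
  congr 1
  ring

/-- Every element of the Lie algebra generates a one-parameter subgroup. -/
lemma exists_isOneParameterSubgroup (X : GroupLieAlgebra IG G) : ∃ c : ℝ → G, IsOneParameterSubgroup IG c X := by
  have : LieGroup IG (minSmoothness ℝ 3) G := LieGroup.of_le (n := ∞) (by
    simp only [minSmoothness_of_isRCLikeNormedField]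
    exact WithTop.coe_le_coe.2 le_top)
  have : IsManifold IG 1 G := IsManifold.of_le (n := ∞) (by simp)
  have : T2Space G := t2Space_of_lieGroup IG G
  have : CompleteSpace EG := FiniteDimensional.complete ℝ EG
  set v : ∀ g : G, TangentSpace IG g := mulInvariantVectorField X with hv_def
  have hv : ContMDiff IG IG.tangent 1 (fun g : G => (⟨g, v g⟩ : TangentBundle IG G)) :=
    (contMDiff_mulInvariantVectorField X).of_le (by simp)
  have htrans : ∀ (g : G) (γ : ℝ → G) (s : Set ℝ), IsMIntegralCurveOn γ v s → IsMIntegralCurveOn (fun t => g * γ t) v s := by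
    intro g γ s h t ht
    have h1 : MDifferentiable IG IG (fun h : G => g * h) :=
      (contMDiff_mul_left (I := IG) (n := ∞) (a := g)).mdifferentiable (by simp)
    have h2 : MDifferentiable IG IG (fun h : G => γ t * h) :=
      (contMDiff_mul_left (I := IG) (n := ∞) (a := γ t)).mdifferentiable (by simp)
    have h3 := ((h1 (γ t)).hasMFDerivAt.hasMFDerivWithinAt (s := univ)).comp t (h t ht) (mapsTo_univ _ _).subset_preimage
    refine h3.congr_mfderiv ?_
    have hva : ∀ a : G, (v a : EG) = mD IG IG (fun h : G => a * h) univ 1 (X : EG) := fun a => by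
      rw [mD_univ]; rfl
    have h4 : (v (g * γ t) : EG) = mD IG IG (fun h : G => g * h) univ (γ t) (v (γ t) : EG) := by
      have e : (fun h : G => g * γ t * h) = (fun h => g * h) ∘ fun h => γ t * h := by
        ext h; simp [mul_assoc]
      rw [hva, hva, e, mD_comp (h1 _).mdifferentiableWithinAt (h2 1).mdifferentiableWithinAt (mapsTo_univ _ _)
        (uniqueMDiffWithinAt_univ IG), mul_one]
      rfl
    rw [mD_univ] at h4
    refine ContinuousLinearMap.ext fun (r : ℝ) => ?_
    refine Eq.trans ?_ (congrArg (fun z : EG => r • z) h4).symm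
    exact ((mfderiv IG IG (fun h : G => g * h) (γ t) : EG →L[ℝ] EG)).map_smul r (v (γ t) : EG)
  obtain ⟨γ, hγ0, hγ⟩ := exists_isMIntegralCurveAt_of_contMDiffAt_boundaryless (t₀ := (0 : ℝ)) (x₀ := (1 : G)) (hv 1)
  obtain ⟨ε, hε, hγε⟩ := isMIntegralCurveAt_iff'.1 hγ
  obtain ⟨c, hc0, hc⟩ := exists_isMIntegralCurve_of_isMIntegralCurveOn hv hε (fun g =>
    ⟨fun t => g * γ t, by simp [hγ0], htrans g γ _ (by simpa [Real.ball_eq_Ioo] using hγε)⟩) (1 : G)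
  have hhom : ∀ s t, c (s + t) = c s * c t := by
    intro s
    have h1 : IsMIntegralCurve (fun t => c (t + s)) v := hc.comp_add s
    have h2 : IsMIntegralCurve (fun t => c s * c t) v := by
      intro t
      exact (htrans (c s) c univ (hc.isMIntegralCurveOn univ) t (mem_univ t)).hasMFDerivAt Filter.univ_mem
    have h3 := isMIntegralCurve_Ioo_eq_of_contMDiff_boundaryless (t₀ := 0) hv h1 h2 (by simp [hc0])
    intro t
    rw [add_comm]
    exact congrFun h3 t
  refine ⟨c, contMDiff_of_homomorphism hhom (hc 0).mdifferentiableAt, hhom, ?_⟩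
  rw [(hc 0).mfderiv]
  have : v (c 0) = (X : EG) := by
    rw [hc0]
    simp only [hv_def, mulInvariantVectorField]
    have e : (fun h : G => 1 * h) = id := by ext; simp
    rw [e, mfderiv_id]
    rfl
  rw [this]
  exact one_smul ℝ (X : EG)

end OneParameter

section Lift

variable {F : Type*} [NormedAddCommGroup F] [NormedSpace ℝ F]
  {HF : Type*} [TopologicalSpace HF] {J : ModelWithCorners ℝ F HF}
  {N : Type*} [TopologicalSpace N] [ChartedSpace HF N]
  {F' : Type*} [NormedAddCommGroup F'] [NormedSpace ℝ F']
  {HF' : Type*} [TopologicalSpace HF'] {J' : ModelWithCorners ℝ F' HF'}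
  {N' : Type*} [TopologicalSpace N'] [ChartedSpace HF' N']

variable (J) in
/-- A function with values in `ℝ/ℤ` has a smooth real-valued lift near `p`. -/
def SmoothLiftAt (u : N → AddCircle (1 : ℝ)) (p : N) : Prop :=
  ∃ g : N → ℝ, ContMDiffAt J 𝓘(ℝ, ℝ) ∞ g p ∧ ∀ᶠ q in 𝓝 p, u q = (g q : AddCircle (1 : ℝ))

namespace SmoothLiftAt

variable {u u' : N → AddCircle (1 : ℝ)} {p : N}

lemma add (h : SmoothLiftAt J u p) (h' : SmoothLiftAt J u' p) : SmoothLiftAt J (fun q => u q + u' q) p := by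
  obtain ⟨g, h1, h2⟩ := h
  obtain ⟨g', h1', h2'⟩ := h'
  refine ⟨fun q => g q + g' q, h1.add h1', ?_⟩
  filter_upwards [h2, h2'] with q hq hq'
  rw [hq, hq', AddCircle.coe_add]

lemma comp {f : N' → N} {p' : N'} (h : SmoothLiftAt J u (f p')) (hf : ContMDiffAt J' J ∞ f p') :
    SmoothLiftAt J' (fun q => u (f q)) p' := by
  obtain ⟨g, h1, h2⟩ := h
  exact ⟨g ∘ f, h1.comp p' hf, hf.continuousAt.eventually h2⟩

lemma congr (h : SmoothLiftAt J u p) (he : ∀ᶠ q in 𝓝 p, u' q = u q) : SmoothLiftAt J u' p := by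
  obtain ⟨g, h1, h2⟩ := h
  refine ⟨g, h1, ?_⟩
  filter_upwards [h2, he] with q hq hq'
  rw [hq', hq]

lemma const (r : AddCircle (1 : ℝ)) : SmoothLiftAt J (fun _ : N => r) p := by
  obtain ⟨x, rfl⟩ := QuotientAddGroup.mk_surjective r
  exact ⟨fun _ => x, contMDiffAt_const, Filter.Eventually.of_forall fun _ => rfl⟩

lemma contMDiffAt_toCircle (h : SmoothLiftAt J u p) :
    ContMDiffAt J (𝓡 1) ∞ (fun q => AddCircle.toCircle (u q)) p := by
  obtain ⟨g, h1, h2⟩ := h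
  have h3 : ContMDiffAt J (𝓡 1) ∞ (fun q => Circle.exp (2 * Real.pi * g q)) p :=
    (contMDiff_circleExp (m := ∞)).contMDiffAt.comp p (contMDiffAt_const.mul h1)
  refine h3.congr_of_eventuallyEq ?_
  filter_upwards [h2] with q hq
  rw [hq, circleExp_eq_toCircle]

end SmoothLiftAt

end Lift

section Coordinates

variable {EG : Type*} [NormedAddCommGroup EG] [NormedSpace ℝ EG] [FiniteDimensional ℝ EG]
  {HG : Type*} [TopologicalSpace HG] {IG : ModelWithCorners ℝ EG HG} [IG.Boundaryless]
  {G : Type*} [TopologicalSpace G] [ChartedSpace HG G] [Group G] [LieGroup IG ∞ G]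

lemma IsOneParameterSubgroup.comp_smul {c : ℝ → G} {X : GroupLieAlgebra IG G} (h : IsOneParameterSubgroup IG c X)
    (r : ℝ) : IsOneParameterSubgroup IG (fun s => c (r * s)) (r • X) where
  smooth := h.smooth.comp (ContDiff.contMDiff (by fun_prop))
  map_add s t := by rw [mul_add, h.map_add]
  velocity := by
    have h1 : MDifferentiableAt 𝓘(ℝ, ℝ) IG c (r * 0) := (h.smooth.mdifferentiable (by simp)) _
    have h2 : HasFDerivAt (fun s : ℝ => r * s) (r • ContinuousLinearMap.id ℝ ℝ) 0 :=
      (hasFDerivAt_id (0 : ℝ)).const_mul r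
    have h3 := mD_comp (g := c) (f := fun s : ℝ => r * s) (S := univ) (T := univ) (x := (0 : ℝ))
      h1.mdifferentiableWithinAt h2.differentiableAt.mdifferentiableAt.mdifferentiableWithinAt (mapsTo_univ _ _)
      (uniqueMDiffWithinAt_univ _)
    rw [mD_eq_fderivWithin, fderivWithin_univ, h2.fderiv, mul_zero, mD_univ, mD_univ] at h3
    have h4 := congrArg (fun L : ℝ →L[ℝ] EG => L 1) h3
    have h5 : (mfderiv 𝓘(ℝ, ℝ) IG c 0 : ℝ →L[ℝ] EG) 1 = (X : EG) := h.velocity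
    refine h4.trans ?_
    exact ((mfderiv 𝓘(ℝ, ℝ) IG c 0 : ℝ →L[ℝ] EG).map_smul r 1).trans (congrArg (fun z : EG => r • z) h5)

lemma contMDiff_list_prod {N : Type*} {F HF : Type*} [NormedAddCommGroup F] [NormedSpace ℝ F]
    [TopologicalSpace HF] {J : ModelWithCorners ℝ F HF} [TopologicalSpace N] [ChartedSpace HF N] {ι : Type*}
    (l : List ι) {f : ι → N → G} (hf : ∀ i, ContMDiff J IG ∞ (f i)) :
    ContMDiff J IG ∞ (fun p => (l.map fun i => f i p).prod) := by
  induction l with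
  | nil => simpa using contMDiff_const
  | cons i l ih =>
    simp only [List.map_cons, List.prod_cons]
    exact (hf i).mul ih

/-- Canonical coordinates of the second kind. -/
lemma exists_coordinates : ∃ (n : ℕ) (X : Fin n → GroupLieAlgebra IG G) (c : Fin n → ℝ → G) (τ : G → Fin n → ℝ),
    (∀ i, IsOneParameterSubgroup IG (c i) (X i)) ∧ ContMDiffAt IG 𝓘(ℝ, Fin n → ℝ) ∞ τ 1 ∧ τ 1 = 0 ∧
    ∀ᶠ g in 𝓝 (1 : G), ((List.finRange n).map fun i => c i (τ g i)).prod = g := by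
  have : IsManifold IG 1 G := IsManifold.of_le (n := ∞) (by simp)
  have : CompleteSpace EG := FiniteDimensional.complete ℝ EG
  set n := Module.finrank ℝ EG
  let b := Module.finBasis ℝ EG
  set φ := extChartAt IG (1 : G)
  have hφd : MDifferentiableAt IG 𝓘(ℝ, EG) φ 1 := mdifferentiableAt_extChartAt (mem_chart_source HG 1)
  have hsurj : ∀ v : EG, ∃ X : EG, mD IG 𝓘(ℝ, EG) φ univ 1 X = v :=
    (LinearMap.injective_iff_surjective (f := (mD IG 𝓘(ℝ, EG) φ univ 1).toLinearMap)).1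
      (Function.LeftInverse.injective (g := mD 𝓘(ℝ, EG) IG φ.symm univ (φ 1)) fun v => mD_symm_surjective (I := IG) (1 : G) v)
  choose X hX using fun i => hsurj (b i)
  choose c hc using fun i => exists_isOneParameterSubgroup (IG := IG) (G := G) (X i)
  let Ψ : (Fin n → ℝ) → G := fun t => ((List.finRange n).map fun i => c i (t i)).prod
  have hΨ : ContMDiff 𝓘(ℝ, Fin n → ℝ) IG ∞ Ψ := contMDiff_list_prod _ fun i =>
    (hc i).smooth.comp (ContDiff.contMDiff (contDiff_apply ℝ ℝ i))
  have hΨ0 : Ψ 0 = 1 := List.prod_eq_one (by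
    intro x hx
    obtain ⟨i, -, rfl⟩ := List.mem_map.1 hx
    exact (hc i).map_zero)
  have hΨi : ∀ i (t : ℝ), Ψ (Pi.single i t) = c i t := fun i t => by
    have h1 := List.prod_map_eq_pow_single (l := List.finRange n) i (fun j => c j ((Pi.single i t : Fin n → ℝ) j))
      (fun j hj _ => by rw [Pi.single_eq_of_ne hj, (hc j).map_zero])
    rw [List.count_eq_one_of_mem (List.nodup_finRange n) (List.mem_finRange i), pow_one, Pi.single_eq_same] at h1
    exact h1
  let f : (Fin n → ℝ) → EG := φ ∘ Ψ
  have hf : ContDiffAt ℝ ∞ f 0 := by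
    have h1 : ContMDiffAt IG 𝓘(ℝ, EG) ∞ φ (Ψ 0) := by
      rw [hΨ0]; exact contMDiffAt_extChartAt
    exact (h1.comp 0 (hΨ 0)).contDiffAt
  have hfd : DifferentiableAt ℝ f 0 := hf.differentiableAt (by simp)
  have hfi : ∀ i, fderiv ℝ f 0 (Pi.single i 1) = b i := by
    intro i
    have h1 : HasDerivAt (fun t : ℝ => t • (Pi.single i 1 : Fin n → ℝ)) (Pi.single i 1) 0 := by
      simpa using (hasDerivAt_id (0 : ℝ)).smul_const (Pi.single i 1 : Fin n → ℝ)
    have h2 : HasFDerivAt f (fderiv ℝ f 0) ((0 : ℝ) • (Pi.single i 1 : Fin n → ℝ)) := by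
      rw [zero_smul]; exact hfd.hasFDerivAt
    have h3 := h2.comp_hasDerivAt (0 : ℝ) h1
    have e : (f ∘ fun t : ℝ => t • (Pi.single i 1 : Fin n → ℝ)) = φ ∘ c i := by
      ext1 t
      have : t • (Pi.single i 1 : Fin n → ℝ) = Pi.single i t := by
        rw [← Pi.single_smul]; simp
      simp only [Function.comp_apply, f, this, hΨi]
    rw [e] at h3
    have h4 := mD_comp (g := φ) (f := c i) (S := univ) (T := univ) (x := (0 : ℝ)) (I₁ := 𝓘(ℝ, ℝ)) (I₂ := IG) (I₃ := 𝓘(ℝ, EG))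
      (by rw [(hc i).map_zero]; exact hφd.mdifferentiableWithinAt)
      (((hc i).smooth.mdifferentiable (by simp)) 0).mdifferentiableWithinAt (mapsTo_univ _ _) (uniqueMDiffWithinAt_univ _)
    rw [mD_eq_fderivWithin, fderivWithin_univ, h3.hasFDerivAt.fderiv, (hc i).map_zero, mD_univ (c i)] at h4
    have h5 := congrArg (fun A : ℝ →L[ℝ] EG => A 1) h4
    have h6 : (mfderiv 𝓘(ℝ, ℝ) IG (c i) 0 : ℝ →L[ℝ] EG) 1 = X i := (hc i).velocity
    have h7 := h5.trans ((congrArg (mD IG 𝓘(ℝ, EG) φ univ 1) h6).trans (hX i))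
    simpa using h7
  have hinj : (fderiv ℝ f 0 : (Fin n → ℝ) →ₗ[ℝ] EG) = b.equivFun.symm := by
    refine (Pi.basisFun ℝ (Fin n)).ext fun i => ?_
    simpa using hfi i
  let L : (Fin n → ℝ) ≃L[ℝ] EG := b.equivFun.symm.toContinuousLinearEquiv
  have hL : HasFDerivAt f (L : (Fin n → ℝ) →L[ℝ] EG) 0 := by
    convert hfd.hasFDerivAt using 1
    ext v
    exact (LinearMap.congr_fun hinj v).symm
  set θ := hf.localInverse hL (by simp) with hθ
  have hf0 : f 0 = φ 1 := by simp [f, hΨ0]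
  have hθs : ContDiffAt ℝ ∞ θ (φ 1) := by
    rw [← hf0]; exact hf.to_localInverse hL (by simp)
  refine ⟨n, X, c, fun g => θ (φ g), hc, hθs.contMDiffAt.comp (1 : G) contMDiffAt_extChartAt, ?_, ?_⟩
  · change θ (φ 1) = 0
    rw [← hf0]
    exact hf.localInverse_apply_image hL (by simp)
  · have hθ0 : θ (φ 1) = 0 := by rw [← hf0]; exact hf.localInverse_apply_image hL (by simp)
    have hφc : ContinuousAt φ (1 : G) := continuousAt_extChartAt (I := IG) (1 : G)
    have hcont : ContinuousAt (fun g => Ψ (θ (φ g))) 1 := by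
      refine ContinuousAt.comp (f := fun g => θ (φ g)) (g := Ψ) hΨ.continuous.continuousAt ?_
      exact ContinuousAt.comp (f := φ) (g := θ) hθs.continuousAt hφc
    have h1 : ∀ᶠ g in 𝓝 (1 : G), Ψ (θ (φ g)) ∈ φ.source := hcont.eventually (by
      change φ.source ∈ 𝓝 (Ψ (θ (φ 1)))
      rw [hθ0, hΨ0]; exact extChartAt_source_mem_nhds (I := IG) (1 : G))
    have h2 : ∀ᶠ y in 𝓝 (φ 1), f (θ y) = y := by
      rw [← hf0]
      exact (hf.hasStrictFDerivAt' hL (by simp)).eventually_right_inverse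
    filter_upwards [h1, hφc.eventually h2, extChartAt_source_mem_nhds (I := IG) (1 : G)] with g hg1 hg2 hg3
    exact φ.injOn hg1 hg3 hg2

end Coordinates

section Data

variable {EG : Type*} [NormedAddCommGroup EG] [NormedSpace ℝ EG] [FiniteDimensional ℝ EG]
  {HG : Type*} [TopologicalSpace HG] (IG : ModelWithCorners ℝ EG HG) [IG.Boundaryless]
  (G : Type*) [TopologicalSpace G] [ChartedSpace HG G] [Group G] [LieGroup IG ∞ G]
  {E : Type*} [NormedAddCommGroup E] [NormedSpace ℝ E] [FiniteDimensional ℝ E]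
  {H : Type*} [TopologicalSpace H] (I : ModelWithCorners ℝ E H) [I.Boundaryless]
  (M : Type*) [TopologicalSpace M] [ChartedSpace H M] [IsManifold I ∞ M] [MulAction G M]
  [ContMDiffSMul IG I ∞ G M]

/-- An equivariant functional on arcs: the parallel transport and the action of `G`, relative to a
section of the bundle to be constructed. -/
structure TransportData where
  /-- the parallel transport along arcs -/
  P : (unitInterval → M) → AddCircle (1 : ℝ)
  /-- the action of the group -/
  K : G → M → AddCircle (1 : ℝ)
  potentials : HasPotentials I P
  split : SplitAdditive I P
  smul : ∀ (φ : G) (γ : ℝ → M) (a d : ℝ), a < d → ContMDiffOn 𝓘(ℝ, ℝ) I ∞ γ (Icc a d) →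
    P (arc (fun t => φ • γ t) a d) = P (arc γ a d) + K φ (γ a) - K φ (γ d)
  mul : ∀ (ψ φ : G) (x : M), K (ψ * φ) x = K ψ (φ • x) + K φ x
  orbit : ∀ (X : GroupLieAlgebra IG G) (c : ℝ → G), IsOneParameterSubgroup IG c X →
    ∃ m : M → ℝ, ContMDiff I 𝓘(ℝ, ℝ) ∞ m ∧
      ∀ t x, P (arc (fun s => c (t * s) • x) 0 1) + K (c t) x = ((t * m x : ℝ) : AddCircle (1 : ℝ))

variable {IG G I M}

/-- The data determined by a character. -/
def IsCharacterWithCurvature.data {χ : EquivCurve G I M → AddCircle (1 : ℝ)} {w : EquivariantTwoForm IG G I M}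
    (hχ : IsCharacterWithCurvature IG χ w) (b : BasePaths I M) : TransportData IG G I M where
  P := charArc b χ
  K := charTwist b χ
  potentials := hχ.hasPotentials_charArc
  split := hχ.splitAdditive_charArc
  smul φ _ _ _ had hγ := hχ.charArc_smul φ had hγ
  mul := hχ.charTwist_mul
  orbit X c hc := by
    refine ⟨w.moment X, w.moment_smooth X, fun t x => ?_⟩
    have h1 := hc.comp_smul t
    have h2 := hχ.map_orbit _ _ h1 x
    have hs : IsSmoothSubdivision I (h1.orbitCurve (I := I) x).path (n := 1) (fun i : Fin 2 => (i : ℝ)) := by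
      refine ⟨fun i j hij => by exact_mod_cast hij, by simp, by simp, fun i => ?_⟩
      refine ((h1.orbit_smooth (I := I) x).contMDiffOn (s := Icc 0 1)).congr_mono (fun s hs => ?_) (fun s hs => ?_)
      · have hs' : s ∈ Icc (0 : ℝ) 1 := by fin_cases i; simpa using hs
        rw [Path.extend_apply _ hs']
        rfl
      · fin_cases i; simpa using hs
    rw [hχ.eq_pieceSum (b := b) _ hs] at h2
    have h3 : w.moment (t • X) x = t * w.moment X x := by rw [map_smul]; rfl
    rw [h3] at h2
    rw [← h2]
    simp only [pieceSum, Finset.univ_unique, Finset.sum_singleton]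
    congr 1
    · congr 1
      ext s
      have e : ((((default : Fin 1).castSucc : Fin 2) : ℕ) : ℝ) + s * (((((default : Fin 1).succ : Fin 2) : ℕ) : ℝ) - ((((default : Fin 1).castSucc : Fin 2) : ℕ) : ℝ)) = s := by simp
      simp only [arc]
      rw [e, Path.extend_apply _ s.2]
      change c (t * (0 + s * (1 - 0))) • x = c (t * s) • x
      simp
    · change charTwist b χ (c t) x = charTwist b χ (c (t * 1)) x
      rw [mul_one]

namespace TransportData

variable (D : TransportData IG G I M)

/-- The domain of the chosen potential at a point, in the chart. -/
def target (a : M) : Set E := (D.potentials a).choose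

/-- The domain of the chosen potential at a point. -/
def dom (a : M) : Set M := (extChartAt I a).source ∩ extChartAt I a ⁻¹' D.target a

/-- The height function of the chosen potential at a point. -/
def height (a x : M) : AddCircle (1 : ℝ) := (D.potentials a).choose_spec.choose (extChartAt I a x)

/-- The `1`-form of the chosen potential, in the chart. -/
def potForm (a : M) : E → E [⋀^Fin 1]→L[ℝ] ℝ := (D.potentials a).choose_spec.choose_spec.choose

lemma mem_dom (a : M) : a ∈ D.dom a :=
  ⟨mem_extChartAt_source a, (D.potentials a).choose_spec.choose_spec.choose_spec.1⟩

lemma isOpen_target (a : M) : IsOpen (D.target a) := (D.potentials a).choose_spec.choose_spec.choose_spec.2.2.isOpen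

lemma isOpen_dom (a : M) : IsOpen (D.dom a) :=
  (continuousOn_extChartAt a).isOpen_inter_preimage (isOpen_extChartAt_source a) (D.isOpen_target a)

variable {V : Type*} [NormedAddCommGroup V] [NormedSpace ℝ V] [FiniteDimensional ℝ V]

/-- The pull-back of the chosen potential form. -/
def pullForm (a : M) (f : V → M) (y : V) : V [⋀^Fin 1]→L[ℝ] ℝ :=
  (D.potForm a (extChartAt I a (f y))).compContinuousLinearMap (fderiv ℝ (extChartAt I a ∘ f) y)

lemma isPotential_height {a : M} {f : V → M} {O : Set V} (hO : IsOpen O) (hf : ContMDiffOn 𝓘(ℝ, V) I ∞ f O)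
    (h : MapsTo f O (D.dom a)) : IsPotential I D.P f O (fun y => D.height a (f y)) (D.pullForm a f) :=
  (D.potentials a).choose_spec.choose_spec.choose_spec.2.2.of_chart hO hf (fun y hy => (h hy).1) fun y hy => (h hy).2

lemma isPotential_untwist (φ : G) {f : V → M} {O : Set V} (hf : ContMDiffOn 𝓘(ℝ, V) I ∞ f O)
    {h : V → AddCircle (1 : ℝ)} {A : V → V [⋀^Fin 1]→L[ℝ] ℝ} (hp : IsPotential I D.P (fun y => φ • f y) O h A) :
    IsPotential I D.P f O (fun y => D.K φ (f y) + h y) A where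
  isOpen := hp.isOpen
  smooth_map := hf
  smooth := hp.smooth
  eq c a d had hc hcO := by
    have h1 := hp.eq c a d had hc hcO
    have h2 := D.smul φ (f ∘ c) a d had (hf.comp hc.contMDiffOn hcO)
    have h3 : D.P (arc ((fun y => φ • f y) ∘ c) a d) = D.P (arc (fun t => φ • (f ∘ c) t) a d) := rfl
    rw [h1, h2] at h3
    simp only [Function.comp] at h3 ⊢
    rw [eq_sub_iff_add_eq] at h3
    rw [eq_sub_of_add_eq h3.symm]
    abel

lemma K_one (x : M) : D.K 1 x = 0 := by
  have := D.mul 1 1 x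
  rw [one_mul, one_smul] at this
  exact left_eq_add.1 this

lemma smoothLift_fixed (φ : G) {a b x : M} (ha : x ∈ D.dom a) (hb : φ • x ∈ D.dom b) :
    SmoothLiftAt I (fun z => D.K φ z + D.height b (φ • z) - D.height a z) x := by
  set f := (extChartAt I x).symm
  set y₀ := extChartAt I x x
  have hfy : f y₀ = x := extChartAt_to_inv x
  have hT := isOpen_extChartAt_target (I := I) x
  have hf : ContMDiffOn 𝓘(ℝ, E) I ∞ f (extChartAt I x).target := contMDiffOn_extChartAt_symm (I := I) x
  have hφf : ContMDiffOn 𝓘(ℝ, E) I ∞ (fun y => φ • f y) (extChartAt I x).target :=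
    (ContMDiffSMul.contMDiff_const_smul (I := IG) (I' := I) (n := ∞) φ).comp_contMDiffOn hf
  have hO : IsOpen ((extChartAt I x).target ∩ f ⁻¹' D.dom a ∩ ((extChartAt I x).target ∩ (fun y => φ • f y) ⁻¹' D.dom b)) :=
    (hf.continuousOn.isOpen_inter_preimage hT (D.isOpen_dom a)).inter
      (hφf.continuousOn.isOpen_inter_preimage hT (D.isOpen_dom b))
  have hy₀ : y₀ ∈ (extChartAt I x).target := mem_extChartAt_target x
  obtain ⟨r, hr, hrO⟩ := Metric.isOpen_iff.1 hO y₀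
    ⟨⟨hy₀, by rw [mem_preimage, hfy]; exact ha⟩, hy₀, by rw [mem_preimage, hfy]; exact hb⟩
  have hp := D.isPotential_height (a := a) hO (hf.mono fun y hy => hy.1.1) fun y hy => hy.1.2
  have hq := D.isPotential_untwist φ (hf.mono fun y hy => hy.1.1)
    (D.isPotential_height (a := b) hO (hφf.mono fun y hy => hy.1.1) fun y hy => hy.2.2)
  obtain ⟨g, -, hg, hgy⟩ := hq.exists_gauge hp hrO
  have h1 : SmoothLiftAt I (fun z => (D.K φ x + D.height b (φ • x) - D.height a x) +
      (g (extChartAt I x z) : AddCircle (1 : ℝ))) x := by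
    refine (SmoothLiftAt.const _).add ⟨fun z => g (extChartAt I x z), ?_, Filter.Eventually.of_forall fun _ => rfl⟩
    exact ((hg.contDiffAt (Metric.ball_mem_nhds _ hr)).contMDiffAt).comp x contMDiffAt_extChartAt
  refine h1.congr ?_
  filter_upwards [extChartAt_source_mem_nhds (I := I) x,
    (continuousAt_extChartAt (I := I) x).eventually (Metric.ball_mem_nhds _ hr)] with z hz hzr
  have h2 := (hgy _ hzr).1
  have h3 : f (extChartAt I x z) = z := (extChartAt I x).left_inv hz
  simp only [hfy, h3] at h2
  exact h2

lemma smoothLift_oneParameter {X : GroupLieAlgebra IG G} {c : ℝ → G} (hc : IsOneParameterSubgroup IG c X) {a x : M}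
    (ha : x ∈ D.dom a) :
    SmoothLiftAt (𝓘(ℝ, ℝ).prod I) (fun p : ℝ × M => D.K (c p.1) p.2 + D.height a (c p.1 • p.2) - D.height a p.2) (0, x) := by
  obtain ⟨m, hm, hmo⟩ := D.orbit X c hc
  set f := (extChartAt I x).symm
  set y₀ := extChartAt I x x
  have hfy : f y₀ = x := extChartAt_to_inv x
  have hT := isOpen_extChartAt_target (I := I) x
  have hf : ContMDiffOn 𝓘(ℝ, E) I ∞ f (extChartAt I x).target := contMDiffOn_extChartAt_symm (I := I) x
  let q : ℝ × E → M := fun p => c p.1 • f p.2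
  have hq : ContMDiffOn 𝓘(ℝ, ℝ × E) I ∞ q (univ ×ˢ (extChartAt I x).target) :=
    (hc.smooth.comp_contMDiffOn (contDiff_fst.contMDiff (n := ∞)).contMDiffOn).smul
      (hf.comp (contDiff_snd.contMDiff (n := ∞)).contMDiffOn fun p hp => hp.2)
  have hO : IsOpen (univ ×ˢ (extChartAt I x).target ∩ q ⁻¹' D.dom a) :=
    hq.continuousOn.isOpen_inter_preimage (isOpen_univ.prod hT) (D.isOpen_dom a)
  have h0 : ((0 : ℝ), y₀) ∈ univ ×ˢ (extChartAt I x).target ∩ q ⁻¹' D.dom a :=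
    ⟨⟨mem_univ _, mem_extChartAt_target x⟩, by
      change c 0 • f y₀ ∈ D.dom a
      rw [hc.map_zero, one_smul, hfy]; exact ha⟩
  set O := univ ×ˢ (extChartAt I x).target ∩ q ⁻¹' D.dom a
  obtain ⟨r, hr, hrO⟩ := Metric.isOpen_iff.1 hO _ h0
  have hp := D.isPotential_height (a := a) hO (hq.mono inter_subset_left) fun y hy => hy.2
  set A := D.pullForm a q
  have hmem : ∀ t y, |t| < r → y ∈ Metric.ball y₀ r → (t, y) ∈ O := fun t y ht hy => hrO (by
    rw [Metric.mem_ball, Prod.dist_eq, max_lt_iff]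
    exact ⟨by simpa using ht, hy⟩)
  let S : Set ((ℝ × E) × ℝ) := {p | |p.1.1 * p.2| < r ∧ p.1.2 ∈ Metric.ball y₀ r}
  have hS : IsOpen S := (isOpen_lt (f := fun p : (ℝ × E) × ℝ => |p.1.1 * p.2|) (by fun_prop) continuous_const).inter
    (Metric.isOpen_ball.preimage (by fun_prop : Continuous fun p : (ℝ × E) × ℝ => p.1.2))
  let W : Set (ℝ × E) := {p | |p.1| < r ∧ p.2 ∈ Metric.ball y₀ r}
  have hW : IsOpen W := (isOpen_lt (f := fun p : ℝ × E => |p.1|) (by fun_prop) continuous_const).inter (Metric.isOpen_ball.preimage continuous_snd)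
  have hWS : ∀ p ∈ W, ∀ s ∈ Icc (0 : ℝ) 1, (p, s) ∈ S := fun p hp s hs => by
    refine ⟨?_, hp.2⟩
    simp only
    rw [abs_mul]
    calc |p.1| * |s| ≤ |p.1| * 1 := by
          gcongr
          rw [abs_of_nonneg hs.1]; exact hs.2
      _ < r := by rw [mul_one]; exact hp.1
  let B : (ℝ × E) × ℝ → ℝ := fun p => A (p.1.1 * p.2, p.1.2) ![(p.1.1, 0)]
  have hB : ContDiffOn ℝ ∞ B S := by
    have h1 : ContDiffOn ℝ ∞ (fun p : (ℝ × E) × ℝ => (p.1.1 * p.2, p.1.2)) S := ContDiff.contDiffOn (by fun_prop)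
    have h2 : ContDiffOn ℝ ∞ (fun p : (ℝ × E) × ℝ => ((p.1.1, (0 : E)))) S := ContDiff.contDiffOn (by fun_prop)
    exact contDiffOn_alternating_apply (hp.smooth.comp h1 fun p hp => hmem _ _ hp.1 hp.2) (contDiffOn_vec_one h2)
  have hint := contDiffOn_integral_param hS hW hWS hB
  have hW0 : ((0 : ℝ), y₀) ∈ W := ⟨by simpa using hr, Metric.mem_ball_self hr⟩
  have key : ∀ p ∈ W, D.K (c p.1) (f p.2) + D.height a (c p.1 • f p.2) - D.height a (f p.2) =
      ((p.1 * m (f p.2) - ∫ s in (0 : ℝ)..1, B (p, s) : ℝ) : AddCircle (1 : ℝ)) := by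
    intro p hpW
    have hl : ContDiff ℝ ∞ (fun s : ℝ => (p.1 * s, p.2)) := by fun_prop
    have h1 := hp.eq (fun s => (p.1 * s, p.2)) 0 1 zero_lt_one hl.contDiffOn
      fun s hs => hmem _ _ (hWS p hpW s hs).1 hpW.2
    have h2 := hmo p.1 (f p.2)
    have h3 : lineInt A (fun s : ℝ => (p.1 * s, p.2)) 0 1 = ∫ s in (0 : ℝ)..1, B (p, s) := by
      refine intervalIntegral.integral_congr fun s _ => ?_
      have : HasDerivAt (fun s : ℝ => (p.1 * s, p.2)) (p.1, 0) s := by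
        simpa using ((hasDerivAt_id s).const_mul p.1).prodMk (hasDerivAt_const s p.2)
      simp only [this.deriv]
      rfl
    rw [h3] at h1
    have h4 : D.P (arc (q ∘ fun s : ℝ => (p.1 * s, p.2)) 0 1) = D.P (arc (fun s => c (p.1 * s) • f p.2) 0 1) := rfl
    rw [h1] at h4
    rw [← h4] at h2
    have h5 : q (p.1 * 1, p.2) = c p.1 • f p.2 := by simp [q]
    have h6 : q (p.1 * 0, p.2) = f p.2 := by simp [q, hc.map_zero]
    rw [h5, h6] at h2
    rw [AddCircle.coe_sub, ← h2]
    abel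
  have hfp : ContMDiffOn 𝓘(ℝ, ℝ × E) 𝓘(ℝ, ℝ) ∞ (fun p : ℝ × E => m (f p.2)) W := by
    refine hm.comp_contMDiffOn (hf.comp (contDiff_snd.contMDiff (n := ∞)).contMDiffOn fun p hp => ?_)
    exact (hmem p.1 p.2 hp.1 hp.2).1.2
  have hg : ContDiffAt ℝ ∞ (fun p : ℝ × E => p.1 * m (f p.2) - ∫ s in (0 : ℝ)..1, B (p, s)) (0, y₀) :=
    ((contDiffOn_fst.mul hfp.contDiffOn).sub hint).contDiffAt (hW.mem_nhds hW0)
  have hχ : ContMDiffAt (𝓘(ℝ, ℝ).prod I) 𝓘(ℝ, ℝ × E) ∞ (fun p : ℝ × M => (p.1, extChartAt I x p.2)) (0, x) := by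
    rw [modelWithCornersSelf_prod, ← chartedSpaceSelf_prod]
    exact contMDiffAt_fst.prodMk (contMDiffAt_extChartAt.comp (0, x) contMDiffAt_snd)
  refine ⟨_, hg.contMDiffAt.comp (0, x) hχ, ?_⟩
  have h7 : ∀ᶠ p : ℝ × M in 𝓝 (0, x), (p.1, extChartAt I x p.2) ∈ W := hχ.continuousAt.eventually (hW.mem_nhds hW0)
  have h8 : ∀ᶠ p : ℝ × M in 𝓝 (0, x), p.2 ∈ (extChartAt I x).source :=
    continuousAt_snd.eventually (extChartAt_source_mem_nhds (I := I) x)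
  filter_upwards [h7, h8] with p hp7 hp8
  have h9 := key _ hp7
  have h10 : f (extChartAt I x p.2) = p.2 := (extChartAt I x).left_inv hp8
  simp only [Function.comp_apply]
  rw [h10] at h9 ⊢
  exact h9

section Family

variable {F : Type*} [NormedAddCommGroup F] [NormedSpace ℝ F]
  {HF : Type*} [TopologicalSpace HF] {J : ModelWithCorners ℝ F HF}
  {N : Type*} [TopologicalSpace N] [ChartedSpace HF N]

lemma smoothLift_list {ι : Type*} {X : ι → GroupLieAlgebra IG G} {c : ι → ℝ → G}
    (hc : ∀ i, IsOneParameterSubgroup IG (c i) (X i)) {τ : N → ι → ℝ} {p : N}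
    (hτ : ∀ i, ContMDiffAt J 𝓘(ℝ, ℝ) ∞ (fun q => τ q i) p) (hτ0 : ∀ i, τ p i = 0) {ζ : N → M}
    (hζ : ContMDiffAt J I ∞ ζ p) {a : M} (ha : ζ p ∈ D.dom a) (l : List ι) :
    ContMDiffAt J IG ∞ (fun q => (l.map fun i => c i (τ q i)).prod) p ∧
    SmoothLiftAt J (fun q => D.K (l.map fun i => c i (τ q i)).prod (ζ q) +
      D.height a ((l.map fun i => c i (τ q i)).prod • ζ q) - D.height a (ζ q)) p := by
  induction l with
  | nil =>
    refine ⟨contMDiffAt_const, (SmoothLiftAt.const 0).congr (Filter.Eventually.of_forall fun q => ?_)⟩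
    simp [D.K_one]
  | cons i l ih =>
    obtain ⟨h1, h2⟩ := ih
    have h3 : ContMDiffAt J IG ∞ (fun q => c i (τ q i)) p := (hc i).smooth.contMDiffAt.comp p (hτ i)
    have h4 : ContMDiffAt J I ∞ (fun q => (l.map fun i => c i (τ q i)).prod • ζ q) p := h1.smul hζ
    have hl : (l.map fun i => c i (τ p i)).prod = 1 := List.prod_eq_one (by
      intro x hx
      obtain ⟨j, -, rfl⟩ := List.mem_map.1 hx
      rw [hτ0, (hc j).map_zero])
    refine ⟨by simp only [List.map_cons, List.prod_cons]; exact h3.mul h1, ?_⟩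
    have h5 : SmoothLiftAt (𝓘(ℝ, ℝ).prod I) (fun p : ℝ × M => D.K (c i p.1) p.2 + D.height a (c i p.1 • p.2) - D.height a p.2)
        (τ p i, (l.map fun i => c i (τ p i)).prod • ζ p) := by
      rw [hτ0, hl, one_smul]
      exact D.smoothLift_oneParameter (hc i) ha
    refine ((h5.comp (f := fun q => (τ q i, (l.map fun i => c i (τ q i)).prod • ζ q)) ((hτ i).prodMk h4)).add h2).congr
      (Filter.Eventually.of_forall fun q => ?_)
    simp only [List.map_cons, List.prod_cons]
    rw [D.mul, mul_smul]
    abel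

/-- The action of the group is smooth in the trivializations given by potentials. -/
lemma smoothLift {a b x : M} {φ : G} (ha : x ∈ D.dom a) (hb : φ • x ∈ D.dom b) :
    SmoothLiftAt (IG.prod I) (fun p : G × M => D.K p.1 p.2 + D.height b (p.1 • p.2) - D.height a p.2) (φ, x) := by
  obtain ⟨n, X, c, τ, hc, hτ, hτ1, hτe⟩ := exists_coordinates (IG := IG) (G := G)
  let ψ : G × M → G := fun p => φ⁻¹ * p.1
  have hψ : ContMDiff (IG.prod I) IG ∞ ψ := contMDiff_const.mul contMDiff_fst
  have hψ1 : ψ (φ, x) = 1 := inv_mul_cancel φ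
  have hτψ : ContMDiffAt (IG.prod I) 𝓘(ℝ, Fin n → ℝ) ∞ (fun p => τ (ψ p)) (φ, x) := by
    refine ContMDiffAt.comp (φ, x) ?_ hψ.contMDiffAt
    rw [hψ1]; exact hτ
  have h1 := (D.smoothLift_list (J := IG.prod I) (p := (φ, x)) hc (τ := fun p => τ (ψ p)) (ζ := Prod.snd)
    (fun i => ((contDiff_apply ℝ ℝ i).contMDiff (n := ∞)).contMDiffAt.comp (φ, x) hτψ)
    (fun i => by rw [hψ1, hτ1]; rfl) contMDiffAt_snd ha (List.finRange n)).2
  have h2 : ContMDiffAt (IG.prod I) I ∞ (fun p : G × M => ψ p • p.2) (φ, x) := (hψ.smul contMDiff_snd).contMDiffAt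
  have h3 : SmoothLiftAt I (fun z => D.K φ z + D.height b (φ • z) - D.height a z) ((fun p : G × M => ψ p • p.2) (φ, x)) := by
    simp only [hψ1, one_smul]
    exact D.smoothLift_fixed φ ha hb
  refine ((h3.comp (p' := (φ, x)) h2).add h1).congr ?_
  have h4 : ∀ᶠ p : G × M in 𝓝 (φ, x), ((List.finRange n).map fun i => c i (τ (ψ p) i)).prod = ψ p := by
    have : Filter.Tendsto ψ (𝓝 (φ, x)) (𝓝 1) := by
      rw [← hψ1]; exact hψ.continuous.tendsto _
    exact this.eventually hτe
  filter_upwards [h4] with p hp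
  rw [hp]
  have h5 : φ * ψ p = p.1 := mul_inv_cancel_left φ p.1
  have h6 := D.mul φ (ψ p) p.2
  rw [h5] at h6
  have h7 : φ • ψ p • p.2 = p.1 • p.2 := by rw [← mul_smul, h5]
  rw [h6, h7]
  abel

end Family

end TransportData

end Data

section Gluing

variable {F : Type*} [NormedAddCommGroup F] [NormedSpace ℝ F]
  {HF : Type*} [TopologicalSpace HF] (J : ModelWithCorners ℝ F HF)
  (N : Type*) [TopologicalSpace N] [ChartedSpace HF N]
  (T : Type*)

/-- Charts on a set with values in a manifold, with smooth transition maps. -/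
structure SmoothGluing extends ChartedSpaceCore N T where
  contMDiffOn_toFun : ∀ e e' : PartialEquiv T N, e ∈ atlas → e' ∈ atlas →
    ContMDiffOn J J ∞ (e.symm.trans e') (e.symm.trans e').source

namespace SmoothGluing

variable {J N T} [IsManifold J ∞ N] (c : SmoothGluing J N T)

/-- The charted space obtained by gluing. -/
@[reducible]
def charted : @ChartedSpace HF _ T c.toTopologicalSpace :=
  letI := c.toTopologicalSpace
  letI : ChartedSpace N T := c.toChartedSpace
  ChartedSpace.comp HF N T

lemma mem_contDiffGroupoid_of_contMDiffOn {e : OpenPartialHomeomorph HF HF} (h : ContMDiffOn J J ∞ e e.source)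
    (h' : ContMDiffOn J J ∞ e.symm e.target) : e ∈ contDiffGroupoid ∞ J := by
  rw [contDiffGroupoid, mem_groupoid_of_pregroupoid]
  constructor
  · change ContDiffOn ℝ ∞ (J ∘ e ∘ J.symm) (J.symm ⁻¹' e.source ∩ range J)
    rw [← contMDiffOn_iff_contDiffOn]
    exact J.contMDiff.comp_contMDiffOn (h.comp (J.contMDiffOn_symm.mono (by simp)) fun x hx => hx.1)
  · change ContDiffOn ℝ ∞ (J ∘ e.symm ∘ J.symm) (J.symm ⁻¹' e.target ∩ range J)
    rw [← contMDiffOn_iff_contDiffOn]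
    exact J.contMDiff.comp_contMDiffOn (h'.comp (J.contMDiffOn_symm.mono (by simp)) fun x hx => hx.1)

lemma contMDiffOn_transition {e e' : PartialEquiv T N} (he : e ∈ c.atlas) (he' : e' ∈ c.atlas)
    {φ φ' : OpenPartialHomeomorph N HF} (hφ : φ ∈ atlas HF N) (hφ' : φ' ∈ atlas HF N) :
    ContMDiffOn J J ∞ (φ' ∘ (e' ∘ e.symm) ∘ φ.symm)
      (φ.target ∩ φ.symm ⁻¹' (e.target ∩ e.symm ⁻¹' e'.source ∩ (e' ∘ e.symm) ⁻¹' φ'.source)) := by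
  have h1 := contMDiffOn_symm_of_mem_maximalAtlas (I := J) (n := ∞) (IsManifold.subset_maximalAtlas hφ)
  have h2 := contMDiffOn_of_mem_maximalAtlas (I := J) (n := ∞) (IsManifold.subset_maximalAtlas hφ')
  refine h2.comp ((c.contMDiffOn_toFun e e' he he').comp (h1.mono inter_subset_left) fun x hx => ?_) fun x hx => hx.2.2
  rw [PartialEquiv.trans_source]
  exact hx.2.1

lemma isManifold : @IsManifold ℝ _ F _ _ HF _ J ∞ T c.toTopologicalSpace c.charted := by
  let := c.toTopologicalSpace
  let : ChartedSpace N T := c.toChartedSpace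
  let : ChartedSpace HF T := c.charted
  refine @IsManifold.mk _ _ _ _ _ _ _ J ∞ T _ _ ⟨?_⟩
  rintro _ _ ⟨e, he, φ, hφ, rfl⟩ ⟨e', he', φ', hφ', rfl⟩
  change e ∈ ⋃ (e : PartialEquiv T N) (he : e ∈ c.atlas), {c.openPartialHomeomorph e he} at he
  change e' ∈ ⋃ (e : PartialEquiv T N) (he : e ∈ c.atlas), {c.openPartialHomeomorph e he} at he'
  simp only [mem_iUnion, mem_singleton_iff] at he he'
  obtain ⟨e, he, rfl⟩ := he
  obtain ⟨e', he', rfl⟩ := he'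
  refine mem_contDiffGroupoid_of_contMDiffOn ?_ ?_
  · refine (c.contMDiffOn_transition he he' hφ hφ').mono fun x hx => ?_
    simp only [mfld_simps, mem_inter_iff, mem_preimage] at hx
    exact ⟨hx.1.1, ⟨hx.1.2, hx.2.1⟩, hx.2.2⟩
  · refine (c.contMDiffOn_transition he' he hφ' hφ).mono fun x hx => ?_
    simp only [mfld_simps, mem_inter_iff, mem_preimage] at hx
    exact ⟨hx.1.1, ⟨hx.1.2, hx.2.1⟩, hx.2.2⟩

lemma contMDiffOn_chart {e : PartialEquiv T N} (he : e ∈ c.atlas) :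
    letI := c.toTopologicalSpace
    letI : ChartedSpace HF T := c.charted
    ContMDiffOn J J ∞ e e.source := by
  let := c.toTopologicalSpace
  let : ChartedSpace N T := c.toChartedSpace
  let : ChartedSpace HF T := c.charted
  have := c.isManifold
  intro p hp
  let ψ : OpenPartialHomeomorph T N := c.openPartialHomeomorph e he
  let φ := chartAt HF (ψ p)
  have hψ : ψ ≫ₕ φ ∈ atlas HF T := ⟨ψ, mem_iUnion₂.2 ⟨e, he, rfl⟩, φ, chart_mem_atlas _ _, rfl⟩
  have hps : p ∈ (ψ ≫ₕ φ).source := by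
    rw [OpenPartialHomeomorph.trans_source]
    exact ⟨hp, mem_chart_source HF (ψ p)⟩
  have h1 := contMDiffAt_of_mem_maximalAtlas (I := J) (n := ∞) (IsManifold.subset_maximalAtlas hψ) hps
  have h2 : ContMDiffAt J J ∞ φ.symm ((ψ ≫ₕ φ) p) :=
    contMDiffAt_symm_of_mem_maximalAtlas (IsManifold.chart_mem_maximalAtlas (ψ p)) (mem_chart_target HF (ψ p))
  refine ((h2.comp p h1).congr_of_eventuallyEq ?_).contMDiffWithinAt
  filter_upwards [(ψ ≫ₕ φ).open_source.mem_nhds hps] with q hq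
  rw [OpenPartialHomeomorph.trans_source] at hq
  exact (φ.left_inv hq.2).symm

lemma contMDiffOn_chart_symm {e : PartialEquiv T N} (he : e ∈ c.atlas) :
    letI := c.toTopologicalSpace
    letI : ChartedSpace HF T := c.charted
    ContMDiffOn J J ∞ e.symm e.target := by
  let := c.toTopologicalSpace
  let : ChartedSpace N T := c.toChartedSpace
  let : ChartedSpace HF T := c.charted
  have := c.isManifold
  intro p hp
  let ψ : OpenPartialHomeomorph T N := c.openPartialHomeomorph e he
  let φ := chartAt HF p
  have hψ : ψ ≫ₕ φ ∈ atlas HF T := ⟨ψ, mem_iUnion₂.2 ⟨e, he, rfl⟩, φ, chart_mem_atlas _ _, rfl⟩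
  have hps : φ p ∈ (ψ ≫ₕ φ).target := by
    rw [OpenPartialHomeomorph.trans_target]
    refine ⟨mem_chart_target HF p, ?_⟩
    rw [mem_preimage, φ.left_inv (mem_chart_source HF p)]
    exact hp
  have h1 := contMDiffAt_symm_of_mem_maximalAtlas (I := J) (n := ∞) (IsManifold.subset_maximalAtlas hψ) hps
  have h2 : ContMDiffAt J J ∞ φ p :=
    contMDiffAt_of_mem_maximalAtlas (IsManifold.chart_mem_maximalAtlas p) (mem_chart_source HF p)
  refine ((h1.comp p h2).congr_of_eventuallyEq ?_).contMDiffWithinAt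
  filter_upwards [φ.open_source.mem_nhds (mem_chart_source HF p)] with q hq
  change e.symm q = ψ.symm (φ.symm (φ q))
  rw [φ.left_inv hq]
  rfl

end SmoothGluing

end Gluing

section Total

variable {EG : Type*} [NormedAddCommGroup EG] [NormedSpace ℝ EG] [FiniteDimensional ℝ EG]
  {HG : Type*} [TopologicalSpace HG] {IG : ModelWithCorners ℝ EG HG} [IG.Boundaryless]
  {G : Type*} [TopologicalSpace G] [ChartedSpace HG G] [Group G] [LieGroup IG ∞ G]
  {E : Type*} [NormedAddCommGroup E] [NormedSpace ℝ E] [FiniteDimensional ℝ E]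
  {H : Type*} [TopologicalSpace H] {I : ModelWithCorners ℝ E H} [I.Boundaryless]
  {M : Type*} [TopologicalSpace M] [ChartedSpace H M] [IsManifold I ∞ M] [MulAction G M]
  [ContMDiffSMul IG I ∞ G M]

namespace TransportData

/-- The total space of the bundle with the given transport: every fibre has a base point. -/
def Total (_ : TransportData IG G I M) : Type _ := M × Circle

variable (D : TransportData IG G I M)

/-- The projection to the base. -/
def base (p : D.Total) : M := p.1

/-- The coordinate in the fibre, relative to the base point. -/
def fib (p : D.Total) : Circle := p.2

/-- The coordinate in the fibre, relative to the section over `D.dom a` with constant height. -/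
def angle (a : M) (p : D.Total) : Circle := AddCircle.toCircle (-D.height a (D.base p)) * D.fib p

/-- The trivialization over `D.dom a`, as a partial equivalence. -/
def trivEquiv (a : M) : PartialEquiv D.Total (M × Circle) where
  toFun p := (D.base p, D.angle a p)
  invFun q := (q.1, AddCircle.toCircle (D.height a q.1) * q.2)
  source := {p | D.base p ∈ D.dom a}
  target := D.dom a ×ˢ univ
  map_source' p hp := ⟨hp, mem_univ _⟩
  map_target' q hq := hq.1
  left_inv' p _ := Prod.ext rfl (by
    change AddCircle.toCircle (D.height a (D.base p)) * (AddCircle.toCircle (-D.height a (D.base p)) * D.fib p) = p.2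
    rw [← mul_assoc, ← AddCircle.toCircle_add, add_neg_cancel, AddCircle.toCircle_zero, one_mul]
    rfl)
  right_inv' q _ := Prod.ext rfl (by
    change AddCircle.toCircle (-D.height a q.1) * (AddCircle.toCircle (D.height a q.1) * q.2) = q.2
    rw [← mul_assoc, ← AddCircle.toCircle_add, neg_add_cancel, AddCircle.toCircle_zero, one_mul])

lemma trivEquiv_trans_source (a b : M) :
    ((D.trivEquiv a).symm.trans (D.trivEquiv b)).source = (D.dom a ∩ D.dom b) ×ˢ univ := by
  ext q
  rw [PartialEquiv.trans_source]
  exact ⟨fun h => ⟨⟨h.1.1, h.2⟩, mem_univ _⟩, fun h => ⟨⟨h.1.1, mem_univ _⟩, h.1.2⟩⟩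

lemma contMDiffOn_trivEquiv (a b : M) : ContMDiffOn (I.prod (𝓡 1)) (I.prod (𝓡 1)) ∞
    ((D.trivEquiv a).symm.trans (D.trivEquiv b)) ((D.trivEquiv a).symm.trans (D.trivEquiv b)).source := by
  rw [trivEquiv_trans_source]
  rintro q ⟨⟨ha, hb⟩, -⟩
  have h1 := (D.smoothLift_fixed (1 : G) hb (b := a) (by rwa [one_smul])).contMDiffAt_toCircle
  have h2 : ContMDiffAt (I.prod (𝓡 1)) (𝓡 1) ∞ (fun q : M × Circle =>
      AddCircle.toCircle (D.K 1 q.1 + D.height a ((1 : G) • q.1) - D.height b q.1) * q.2) q :=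
    (h1.comp q contMDiffAt_fst).mul contMDiffAt_snd
  refine ((contMDiffAt_fst.prodMk h2).congr_of_eventuallyEq (Filter.Eventually.of_forall fun q => ?_)).contMDiffWithinAt
  refine Prod.ext rfl ?_
  change AddCircle.toCircle (-D.height b q.1) * (AddCircle.toCircle (D.height a q.1) * q.2) = _ * _
  rw [← mul_assoc, ← AddCircle.toCircle_add, D.K_one, one_smul, zero_add, sub_eq_add_neg, add_comm]

/-- The trivializations glue. -/
def gluing : SmoothGluing (I.prod (𝓡 1)) (M × Circle) D.Total where
  atlas := range D.trivEquiv
  chartAt p := D.trivEquiv (D.base p)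
  mem_chart_source p := D.mem_dom _
  chart_mem_atlas p := mem_range_self _
  open_source := by
    rintro _ _ ⟨a, rfl⟩ ⟨b, rfl⟩
    rw [trivEquiv_trans_source]
    exact ((D.isOpen_dom a).inter (D.isOpen_dom b)).prod isOpen_univ
  continuousOn_toFun := by
    rintro _ _ ⟨a, rfl⟩ ⟨b, rfl⟩
    exact (D.contMDiffOn_trivEquiv a b).continuousOn
  contMDiffOn_toFun := by
    rintro _ _ ⟨a, rfl⟩ ⟨b, rfl⟩
    exact D.contMDiffOn_trivEquiv a b

instance : TopologicalSpace D.Total := D.gluing.toTopologicalSpace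

instance : ChartedSpace (ModelProd H (EuclideanSpace ℝ (Fin 1))) D.Total := D.gluing.charted

instance : IsManifold (I.prod (𝓡 1)) ∞ D.Total := D.gluing.isManifold

/-- The trivialization over `D.dom a`. -/
def triv (a : M) : OpenPartialHomeomorph D.Total (M × Circle) :=
  D.gluing.openPartialHomeomorph (D.trivEquiv a) (mem_range_self a)

lemma triv_apply (a : M) (p : D.Total) : D.triv a p = (D.base p, D.angle a p) := rfl

lemma contMDiffOn_triv (a : M) : ContMDiffOn (I.prod (𝓡 1)) (I.prod (𝓡 1)) ∞ (D.triv a) (D.triv a).source :=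
  D.gluing.contMDiffOn_chart (mem_range_self a)

lemma contMDiffOn_triv_symm (a : M) : ContMDiffOn (I.prod (𝓡 1)) (I.prod (𝓡 1)) ∞ (D.triv a).symm (D.triv a).target :=
  D.gluing.contMDiffOn_chart_symm (mem_range_self a)

lemma contMDiff_base : ContMDiff (I.prod (𝓡 1)) I ∞ D.base := fun p =>
  contMDiffAt_fst.comp (f := D.triv (D.base p)) p
    ((D.contMDiffOn_triv (D.base p)).contMDiffAt ((D.triv _).open_source.mem_nhds (D.mem_dom (D.base p))))

lemma contMDiffAt_angle {a : M} {p : D.Total} (hp : D.base p ∈ D.dom a) :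
    ContMDiffAt (I.prod (𝓡 1)) (𝓡 1) ∞ (D.angle a) p :=
  contMDiffAt_snd.comp (f := D.triv a) p
    ((D.contMDiffOn_triv a).contMDiffAt ((D.triv a).open_source.mem_nhds hp))

section Maps

variable {F : Type*} [NormedAddCommGroup F] [NormedSpace ℝ F]
  {HF : Type*} [TopologicalSpace HF] {J : ModelWithCorners ℝ F HF}
  {N : Type*} [TopologicalSpace N] [ChartedSpace HF N]

variable {D} in
lemma contMDiffAt_of_angle {f : N → D.Total} {q : N} {a : M} (ha : D.base (f q) ∈ D.dom a)
    (h1 : ContMDiffAt J I ∞ (fun q => D.base (f q)) q) (h2 : ContMDiffAt J (𝓡 1) ∞ (fun q => D.angle a (f q)) q) :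
    ContMDiffAt J (I.prod (𝓡 1)) ∞ f q := by
  have h3 : (D.base (f q), D.angle a (f q)) ∈ (D.triv a).target := ⟨ha, mem_univ _⟩
  have h4 := ((D.contMDiffOn_triv_symm a).contMDiffAt ((D.triv a).open_target.mem_nhds h3)).comp q (h1.prodMk h2)
  refine h4.congr_of_eventuallyEq ?_
  filter_upwards [h1.continuousAt.eventually ((D.isOpen_dom a).mem_nhds ha)] with z hz
  exact ((D.triv a).left_inv (x := f z) hz).symm

end Maps

instance : MulAction Circle D.Total where
  smul z p := (D.base p, z * D.fib p)
  one_smul p := Prod.ext rfl (one_mul _)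
  mul_smul z z' p := Prod.ext rfl (mul_assoc _ _ _)

instance : MulAction G D.Total where
  smul φ p := (φ • D.base p, AddCircle.toCircle (-D.K φ (D.base p)) * D.fib p)
  one_smul p := Prod.ext (one_smul _ _) (by
    change AddCircle.toCircle (-D.K 1 (D.base p)) * D.fib p = _
    rw [D.K_one, neg_zero, AddCircle.toCircle_zero, one_mul]
    rfl)
  mul_smul ψ φ p := Prod.ext (mul_smul _ _ _) (by
    change AddCircle.toCircle (-D.K (ψ * φ) (D.base p)) * D.fib p =
      AddCircle.toCircle (-D.K ψ (φ • D.base p)) * (AddCircle.toCircle (-D.K φ (D.base p)) * D.fib p)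
    rw [D.mul, neg_add, AddCircle.toCircle_add, mul_assoc])

lemma base_circle (z : Circle) (p : D.Total) : D.base (z • p) = D.base p := rfl

lemma angle_circle (a : M) (z : Circle) (p : D.Total) : D.angle a (z • p) = z * D.angle a p :=
  mul_left_comm _ _ _

lemma angle_smul (a b : M) (φ : G) (p : D.Total) : D.angle b (φ • p) =
    AddCircle.toCircle (-(D.K φ (D.base p) + D.height b (φ • D.base p) - D.height a (D.base p))) * D.angle a p := by
  change AddCircle.toCircle (-D.height b (φ • D.base p)) * (AddCircle.toCircle (-D.K φ (D.base p)) * D.fib p) =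
    _ * (AddCircle.toCircle (-D.height a (D.base p)) * D.fib p)
  rw [← mul_assoc, ← mul_assoc, ← AddCircle.toCircle_add, ← AddCircle.toCircle_add]
  congr 2
  abel

lemma smul_comm_circle (φ : G) (z : Circle) (p : D.Total) : φ • z • p = z • φ • p :=
  Prod.ext rfl (mul_left_comm _ _ _)

instance : ContMDiffSMul (𝓡 1) (I.prod (𝓡 1)) ∞ Circle D.Total where
  contMDiff_smul q := by
    refine contMDiffAt_of_angle (a := D.base q.2) (D.mem_dom _) ?_ ?_
    · have h1 : ContMDiffAt ((𝓡 1).prod (I.prod (𝓡 1))) I ∞ (fun q : Circle × D.Total => D.base q.2) q :=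
        D.contMDiff_base.contMDiffAt.comp q contMDiffAt_snd
      exact h1
    · simp only [angle_circle]
      exact contMDiffAt_fst.mul ((D.contMDiffAt_angle (D.mem_dom _)).comp q contMDiffAt_snd)

instance : ContMDiffSMul IG (I.prod (𝓡 1)) ∞ G D.Total where
  contMDiff_smul q := by
    have hb : ContMDiffAt (IG.prod (I.prod (𝓡 1))) I ∞ (fun q : G × D.Total => D.base q.2) q :=
      D.contMDiff_base.contMDiffAt.comp q contMDiffAt_snd
    refine contMDiffAt_of_angle (a := q.1 • D.base q.2) (D.mem_dom _) ?_ ?_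
    · exact contMDiffAt_fst.smul hb
    · have h1 := (D.smoothLift (φ := q.1) (D.mem_dom (D.base q.2)) (D.mem_dom (q.1 • D.base q.2))).comp
        (f := fun q : G × D.Total => (q.1, D.base q.2)) (p' := q) (contMDiffAt_fst.prodMk hb)
      have h2 := h1.contMDiffAt_toCircle.inv.mul ((D.contMDiffAt_angle (D.mem_dom (D.base q.2))).comp q contMDiffAt_snd)
      refine h2.congr_of_eventuallyEq (Filter.Eventually.of_forall fun p => ?_)
      simp only [D.angle_smul (D.base q.2)]
      rw [AddCircle.toCircle_neg]
      rfl

end TransportData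

end Total

section LogDerivative

variable {V : Type*} [NormedAddCommGroup V] [NormedSpace ℝ V]
  {V' : Type*} [NormedAddCommGroup V'] [NormedSpace ℝ V']

/-- The derivative of the angle of a circle-valued function. -/
def angleDeriv (ζ : V → Circle) (y v : V) : ℝ :=
  (starRingEnd ℂ (ζ y) * fderiv ℝ (fun y => (ζ y : ℂ)) y v).im

lemma angleDeriv_of_eventuallyEq {ζ : V → Circle} {ϑ : V → ℝ} {y : V} (hϑ : DifferentiableAt ℝ ϑ y)
    (h : ∀ᶠ z in 𝓝 y, ζ z = Circle.exp (ϑ z)) (v : V) : angleDeriv ζ y v = fderiv ℝ ϑ y v := by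
  have h1 : HasFDerivAt (fun z => Complex.exp ((ϑ z : ℂ) * Complex.I))
      (Complex.exp ((ϑ y : ℂ) * Complex.I) • ((fderiv ℝ ϑ y).smulRight (1 : ℂ)).smulRight Complex.I) y := by
    have e := (Complex.ofRealCLM.hasFDerivAt (x := ϑ y)).comp y hϑ.hasFDerivAt
    have e2 := (e.mul_const Complex.I).cexp
    refine e2.congr_fderiv ?_
    ext w
    simp
    ring
  have h2 : (fun z => (ζ z : ℂ)) =ᶠ[𝓝 y] fun z => Complex.exp ((ϑ z : ℂ) * Complex.I) := by
    filter_upwards [h] with z hz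
    rw [hz, Circle.coe_exp]
  rw [angleDeriv, h2.fderiv_eq, h1.fderiv]
  have h3 : starRingEnd ℂ (ζ y : ℂ) * Complex.exp ((ϑ y : ℂ) * Complex.I) = 1 := by
    have : (ζ y : ℂ) = Complex.exp ((ϑ y : ℂ) * Complex.I) := h2.self_of_nhds
    rw [← this, mul_comm, Complex.mul_conj, Circle.normSq_coe, Complex.ofReal_one]
  simp only [smul_apply, ContinuousLinearMap.smulRight_apply, smul_eq_mul]
  rw [← mul_assoc, h3]
  simp

lemma exists_angle_at {ζ : V → Circle} {y : V} (h : ContMDiffAt 𝓘(ℝ, V) (𝓡 1) ∞ ζ y) :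
    ∃ ϑ : V → ℝ, DifferentiableAt ℝ ϑ y ∧ ∀ᶠ z in 𝓝 y, ζ z = Circle.exp (ϑ z) := by
  obtain ⟨ϑ, h1, h2⟩ := exists_angle (mem_univ y) h.contMDiffWithinAt
  rw [nhdsWithin_univ] at h2
  exact ⟨ϑ, (h1.contDiffAt Filter.univ_mem).differentiableAt (by simp), h2⟩

lemma angleDeriv_exp_mul {ζ ζ' : V → Circle} {ϑ : V → ℝ} {y : V} (hζ : ContMDiffAt 𝓘(ℝ, V) (𝓡 1) ∞ ζ y)
    (hϑ : DifferentiableAt ℝ ϑ y) (h : ∀ᶠ z in 𝓝 y, ζ' z = Circle.exp (ϑ z) * ζ z) (v : V) :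
    angleDeriv ζ' y v = fderiv ℝ ϑ y v + angleDeriv ζ y v := by
  obtain ⟨ϑ', h1, h2⟩ := exists_angle_at hζ
  rw [angleDeriv_of_eventuallyEq h1 h2, angleDeriv_of_eventuallyEq (hϑ.add h1), fderiv_add hϑ h1]
  · rfl
  · filter_upwards [h, h2] with z hz hz2
    rw [hz, hz2, ← Circle.exp_add]
    rfl

lemma angleDeriv_comp {ζ : V → Circle} {g : V' → V} {y : V'} (hζ : ContMDiffAt 𝓘(ℝ, V) (𝓡 1) ∞ ζ (g y))
    (hg : DifferentiableAt ℝ g y) (v : V') : angleDeriv (ζ ∘ g) y v = angleDeriv ζ (g y) (fderiv ℝ g y v) := by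
  obtain ⟨ϑ, h1, h2⟩ := exists_angle_at hζ
  rw [angleDeriv_of_eventuallyEq h1 h2, angleDeriv_of_eventuallyEq (ζ := ζ ∘ g) (ϑ := ϑ ∘ g) (h1.comp y hg)
    (hg.continuousAt.eventually h2), fderiv_comp y h1 hg]
  rfl

lemma angleDeriv_congr {ζ ζ' : V → Circle} {y : V} (h : ζ' =ᶠ[𝓝 y] ζ) (v : V) :
    angleDeriv ζ' y v = angleDeriv ζ y v := by
  have h2 : (fun z => (ζ' z : ℂ)) =ᶠ[𝓝 y] fun z => (ζ z : ℂ) := h.mono fun z hz => by simp only [hz]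
  rw [angleDeriv, angleDeriv, h2.fderiv_eq, h.self_of_nhds]

lemma contDiffOn_angleDeriv {ζ : V → Circle} {O : Set V} (hO : IsOpen O) (h : ContMDiffOn 𝓘(ℝ, V) (𝓡 1) ∞ ζ O) (v : V) :
    ContDiffOn ℝ ∞ (fun y => angleDeriv ζ y v) O := by
  have h1 : ContDiffOn ℝ ∞ (fun y => (ζ y : ℂ)) O := by
    rw [← contMDiffOn_iff_contDiffOn]
    have : Fact (Module.finrank ℝ ℂ = 1 + 1) := ⟨Complex.finrank_real_complex⟩
    exact (contMDiff_coe_sphere (E := ℂ) (n := 1)).comp_contMDiffOn h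
  have h2 : ContDiffOn ℝ ∞ (fun y => fderiv ℝ (fun y => (ζ y : ℂ)) y v) O :=
    (h1.fderiv_of_isOpen hO (by simp)).clm_apply contDiffOn_const
  exact Complex.imCLM.contDiff.comp_contDiffOn ((Complex.conjCLE.contDiff.comp_contDiffOn h1).mul h2)

/-- The derivative of the angle as a `1`-form. -/
def angleForm (ζ : V → Circle) (y : V) : V [⋀^Fin 1]→L[ℝ] ℝ :=
  ContinuousAlternatingMap.ofSubsingleton ℝ V ℝ (0 : Fin 1)
    (Complex.imCLM.comp ((ContinuousLinearMap.mul ℝ ℂ (starRingEnd ℂ (ζ y))).comp (fderiv ℝ (fun y => (ζ y : ℂ)) y)))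

end LogDerivative

section Connection

variable {EG : Type*} [NormedAddCommGroup EG] [NormedSpace ℝ EG] [FiniteDimensional ℝ EG]
  {HG : Type*} [TopologicalSpace HG] {IG : ModelWithCorners ℝ EG HG} [IG.Boundaryless]
  {G : Type*} [TopologicalSpace G] [ChartedSpace HG G] [Group G] [LieGroup IG ∞ G]
  {E : Type*} [NormedAddCommGroup E] [NormedSpace ℝ E] [FiniteDimensional ℝ E]
  {H : Type*} [TopologicalSpace H] {I : ModelWithCorners ℝ E H} [I.Boundaryless]
  {M : Type*} [TopologicalSpace M] [ChartedSpace H M] [IsManifold I ∞ M] [MulAction G M]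
  [ContMDiffSMul IG I ∞ G M]
  {V : Type*} [NormedAddCommGroup V] [NormedSpace ℝ V] [FiniteDimensional ℝ V]
  {V' : Type*} [NormedAddCommGroup V'] [NormedSpace ℝ V'] [FiniteDimensional ℝ V']

namespace TransportData

variable (D : TransportData IG G I M)

lemma pullForm_apply (a : M) (f : V → M) (y : V) (v : Fin 1 → V) :
    D.pullForm a f y v = D.potForm a (extChartAt I a (f y)) ![fderiv ℝ (extChartAt I a ∘ f) y (v 0)] := by
  refine congrArg (D.potForm a (extChartAt I a (f y))) ?_
  ext1 i
  fin_cases i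
  rfl

/-- The pull-back of the connection form under a map, computed in a trivialization. -/
def connForm (a : M) (F : V → D.Total) (y : V) : V [⋀^Fin 1]→L[ℝ] ℝ :=
  angleForm (D.angle a ∘ F) y - (2 * Real.pi) • D.pullForm a (D.base ∘ F) y

lemma connForm_apply (a : M) (F : V → D.Total) (y : V) (v : Fin 1 → V) :
    D.connForm a F y v = angleDeriv (D.angle a ∘ F) y (v 0) - 2 * Real.pi * D.pullForm a (D.base ∘ F) y v := rfl

variable {D} {F : V → D.Total} {O : Set V} {a : M} {y : V}

lemma contMDiffOn_base_comp (hF : ContMDiffOn 𝓘(ℝ, V) (I.prod (𝓡 1)) ∞ F O) :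
    ContMDiffOn 𝓘(ℝ, V) I ∞ (D.base ∘ F) O :=
  D.contMDiff_base.comp_contMDiffOn hF

lemma isOpen_inter_base (hO : IsOpen O) (hF : ContMDiffOn 𝓘(ℝ, V) (I.prod (𝓡 1)) ∞ F O) {U : Set M} (hU : IsOpen U) :
    IsOpen (O ∩ (D.base ∘ F) ⁻¹' U) :=
  (contMDiffOn_base_comp hF).continuousOn.isOpen_inter_preimage hO hU

lemma contMDiffAt_angle_comp (hO : IsOpen O) (hF : ContMDiffOn 𝓘(ℝ, V) (I.prod (𝓡 1)) ∞ F O) (hy : y ∈ O)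
    (ha : D.base (F y) ∈ D.dom a) : ContMDiffAt 𝓘(ℝ, V) (𝓡 1) ∞ (D.angle a ∘ F) y :=
  (D.contMDiffAt_angle ha).comp y (hF.contMDiffAt (hO.mem_nhds hy))

lemma differentiableAt_chart_base (hO : IsOpen O) (hF : ContMDiffOn 𝓘(ℝ, V) (I.prod (𝓡 1)) ∞ F O) (hy : y ∈ O)
    (ha : D.base (F y) ∈ D.dom a) : DifferentiableAt ℝ (extChartAt I a ∘ D.base ∘ F) y := by
  have h1 := isOpen_inter_base hO hF (D.isOpen_dom a)
  have h2 := contDiffOn_extChartAt_comp ((contMDiffOn_base_comp hF).mono inter_subset_left) a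
    (W := O ∩ (D.base ∘ F) ⁻¹' D.dom a) fun z hz => hz.2.1
  exact (h2.contDiffAt (h1.mem_nhds ⟨hy, ha⟩)).differentiableAt (by simp)

lemma connForm_comp (hO : IsOpen O) (hF : ContMDiffOn 𝓘(ℝ, V) (I.prod (𝓡 1)) ∞ F O) {g : V' → V} {y : V'}
    (hy : g y ∈ O) (ha : D.base (F (g y)) ∈ D.dom a) (hg : DifferentiableAt ℝ g y) :
    D.connForm a (F ∘ g) y = (D.connForm a F (g y)).compContinuousLinearMap (fderiv ℝ g y) := by
  ext v
  have h1 := angleDeriv_comp (contMDiffAt_angle_comp hO hF hy ha) hg (v 0)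
  have h2 := fderiv_comp y (differentiableAt_chart_base hO hF hy ha) hg
  rw [ContinuousAlternatingMap.compContinuousLinearMap_apply, connForm_apply, connForm_apply, pullForm_apply, pullForm_apply]
  refine congrArg₂ (· - ·) h1 (congrArg (fun w => 2 * Real.pi * w) ?_)
  have h3 : fderiv ℝ (extChartAt I a ∘ D.base ∘ F ∘ g) y = _ := h2
  change D.potForm a _ ![fderiv ℝ (extChartAt I a ∘ D.base ∘ F ∘ g) y (v 0)] = _
  rw [h3]
  rfl

lemma connForm_congr {F' : V → D.Total} (h : F' =ᶠ[𝓝 y] F) : D.connForm a F' y = D.connForm a F y := by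
  ext v
  have h1 : (D.angle a ∘ F') =ᶠ[𝓝 y] (D.angle a ∘ F) := h.fun_comp _
  have h2 : (extChartAt I a ∘ D.base ∘ F') =ᶠ[𝓝 y] (extChartAt I a ∘ D.base ∘ F) := h.fun_comp (extChartAt I a ∘ D.base)
  rw [connForm_apply, connForm_apply, pullForm_apply, pullForm_apply, angleDeriv_congr h1, h2.fderiv_eq]
  simp only [Function.comp_apply, h.self_of_nhds]

lemma contDiffOn_connForm (hO : IsOpen O) (hF : ContMDiffOn 𝓘(ℝ, V) (I.prod (𝓡 1)) ∞ F O)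
    (ha : MapsTo (D.base ∘ F) O (D.dom a)) : ContDiffOn ℝ ∞ (D.connForm a F) O := by
  refine ContDiffOn.sub (contDiffOn_alternating_of_apply fun v => ?_) (ContDiffOn.const_smul _ ?_)
  · exact contDiffOn_angleDeriv hO (fun y hy => (contMDiffAt_angle_comp hO hF hy (ha hy)).contMDiffWithinAt) (v 0)
  · exact (D.isPotential_height hO (contMDiffOn_base_comp hF) ha).smooth

lemma connForm_circle (hO : IsOpen O) (hF : ContMDiffOn 𝓘(ℝ, V) (I.prod (𝓡 1)) ∞ F O) (hy : y ∈ O)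
    (ha : D.base (F y) ∈ D.dom a) {ϑ : V → ℝ} (hϑ : DifferentiableAt ℝ ϑ y) (v : Fin 1 → V) :
    D.connForm a (fun y => Circle.exp (ϑ y) • F y) y v = fderiv ℝ ϑ y (v 0) + D.connForm a F y v := by
  rw [connForm_apply, connForm_apply, angleDeriv_exp_mul (ζ' := D.angle a ∘ fun y => Circle.exp (ϑ y) • F y)
    (contMDiffAt_angle_comp hO hF hy ha) hϑ (Filter.Eventually.of_forall fun z => D.angle_circle a _ _), add_sub_assoc]
  rfl

/-- The connection form is independent of the trivialization, and invariant. -/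
lemma connForm_group (φ : G) (hO : IsOpen O) (hF : ContMDiffOn 𝓘(ℝ, V) (I.prod (𝓡 1)) ∞ F O) (hy : y ∈ O)
    (ha : D.base (F y) ∈ D.dom a) {b : M} (hb : φ • D.base (F y) ∈ D.dom b) :
    D.connForm b (fun y => φ • F y) y = D.connForm a F y := by
  have hφ : ContMDiff I I ∞ (fun x : M => φ • x) :=
    ContMDiffSMul.contMDiff_const_smul (I := IG) (I' := I) (n := ∞) φ
  have hO1 := isOpen_inter_base hO hF ((D.isOpen_dom a).inter ((D.isOpen_dom b).preimage hφ.continuous))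
  obtain ⟨r, hr, hrO⟩ := Metric.isOpen_iff.1 hO1 y ⟨hy, ha, hb⟩
  have hf := (contMDiffOn_base_comp hF).mono (inter_subset_left (t := (D.base ∘ F) ⁻¹' (D.dom a ∩ (fun x : M => φ • x) ⁻¹' D.dom b)))
  have hp := D.isPotential_height (a := a) hO1 hf fun z hz => hz.2.1
  have hq := D.isPotential_untwist φ hf (D.isPotential_height (a := b) hO1 (hφ.comp_contMDiffOn hf) fun z hz => hz.2.2)
  obtain ⟨g, -, hg, hgy⟩ := hq.exists_gauge hp hrO
  have hgd : DifferentiableAt ℝ g y := (hg.contDiffAt (Metric.ball_mem_nhds y hr)).differentiableAt (by simp)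
  set k : AddCircle (1 : ℝ) := D.K φ (D.base (F y)) + D.height b (φ • D.base (F y)) - D.height a (D.base (F y)) with hk
  obtain ⟨k', hk'⟩ := QuotientAddGroup.mk_surjective k
  have hϑ : HasFDerivAt (fun z => 2 * Real.pi * -(k' + g z)) ((-(2 * Real.pi)) • fderiv ℝ g y) y := by
    have := ((hgd.hasFDerivAt.const_add k').neg).const_mul (2 * Real.pi)
    refine this.congr_fderiv ?_
    ext w
    simp
  have h1 : ∀ᶠ z in 𝓝 y, (D.angle b ∘ fun y => φ • F y) z = Circle.exp (2 * Real.pi * -(k' + g z)) * (D.angle a ∘ F) z := by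
    filter_upwards [Metric.ball_mem_nhds y hr] with z hz
    have h2 := (hgy z hz).1
    simp only [Function.comp_apply] at h2 ⊢
    rw [D.angle_smul a, circleExp_eq_toCircle, AddCircle.coe_neg, AddCircle.coe_add]
    congr 3
    rw [h2]
    rw [show ((k' : ℝ) : AddCircle (1 : ℝ)) = k from hk']
  ext v
  have h3 := (hgy y (Metric.mem_ball_self hr)).2 (v 0)
  have h4 : D.pullForm a (D.base ∘ F) y v = D.pullForm a (D.base ∘ F) y ![v 0] := by rw [← vec_one_eta v]
  have h5 : D.pullForm b (D.base ∘ fun y => φ • F y) y v = D.pullForm b (fun y => φ • (D.base ∘ F) y) y ![v 0] := by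
    rw [← vec_one_eta v]; rfl
  rw [connForm_apply, connForm_apply, angleDeriv_exp_mul (contMDiffAt_angle_comp hO hF hy ha) hϑ.differentiableAt h1,
    hϑ.fderiv, h4, h5]
  have h6 : ((-(2 * Real.pi)) • fderiv ℝ g y) (v 0) = -(2 * Real.pi) * fderiv ℝ g y (v 0) := rfl
  rw [h6, h3]
  change -(2 * Real.pi) * (D.pullForm a (D.base ∘ F) y ![v 0] - D.pullForm b (fun y => φ • (D.base ∘ F) y) y ![v 0]) + _ - _ = _
  ring

lemma connForm_eq (hO : IsOpen O) (hF : ContMDiffOn 𝓘(ℝ, V) (I.prod (𝓡 1)) ∞ F O) (hy : y ∈ O)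
    (ha : D.base (F y) ∈ D.dom a) {b : M} (hb : D.base (F y) ∈ D.dom b) : D.connForm b F y = D.connForm a F y := by
  have h := connForm_group (1 : G) hO hF hy ha (b := b) (by rwa [one_smul])
  simp only [one_smul] at h
  exact h

variable (D) in
/-- The values of the connection form. -/
def connVal (p : D.Total) : (E × EuclideanSpace ℝ (Fin 1)) [⋀^Fin 1]→L[ℝ] ℝ :=
  (D.connForm (D.base p) (extChartAt (I.prod (𝓡 1)) p).symm (extChartAt (I.prod (𝓡 1)) p p)).compContinuousLinearMap
    (mD (I.prod (𝓡 1)) 𝓘(ℝ, E × EuclideanSpace ℝ (Fin 1)) (extChartAt (I.prod (𝓡 1)) p) univ p)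

lemma connVal_pull (hO : IsOpen O) (hF : ContMDiffOn 𝓘(ℝ, V) (I.prod (𝓡 1)) ∞ F O) (hy : y ∈ O)
    (ha : D.base (F y) ∈ D.dom a) :
    (D.connVal (F y)).compContinuousLinearMap (mD 𝓘(ℝ, V) (I.prod (𝓡 1)) F univ y) = D.connForm a F y := by
  set J := I.prod (𝓡 1)
  set p := F y
  set g : V → E × EuclideanSpace ℝ (Fin 1) := extChartAt J p ∘ F
  have hFy : ContMDiffAt 𝓘(ℝ, V) J ∞ F y := hF.contMDiffAt (hO.mem_nhds hy)
  have hc : ContMDiffAt J 𝓘(ℝ, E × EuclideanSpace ℝ (Fin 1)) ∞ (extChartAt J p) (F y) := contMDiffAt_extChartAt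
  have hg : DifferentiableAt ℝ g y := (hc.comp y hFy).contDiffAt.differentiableAt (by simp)
  have h1 : ((extChartAt J p).symm ∘ g) =ᶠ[𝓝 y] F := by
    filter_upwards [hFy.continuousAt.eventually (extChartAt_source_mem_nhds (I := J) p)] with z hz
    exact (extChartAt J p).left_inv hz
  have h2 : mD 𝓘(ℝ, V) 𝓘(ℝ, E × EuclideanSpace ℝ (Fin 1)) g univ y = _ :=
    mD_comp (hc.mdifferentiableAt (by simp)).mdifferentiableWithinAt (hFy.mdifferentiableAt (by simp)).mdifferentiableWithinAt
      (mapsTo_univ _ _) (uniqueMDiffWithinAt_univ _)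
  rw [mD_eq_fderivWithin, fderivWithin_univ] at h2
  have hgy : g y = extChartAt J p p := rfl
  have h3 : D.base ((extChartAt J p).symm (g y)) ∈ D.dom (D.base p) := by
    rw [hgy, extChartAt_to_inv]
    exact D.mem_dom _
  have h4 := connForm_comp (isOpen_extChartAt_target (I := J) p) (contMDiffOn_extChartAt_symm (I := J) (n := ∞) p)
    (g := g) (y := y) (mem_extChartAt_target p) h3 hg
  rw [connForm_congr h1, connForm_eq hO hF hy ha (D.mem_dom _), h2] at h4
  rw [h4]
  rfl

end TransportData

end Connection

section Bundle

universe u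

variable {EG : Type*} [NormedAddCommGroup EG] [NormedSpace ℝ EG] [FiniteDimensional ℝ EG]
  {HG : Type*} [TopologicalSpace HG] {IG : ModelWithCorners ℝ EG HG} [IG.Boundaryless]
  {G : Type*} [TopologicalSpace G] [ChartedSpace HG G] [Group G] [LieGroup IG ∞ G]
  {E : Type*} [NormedAddCommGroup E] [NormedSpace ℝ E] [FiniteDimensional ℝ E]
  {H : Type*} [TopologicalSpace H] {I : ModelWithCorners ℝ E H} [I.Boundaryless]
  {M : Type u} [TopologicalSpace M] [ChartedSpace H M] [IsManifold I ∞ M] [MulAction G M]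
  [ContMDiffSMul IG I ∞ G M]
  {V : Type*} [NormedAddCommGroup V] [NormedSpace ℝ V] [FiniteDimensional ℝ V]

namespace TransportData

variable (D : TransportData IG G I M)

/-- The connection form. -/
def connection : DifferentialForm (I.prod (𝓡 1)) D.Total 1 where
  toFun := D.connVal
  smooth p₀ y hy := by
    set σ : E × EuclideanSpace ℝ (Fin 1) → D.Total := fun z => (extChartAt (I.prod (𝓡 1)) p₀).symm z
    have hT := isOpen_extChartAt_target (I := I.prod (𝓡 1)) p₀
    have hσ : ContMDiffOn 𝓘(ℝ, E × EuclideanSpace ℝ (Fin 1)) (I.prod (𝓡 1)) ∞ σ (extChartAt (I.prod (𝓡 1)) p₀).target :=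
      contMDiffOn_extChartAt_symm (I := I.prod (𝓡 1)) p₀
    have hO := isOpen_inter_base hT hσ (D.isOpen_dom (D.base (σ y)))
    have hyO : y ∈ (extChartAt (I.prod (𝓡 1)) p₀).target ∩ (D.base ∘ σ) ⁻¹' D.dom (D.base (σ y)) := ⟨hy, D.mem_dom _⟩
    have h1 := contDiffOn_connForm hO (hσ.mono inter_subset_left) fun z hz => hz.2
    refine ((h1.contDiffAt (hO.mem_nhds hyO)).congr_of_eventuallyEq ?_).contDiffWithinAt
    filter_upwards [hO.mem_nhds hyO] with z hz
    rw [← connVal_pull hO (hσ.mono inter_subset_left) hz hz.2, mD_univ]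
    rfl

lemma connVal_smul_pull {A : Type*} [SMul A D.Total] (z : A)
    (hz : ContMDiff (I.prod (𝓡 1)) (I.prod (𝓡 1)) ∞ fun q : D.Total => z • q)
    (h : ∀ (O : Set (E × EuclideanSpace ℝ (Fin 1))) (F : E × EuclideanSpace ℝ (Fin 1) → D.Total) (y : E × EuclideanSpace ℝ (Fin 1)),
      IsOpen O → ContMDiffOn 𝓘(ℝ, E × EuclideanSpace ℝ (Fin 1)) (I.prod (𝓡 1)) ∞ F O → y ∈ O →
        D.connForm (D.base (z • F y)) (fun y => z • F y) y = D.connForm (D.base (F y)) F y) (p : D.Total) :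
    D.connection.pullbackAt (I' := I.prod (𝓡 1)) (fun q : D.Total => z • q) p = D.connection.toFun p := by
  refine eq_of_comp_mD_symm (I := I.prod (𝓡 1)) p ?_
  set σ : E × EuclideanSpace ℝ (Fin 1) → D.Total := fun z => (extChartAt (I.prod (𝓡 1)) p).symm z
  set y := extChartAt (I.prod (𝓡 1)) p p
  have hT := isOpen_extChartAt_target (I := I.prod (𝓡 1)) p
  have hy : y ∈ (extChartAt (I.prod (𝓡 1)) p).target := mem_extChartAt_target p
  have hσ : ContMDiffOn 𝓘(ℝ, E × EuclideanSpace ℝ (Fin 1)) (I.prod (𝓡 1)) ∞ σ (extChartAt (I.prod (𝓡 1)) p).target :=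
    contMDiffOn_extChartAt_symm (I := I.prod (𝓡 1)) p
  have hσy : σ y = p := extChartAt_to_inv p
  have h1 := connVal_pull hT hσ hy (D.mem_dom _)
  have h2 := connVal_pull hT (hz.comp_contMDiffOn hσ) hy (D.mem_dom _)
  have h3 := h _ σ y hT hσ hy
  rw [← h1] at h3
  have h4 := h2.trans h3
  rw [mD_comp ((hz.mdifferentiable (by simp)) (σ y)).mdifferentiableWithinAt
    ((hσ.contMDiffAt (hT.mem_nhds hy)).mdifferentiableAt (by simp)).mdifferentiableWithinAt (mapsTo_univ _ _)
    (uniqueMDiffWithinAt_univ _)] at h4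
  simp only [Function.comp_apply, hσy] at h4
  rw [mD_univ (fun q : D.Total => z • q)] at h4
  exact h4

/-- The equivariant bundle with connection determined by transport data. -/
def bundle : EquivariantBundle IG G I M where
  Total := D.Total
  proj := D.base
  locally_trivial x := by
    refine ⟨D.dom x, D.triv x, D.isOpen_dom x, D.mem_dom x, rfl, rfl, D.contMDiffOn_triv x, D.contMDiffOn_triv_symm x,
      fun p hp => ⟨rfl, fun z => ⟨hp, ?_⟩⟩⟩
    rw [triv_apply, triv_apply, angle_circle, base_circle]
  proj_smul _ _ := rfl
  smul_comm := D.smul_comm_circle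
  form := D.connection
  form_vertical p := by
    have hF : ContMDiff 𝓘(ℝ, ℝ) (I.prod (𝓡 1)) ∞ (fun t : ℝ => Circle.exp t • p) :=
      (contMDiff_circleExp (m := ∞)).smul contMDiff_const
    have h1 := connVal_pull isOpen_univ hF.contMDiffOn (mem_univ (0 : ℝ)) (D.mem_dom _)
    have h2 := connForm_circle (F := fun _ : ℝ => p) (y := 0) isOpen_univ contMDiffOn_const (mem_univ (0 : ℝ))
      (D.mem_dom _) (ϑ := fun t => t) differentiableAt_id ![1]
    have h3 : D.connForm (D.base p) (fun _ : ℝ => p) 0 ![1] = 0 := by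
      have e1 : angleDeriv (D.angle (D.base p) ∘ fun _ : ℝ => p) 0 1 = 0 := by
        change (_ * fderiv ℝ (fun _ : ℝ => (D.angle (D.base p) p : ℂ)) 0 1).im = 0
        simp
      have e2 : fderiv ℝ (extChartAt I (D.base p) ∘ D.base ∘ fun _ : ℝ => p) 0 (1 : ℝ) = 0 := by
        change fderiv ℝ (fun _ : ℝ => extChartAt I (D.base p) (D.base p)) 0 1 = 0
        simp
      rw [connForm_apply, pullForm_apply]
      simp only [Matrix.cons_val_zero]
      rw [e1, e2]
      have := alternating_smul_one (D.potForm (D.base p) (extChartAt I (D.base p) ((D.base ∘ fun _ : ℝ => p) 0))) 0 0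
      rw [zero_smul, zero_mul] at this
      rw [this]
      simp
    rw [h3] at h2
    have h4 := DFunLike.congr_fun h1 ![(1 : ℝ)]
    simp only [Circle.exp_zero, one_smul] at h4
    rw [h2, mD_univ] at h4
    simp only [Matrix.cons_val_zero, add_zero, fderiv_fun_id, ContinuousLinearMap.id_apply] at h4
    refine Eq.trans (congrArg (D.connVal p) ?_) h4
    ext1 i
    fin_cases i
    rfl
  form_circle_invariant z p := by
    refine D.connVal_smul_pull z (ContMDiffSMul.contMDiff_const_smul (I := 𝓡 1) (I' := I.prod (𝓡 1)) (n := ∞) z)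
      (fun O F y hO hF hy => ?_) p
    obtain ⟨r, rfl⟩ : ∃ r : ℝ, Circle.exp r = z := ⟨_, Circle.exp_arg z⟩
    ext v
    have := connForm_circle hO hF hy (D.mem_dom _) (differentiableAt_const r) v
    rw [fderiv_fun_const] at this
    exact this.trans (zero_add _)
  form_invariant g p := by
    refine D.connVal_smul_pull g (ContMDiffSMul.contMDiff_const_smul (I := IG) (I' := I.prod (𝓡 1)) (n := ∞) g)
      (fun O F y hO hF hy => ?_) p
    exact connForm_group g hO hF hy (D.mem_dom _) (D.mem_dom _)

/-- The section of base points. -/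
def zeroSection (x : M) : D.bundle.Total := ((x, 1) : M × Circle)

lemma proj_zeroSection (x : M) : D.bundle.proj (D.zeroSection x) = x := rfl

lemma twist_zeroSection (φ : G) (x : M) :
    EquivariantBundle.twist D.zeroSection D.proj_zeroSection φ x = D.K φ x := by
  have h1 := EquivariantBundle.smul_section D.proj_zeroSection φ x
  have h2 : φ • D.zeroSection x = AddCircle.toCircle (-D.K φ x) • D.zeroSection (φ • x) := rfl
  rw [h2] at h1
  exact (neg_inj.1 (toCircle_injective (D.bundle.circle_free h1))).symm

/-- The section over `D.dom a` with constant height. -/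
def flatSection (a : M) (f : V → M) (y : V) : D.Total := ((f y, AddCircle.toCircle (D.height a (f y))) : M × Circle)

lemma isPotential_phase_zeroSection {a : M} {f : V → M} {O : Set V} (hO : IsOpen O) (hf : ContMDiffOn 𝓘(ℝ, V) I ∞ f O)
    (h : MapsTo f O (D.dom a)) :
    IsPotential I (EquivariantBundle.phase D.zeroSection) f O (fun y => D.height a (f y)) (D.pullForm a f) := by
  have hangle : ∀ y, D.angle a (D.flatSection a f y) = 1 := fun y => by
    change AddCircle.toCircle (-D.height a (f y)) * AddCircle.toCircle (D.height a (f y)) = 1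
    rw [← AddCircle.toCircle_add, neg_add_cancel, AddCircle.toCircle_zero]
  have hσ : ContMDiffOn 𝓘(ℝ, V) (I.prod (𝓡 1)) ∞ (D.flatSection a f) O := fun y hy => by
    refine (contMDiffAt_of_angle (a := a) (h hy) (hf.contMDiffAt (hO.mem_nhds hy)) ?_).contMDiffWithinAt
    exact (contMDiffAt_const (c := (1 : Circle))).congr_of_eventuallyEq (Filter.Eventually.of_forall hangle)
  have h1 := EquivariantBundle.isPotential_phase (σ := D.flatSection a f) D.proj_zeroSection hO hσ (h := fun y => D.height a (f y)) fun y hy => by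
    refine Prod.ext rfl ?_
    exact (mul_one _).symm
  have h2 : EqOn (D.pullForm a f) (EquivariantBundle.localForm (B := D.bundle) (D.flatSection a f)) O := fun y hy => by
    ext v
    have e1 : EquivariantBundle.localForm (B := D.bundle) (D.flatSection a f) y v = -(2 * Real.pi)⁻¹ * D.connForm a (D.flatSection a f) y v := by
      rw [← connVal_pull hO hσ hy (h hy)]
      rfl
    have e2 : angleDeriv (D.angle a ∘ D.flatSection a f) y (v 0) = 0 := by
      rw [show D.angle a ∘ D.flatSection a f = fun _ => 1 from funext hangle]
      simp [angleDeriv]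
    rw [e1, connForm_apply, e2]
    change D.pullForm a f y v = -(2 * Real.pi)⁻¹ * (0 - 2 * Real.pi * D.pullForm a f y v)
    have := Real.pi_ne_zero
    field_simp
    ring
  exact
    { isOpen := hO
      smooth_map := hf
      smooth := (D.isPotential_height hO hf h).smooth
      eq := fun c x d hxd hc hcO => by
        have h3 := h1.eq c x d hxd hc hcO
        have h4 : lineInt (EquivariantBundle.localForm (B := D.bundle) (D.flatSection a f)) c x d = lineInt (D.pullForm a f) c x d := by
          refine intervalIntegral.integral_congr fun t ht => ?_
          rw [uIcc_of_le hxd.le] at ht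
          simp only [h2 (hcO ht)]
        rw [h4] at h3
        exact h3 }

lemma phase_zeroSection {γ : ℝ → M} {x d : ℝ} (hxd : x < d) (hγ : ContMDiffOn 𝓘(ℝ, ℝ) I ∞ γ (Icc x d)) :
    EquivariantBundle.phase D.zeroSection (arc γ x d) = D.P (arc γ x d) := by
  have key : x < d → EquivariantBundle.phase D.zeroSection (arc γ x d) = D.P (arc γ x d) := by
    refine interval_induction hxd.le
      (Q := fun a b => a < b → EquivariantBundle.phase D.zeroSection (arc γ a b) = D.P (arc γ a b))
      (fun t ht => absurd ht (lt_irrefl t)) (fun t u v htx htu huv hvd h1 h2 _ => ?_) fun t ht => ?_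
    · have hm : ContMDiffOn 𝓘(ℝ, ℝ) I ∞ γ (Icc t v) := hγ.mono (Icc_subset_Icc htx hvd)
      rw [EquivariantBundle.phase_split D.proj_zeroSection htu huv hm, D.split γ t u v htu huv hm, h1 htu, h2 huv]
    · set a := γ t
      set W := (extChartAt I a).target ∩ (extChartAt I a).symm ⁻¹' D.dom a
      have hW : IsOpen W := (continuousOn_extChartAt_symm a).isOpen_inter_preimage (isOpen_extChartAt_target a) (D.isOpen_dom a)
      have hf : ContMDiffOn 𝓘(ℝ, E) I ∞ (extChartAt I a).symm W := (contMDiffOn_extChartAt_symm a).mono inter_subset_left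
      have hp := D.isPotential_height hW hf fun y hy => hy.2
      have hq := D.isPotential_phase_zeroSection hW hf fun y hy => hy.2
      have hU : γ ⁻¹' D.dom a ∈ 𝓝[Icc x d] t := (hγ.continuousOn t ht).preimage_mem_nhdsWithin ((D.isOpen_dom a).mem_nhds (D.mem_dom a))
      obtain ⟨U, hU, hUs⟩ := mem_nhdsWithin_iff_exists_mem_nhds_inter.1 hU
      obtain ⟨r, hr, hrU⟩ := Metric.mem_nhds_iff.1 hU
      refine ⟨Metric.ball t r, Metric.ball_mem_nhds t hr, fun u hu v hv hxu huv hvd _ => ?_⟩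
      have hs : Icc u v ⊆ Icc x d := Icc_subset_Icc hxu hvd
      have hdom : MapsTo γ (Icc u v) (D.dom a) := fun z hz =>
        hUs ⟨hrU (((convex_ball t r).ordConnected).out hu hv hz), hs hz⟩
      have hc : ContDiffOn ℝ ∞ (extChartAt I a ∘ γ) (Icc u v) :=
        contDiffOn_extChartAt_comp (hγ.mono hs) a fun z hz => (hdom hz).1
      have hinv : ∀ z ∈ Icc u v, (extChartAt I a).symm (extChartAt I a (γ z)) = γ z := fun z hz =>
        (extChartAt I a).left_inv (hdom hz).1
      have hcW : MapsTo (extChartAt I a ∘ γ) (Icc u v) W := fun z hz =>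
        ⟨(extChartAt I a).map_source (hdom hz).1, by
          rw [mem_preimage, Function.comp_apply, hinv z hz]
          exact hdom hz⟩
      have e : arc ((extChartAt I a).symm ∘ extChartAt I a ∘ γ) u v = arc γ u v := arc_congr huv.le hinv
      have h1 := hp.eq _ u v huv hc hcW
      have h2 := hq.eq _ u v huv hc hcW
      rw [e] at h1 h2
      rw [h1, h2]
  exact key hxd

lemma isLogHolonomy_bundle (k : EquivCurve G I M) {n : ℕ} {t : Fin (n + 1) → ℝ} (ht : IsSmoothSubdivision I k.path t) :
    D.bundle.IsLogHolonomy k (pieceSum D.P k.path t + D.K k.elt k.base) := by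
  have h1 := EquivariantBundle.isLogHolonomy_pieceSum D.proj_zeroSection k ht
  rw [D.twist_zeroSection] at h1
  have h2 : pieceSum (EquivariantBundle.phase D.zeroSection) k.path t = pieceSum D.P k.path t :=
    Finset.sum_congr rfl fun i _ => D.phase_zeroSection (ht.strictMono i.castSucc_lt_succ) (ht.smooth i)
  rwa [h2] at h1

end TransportData

/-- Every equivariant differential character is the holonomy of a bundle with connection. -/
lemma IsCharacterWithCurvature.exists_bundle [ConnectedSpace M] {χ : EquivCurve G I M → AddCircle (1 : ℝ)}
    {w : EquivariantTwoForm IG G I M} (hχ : IsCharacterWithCurvature IG χ w) :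
    ∃ B : EquivariantBundle IG G I M, ∀ k, B.IsLogHolonomy k (χ k) := by
  obtain ⟨b⟩ := nonempty_basePaths I M
  refine ⟨(hχ.data b).bundle, fun k => ?_⟩
  obtain ⟨n, t, ht⟩ := k.smooth.exists_subdivision
  rw [hχ.eq_pieceSum (b := b) k ht]
  exact (hχ.data b).isLogHolonomy_bundle k ht

end Bundle

end EquivHol

end

open scoped Manifold ContDiff in
theorem corollary4p4
    {EG : Type*} [NormedAddCommGroup EG] [NormedSpace ℝ EG] [FiniteDimensional ℝ EG]
    {HG : Type*} [TopologicalSpace HG] (IG : ModelWithCorners ℝ EG HG) [IG.Boundaryless]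
    (G : Type*) [TopologicalSpace G] [ChartedSpace HG G] [Group G] [LieGroup IG ∞ G]
    {E : Type*} [NormedAddCommGroup E] [NormedSpace ℝ E] [FiniteDimensional ℝ E]
    {H : Type*} [TopologicalSpace H] (I : ModelWithCorners ℝ E H) [I.Boundaryless]
    (M : Type*) [TopologicalSpace M] [ChartedSpace H M] [IsManifold I ∞ M]
    [T2Space M] [SecondCountableTopology M] [ContractibleSpace M]
    [MulAction G M] [ContMDiffSMul IG I ∞ G M] :
    (∃ hol : EquivHol.Bund IG G I M → EquivHol.EquivDiffCharacter IG G I M,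
      (∀ (B : EquivHol.EquivariantBundle IG G I M) (k : EquivHol.EquivCurve G I M),
        B.IsLogHolonomy k ((hol B.toBund).1 k)) ∧
      Function.Bijective hol) ∧
    ∀ χ : EquivHol.EquivDiffCharacter IG G I M, ∃ B : EquivHol.EquivariantBundle IG G I M,
      ∀ k : EquivHol.EquivCurve G I M, B.IsLogHolonomy k (χ.1 k) := by
  have : ConnectedSpace M := inferInstance
  have hsurj : ∀ χ : EquivHol.EquivDiffCharacter IG G I M, ∃ B : EquivHol.EquivariantBundle IG G I M,
      ∀ k : EquivHol.EquivCurve G I M, B.IsLogHolonomy k (χ.1 k) := fun ⟨_, _, hχ⟩ => hχ.exists_bundle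
  refine ⟨⟨Quotient.lift (s := EquivHol.bundleSetoid IG G I M)
    (fun B => ⟨B.logHol, _, B.isCharacter_logHol⟩) fun B B' ⟨Φ⟩ => Subtype.ext Φ.logHol_eq,
    fun B k => B.isLogHolonomy_logHol k, ?_, fun χ => ?_⟩, hsurj⟩
  · rintro ⟨B⟩ ⟨B'⟩ h
    exact Quotient.sound (s := EquivHol.bundleSetoid IG G I M)
      (EquivHol.EquivariantBundle.nonempty_iso_of_logHol_eq (congrArg Subtype.val h))
  · obtain ⟨B, hB⟩ := hsurj χ
    exact ⟨B.toBund, Subtype.ext (funext fun k => (B.isLogHolonomy_logHol k).unique (hB k))⟩
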